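/- **Setting.** Fix $\lambda,\lambda_b,\xi,\theta,N_0>0$, $q,\varepsilon,\beta\in[0,1]$, path-loss exponents $\tau_c,\tau_d>2$, and $a,b>0$. Put $R=(\pi\lambda_b)^{-1/2}$, $\delta_c=2/\tau_c$, $\delta_d=2/\tau_d$. The D2D link length $L_d$ has density $2\pi\xi x e^{-\xi\pi x^2}$ on $[0,\infty)$; a potential D2D user (UE) works in D2D mode if $L_d\le\theta$ and in cellular mode otherwise; $\lambda_c=[(1-q)+q\,\mathrm P(L_d>\theta)]\lambda$. The cellular link length $L_c$ has density $2x/R^2$ on $[0,R]$. *Fading.* With $\bar w>0$ and $\mu>0$, a power gain $G$ with mean $\bar w$ is $\kappa$-$\mu$ distributed ($\kappa\ge 0$) if it has on $(0,\infty)$ the density $$\frac{\mu}{\kappa^{\frac{\mu-1}2}e^{\mu\kappa}}\Big(\frac{1+\kappa}{\bar w}\Big)^{\frac{\mu+1}2}x^{\frac{\mu-1}2}e^{-\frac{\mu(1+\kappa)x}{\bar w}}\,\mathrm I_{\mu-1}\Big(2\mu\sqrt{\tfrac{\kappa(1+\kappa)x}{\bar w}}\Big),$$ and $\eta$-$\mu$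 distributed ($\eta>0$) if it has the density $$\frac{2\sqrt\pi\,\mu^{\mu+\frac12}h^\mu}{\Gamma(\mu)|H|^{\mu-\frac12}\bar w^{\mu+\frac12}}x^{\mu-\frac12}e^{-\frac{2\mu hx}{\bar w}}\,\mathrm I_{\mu-\frac12}\Big(\frac{2\mu|H|x}{\bar w}\Big),\qquad h=\tfrac{2+\eta^{-1}+\eta}4,\quad H=\tfrac{\eta^{-1}-\eta}4$$ (for $\kappa=0$, respectively $\eta=1$: the limits, which are gamma densities). *Interference.* For D2D mode, the UEs form a Poisson process $\{X_j\}$ of intensity $\lambda$ in $\mathbb R^2$; independently of it they carry i.i.d. marks with independent components: $\varrho_j$ (potential D2D UE, probability $q$), $L_j\sim L_d$, an ALOHA indicator $e_j$ (probability $\varepsilon$), and a $\kappa$-$\mu$ or $\eta$-$\mu$ gain $G_j$. Then $I_d=\sum_j \mathbf 1\{\varrho_j=1,\,L_j\le\theta,\,e_j=1\}\,L_j^{\tau_d}G_j\|X_j\|^{-\tau_d}$. For cellular mode, $\{Y_j\}$ is a Poisson process of intensity $\lambda_b$ with independent i.i.d. marks $(L_j,G_j)$, $L_j\sim L_c$,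 $G_j$ a $\kappa$-$\mu$ or $\eta$-$\mu$ gain independent of $L_j$, and $I_c=\sum_j\mathbf 1\{\|Y_j\|\ge R\}\,L_j^{\tau_c}G_j\|Y_j\|^{-\tau_c}$. In either mode the gain $W$ of the intended link is $\kappa$-$\mu$ or $\eta$-$\mu$ distributed and independent of the interferers (intended and interfering links may have different models and parameters). Write $\mathcal L_I(s)=\mathbb E[e^{-sI}]$. *Rates and bit error probabilities.* The average rate of a cellular UE is $R_c=(1-\beta)\,\mathbb E[1/N]\,\mathbb E[\log(1+\frac{W}{I_c+N_0})]$, where $N-1$ is Poisson with mean $\lambda_c\pi R^2$; that of a potential D2D UE in D2D mode is $\hat R_d=\beta\varepsilon\,\mathbb E[\log(1+\frac W{I_d+N_0})]$. The conditional bit error probability (BEP) at SINR $\gamma$ is $\Gamma(b,a\gamma)/(2\Gamma(b))$; the average BEPs of a cellular UE and of a potential D2D UE in D2D mode are $$P_{e,c}=\mathbb E\Big[\tfrac{\Gamma(b,\,aW/(I_c+N_0))}{2\Gamma(b)}\Big],\qquad \hat P_{e,d}=\mathbb E\Big[\tfrac{\Gamma(b,\,aW/(I_d+N_0))}{2\Gamma(b)}\Big],$$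 and the average BEP $P_{e,d}$ of a potential D2D UE is its mean rate of erroneous bits divided by its mean rate of bits, both averaged over the mode. **Theorem.** The interference powers are almost surely finite, all averages exist, and the following holds. 1. $\mathrm P(L_d\le\theta)=1-e^{-\xi\pi\theta^2}$, $\;R_c=(1-\beta)\frac{\lambda_b}{\lambda_c}\big(1-e^{-\lambda_c/\lambda_b}\big)\mathbb E\big[\log(1+\frac W{I_c+N_0})\big]$, and, if the denominator is not $0$, $$P_{e,d}=\frac{R_c\,\mathrm P(L_d>\theta)\,P_{e,c}+\hat R_d\,\mathrm P(L_d\le\theta)\,\hat P_{e,d}}{R_c\,\mathrm P(L_d>\theta)+\hat R_d\,\mathrm P(L_d\le\theta)}.$$ 2. Let $I=I_d$ (left-hand side $\hat P_{e,d}$) or $I=I_c$ (left-hand side $P_{e,c}$). If $W$ is $\kappa$-$\mu$ distributed, put $\sigma=\frac{\bar w}{\mu(1+\kappa)}$, $\alpha_n=\frac{(\mu\kappa)^n}{n!\,e^{\mu\kappa}}$, $i_n=\mu+n$; if $W$ is $\eta$-$\mu$ distributed, put $\sigma=\frac{\bar w}{2\mu h}$, $\alpha_n=\binom{n+\mu-1}{n}\frac{H^{2n}}{h^{\mu+2n}}$,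 $i_n=2\mu+2n$. Then $$\mathbb E\Big[\tfrac{\Gamma(b,\,aW/(I+N_0))}{2\Gamma(b)}\Big]=\frac12+\frac{\sigma}{N_0}\sum_{n=0}^\infty\alpha_n\int_0^\infty g_{i_n}\Big(\frac{\sigma x}{N_0}\Big)\mathcal L_I\Big(\frac x{N_0}\Big)e^{-x}\,dx =\lim_{M\to\infty}\Big[\frac12+\frac\sigma{N_0}\sum_{m=1}^M\sum_{n=0}^\infty c_m\alpha_n\,g_{i_n}\Big(\frac{\sigma x_m}{N_0}\Big)\mathcal L_I\Big(\frac{x_m}{N_0}\Big)\Big],$$ where all integrals and series converge absolutely and $x_m$, $c_m$ are the abscissas and weights of the Gauss–Laguerre rule of order $M$. 3. The Laplace transform of $I_d$ is $\mathcal L_{I_d}(s)=\exp(-c\,s^{\delta_d})$ for $s\ge 0$, where, with the parameters of the interfering links, $\hat\xi=\xi/\gamma(2,\xi\pi\theta^2)$, $\mathrm{sinc}(x)=\frac{\sin\pi x}{\pi x}$, and $\binom xy=\frac{\Gamma(x+1)}{\Gamma(y+1)\Gamma(x-y+1)}$, $$c_{\kappa\text{-}\mu}=\frac{q\varepsilon\lambda}{\hat\xi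 e^{\mu\kappa}}\,\frac{{}_1F_1(\mu+\delta_d;\mu;\mu\kappa)}{\mathrm{sinc}(\delta_d)}\Big(\frac{\bar w}{(1+\kappa)\mu}\Big)^{\delta_d}\binom{\mu+\delta_d-1}{\delta_d},$$ $$c_{\eta\text{-}\mu}=\frac{q\varepsilon\lambda}{\hat\xi h^{\mu}}\,\frac{{}_2F_1\big(\mu+\frac{\delta_d}2+\frac12,\mu+\frac{\delta_d}2;\mu+\frac12;(\frac Hh)^2\big)}{\mathrm{sinc}(\delta_d)}\Big(\frac{\bar w}{2\mu h}\Big)^{\delta_d}\binom{2\mu+\delta_d-1}{\delta_d}.$$ The Laplace transform of $I_c$ is $\mathcal L_{I_c}(s)=\exp\big(-2\pi\lambda_b\int_R^\infty(1-\varphi(r))\,r\,dr\big)$ for $s>0$, where $$\varphi_{\kappa\text{-}\mu}(r)=\frac{\pi\lambda_br^2\delta_c}{e^{\mu\kappa}}\Big(\frac{\mu(1+\kappa)}{s\bar w}\Big)^{\delta_c}\sum_{n=0}^\infty\frac{(\mu\kappa)^n}{n!\,\Gamma(\mu+n)}\,G^{2,1}_{2,2}\Big(\frac{\mu(1+\kappa)(\pi\lambda_b)^{1/\delta_c}r^{\tau_c}}{s\bar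 w}\Big|{1-\delta_c,\,1\atop 0,\,n+\mu-\delta_c}\Big),$$ $$\varphi_{\eta\text{-}\mu}(r)=\frac{2\pi^{3/2}\lambda_br^2\delta_c}{\Gamma(\mu)h^\mu}\Big(\frac{2\mu h}{s\bar w}\Big)^{\delta_c}\sum_{n=0}^\infty\frac{2^{-2n-2\mu}}{n!\,\Gamma(\mu+n+\frac12)}\Big(\frac Hh\Big)^{2n}G^{2,1}_{2,2}\Big(\frac{2\mu h(\pi\lambda_b)^{1/\delta_c}r^{\tau_c}}{s\bar w}\Big|{1-\delta_c,\,1\atop 0,\,2n+2\mu-\delta_c}\Big).$$ 4. For all real $i>0$ and $x>0$, $$g_i(x):=\frac1{2\Gamma(b)\Gamma(i)}\frac{d^i}{dx^i}\Big(x^{i-1}\Gamma(b,ax)\Big)=\frac a{2\Gamma(b)\Gamma(i)}\,G^{1,2}_{3,2}\Big(\frac1{ax}\Big|{2,\,2-b,\,1\atop 1+i,\,1}\Big),$$ where $d^i/dx^i$ is the Riemann–Liouville derivative with base point $0$ (the ordinary $i$-th derivative if $i$ is an integer). -/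

import Mathlib

open MeasureTheory ProbabilityTheory Filter Topology

noncomputable section

namespace Overlay

/-! ### Special functions -/

/-- Upper incomplete gamma function `Γ(b, y) = ∫_y^∞ t^(b-1) e^(-t) dt`. -/
def upperGamma (b y : ℝ) : ℝ := ∫ t in Set.Ioi y, t ^ (b - 1) * Real.exp (-t)

/-- Lower incomplete gamma function `γ(b, y) = ∫_0^y t^(b-1) e^(-t) dt`. -/
def lowerGamma (b y : ℝ) : ℝ := ∫ t in (0 : ℝ)..y, t ^ (b - 1) * Real.exp (-t)

/-- Modified Bessel function of the first kind `I_ν(x)`, for `x > 0`. -/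
def besselI (ν x : ℝ) : ℝ :=
  ∑' n : ℕ, (x / 2) ^ (2 * (n : ℝ) + ν) / ((n.factorial : ℝ) * Real.Gamma (n + ν + 1))

/-- Confluent hypergeometric function `₁F₁(a; c; x)`. -/
def hyp1F1 (a c x : ℝ) : ℝ :=
  ∑' n : ℕ, (ascPochhammer ℝ n).eval a / (ascPochhammer ℝ n).eval c * x ^ n / (n.factorial : ℝ)

/-- Binomial coefficient with real entries,
`binom(x, y) = Γ(x+1) / (Γ(y+1) Γ(x-y+1))`. -/
def gbinom (x y : ℝ) : ℝ :=
  Real.Gamma (x + 1) / (Real.Gamma (y + 1) * Real.Gamma (x - y + 1))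

/-- Normalized cardinal sine `sin(πx)/(πx)`. -/
def nsinc (x : ℝ) : ℝ := Real.sinc (Real.pi * x)

/-- Integrand of the Mellin-Barnes integral of the Meijer function
`G_{p,q}^{m,n}(z | a_1, …, a_p; b_1, …, b_q)`:
`∏_{j ≤ m} Γ(b_j - s) ∏_{j ≤ n} Γ(1 - a_j + s) z^s /
(∏_{j > m} Γ(1 - b_j + s) ∏_{j > n} Γ(a_j - s))`.
(Mathlib sets `Γ = 0` at the poles of `Γ` and `x / 0 = 0`, which gives the correct value `0` for
the entire function `1/Γ` in the denominator.) -/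
def meijerIntegrand (m n : ℕ) (as bs : List ℝ) (z : ℝ) (s : ℂ) : ℂ :=
  (((bs.take m).map fun β => Complex.Gamma ((β : ℂ) - s)).prod
      * ((as.take n).map fun α => Complex.Gamma (1 - (α : ℂ) + s)).prod)
    / (((bs.drop m).map fun β => Complex.Gamma (1 - (β : ℂ) + s)).prod
      * ((as.drop n).map fun α => Complex.Gamma ((α : ℂ) - s)).prod)
    * (z : ℂ) ^ s

/-- The vertical line `Re s = c` separates the poles of the `Γ(b_j - s)`, `j ≤ m`, from those of
the `Γ(1 - a_j + s)`, `j ≤ n`. -/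
def MeijerSeparates (m n : ℕ) (as bs : List ℝ) (c : ℝ) : Prop :=
  (∀ α ∈ as.take n, α - 1 < c) ∧ ∀ β ∈ bs.take m, c < β

open Classical in
/-- The Meijer `G`-function `G_{p,q}^{m,n}(z | as; bs)` at `z > 0`, as the Mellin-Barnes integral
`(1/2πi) ∫ … ds` along a vertical line that separates the two families of poles (where the
integral converges absolutely, it does not depend on the line). -/
def meijerG (m n : ℕ) (as bs : List ℝ) (z : ℝ) : ℂ :=
  if h : ∃ c : ℝ, MeijerSeparates m n as bs c then
    (1 / (2 * (Real.pi : ℂ))) *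
      ∫ t : ℝ, meijerIntegrand m n as bs z ((h.choose : ℂ) + (t : ℂ) * Complex.I)
  else 0

/-- There is a separating vertical line, and the Mellin-Barnes integral converges absolutely along
every such line. -/
def MeijerConverges (m n : ℕ) (as bs : List ℝ) (z : ℝ) : Prop :=
  (∃ c : ℝ, MeijerSeparates m n as bs c) ∧
    ∀ c : ℝ, MeijerSeparates m n as bs c →
      Integrable fun t : ℝ => meijerIntegrand m n as bs z ((c : ℂ) + (t : ℂ) * Complex.I)

/-- Riemann-Liouville integral of order `α ≥ 0` with base point `0`
(order `0` is the identity). -/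
def rlIntegral (α : ℝ) (f : ℝ → ℝ) (x : ℝ) : ℝ :=
  if α = 0 then f x else (Real.Gamma α)⁻¹ * ∫ t in (0 : ℝ)..x, (x - t) ^ (α - 1) * f t

/-- Derivative `d^i f / dx^i` of real order `i ≥ 0`: the Riemann-Liouville derivative
`(d/dx)^⌈i⌉ I^(⌈i⌉ - i) f`, which is the ordinary iterated derivative if `i` is an integer. -/
def rlDeriv (i : ℝ) (f : ℝ → ℝ) (x : ℝ) : ℝ :=
  iteratedDeriv ⌈i⌉₊ (rlIntegral ((⌈i⌉₊ : ℝ) - i) f) x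

theorem rlDeriv_natCast (k : ℕ) (f : ℝ → ℝ) : rlDeriv (k : ℝ) f = iteratedDeriv k f := by
  funext x
  have h : rlIntegral 0 f = f := by funext y; simp [rlIntegral]
  simp [rlDeriv, h]

/-- Laguerre polynomial `L_M(X) = ∑_{k ≤ M} binom(M, k) (-1)^k / k! X^k`. -/
def laguerrePoly (M : ℕ) : Polynomial ℝ :=
  ∑ k ∈ Finset.range (M + 1),
    Polynomial.C ((M.choose k : ℝ) * (-1) ^ k / (k.factorial : ℝ)) * Polynomial.X ^ k

/-- Abscissas of the Gauss-Laguerre rule of order `M`: the zeros of `L_M`. -/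
def laguerreNodes (M : ℕ) : Finset ℝ := (laguerrePoly M).roots.toFinset

/-- Weight of the Gauss-Laguerre rule of order `M` at the abscissa `x`: the integral against
`e^(-t)` on `(0, ∞)` of the Lagrange basis polynomial that belongs to `x`. -/
def laguerreWeight (M : ℕ) (x : ℝ) : ℝ :=
  ∫ t in Set.Ioi (0 : ℝ), (Lagrange.basis (laguerreNodes M) id x).eval t * Real.exp (-t)

/-! ### Fading models -/

/-- A fading model for the power gain `G` of a channel (the envelope is `√G`), with mean power
`w`: the `κ-μ` model or the `η-μ` model. -/
inductive Fading where
  | kappaMu (κ μ w : ℝ)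
  | etaMu (η μ w : ℝ)

namespace Fading

/-- The parameter `h = (2 + η⁻¹ + η) / 4`. -/
def hPar (η : ℝ) : ℝ := (2 + η⁻¹ + η) / 4

/-- The parameter `H = (η⁻¹ - η) / 4`. -/
def HPar (η : ℝ) : ℝ := (η⁻¹ - η) / 4

/-- Admissible parameters; `κ = 0` and `η = 1` (Nakagami fading) are allowed. -/
def Valid : Fading → Prop
  | kappaMu κ μ w => 0 ≤ κ ∧ 0 < μ ∧ 0 < w
  | etaMu η μ w => 0 < η ∧ 0 < μ ∧ 0 < w

/-- Density of the power gain on `(0, ∞)`. For `κ = 0`, respectively `η = 1`, it is the limit of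
the general formula, a gamma density. In the `η-μ` case the formula depends on `H` only through
`|H|`, as `z ↦ z^(-ν) I_ν(z)` is even; writing `|H|` gives the real powers their meaning for
`η > 1`. -/
def pdf : Fading → ℝ → ℝ
  | kappaMu κ μ w, x =>
      if x ≤ 0 then 0
      else if κ = 0 then gammaPDFReal μ (μ / w) x
      else μ / (κ ^ ((μ - 1) / 2) * Real.exp (μ * κ)) * ((1 + κ) / w) ^ ((μ + 1) / 2)
        * x ^ ((μ - 1) / 2) * Real.exp (-(μ * (1 + κ) / w * x))
        * besselI (μ - 1) (2 * μ * √(κ * (1 + κ) / w * x))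
  | etaMu η μ w, x =>
      if x ≤ 0 then 0
      else if η = 1 then gammaPDFReal (2 * μ) (2 * μ / w) x
      else 2 * √Real.pi * μ ^ (μ + 1 / 2) * hPar η ^ μ
          / (Real.Gamma μ * |HPar η| ^ (μ - 1 / 2) * w ^ (μ + 1 / 2))
        * x ^ (μ - 1 / 2) * Real.exp (-(2 * μ * hPar η * x / w))
        * besselI (μ - 1 / 2) (2 * μ * |HPar η| * x / w)

/-- Law of the power gain. -/
def law (F : Fading) : Measure ℝ := volume.withDensity fun x => ENNReal.ofReal (F.pdf x)

/-- `w / (μ (1 + κ))`, respectively `w / (2 μ h)`. -/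
def scale : Fading → ℝ
  | kappaMu κ μ w => w / (μ * (1 + κ))
  | etaMu η μ w => w / (2 * μ * hPar η)

/-- `(μκ)^n / (n! e^(μκ))`, respectively
`a_n = binom(n + μ - 1, n) H^(2n) / h^(μ + 2n)`. -/
def coeff : Fading → ℕ → ℝ
  | kappaMu κ μ _, n => (μ * κ) ^ n / ((n.factorial : ℝ) * Real.exp (μ * κ))
  | etaMu η μ _, n =>
      gbinom (n + μ - 1) n * (HPar η ^ (2 * n) / hPar η ^ (μ + 2 * (n : ℝ)))

/-- `μ + n`, respectively `2μ + 2n`. -/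
def order : Fading → ℕ → ℝ
  | kappaMu _ μ _, n => μ + n
  | etaMu _ μ _, n => 2 * μ + 2 * n

end Fading

/-! ### The network -/

/-- Parameters of an overlaid D2D network. -/
structure Params where
  /-- intensity `λ` of the user equipments (UEs) -/
  lam : ℝ
  /-- intensity `λ_b` of the base stations -/
  lamB : ℝ
  /-- D2D distance parameter `ξ` -/
  xi : ℝ
  /-- mode selection threshold `θ` -/
  theta : ℝ
  /-- probability `q` that a UE is a potential D2D UE -/
  q : ℝ
  /-- ALOHA transmit probability `ε` -/
  eps : ℝ
  /-- spectrum partition factor `β` -/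
  beta : ℝ
  /-- path-loss exponent `τ_c` of cellular links -/
  tauC : ℝ
  /-- path-loss exponent `τ_d` of D2D links -/
  tauD : ℝ
  /-- noise power `N₀` -/
  N0 : ℝ
  lam_pos : 0 < lam
  lamB_pos : 0 < lamB
  xi_pos : 0 < xi
  theta_pos : 0 < theta
  q_mem : q ∈ Set.Icc (0 : ℝ) 1
  eps_mem : eps ∈ Set.Icc (0 : ℝ) 1
  beta_mem : beta ∈ Set.Icc (0 : ℝ) 1
  tauC_gt : 2 < tauC
  tauD_gt : 2 < tauD
  N0_pos : 0 < N0

/-- The Euclidean plane. -/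
abbrev Plane : Type := EuclideanSpace ℝ (Fin 2)

/-- Number of points of the sequence `X` that lie in `A`. -/
def pointCount {Ω E : Type*} (X : ℕ → Ω → E) (A : Set E) (ω : Ω) : ENNReal :=
  ∑' j, A.indicator (fun _ => (1 : ENNReal)) (X j ω)

/-- The points `X 0, X 1, …` form a Poisson point process with intensity measure `Λ`. -/
structure IsPoissonProcess {Ω E : Type*} [MeasurableSpace Ω] [MeasurableSpace E]
    (P : Measure Ω) (Λ : Measure E) (X : ℕ → Ω → E) : Prop where
  measurable : ∀ j, Measurable (X j)
  count_law : ∀ A : Set E, MeasurableSet A → Λ A ≠ ⊤ →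
    HasLaw (pointCount X A)
      ((poissonMeasure (Λ A).toNNReal).map fun k : ℕ => (k : ENNReal)) P
  count_indep : ∀ (n : ℕ) (A : Fin n → Set E), (∀ i, MeasurableSet (A i)) →
    Pairwise (fun i j => Disjoint (A i) (A j)) → iIndepFun (fun i => pointCount X (A i)) P

/-- Law of a coin that shows `true` with probability `p`. -/
def coin (p : ℝ) : Measure Bool :=
  ENNReal.ofReal p • Measure.dirac true + ENNReal.ofReal (1 - p) • Measure.dirac false

namespace Params

variable (p : Params)

/-- Cell radius `R = √(1 / (π λ_b))`. -/
def R : ℝ := √(1 / (Real.pi * p.lamB))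

/-- `δ_c = 2 / τ_c`. -/
def deltaC : ℝ := 2 / p.tauC

/-- `δ_d = 2 / τ_d`. -/
def deltaD : ℝ := 2 / p.tauD

/-- Law of the D2D link length `L_d`, with density `2 π ξ x e^(-ξ π x²)` for `x ≥ 0`. -/
def d2dLengthLaw : Measure ℝ :=
  volume.withDensity fun x => ENNReal.ofReal
    (if 0 ≤ x then 2 * Real.pi * p.xi * x * Real.exp (-(p.xi * Real.pi * x ^ 2)) else 0)

/-- Law of the cellular link length `L_c`, with density `2 x / R²` for `0 ≤ x ≤ R`. -/
def cellLengthLaw : Measure ℝ :=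
  volume.withDensity fun x => ENNReal.ofReal
    (if 0 ≤ x ∧ x ≤ p.R then 2 * x / p.R ^ 2 else 0)

/-- Probability `P(L_d ≤ θ)` of the D2D mode. -/
def probD2D : ℝ := p.d2dLengthLaw.real (Set.Iic p.theta)

/-- Probability `P(L_d > θ)` of the cellular mode. -/
def probCell : ℝ := p.d2dLengthLaw.real (Set.Ioi p.theta)

/-- Intensity `λ_c` of the UEs operating in cellular mode. -/
def lamC : ℝ := ((1 - p.q) + p.q * p.probCell) * p.lam

/-- Mean fraction `E[1/N]` of the cellular resource that a cellular UE gets, where `N - 1`, the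
number of the other UEs in cellular mode in the cell, is Poisson with mean `λ_c π R²`. -/
def cellShare : ℝ :=
  ∫ k : ℕ, 1 / ((k : ℝ) + 1) ∂(poissonMeasure (p.lamC * (Real.pi * p.R ^ 2)).toNNReal)

end Params

section Links

variable {Ω : Type*} [MeasurableSpace Ω]

/-- A typical D2D link with receiver at the origin, fading model `FW` of the intended link and
fading model `FI` of the interfering links. The UEs sit at the points `X j` of a Poisson process
of intensity `λ` and carry independent marks: `ty j` (is it a potential D2D UE?), the length `L j`
of its D2D link, `act j` (does ALOHA let it transmit?), and the gain `G j` of its channel to the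
receiver. `W` is the gain of the intended link, independent of all that. -/
structure IsD2DLink (P : Measure Ω) (p : Params) (FW FI : Fading) (X : ℕ → Ω → Plane)
    (ty : ℕ → Ω → Bool) (L : ℕ → Ω → ℝ) (act : ℕ → Ω → Bool) (G : ℕ → Ω → ℝ)
    (W : Ω → ℝ) : Prop where
  points : IsPoissonProcess P (ENNReal.ofReal p.lam • (volume : Measure Plane)) X
  marks_law : ∀ j, HasLaw (fun ω => (ty j ω, L j ω, act j ω, G j ω))
    ((coin p.q).prod (p.d2dLengthLaw.prod ((coin p.eps).prod FI.law))) P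
  marks_indep : iIndepFun (fun j ω => (ty j ω, L j ω, act j ω, G j ω)) P
  points_marks : IndepFun (fun ω j => X j ω)
    (fun ω j => (ty j ω, L j ω, act j ω, G j ω)) P
  signal_law : HasLaw W FW.law P
  signal_indep : IndepFun W
    (fun ω => ((fun j => X j ω), fun j => (ty j ω, L j ω, act j ω, G j ω))) P

/-- Interference power at the D2D receiver from the UE with index `j`: it counts if it is a
potential D2D UE, works in D2D mode and is active; its transmit power is `L^τ_d`. -/
def d2dInterferenceTerm (p : Params) (X : ℕ → Ω → Plane) (ty : ℕ → Ω → Bool)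
    (L : ℕ → Ω → ℝ) (act : ℕ → Ω → Bool) (G : ℕ → Ω → ℝ) (ω : Ω) (j : ℕ) : ℝ :=
  if ty j ω = true ∧ L j ω ≤ p.theta ∧ act j ω = true then
    L j ω ^ p.tauD * G j ω * ‖X j ω‖ ^ (-p.tauD)
  else 0

/-- Interference `I_d` at the D2D receiver. -/
def d2dInterference (p : Params) (X : ℕ → Ω → Plane) (ty : ℕ → Ω → Bool)
    (L : ℕ → Ω → ℝ) (act : ℕ → Ω → Bool) (G : ℕ → Ω → ℝ) (ω : Ω) : ℝ :=
  ∑' j, d2dInterferenceTerm p X ty L act G ω j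

/-- A typical uplink with base station at the origin, fading model `FW` of the intended link and
fading model `FI` of the interfering links. The active cellular transmitters sit at the points
`Y j` of a Poisson process of intensity `λ_b` (only those outside the cell interfere) and carry
independent marks: the length `L j` of the link to the own base station and the gain `G j` of the
channel to the typical base station. `W` is the gain of the intended link, independent of all
that. -/
structure IsCellLink (P : Measure Ω) (p : Params) (FW FI : Fading) (Y : ℕ → Ω → Plane)
    (L : ℕ → Ω → ℝ) (G : ℕ → Ω → ℝ) (W : Ω → ℝ) : Prop where
  points : IsPoissonProcess P (ENNReal.ofReal p.lamB • (volume : Measure Plane)) Y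
  marks_law : ∀ j, HasLaw (fun ω => (L j ω, G j ω)) (p.cellLengthLaw.prod FI.law) P
  marks_indep : iIndepFun (fun j ω => (L j ω, G j ω)) P
  points_marks : IndepFun (fun ω j => Y j ω) (fun ω j => (L j ω, G j ω)) P
  signal_law : HasLaw W FW.law P
  signal_indep : IndepFun W (fun ω => ((fun j => Y j ω), fun j => (L j ω, G j ω))) P

/-- Interference power at the base station from the transmitter with index `j`: it counts if it is
outside the cell; its transmit power is `L^τ_c`. -/
def cellInterferenceTerm (p : Params) (Y : ℕ → Ω → Plane) (L : ℕ → Ω → ℝ)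
    (G : ℕ → Ω → ℝ) (ω : Ω) (j : ℕ) : ℝ :=
  if p.R ≤ ‖Y j ω‖ then L j ω ^ p.tauC * G j ω * ‖Y j ω‖ ^ (-p.tauC) else 0

/-- Interference `I_c` at the base station. -/
def cellInterference (p : Params) (Y : ℕ → Ω → Plane) (L : ℕ → Ω → ℝ)
    (G : ℕ → Ω → ℝ) (ω : Ω) : ℝ :=
  ∑' j, cellInterferenceTerm p Y L G ω j

/-! ### Performance measures -/

/-- The ratio `W / (I + N₀)`. -/
def sinr (p : Params) (W I : Ω → ℝ) (ω : Ω) : ℝ := W ω / (I ω + p.N0)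

/-- Laplace transform `E[e^(-s I)]`. -/
def laplace (P : Measure Ω) (I : Ω → ℝ) (s : ℝ) : ℝ := ∫ ω, Real.exp (-(s * I ω)) ∂P

/-- Bit error probability `Γ(b, aγ) / (2 Γ(b))` given the SINR `γ`. -/
def condBEP (a b γ : ℝ) : ℝ := upperGamma b (a * γ) / (2 * Real.Gamma b)

/-- Average bit error probability of a link. -/
def avgBEP (P : Measure Ω) (p : Params) (a b : ℝ) (W I : Ω → ℝ) : ℝ :=
  ∫ ω, condBEP a b (sinr p W I ω) ∂P

/-- Average spectral efficiency `E[log(1 + SINR)]` of a link that is in use. -/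
def avgLog (P : Measure Ω) (p : Params) (W I : Ω → ℝ) : ℝ :=
  ∫ ω, Real.log (1 + sinr p W I ω) ∂P

/-- Average rate `R_c` of a cellular UE. -/
def rateCell (P : Measure Ω) (p : Params) (W I : Ω → ℝ) : ℝ :=
  (1 - p.beta) * (p.cellShare * avgLog P p W I)

/-- Average rate of a potential D2D UE in D2D mode. -/
def rateD2D (P : Measure Ω) (p : Params) (W I : Ω → ℝ) : ℝ :=
  p.beta * (p.eps * avgLog P p W I)

/-- Average bit error probability of a potential D2D UE, with rate `rd` and bit error probability
`ed` in D2D mode (`L_d ≤ θ`), and `rc` and `ec` in cellular mode (`L_d > θ`): the mean rate of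
erroneous bits over the mean rate of bits, both averaged over the mode. -/
def mixedBEP (p : Params) (rc ec rd ed : ℝ) : ℝ :=
  (∫ l, (if l ≤ p.theta then rd * ed else rc * ec) ∂p.d2dLengthLaw)
    / ∫ l, (if l ≤ p.theta then rd else rc) ∂p.d2dLengthLaw

end Links

/-! ### The terms of the formulas -/

/-- `g_i(x) = 1 / (2 Γ(b) Γ(i)) · d^i/dx^i (x^(i-1) Γ(b, a x))`. -/
def gTerm (a b i x : ℝ) : ℝ :=
  1 / (2 * Real.Gamma b * Real.Gamma i)
    * rlDeriv i (fun t => t ^ (i - 1) * upperGamma b (a * t)) x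

/-- The summand `coeff_n · g_{order n}(scale · x / N₀) · 𝓛_I(x / N₀)`, where `Lap` is the Laplace
transform of the interference. -/
def seriesTerm (p : Params) (F : Fading) (a b : ℝ) (Lap : ℝ → ℝ) (n : ℕ) (x : ℝ) : ℝ :=
  F.coeff n * gTerm a b (F.order n) (F.scale * x / p.N0) * Lap (x / p.N0)

/-- The constant `ξ̂ = ξ / γ(2, ξ π θ²)`. -/
def xiHat (p : Params) : ℝ := p.xi / lowerGamma 2 (p.xi * Real.pi * p.theta ^ 2)

/-- The constant `c` in the Laplace transform of the interference at the D2D receiver. -/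
def d2dConst (p : Params) : Fading → ℝ
  | .kappaMu κ μ w =>
      p.q * p.eps * p.lam / (xiHat p * Real.exp (μ * κ))
        * (hyp1F1 (μ + p.deltaD) μ (μ * κ) / nsinc p.deltaD)
        * (w / ((1 + κ) * μ)) ^ p.deltaD
        * gbinom (μ + p.deltaD - 1) p.deltaD
  | .etaMu η μ w =>
      p.q * p.eps * p.lam / (xiHat p * Fading.hPar η ^ μ)
        * (₂F₁ (μ + p.deltaD / 2 + 1 / 2) (μ + p.deltaD / 2) (μ + 1 / 2)
            ((Fading.HPar η / Fading.hPar η) ^ 2) / nsinc p.deltaD)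
        * (w / (2 * μ * Fading.hPar η)) ^ p.deltaD
        * gbinom (2 * μ + p.deltaD - 1) p.deltaD

/-- The summands of the series in `φ(r)`, see `cellPhi`. -/
def cellPhiTerm (p : Params) (s r : ℝ) : Fading → ℕ → ℂ
  | .kappaMu κ μ w, n =>
      (((μ * κ) ^ n / ((n.factorial : ℝ) * Real.Gamma (μ + n)) : ℝ) : ℂ)
        * meijerG 2 1 [1 - p.deltaC, 1] [0, n + μ - p.deltaC]
            (μ * (1 + κ) * (Real.pi * p.lamB) ^ (1 / p.deltaC) * r ^ p.tauC / (s * w))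
  | .etaMu η μ w, n =>
      (((2 : ℝ) ^ (-2 * (n : ℝ) - 2 * μ) / ((n.factorial : ℝ) * Real.Gamma (μ + n + 1 / 2))
          * (Fading.HPar η / Fading.hPar η) ^ (2 * n) : ℝ) : ℂ)
        * meijerG 2 1 [1 - p.deltaC, 1] [0, 2 * n + 2 * μ - p.deltaC]
            (2 * μ * Fading.hPar η * (Real.pi * p.lamB) ^ (1 / p.deltaC) * r ^ p.tauC
              / (s * w))

/-- The function `φ(r)` in the Laplace transform at `s` of the interference at the base station. -/
def cellPhi (p : Params) (F : Fading) (s r : ℝ) : ℂ :=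
  ((match F with
    | .kappaMu κ μ w =>
        Real.pi * p.lamB * r ^ 2 * p.deltaC / Real.exp (μ * κ)
          * (μ * (1 + κ) / (s * w)) ^ p.deltaC
    | .etaMu η μ w =>
        2 * Real.pi ^ (3 / 2 : ℝ) * p.lamB * r ^ 2 * p.deltaC
            / (Real.Gamma μ * Fading.hPar η ^ μ)
          * (2 * μ * Fading.hPar η / (s * w)) ^ p.deltaC : ℝ) : ℂ)
    * ∑' n, cellPhiTerm p s r F n

end Overlay

end

/-! Bit error probability. Expanding the Bessel functions term by term shows that a κ-μ or η-μ law
is a mixture of gamma laws with weights α_n, shapes i_n and common scale σ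
(`Fading.Valid.lintegral_law`). For a gamma gain of shape i and a fixed denominator y = I + N₀, the
mean BEP is 1/2 + ∫ g_i(t) e^(-yt/σ) dt (`integral_condBEP_gammaMeasure`). Since y enters only
through an exponential, averaging over the independent interference produces its Laplace transform,
and t = σx/N₀ gives the integrals of the theorem.

The kernel. Termwise fractional integration and differentiation of power series give g_i(x) = -a^b
x^(b-1) K(ax) / (2Γ(b)Γ(i)), where K is the Kummer function `kummerEntire b i` (`gTerm_eq`). K is a
gamma average of a Bessel function that is bounded by Poisson's integral, whence |g_i(x)| ≤ C
Γ(i+b)/Γ(i) x^(b-1) (`abs_gTerm_le`). The quotient Γ(i_n+b)/Γ(i_n) grows at most polynomially in n,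
while α_n decays at least exponentially up to polynomial factors. Hence sums and integrals may be
exchanged, and the summed integrand is continuous and at most a multiple of x^(b-1).

Gauss-Laguerre limit. That bound is all the quadrature needs (`LaguerreConverges.of_abs_le_rpow`).
For a resolvent 1/(x+t), the function (L_M(x)² - L_M(-t)²)/(x+t) is a polynomial of degree less than
2M, on which the rule is exact; so the error lies between 0 and 1/(t L_M(-t)²)
(`laguerreRule_resolvent`). Partial fractions and Weierstrass approximation then give all continuous
functions of 1/(x+1) on [0, 1]. Powers x^(p-1) with 0 < p < 1 are positive mixtures of resolvents,
and the sign of the error provides the domination. A cutoff argument passes to every continuous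
function dominated by such powers and polynomials.

Interference. For a Poisson process with independent marks, E exp(-∑ T(X_j, m_j)) = exp(-∫ (1 - E
e^(-T(x,m))) Λ(dx)), proved for [0, ∞]-valued T, so that infinite sums need no separate treatment
(`IsPoissonProcess.lintegral_expNeg_marked`). Replacing T by sT and letting s tend to 0 yields
almost sure finiteness (`IsPoissonProcess.shotNoise`). In D2D mode the plane integral is πΓ(1-δ_d)
A^δ_d with A = s L^τ_d G; its mean factors into E[L²; L ≤ θ], E[G^δ_d] and probabilities, and the
gamma mixture turns E[G^δ_d] into a hypergeometric series. In cellular mode the interferers stay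
outside the cell, where the exponent is finite because τ_c > 2; the gamma mixture expresses φ(r)
through the integrals ∫₀¹ u^(δ-1) (1+u/z)^(-ν) du.

Meijer functions. No contour is moved and no residue is taken. Multiplying a Mellin transform by
that of a kernel k means averaging the original function against k (`mellinInv_mul`). Starting from
Γ(B+s), the transform of y^B e^(-y), the remaining gamma factors and quotients are transforms of
gamma and beta densities. This gives absolute convergence and the value on every separating line
(`meijerG_two_one`, `meijerG_one_two`). -/

section

open scoped ENNReal NNReal

noncomputable section

namespace Overlay

section

/-! ### The Laplace functional of a marked Poisson process -/

/-- The function `e^(-x)` on `[0, ∞]`. -/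
def expNeg (x : ℝ≥0∞) : ℝ≥0∞ := EReal.exp (-(x : EReal))

theorem expNeg_zero : expNeg 0 = 1 := by simp [expNeg]

theorem expNeg_top : expNeg ⊤ = 0 := by simp [expNeg]

theorem expNeg_add (x y : ℝ≥0∞) : expNeg (x + y) = expNeg x * expNeg y := by
  unfold expNeg
  rw [← EReal.exp_add, EReal.coe_ennreal_add, EReal.neg_add, sub_eq_add_neg]
  · left; simp
  · right; simp

theorem expNeg_ofReal {r : ℝ} (hr : 0 ≤ r) :
    expNeg (ENNReal.ofReal r) = ENNReal.ofReal (Real.exp (-r)) := by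
  unfold expNeg
  rw [EReal.coe_ennreal_ofReal, max_eq_left hr, ← EReal.coe_neg, EReal.exp_coe]

theorem continuous_expNeg : Continuous expNeg :=
  ENNReal.continuous_exp.comp (continuous_neg.comp continuous_coe_ennreal_ereal)

theorem measurable_expNeg : Measurable expNeg := continuous_expNeg.measurable

theorem expNeg_le_one (x : ℝ≥0∞) : expNeg x ≤ 1 := by
  unfold expNeg
  rw [EReal.exp_le_one_iff, EReal.neg_le_zero]
  exact EReal.coe_ennreal_nonneg x

theorem expNeg_antitone : Antitone expNeg := fun x y h => by
  unfold expNeg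
  rw [EReal.exp_le_exp_iff, EReal.neg_le_neg_iff]
  exact_mod_cast h

theorem expNeg_sum {ι : Type*} (s : Finset ι) (f : ι → ℝ≥0∞) :
    expNeg (∑ i ∈ s, f i) = ∏ i ∈ s, expNeg (f i) := by
  classical
  induction s using Finset.induction_on with
  | empty => simp [expNeg_zero]
  | insert a s ha ih => rw [Finset.sum_insert ha, Finset.prod_insert ha, expNeg_add, ih]

theorem tendsto_prod_expNeg (f : ℕ → ℝ≥0∞) :
    Tendsto (fun n => ∏ j ∈ Finset.range n, expNeg (f j)) atTop (𝓝 (expNeg (∑' j, f j))) := by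
  simp_rw [← expNeg_sum]
  exact (continuous_expNeg.tendsto _).comp (ENNReal.summable.hasSum.tendsto_sum_nat)

/-- The function `-log x` on `[0, 1]`, with values in `[0, ∞]`. -/
def negLog (x : ℝ≥0∞) : ℝ≥0∞ := (-ENNReal.log x).toENNReal

theorem measurable_negLog : Measurable negLog :=
  (continuous_neg.measurable.comp ENNReal.measurable_log).ereal_toENNReal

theorem expNeg_negLog {x : ℝ≥0∞} (hx : x ≤ 1) : expNeg (negLog x) = x := by
  unfold expNeg negLog
  rw [EReal.coe_toENNReal, neg_neg, ENNReal.exp_log]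
  have : ENNReal.log x ≤ 0 := by
    rw [← ENNReal.log_one]; exact ENNReal.log_monotone hx
  simpa using this

/-- Generating function of the Poisson law, E z^N = e^(-(1-z)r) at z = e^(-c). Finiteness of `c`
allows the computation in real numbers. -/
theorem lintegral_expNeg_poisson (r : ℝ≥0) {c : ℝ≥0∞} (hc : c ≠ ⊤) :
    ∫⁻ k, expNeg (c * k) ∂((poissonMeasure r).map fun k : ℕ => (k : ℝ≥0∞))
      = expNeg ((1 - expNeg c) * r) := by
  rw [lintegral_map (f := fun k => expNeg (c * k))
    (measurable_expNeg.comp (measurable_const_mul c)) .of_discrete, poissonMeasure,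
    lintegral_sum_measure]
  simp_rw [lintegral_smul_measure, lintegral_dirac, smul_eq_mul]
  obtain ⟨c, hc0, rfl⟩ : ∃ d : ℝ, 0 ≤ d ∧ c = ENNReal.ofReal d :=
    ⟨c.toReal, ENNReal.toReal_nonneg, (ENNReal.ofReal_toReal hc).symm⟩
  have h1 : ∀ n : ℕ, ENNReal.ofReal (Real.exp (-r) * r ^ n / n.factorial)
      * expNeg (ENNReal.ofReal c * n)
      = ENNReal.ofReal (Real.exp (-r) * ((r * Real.exp (-c)) ^ n / n.factorial)) := by
    intro n
    rw [← ENNReal.ofReal_natCast n, ← ENNReal.ofReal_mul hc0, expNeg_ofReal (by positivity),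
      ← ENNReal.ofReal_mul (by positivity), mul_pow, ← Real.exp_nat_mul]
    congr 1
    rw [show -(c * (n : ℝ)) = n * -c by ring]
    ring
  have h2 : HasSum (fun n : ℕ => Real.exp (-r) * ((r * Real.exp (-c)) ^ n / n.factorial))
      (Real.exp (-r) * Real.exp (r * Real.exp (-c))) := by
    rw [Real.exp_eq_exp_ℝ]
    exact (NormedSpace.expSeries_div_hasSum_exp (r * NormedSpace.exp (-c) : ℝ)).mul_left _
  simp_rw [h1]
  rw [← ENNReal.ofReal_tsum_of_nonneg (fun n => by positivity) h2.summable, h2.tsum_eq,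
    expNeg_ofReal hc0, ← Real.exp_add, ← ENNReal.ofReal_one,
    ← ENNReal.ofReal_sub _ (Real.exp_pos _).le, ← ENNReal.ofReal_coe_nnreal,
    ← ENNReal.ofReal_mul (by simpa using hc0), expNeg_ofReal]
  · congr 2; ring
  · exact mul_nonneg (by simpa using hc0) r.2

variable {Ω E : Type*} [MeasurableSpace Ω] [MeasurableSpace E] {P : Measure Ω}
  {Λ : Measure E} {X : ℕ → Ω → E}

/-- The sum over the points is a linear combination of the counts in the level sets, which are
independent Poisson variables. -/
theorem IsPoissonProcess.lintegral_expNeg_simple [IsProbabilityMeasure P]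
    (hX : IsPoissonProcess P Λ X) (h : SimpleFunc E ℝ≥0∞) (hfin : ∀ x, h x ≠ ⊤)
    (hsupp : ∀ c ≠ 0, Λ (h ⁻¹' {c}) ≠ ⊤) :
    ∫⁻ ω, expNeg (∑' j, h (X j ω)) ∂P = expNeg (∫⁻ x, 1 - expNeg (h x) ∂Λ) := by
  classical
  -- The value 0 is dropped: its level set may have infinite intensity, and it contributes nothing
  -- to either side.
  set s := h.range.erase 0 with hs
  let e := s.equivFin
  let c : Fin s.card → ℝ≥0∞ := fun i => e.symm i
  let A : Fin s.card → Set E := fun i => h ⁻¹' {c i}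
  have hc0 : ∀ i, c i ≠ 0 := fun i => (Finset.mem_erase.1 (e.symm i).2).1
  have hct : ∀ i, c i ≠ ⊤ := fun i => by
    obtain ⟨x, hx⟩ := SimpleFunc.mem_range.1 (Finset.mem_erase.1 (e.symm i).2).2
    show ((e.symm i : s) : ℝ≥0∞) ≠ ⊤
    rw [← hx]; exact hfin x
  have hA : ∀ i, MeasurableSet (A i) := fun i => h.measurableSet_preimage _
  have hdisj : Pairwise fun i j => Disjoint (A i) (A j) := by
    intro i j hij
    refine Disjoint.preimage _ ?_
    rw [Set.disjoint_singleton]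
    intro h'
    exact hij (e.symm.injective (Subtype.ext h'))
  have hval : ∀ x, h x = ∑ i, c i * (A i).indicator (fun _ => (1 : ℝ≥0∞)) x := by
    intro x
    have h1 : ∑ i, c i * (A i).indicator (fun _ => (1 : ℝ≥0∞)) x
        = ∑ y ∈ s, y * (h ⁻¹' {y}).indicator (fun _ => (1 : ℝ≥0∞)) x := by
      rw [← Finset.sum_coe_sort s]
      exact Fintype.sum_equiv e.symm _ _ fun i => rfl
    rw [h1]
    by_cases h0 : h x = 0
    · rw [h0]
      symm
      refine Finset.sum_eq_zero fun y hy => ?_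
      have : y ≠ h x := by rw [h0]; exact (Finset.mem_erase.1 hy).1
      simp [Set.indicator, this.symm]
    · rw [Finset.sum_eq_single_of_mem (h x)]
      · simp
      · exact Finset.mem_erase.2 ⟨h0, h.mem_range_self x⟩
      · intro y _ hy
        simp [Set.indicator, hy.symm]
  have hcount : ∀ ω, ∑' j, h (X j ω) = ∑ i, c i * pointCount X (A i) ω := by
    intro ω
    simp_rw [hval, pointCount, ← ENNReal.tsum_mul_left]
    exact Summable.tsum_finsetSum fun _ _ => ENNReal.summable
  have hlaw := fun i => hX.count_law (A i) (hA i) (hsupp _ (hc0 i))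
  simp_rw [hcount, expNeg_sum]
  have hind := (hX.count_indep _ A hA hdisj).comp (fun i x => expNeg (c i * x))
    fun i => measurable_expNeg.comp (measurable_const_mul _)
  have hmeas : ∀ i, Measurable (pointCount X (A i)) := fun i =>
    Measurable.tsum fun j => (measurable_const.indicator (hA i)).comp (hX.measurable j)
  have := lintegral_prod_eq_prod_lintegral_of_indepFun Finset.univ _ hind
    fun i => (measurable_expNeg.comp (measurable_const_mul (c i))).comp (hmeas i)
  simp only [Function.comp_def] at this
  rw [this]
  have h2 : ∀ i, ∫⁻ ω, expNeg (c i * pointCount X (A i) ω) ∂P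
      = expNeg ((1 - expNeg (c i)) * Λ (A i)) := by
    intro i
    rw [(hlaw i).lintegral_comp (f := fun x => expNeg (c i * x))
      (measurable_expNeg.comp (measurable_const_mul _)).aemeasurable,
      lintegral_expNeg_poisson _ (hct i), ENNReal.coe_toNNReal (hsupp _ (hc0 i))]
  simp_rw [h2, ← expNeg_sum]
  congr 1
  have h3 : ∀ x, 1 - expNeg (h x) = (h.map fun y => 1 - expNeg y) x := fun x => rfl
  simp_rw [h3]
  rw [SimpleFunc.lintegral_eq_lintegral, SimpleFunc.map_lintegral]
  rw [← Finset.sum_erase h.range (a := 0) (by simp [expNeg_zero]), ← hs, ← Finset.sum_coe_sort s]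
  exact Fintype.sum_equiv e.symm _ _ fun i => rfl

/-- Monotone approximation by simple functions. `SimpleFunc.eapprox` has finite values, and the
restriction to spanning sets makes every nonzero level set of finite intensity. -/
theorem IsPoissonProcess.lintegral_expNeg_tsum [IsProbabilityMeasure P] [SigmaFinite Λ]
    (hX : IsPoissonProcess P Λ X) {h : E → ℝ≥0∞} (hh : Measurable h) :
    ∫⁻ ω, expNeg (∑' j, h (X j ω)) ∂P = expNeg (∫⁻ x, 1 - expNeg (h x) ∂Λ) := by
  let g : ℕ → SimpleFunc E ℝ≥0∞ := fun n =>
    (SimpleFunc.eapprox h n).restrict (spanningSets Λ n)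
  have hg : ∀ n x, g n x = (spanningSets Λ n).indicator (SimpleFunc.eapprox h n) x := fun n x => by
    simp only [g]
    rw [SimpleFunc.restrict_apply _ (measurableSet_spanningSets Λ n)]
  have hmono : ∀ x, Monotone fun n => g n x := fun x m n hmn => by
    simp only [hg]
    refine (Set.indicator_le_indicator_of_subset (monotone_spanningSets Λ hmn)
      (fun _ => zero_le) x).trans (Set.indicator_le_indicator ?_)
    exact SimpleFunc.monotone_eapprox h hmn x
  have hlim : ∀ x, Tendsto (fun n => g n x) atTop (𝓝 (h x)) := fun x => by
    have h1 : Tendsto (fun n => SimpleFunc.eapprox h n x) atTop (𝓝 (h x)) := by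
      rw [← SimpleFunc.iSup_eapprox_apply hh x]
      exact tendsto_atTop_iSup fun m n hmn => SimpleFunc.monotone_eapprox h hmn x
    refine h1.congr' ?_
    filter_upwards [eventually_ge_atTop (spanningSetsIndex Λ x)] with n hn
    rw [hg, Set.indicator_of_mem]
    exact monotone_spanningSets Λ hn (mem_spanningSetsIndex Λ x)
  have hsimple : ∀ n, ∫⁻ ω, expNeg (∑' j, g n (X j ω)) ∂P
      = expNeg (∫⁻ x, 1 - expNeg (g n x) ∂Λ) := fun n => by
    refine hX.lintegral_expNeg_simple (g n) (fun x => ?_) (fun c hc => ?_)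
    · rw [hg]
      by_cases hx : x ∈ spanningSets Λ n
      · rw [Set.indicator_of_mem hx]; exact (SimpleFunc.eapprox_lt_top h n x).ne
      · rw [Set.indicator_of_notMem hx]; simp
    · refine ne_top_of_le_ne_top (measure_spanningSets_lt_top Λ n).ne (measure_mono ?_)
      intro x hx
      by_contra hx'
      rw [Set.mem_preimage, hg, Set.indicator_of_notMem hx', Set.mem_singleton_iff] at hx
      exact hc hx.symm
  have hL : Tendsto (fun n => ∫⁻ ω, expNeg (∑' j, g n (X j ω)) ∂P) atTop
      (𝓝 (∫⁻ ω, expNeg (∑' j, h (X j ω)) ∂P)) := by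
    refine tendsto_lintegral_of_dominated_convergence (fun _ => 1) (fun n => ?_) (fun n => ?_)
      (by simp) (ae_of_all _ fun ω => ?_)
    · exact measurable_expNeg.comp
        (Measurable.tsum fun j => (g n).measurable.comp (hX.measurable j))
    · exact ae_of_all _ fun ω => expNeg_le_one _
    · refine (continuous_expNeg.tendsto _).comp ?_
      -- The sum over the points is an integral against counting measure, so monotone convergence
      -- applies to it.
      simp_rw [← lintegral_count]
      exact lintegral_tendsto_of_tendsto_of_monotone (fun n => .of_discrete)
        (ae_of_all _ fun j => hmono _) (ae_of_all _ fun j => hlim _)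
  have hR : Tendsto (fun n => expNeg (∫⁻ x, 1 - expNeg (g n x) ∂Λ)) atTop
      (𝓝 (expNeg (∫⁻ x, 1 - expNeg (h x) ∂Λ))) := by
    refine (continuous_expNeg.tendsto _).comp ?_
    refine lintegral_tendsto_of_tendsto_of_monotone
      (fun n => (measurable_const.sub (measurable_expNeg.comp (g n).measurable)).aemeasurable)
      (ae_of_all _ fun x m n hmn => tsub_le_tsub_left (expNeg_antitone (hmono x hmn)) _)
      (ae_of_all _ fun x => ?_)
    exact ENNReal.Tendsto.sub tendsto_const_nhds ((continuous_expNeg.tendsto _).comp (hlim x))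
      (Or.inl ENNReal.one_ne_top)
  simp_rw [hsimple] at hL
  exact tendsto_nhds_unique hL hR

/-- Laplace functional of a Poisson process with independent marks. -/
theorem IsPoissonProcess.lintegral_expNeg_marked [IsProbabilityMeasure P] [SigmaFinite Λ]
    (hX : IsPoissonProcess P Λ X) {M : Type*} [MeasurableSpace M] {ν : Measure M}
    [IsProbabilityMeasure ν] {m : ℕ → Ω → M} (hm : ∀ j, HasLaw (m j) ν P)
    (hind : iIndepFun m P) (hXm : IndepFun (fun ω j => X j ω) (fun ω j => m j ω) P)
    {T : E × M → ℝ≥0∞} (hT : Measurable T) :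
    ∫⁻ ω, expNeg (∑' j, T (X j ω, m j ω)) ∂P
      = expNeg (∫⁻ x, 1 - ∫⁻ y, expNeg (T (x, y)) ∂ν ∂Λ) := by
  set φ : E → ℝ≥0∞ := fun x => ∫⁻ y, expNeg (T (x, y)) ∂ν with hφ
  have hφm : Measurable φ := (measurable_expNeg.comp hT).lintegral_prod_right'
  have hφ1 : ∀ x, φ x ≤ 1 := fun x => by
    calc φ x ≤ ∫⁻ _, 1 ∂ν := lintegral_mono fun y => expNeg_le_one _
      _ = 1 := by simp
  have hXmeas : Measurable fun ω j => X j ω := measurable_pi_iff.2 hX.measurable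
  have hmmeas : AEMeasurable (fun ω j => m j ω) P := aemeasurable_pi_iff.2 fun j => (hm j).aemeasurable
  have hprod := (indepFun_iff_map_prod_eq_prod_map_map hXmeas.aemeasurable hmmeas).1 hXm
  -- With all points fixed, the marks are still independent with law `ν`, so each of the first n
  -- factors averages to φ(X_j).
  have hn : ∀ n, ∫⁻ ω, ∏ j ∈ Finset.range n, expNeg (T (X j ω, m j ω)) ∂P
      = ∫⁻ ω, ∏ j ∈ Finset.range n, φ (X j ω) ∂P := by
    intro n
    have hmeas : Measurable fun z : (ℕ → E) × (ℕ → M) =>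
        ∏ j ∈ Finset.range n, expNeg (T (z.1 j, z.2 j)) :=
      Finset.measurable_prod _ fun j _ => measurable_expNeg.comp (hT.comp (by fun_prop))
    have := lintegral_map' (μ := P) (f := fun z : (ℕ → E) × (ℕ → M) =>
        ∏ j ∈ Finset.range n, expNeg (T (z.1 j, z.2 j))) hmeas.aemeasurable
        (hXmeas.aemeasurable.prodMk hmmeas)
    rw [← this, hprod]
    have : IsProbabilityMeasure (P.map fun ω j => m j ω) := Measure.isProbabilityMeasure_map hmmeas
    rw [lintegral_prod _ hmeas.aemeasurable]
    rw [lintegral_map hmeas.lintegral_prod_right' hXmeas]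
    refine lintegral_congr fun ω => ?_
    have hml := (hmeas.comp (measurable_prodMk_left (x := fun j => X j ω))).aemeasurable
      (μ := P.map fun ω j => m j ω)
    simp only [Function.comp_def] at hml
    rw [lintegral_map' hml hmmeas]
    -- A law makes a mark only almost everywhere measurable; independence is therefore applied to
    -- measurable versions.
    have hm' : ∀ j, Measurable ((hm j).aemeasurable.mk (m j)) := fun j =>
      (hm j).aemeasurable.measurable_mk
    have hae : ∀ᵐ ω' ∂P, ∀ j, m j ω' = (hm j).aemeasurable.mk (m j) ω' :=
      ae_all_iff.2 fun j => (hm j).aemeasurable.ae_eq_mk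
    have hind' : iIndepFun (fun j => (hm j).aemeasurable.mk (m j)) P :=
      hind.congr fun j => (hm j).aemeasurable.ae_eq_mk
    have hcomp := hind'.comp (fun j y => expNeg (T (X j ω, y))) fun j =>
      measurable_expNeg.comp (hT.comp measurable_prodMk_left)
    have h5 := lintegral_prod_eq_prod_lintegral_of_indepFun (Finset.range n) _ hcomp
      fun j => (measurable_expNeg.comp (hT.comp measurable_prodMk_left)).comp (hm' j)
    simp only [Function.comp_def] at h5
    calc _ = ∫⁻ ω', ∏ j ∈ Finset.range n,
          expNeg (T (X j ω, (hm j).aemeasurable.mk (m j) ω')) ∂P := by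
          refine lintegral_congr_ae ?_
          filter_upwards [hae] with ω' h'
          simp_rw [h']
      _ = _ := by
          rw [h5]
          refine Finset.prod_congr rfl fun j _ => ?_
          have hl : HasLaw ((hm j).aemeasurable.mk (m j)) ν P :=
            (hm j).congr (hm j).aemeasurable.ae_eq_mk.symm
          exact hl.lintegral_comp (f := fun y => expNeg (T (X j ω, y)))
            (measurable_expNeg.comp (hT.comp measurable_prodMk_left)).aemeasurable
  have hlim1 : Tendsto (fun n => ∫⁻ ω, ∏ j ∈ Finset.range n, expNeg (T (X j ω, m j ω)) ∂P) atTop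
      (𝓝 (∫⁻ ω, expNeg (∑' j, T (X j ω, m j ω)) ∂P)) := by
    refine tendsto_lintegral_of_dominated_convergence' (fun _ => 1) (fun n => ?_) (fun n => ?_)
      (by simp) (ae_of_all _ fun ω => tendsto_prod_expNeg _)
    · exact Finset.aemeasurable_fun_prod _ fun j _ => (measurable_expNeg.comp hT).comp_aemeasurable
        ((hX.measurable j).aemeasurable.prodMk (hm j).aemeasurable)
    · exact ae_of_all _ fun ω => Finset.prod_le_one' fun j _ => expNeg_le_one _
  -- As φ = e^(-(-log φ)) takes values in [0, 1], the limit of the products is the exponential of a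
  -- sum over the points alone, and the unmarked formula applies to -log φ.
  have hlim2 : Tendsto (fun n => ∫⁻ ω, ∏ j ∈ Finset.range n, φ (X j ω) ∂P) atTop
      (𝓝 (∫⁻ ω, expNeg (∑' j, negLog (φ (X j ω))) ∂P)) := by
    refine tendsto_lintegral_of_dominated_convergence (fun _ => 1) (fun n => ?_) (fun n => ?_)
      (by simp) (ae_of_all _ fun ω => ?_)
    · exact Finset.measurable_fun_prod _ fun j _ => hφm.comp (hX.measurable j)
    · exact ae_of_all _ fun ω => Finset.prod_le_one' fun j _ => hφ1 _
    · refine (tendsto_prod_expNeg fun j => negLog (φ (X j ω))).congr fun n => ?_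
      exact Finset.prod_congr rfl fun j _ => expNeg_negLog (hφ1 _)
  simp_rw [hn] at hlim1
  have hfin := hX.lintegral_expNeg_tsum (measurable_negLog.comp hφm)
  simp only [Function.comp_def, expNeg_negLog (hφ1 _)] at hfin
  rw [tendsto_nhds_unique hlim1 hlim2, hfin]

/-- The exponent of the Laplace functional of the sum of `u` over a marked Poisson process. -/
def shotExponent {E M : Type*} [MeasurableSpace E] [MeasurableSpace M] (Λ : Measure E)
    (ν : Measure M) (u : E × M → ℝ) (s : ℝ) : ℝ≥0∞ :=
  ∫⁻ x, 1 - ∫⁻ y, expNeg (ENNReal.ofReal (s * u (x, y))) ∂ν ∂Λ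

/-- Finiteness needs no further estimate: if S is the sum in [0, ∞], then E e^(-sS) ≤ P(S < ∞), and
the left side tends to 1 as s tends to 0 because the exponent tends to 0. -/
theorem IsPoissonProcess.shotNoise [IsProbabilityMeasure P] [SigmaFinite Λ]
    (hX : IsPoissonProcess P Λ X) {M : Type*} [MeasurableSpace M] {ν : Measure M}
    [IsProbabilityMeasure ν] {m : ℕ → Ω → M} (hm : ∀ j, HasLaw (m j) ν P)
    (hind : iIndepFun m P) (hXm : IndepFun (fun ω j => X j ω) (fun ω j => m j ω) P)
    {u : E × M → ℝ} (hu : Measurable u) (hu0 : ∀ᵐ y ∂ν, ∀ x, 0 ≤ u (x, y))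
    (hJ : Tendsto (shotExponent Λ ν u) (𝓝[>] 0) (𝓝 0)) :
    (∀ᵐ ω ∂P, Summable fun j => u (X j ω, m j ω)) ∧
      AEMeasurable (fun ω => ∑' j, u (X j ω, m j ω)) P ∧
      (∀ᵐ ω ∂P, 0 ≤ ∑' j, u (X j ω, m j ω)) ∧
      ∀ s, 0 < s → laplace P (fun ω => ∑' j, u (X j ω, m j ω)) s
        = (expNeg (shotExponent Λ ν u s)).toReal := by
  have hnn : ∀ᵐ ω ∂P, ∀ j, 0 ≤ u (X j ω, m j ω) := ae_all_iff.2 fun j => by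
    have : ∀ᵐ ω ∂P, ∀ x, 0 ≤ u (x, m j ω) := by
      refine ae_of_ae_map (p := fun y => ∀ x, 0 ≤ u (x, y)) (hm j).aemeasurable ?_
      rw [(hm j).map_eq]; exact hu0
    filter_upwards [this] with ω h using h _
  set S : Ω → ℝ≥0∞ := fun ω => ∑' j, ENNReal.ofReal (u (X j ω, m j ω)) with hS
  have hSm : AEMeasurable S P := AEMeasurable.tsum fun j =>
    (hu.comp_aemeasurable ((hX.measurable j).aemeasurable.prodMk (hm j).aemeasurable)).ennreal_ofReal
  have hlap : ∀ s, 0 < s → ∫⁻ ω, expNeg (ENNReal.ofReal s * S ω) ∂P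
      = expNeg (shotExponent Λ ν u s) := fun s hs => by
    have := hX.lintegral_expNeg_marked hm hind hXm
      (T := fun z => ENNReal.ofReal (s * u z)) (by fun_prop)
    simp only [hS, ← ENNReal.tsum_mul_left, ← ENNReal.ofReal_mul hs.le]
    exact this
  have hfin : ∀ᵐ ω ∂P, S ω ≠ ⊤ := by
    have hle : ∀ s, 0 < s → expNeg (shotExponent Λ ν u s) ≤ P {ω | S ω ≠ ⊤} := fun s hs => by
      rw [← hlap s hs]
      have hms : NullMeasurableSet {ω | S ω ≠ ⊤} P :=
        hSm.nullMeasurableSet_preimage (measurableSet_singleton ⊤).compl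
      rw [← lintegral_indicator_one₀ hms]
      refine lintegral_mono fun ω => ?_
      by_cases h : S ω = ⊤
      · rw [h, ENNReal.mul_top (by simpa using hs), expNeg_top]; exact zero_le
      · rw [Set.indicator_of_mem (by exact h)]; exact expNeg_le_one _
    have h1 : (1 : ℝ≥0∞) ≤ P {ω | S ω ≠ ⊤} := by
      have ht := (continuous_expNeg.tendsto 0).comp hJ
      rw [expNeg_zero] at ht
      refine le_of_tendsto ht ?_
      filter_upwards [self_mem_nhdsWithin] with s hs using hle s hs
    have hms : NullMeasurableSet {ω | S ω ≠ ⊤} P :=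
      hSm.nullMeasurableSet_preimage (measurableSet_singleton ⊤).compl
    rw [ae_iff, ← Set.compl_ofPred, prob_compl_eq_zero_iff₀ hms]
    exact le_antisymm prob_le_one h1
  have hIS : ∀ᵐ ω ∂P, Summable (fun j => u (X j ω, m j ω)) ∧
      ∑' j, u (X j ω, m j ω) = (S ω).toReal := by
    filter_upwards [hnn, hfin] with ω h0 hf
    have hsum : Summable fun j => u (X j ω, m j ω) := by
      have := ENNReal.summable_toReal hf
      simpa only [ENNReal.toReal_ofReal (h0 _)] using this
    refine ⟨hsum, ?_⟩
    rw [hS]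
    simp only
    rw [← ENNReal.ofReal_tsum_of_nonneg h0 hsum, ENNReal.toReal_ofReal (tsum_nonneg h0)]
  refine ⟨hIS.mono fun ω h => h.1, ?_, ?_, fun s hs => ?_⟩
  · refine AEMeasurable.congr hSm.ennreal_toReal ?_
    filter_upwards [hIS] with ω h using h.2.symm
  · filter_upwards [hnn] with ω h using tsum_nonneg h
  · rw [← hlap s hs, laplace, integral_eq_lintegral_of_nonneg_ae]
    · congr 1
      refine lintegral_congr_ae ?_
      filter_upwards [hIS, hfin] with ω h hf
      rw [h.2, ← expNeg_ofReal (mul_nonneg hs.le ENNReal.toReal_nonneg), ENNReal.ofReal_mul hs.le,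
        ENNReal.ofReal_toReal hf]
    · exact ae_of_all _ fun ω => (Real.exp_pos _).le
    · refine AEStronglyMeasurable.congr (f := fun ω => Real.exp (-(s * (S ω).toReal))) ?_ ?_
      · exact (Real.measurable_exp.comp_aemeasurable
          ((hSm.ennreal_toReal.const_mul s).neg)).aestronglyMeasurable
      · filter_upwards [hIS] with ω h
        rw [h.2]

end

section

/-! ### Bounds for the gamma function -/

theorem Gamma_add_nat {x : ℝ} (hx : 0 < x) (n : ℕ) :
    Real.Gamma (x + n) = Real.Gamma x * ∏ j ∈ Finset.range n, (x + j) := by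
  induction n with
  | zero => simp
  | succ n ih =>
    rw [Finset.prod_range_succ, ← mul_assoc, ← ih, Nat.cast_succ, ← add_assoc,
      Real.Gamma_add_one (by positivity), mul_comm]

theorem Gamma_add_nat_le {x : ℝ} (hx : 0 < x) (n : ℕ) :
    Real.Gamma (x + n) ≤ Real.Gamma x * (x + n) ^ n := by
  rw [Gamma_add_nat hx]
  refine mul_le_mul_of_nonneg_left ?_ (Real.Gamma_pos_of_pos hx).le
  calc ∏ j ∈ Finset.range n, (x + (j : ℝ)) ≤ ∏ j ∈ Finset.range n, (x + n) := by
        refine Finset.prod_le_prod (fun j _ => by positivity) fun j hj => ?_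
        have : (j : ℝ) ≤ n := by exact_mod_cast (Finset.mem_range.1 hj).le
        linarith
    _ = _ := by simp

/-- In Euler's integral, t^(x+b-1) is at most t^(x-1) for t ≤ 1 and at most t^(x+K-1) for t ≥ 1. -/
theorem Gamma_add_le {x b : ℝ} (hx : 0 < x) (hb : 0 ≤ b) {K : ℕ} (hK : b ≤ K) :
    Real.Gamma (x + b) ≤ Real.Gamma x * (1 + (x + K) ^ K) := by
  have h1 : Real.Gamma (x + b) ≤ Real.Gamma x + Real.Gamma (x + K) := by
    rw [Real.Gamma_eq_integral hx, Real.Gamma_eq_integral (by positivity : 0 < x + b),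
      Real.Gamma_eq_integral (by positivity : 0 < x + (K : ℝ)),
      ← integral_add (Real.GammaIntegral_convergent hx)
        (Real.GammaIntegral_convergent (by positivity))]
    refine setIntegral_mono_on (Real.GammaIntegral_convergent (by positivity))
      ((Real.GammaIntegral_convergent hx).add (Real.GammaIntegral_convergent (by positivity)))
      measurableSet_Ioi fun t ht => ?_
    have ht0 : (0 : ℝ) < t := ht
    rw [← mul_add]
    refine mul_le_mul_of_nonneg_left ?_ (Real.exp_pos _).le
    rcases le_total t 1 with h | h
    · have := Real.rpow_le_rpow_of_exponent_ge ht0 h (by linarith : x - 1 ≤ x + b - 1)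
      have h2 : 0 ≤ t ^ (x + K - 1) := by positivity
      linarith
    · have := Real.rpow_le_rpow_of_exponent_le h (by linarith : x + b - 1 ≤ x + K - 1)
      have h2 : 0 ≤ t ^ (x - 1) := by positivity
      linarith
  have h2 := Gamma_add_nat_le hx K
  nlinarith [Real.Gamma_pos_of_pos hx]

/-- The numerator is first raised by an integer M ≥ B - A, each step multiplying it by at least A,
and then compared with the denominator through `Gamma_add_le`. -/
theorem exists_Gamma_div_le {A B : ℝ} (hA : 0 < A) (hB : 0 < B) :
    ∃ C : ℝ, ∃ N : ℕ, 0 ≤ C ∧ ∀ k : ℕ,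
      Real.Gamma (A + k) / Real.Gamma (B + k) ≤ C * (1 + (k : ℝ)) ^ N := by
  obtain ⟨M, hM⟩ := exists_nat_ge (B - A)
  obtain ⟨K, hK⟩ := exists_nat_ge (A + M - B)
  refine ⟨(1 + (B + K + 1) ^ K) / A ^ M, K, by positivity, fun k => ?_⟩
  have hk : (0 : ℝ) ≤ k := k.cast_nonneg
  have hG := Real.Gamma_pos_of_pos (by positivity : 0 < B + k)
  have hGA := Real.Gamma_pos_of_pos (by positivity : 0 < A + k)
  rw [div_le_iff₀ hG]
  have h1 : Real.Gamma (A + k) * A ^ M ≤ Real.Gamma (A + k + M) := by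
    rw [Gamma_add_nat (by positivity : 0 < A + k)]
    refine mul_le_mul_of_nonneg_left ?_ hGA.le
    calc A ^ M = ∏ j ∈ Finset.range M, A := by simp
      _ ≤ _ := Finset.prod_le_prod (fun j _ => hA.le) fun j _ => by
        have : (0 : ℝ) ≤ j := j.cast_nonneg
        linarith
  have h2 : Real.Gamma (A + k + M) ≤ Real.Gamma (B + k) * (1 + (B + k + K) ^ K) := by
    have := Gamma_add_le (by positivity : 0 < B + k) (by linarith : 0 ≤ A + M - B) hK
    convert this using 2
    ring
  have h3 : 1 + (B + k + K) ^ K ≤ (1 + (B + K + 1) ^ K) * (1 + (k : ℝ)) ^ K := by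
    have e1 : (B + k + K) ^ K ≤ (B + K + 1) ^ K * (1 + (k : ℝ)) ^ K := by
      rw [← mul_pow]
      refine pow_le_pow_left₀ (by positivity) ?_ _
      have : 0 ≤ (B + K) * k := by positivity
      nlinarith
    have e2 : 1 ≤ (1 + (k : ℝ)) ^ K := one_le_pow₀ (by linarith)
    nlinarith
  have h4 : Real.Gamma (A + k) * A ^ M
      ≤ Real.Gamma (B + k) * ((1 + (B + K + 1) ^ K) * (1 + (k : ℝ)) ^ K) :=
    h1.trans (h2.trans (mul_le_mul_of_nonneg_left h3 hG.le))
  calc Real.Gamma (A + k) = Real.Gamma (A + k) * A ^ M / A ^ M := by field_simp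
    _ ≤ Real.Gamma (B + k) * ((1 + (B + K + 1) ^ K) * (1 + (k : ℝ)) ^ K) / A ^ M := by gcongr
    _ = _ := by ring

/-- The bound y^N ≤ N! e^y at y = 1 + k turns the polynomial factor into a geometric one, which the
factorial absorbs. -/
theorem summable_pow_div_factorial_mul_pow (y : ℝ) (N : ℕ) :
    Summable fun k : ℕ => |y| ^ k / k.factorial * (1 + (k : ℝ)) ^ N := by
  have h := (Real.summable_pow_div_factorial (|y| * Real.exp 1)).mul_left
    (N.factorial * Real.exp 1)
  refine Summable.of_nonneg_of_le (fun k => by positivity) (fun k => ?_) h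
  have h1 : (1 + (k : ℝ)) ^ N ≤ N.factorial * (Real.exp 1 * Real.exp 1 ^ k) := by
    have := Real.pow_div_factorial_le_exp (1 + (k : ℝ)) (by positivity) N
    rw [div_le_iff₀ (by positivity), Real.exp_add] at this
    rw [← Real.exp_nat_mul, mul_one]; linarith
  calc _ ≤ |y| ^ k / k.factorial * (N.factorial * (Real.exp 1 * Real.exp 1 ^ k)) := by gcongr
    _ = _ := by rw [mul_pow]; ring

theorem summable_pow_div_factorial_mul_Gamma {A B : ℝ} (hA : 0 < A) (hB : 0 < B) (y : ℝ) (N : ℕ) :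
    Summable fun k : ℕ => |y| ^ k / k.factorial * (1 + (k : ℝ)) ^ N
      * (Real.Gamma (A + k) / Real.Gamma (B + k)) := by
  obtain ⟨C, K, hC, h⟩ := exists_Gamma_div_le hA hB
  refine Summable.of_nonneg_of_le (fun k => ?_) (fun k => ?_)
    ((summable_pow_div_factorial_mul_pow y (N + K)).mul_left C)
  · have := Real.Gamma_pos_of_pos (by positivity : 0 < A + k)
    have := Real.Gamma_pos_of_pos (by positivity : 0 < B + k)
    positivity
  · calc _ ≤ |y| ^ k / k.factorial * (1 + (k : ℝ)) ^ N * (C * (1 + (k : ℝ)) ^ K) := by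
          gcongr; exact h k
      _ = _ := by rw [pow_add]; ring

theorem summable_pow_div_factorial_mul_inv_Gamma {B : ℝ} (hB : 0 < B) (y : ℝ) :
    Summable fun k : ℕ => |y| ^ k / (k.factorial * Real.Gamma (B + k)) := by
  refine Summable.of_nonneg_of_le (fun k => ?_) (fun k => ?_)
    (summable_pow_div_factorial_mul_Gamma one_pos hB y 0)
  · have := Real.Gamma_pos_of_pos (by positivity : 0 < B + k)
    positivity
  · have hB' := Real.Gamma_pos_of_pos (by positivity : 0 < B + k)
    have h1 : 1 ≤ Real.Gamma (1 + k) := by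
      rw [add_comm, Real.Gamma_nat_eq_factorial]
      exact_mod_cast Nat.one_le_iff_ne_zero.2 k.factorial_ne_zero
    rw [pow_zero, mul_one, ← div_div, ← mul_div_assoc]
    gcongr
    exact le_mul_of_one_le_right (by positivity) h1

/-! ### Fading laws as mixtures of gamma laws -/

namespace Fading

variable {F : Fading}

theorem hPar_pos {η : ℝ} (hη : 0 < η) : 0 < hPar η := by unfold hPar; positivity

theorem hPar_sq_sub {η : ℝ} (hη : 0 < η) : hPar η ^ 2 - HPar η ^ 2 = hPar η := by
  unfold hPar HPar; field_simp; ring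

theorem div_sq_lt_one {η : ℝ} (hη : 0 < η) : (HPar η / hPar η) ^ 2 < 1 := by
  have h := hPar_pos hη
  rw [div_pow, div_lt_one (by positivity)]
  linarith [hPar_sq_sub hη]

theorem HPar_ne_zero {η : ℝ} (hη : 0 < η) (h1 : η ≠ 1) : HPar η ≠ 0 := by
  unfold HPar
  intro h
  have : η⁻¹ = η := by linarith
  have h2 : η * η = 1 := by rw [← mul_inv_cancel₀ hη.ne', this]
  exact h1 (by nlinarith)

theorem Valid.scale_pos (hF : F.Valid) : 0 < F.scale := by
  cases F with
  | kappaMu κ μ w => obtain ⟨h1, h2, h3⟩ := hF; simp only [scale]; positivity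
  | etaMu η μ w =>
    obtain ⟨h1, h2, h3⟩ := hF
    have := hPar_pos h1
    simp only [scale]; positivity

theorem Valid.order_pos (hF : F.Valid) (n : ℕ) : 0 < F.order n := by
  cases F with
  | kappaMu κ μ w => obtain ⟨h1, h2, h3⟩ := hF; simp only [order]; positivity
  | etaMu η μ w => obtain ⟨h1, h2, h3⟩ := hF; simp only [order]; positivity

theorem coeff_etaMu {η μ w : ℝ} (hη : 0 < η) (n : ℕ) :
    (etaMu η μ w).coeff n = Real.Gamma (n + μ) / (n.factorial * Real.Gamma μ)
      * ((HPar η / hPar η) ^ 2) ^ n * (hPar η ^ μ)⁻¹ := by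
  have h := hPar_pos hη
  simp only [coeff, gbinom]
  rw [show (n : ℝ) + μ - 1 + 1 = n + μ by ring, show (n : ℝ) + μ - 1 - n + 1 = μ by ring,
    Real.Gamma_nat_eq_factorial, Real.rpow_add h, show (2 * (n : ℝ)) = ((2 * n : ℕ) : ℝ) by simp,
    Real.rpow_natCast, ← pow_mul, div_pow]
  field_simp

theorem Valid.coeff_nonneg (hF : F.Valid) (n : ℕ) : 0 ≤ F.coeff n := by
  cases F with
  | kappaMu κ μ w => obtain ⟨h1, h2, h3⟩ := hF; simp only [coeff]; positivity
  | etaMu η μ w =>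
    obtain ⟨h1, h2, h3⟩ := hF
    rw [coeff_etaMu h1]
    have := hPar_pos h1
    have := Real.Gamma_pos_of_pos h2
    have := Real.Gamma_pos_of_pos (by positivity : 0 < n + μ)
    positivity

/-- For κ-μ fading this is an exponential series; for η-μ fading it is dominated by a polynomial
times a geometric series with ratio (H/h)² = 1 - 1/h < 1. -/
theorem Valid.summable_coeff_mul_pow (hF : F.Valid) (N : ℕ) :
    Summable fun n => F.coeff n * (1 + (n : ℝ)) ^ N := by
  cases F with
  | kappaMu κ μ w =>
    obtain ⟨h1, h2, h3⟩ := hF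
    refine ((summable_pow_div_factorial_mul_pow (μ * κ) N).mul_left (Real.exp (μ * κ))⁻¹).congr
      fun n => ?_
    simp only [coeff]
    rw [abs_of_nonneg (by positivity)]
    field_simp
  | etaMu η μ w =>
    obtain ⟨h1, h2, h3⟩ := hF
    obtain ⟨C, K, hC, h⟩ := exists_Gamma_div_le h2 one_pos
    have hh := hPar_pos h1
    have hG := Real.Gamma_pos_of_pos h2
    set ρ := (HPar η / hPar η) ^ 2 with hρ
    have hρ0 : 0 ≤ ρ := sq_nonneg _
    have hs : Summable fun n : ℕ => ((n + 1 : ℕ) : ℝ) ^ (N + K) * ρ ^ n := by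
      -- The index shift below divides by ρ; for ρ = 0 only the term n = 0 survives.
      rcases eq_or_lt_of_le hρ0 with h0 | h0
      · refine summable_of_ne_finset_zero (s := {0}) fun n hn => ?_
        rw [← h0, zero_pow (by simpa using hn), mul_zero]
      · have := (summable_nat_add_iff 1).2 (summable_pow_mul_geometric_of_norm_lt_one (N + K)
          (r := ρ) (by rw [Real.norm_of_nonneg hρ0]; exact div_sq_lt_one h1))
        refine (this.mul_left ρ⁻¹).congr fun n => ?_
        rw [pow_succ]; field_simp
    refine Summable.of_nonneg_of_le
      (fun n => mul_nonneg (Valid.coeff_nonneg (F := etaMu η μ w) ⟨h1, h2, h3⟩ n) (by positivity))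
      (fun n => ?_) (hs.mul_left (C / Real.Gamma μ * (hPar η ^ μ)⁻¹))
    rw [coeff_etaMu h1]
    have h' := h n
    rw [add_comm (1 : ℝ), Real.Gamma_nat_eq_factorial, add_comm μ] at h'
    rw [add_comm (1 : ℝ)]
    push_cast
    calc _ = Real.Gamma (n + μ) / n.factorial * ((Real.Gamma μ)⁻¹ * ρ ^ n * (hPar η ^ μ)⁻¹
          * ((n : ℝ) + 1) ^ N) := by rw [← hρ]; field_simp
      _ ≤ C * ((n : ℝ) + 1) ^ K * ((Real.Gamma μ)⁻¹ * ρ ^ n * (hPar η ^ μ)⁻¹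
          * ((n : ℝ) + 1) ^ N) := by gcongr
      _ = _ := by rw [pow_add]; ring

theorem hasSum_besselI {ν x : ℝ} (hν : 0 < ν + 1) (hx : 0 < x) :
    HasSum (fun n : ℕ => (x / 2) ^ (2 * (n : ℝ) + ν)
      / ((n.factorial : ℝ) * Real.Gamma (n + ν + 1))) (besselI ν x) := by
  refine Summable.hasSum (((summable_pow_div_factorial_mul_inv_Gamma hν ((x / 2) ^ 2)).mul_left
    ((x / 2) ^ ν)).congr fun n => ?_)
  rw [Real.rpow_add (by positivity), show (2 * (n : ℝ)) = ((2 * n : ℕ) : ℝ) by simp,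
    Real.rpow_natCast, abs_of_nonneg (by positivity), ← pow_mul,
    show (n : ℝ) + ν + 1 = ν + 1 + n by ring]
  ring

/-- The powers of x from the prefactor and from the n-th Bessel term combine to x^(μ+n-1), so each
term is a gamma density; the remaining constant is the Poisson weight with mean μκ. -/
theorem besselI_term_kappaMu {κ μ w x : ℝ} (hκ : 0 < κ) (hμ : 0 < μ) (hw : 0 < w) (hx : 0 < x)
    (n : ℕ) :
    μ / (κ ^ ((μ - 1) / 2) * Real.exp (μ * κ)) * ((1 + κ) / w) ^ ((μ + 1) / 2)
        * x ^ ((μ - 1) / 2) * Real.exp (-(μ * (1 + κ) / w * x))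
        * ((2 * μ * √(κ * (1 + κ) / w * x) / 2) ^ (2 * (n : ℝ) + (μ - 1))
          / ((n.factorial : ℝ) * Real.Gamma (n + (μ - 1) + 1)))
      = (kappaMu κ μ w).coeff n
        * gammaPDFReal ((kappaMu κ μ w).order n) ((kappaMu κ μ w).scale)⁻¹ x := by
  have hc : 0 < (1 + κ) / w := by positivity
  simp only [coeff, order, scale, gammaPDFReal, if_pos hx.le]
  rw [show κ * (1 + κ) / w * x = κ * ((1 + κ) / w) * x by ring,
    show (w / (μ * (1 + κ)))⁻¹ = μ * ((1 + κ) / w) by field_simp,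
    show μ * (1 + κ) / w = μ * ((1 + κ) / w) by ring]
  generalize (1 + κ) / w = c at hc
  have e1 : (2 * μ * √(κ * c * x) / 2) ^ (2 * (n : ℝ) + (μ - 1))
      = μ ^ (2 * n) * (μ ^ μ / μ) * ((κ * c * x) ^ n
        * (κ ^ ((μ - 1) / 2) * c ^ ((μ - 1) / 2) * x ^ ((μ - 1) / 2))) := by
    rw [show 2 * μ * √(κ * c * x) / 2 = μ * √(κ * c * x) by ring,
      Real.mul_rpow hμ.le (Real.sqrt_nonneg _), Real.sqrt_eq_rpow, ← Real.rpow_mul (by positivity),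
      show 1 / 2 * (2 * (n : ℝ) + (μ - 1)) = n + (μ - 1) / 2 by ring,
      Real.rpow_add (by positivity) (n : ℝ), Real.rpow_add hμ, Real.rpow_sub_one hμ.ne',
      show (2 * (n : ℝ)) = ((2 * n : ℕ) : ℝ) by simp, Real.rpow_natCast, Real.rpow_natCast,
      Real.mul_rpow (by positivity) hx.le, Real.mul_rpow hκ.le hc.le]
  have e2 : c ^ ((μ + 1) / 2) * c ^ ((μ - 1) / 2) = c ^ μ := by
    rw [← Real.rpow_add hc]; congr 1; ring
  have e3 : x ^ ((μ - 1) / 2) * x ^ ((μ - 1) / 2) = x ^ (μ - 1) := by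
    rw [← Real.rpow_add hx]; congr 1; ring
  have e4 : (μ * c) ^ (μ + n) = μ ^ μ * c ^ μ * (μ * c) ^ n := by
    rw [Real.rpow_add (by positivity), Real.rpow_natCast, Real.mul_rpow hμ.le hc.le]
  have e5 : x ^ (μ + n - 1) = x ^ (μ - 1) * x ^ n := by
    rw [← Real.rpow_natCast, ← Real.rpow_add hx]; congr 1; ring
  rw [e1, e4, e5, ← e2, ← e3, show (n : ℝ) + (μ - 1) + 1 = μ + n by ring]
  have hG := Real.Gamma_pos_of_pos (by positivity : 0 < μ + n)
  field_simp
  ring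

/-- The n-th Bessel term carries x^(2n+μ-1/2) and the prefactor x^(μ-1/2), which gives the shape 2μ
+ 2n. Legendre duplication (`e6`) exchanges Γ(n+μ)Γ(n+μ+1/2) for Γ(2μ+2n). -/
theorem besselI_term_etaMu {η μ w x : ℝ} (hη : 0 < η) (hη1 : η ≠ 1) (hμ : 0 < μ) (hw : 0 < w)
    (hx : 0 < x) (n : ℕ) :
    2 * √Real.pi * μ ^ (μ + 1 / 2) * hPar η ^ μ
          / (Real.Gamma μ * |HPar η| ^ (μ - 1 / 2) * w ^ (μ + 1 / 2))
        * x ^ (μ - 1 / 2) * Real.exp (-(2 * μ * hPar η * x / w))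
        * ((2 * μ * |HPar η| * x / w / 2) ^ (2 * (n : ℝ) + (μ - 1 / 2))
          / ((n.factorial : ℝ) * Real.Gamma (n + (μ - 1 / 2) + 1)))
      = (etaMu η μ w).coeff n
        * gammaPDFReal ((etaMu η μ w).order n) ((etaMu η μ w).scale)⁻¹ x := by
  have hh := hPar_pos hη
  have hH : 0 < |HPar η| := abs_pos.2 (HPar_ne_zero hη hη1)
  rw [coeff_etaMu hη]
  simp only [order, scale, gammaPDFReal, if_pos hx.le]
  rw [div_pow, ← sq_abs (HPar η)]
  generalize |HPar η| = H at hH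
  generalize hPar η = h at hh
  have e1 : (2 * μ * H * x / w / 2) ^ (2 * (n : ℝ) + (μ - 1 / 2))
      = (μ * H * x / w) ^ (2 * n) * (μ ^ (μ - 1 / 2) * H ^ (μ - 1 / 2) * x ^ (μ - 1 / 2)
        / w ^ (μ - 1 / 2)) := by
    rw [show 2 * μ * H * x / w / 2 = μ * H * x / w by ring, Real.rpow_add (by positivity),
      show (2 * (n : ℝ)) = ((2 * n : ℕ) : ℝ) by simp, Real.rpow_natCast,
      Real.div_rpow (by positivity) hw.le, Real.mul_rpow (by positivity) hx.le,
      Real.mul_rpow hμ.le hH.le]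
  have e2 : ∀ y : ℝ, 0 < y → y ^ (μ + 1 / 2) * y ^ (μ - 1 / 2) = (y ^ μ) ^ 2 := fun y hy => by
    rw [← Real.rpow_add hy, ← Real.rpow_natCast, ← Real.rpow_mul hy.le]; congr 1; push_cast; ring
  have e3 : x ^ (μ - 1 / 2) * x ^ (μ - 1 / 2) = (x ^ μ) ^ 2 / x := by
    rw [← e2 x hx, show μ + 1 / 2 = (μ - 1 / 2) + 1 by ring, Real.rpow_add_one hx.ne']
    field_simp
  have e4 : (w / (2 * μ * h))⁻¹ ^ (2 * μ + 2 * (n : ℝ))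
      = ((2 : ℝ) ^ μ * μ ^ μ * h ^ μ / w ^ μ) ^ 2 * (2 * μ * h / w) ^ (2 * n) := by
    rw [inv_div, Real.rpow_add (by positivity), show (2 * (n : ℝ)) = ((2 * n : ℕ) : ℝ) by simp,
      Real.rpow_natCast, show 2 * μ = μ * (2 : ℕ) by push_cast; ring,
      Real.rpow_mul (by positivity), Real.rpow_natCast, Real.div_rpow (by positivity) hw.le,
      Real.mul_rpow (by positivity) hh.le, Real.mul_rpow hμ.le (by positivity)]
    push_cast
    ring
  have e5 : x ^ (2 * μ + 2 * (n : ℝ) - 1) = (x ^ μ) ^ 2 * x ^ (2 * n) / x := by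
    rw [Real.rpow_sub_one hx.ne', Real.rpow_add hx, show (2 * (n : ℝ)) = ((2 * n : ℕ) : ℝ) by simp,
      Real.rpow_natCast, mul_comm 2 μ, Real.rpow_mul hx.le, Real.rpow_ofNat]
  have e6 : Real.Gamma (n + μ) * Real.Gamma (n + (μ - 1 / 2) + 1)
      = Real.Gamma (2 * μ + 2 * n) * (2 / (((2 : ℝ) ^ μ) ^ 2 * 2 ^ (2 * n))) * √Real.pi := by
    have := Real.Gamma_mul_Gamma_add_half (n + μ)
    rw [show (n : ℝ) + (μ - 1 / 2) + 1 = n + μ + 1 / 2 by ring, this,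
      show 2 * ((n : ℝ) + μ) = 2 * μ + 2 * n by ring]
    congr 2
    rw [Real.rpow_sub two_pos, Real.rpow_one, Real.rpow_add two_pos,
      show (2 * (n : ℝ)) = ((2 * n : ℕ) : ℝ) by simp, Real.rpow_natCast, mul_comm 2 μ,
      Real.rpow_mul two_pos.le, Real.rpow_ofNat]
  have hG1 := Real.Gamma_pos_of_pos (by positivity : 0 < n + μ)
  have hG2 := Real.Gamma_pos_of_pos (by linarith [n.cast_nonneg (α := ℝ)] :
    (0 : ℝ) < n + (μ - 1 / 2) + 1)
  have hG3 := Real.Gamma_pos_of_pos (by positivity : 0 < 2 * μ + 2 * (n : ℝ))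
  have hG4 := Real.Gamma_pos_of_pos hμ
  have e7 : Real.Gamma (2 * μ + 2 * n) = Real.Gamma (n + μ) * Real.Gamma (n + (μ - 1 / 2) + 1)
      * (((2 : ℝ) ^ μ) ^ 2 * 2 ^ (2 * n)) / (2 * √Real.pi) := by
    rw [e6]; field_simp
  have e8 : μ ^ (μ + 1 / 2) = (μ ^ μ) ^ 2 / μ ^ (μ - 1 / 2) := by
    rw [← e2 μ hμ]; field_simp
  have e9 : w ^ (μ + 1 / 2) = (w ^ μ) ^ 2 / w ^ (μ - 1 / 2) := by
    rw [← e2 w hw]; field_simp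
  have e10 : Real.exp (-((w / (2 * μ * h))⁻¹ * x)) = Real.exp (-(2 * μ * h * x / w)) := by
    congr 1; field_simp
  rw [e1, e4, e5, e7, e8, e9, e10]
  have e3' : (x ^ μ) ^ 2 = x * (x ^ (μ - 1 / 2)) ^ 2 := by
    rw [sq (x ^ (μ - 1 / 2)), e3]; field_simp
  have hpi : √Real.pi ^ 2 = Real.pi := Real.sq_sqrt Real.pi_pos.le
  rw [e3']
  simp only [div_pow, mul_pow]
  field_simp
  ring

theorem Valid.hasSum_pdf (hF : F.Valid) {x : ℝ} (hx : 0 < x) :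
    HasSum (fun n => F.coeff n * gammaPDFReal (F.order n) (F.scale)⁻¹ x) (F.pdf x) := by
  cases F with
  | kappaMu κ μ w =>
    obtain ⟨h1, h2, h3⟩ := hF
    simp only [pdf, if_neg hx.not_ge]
    split_ifs with hκ
    -- For κ = 0 the weights contain `0 ^ n`, so the mixture reduces to its term n = 0; similarly
    -- below for η = 1, where H = 0.
    · subst hκ
      convert! hasSum_single (α := ℝ) 0 ?_ using 1
      · simp [coeff, order, scale]
      · intro n hn
        simp [coeff, hn]
    · have hκ' : 0 < κ := lt_of_le_of_ne h1 (Ne.symm hκ)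
      have hy : 0 < κ * (1 + κ) / w * x := by positivity
      have := (hasSum_besselI (ν := μ - 1) (by linarith)
        (x := 2 * μ * √(κ * (1 + κ) / w * x)) (by positivity)).mul_left
        (μ / (κ ^ ((μ - 1) / 2) * Real.exp (μ * κ)) * ((1 + κ) / w) ^ ((μ + 1) / 2)
        * x ^ ((μ - 1) / 2) * Real.exp (-(μ * (1 + κ) / w * x)))
      simpa only [besselI_term_kappaMu hκ' h2 h3 hx] using this
  | etaMu η μ w =>
    obtain ⟨h1, h2, h3⟩ := hF
    simp only [pdf, if_neg hx.not_ge]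
    split_ifs with hη
    · subst hη
      convert! hasSum_single (α := ℝ) 0 ?_ using 1
      · rw [coeff_etaMu one_pos]
        have := (Real.Gamma_pos_of_pos h2).ne'
        norm_num [order, scale, hPar, HPar, this]
      · intro n hn
        rw [coeff_etaMu one_pos]
        norm_num [HPar, hn]
    · have hH : 0 < |HPar η| := abs_pos.2 (HPar_ne_zero h1 hη)
      have := (hasSum_besselI (ν := μ - 1 / 2) (by linarith)
        (x := 2 * μ * |HPar η| * x / w) (by positivity)).mul_left
        (2 * √Real.pi * μ ^ (μ + 1 / 2) * hPar η ^ μ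
          / (Real.Gamma μ * |HPar η| ^ (μ - 1 / 2) * w ^ (μ + 1 / 2))
        * x ^ (μ - 1 / 2) * Real.exp (-(2 * μ * hPar η * x / w)))
      simpa only [besselI_term_etaMu h1 hη h2 h3 hx] using this

/-- The law of a power gain is a mixture of gamma laws. -/
theorem Valid.lintegral_law (hF : F.Valid) {f : ℝ → ℝ≥0∞} (hf : Measurable f) :
    ∫⁻ x, f x ∂F.law = ∑' n, ENNReal.ofReal (F.coeff n)
      * ∫⁻ x, f x ∂(gammaMeasure (F.order n) (F.scale)⁻¹) := by
  have hlaw : F.law = volume.withDensity fun x => ∑' n, ENNReal.ofReal (F.coeff n)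
      * gammaPDF (F.order n) (F.scale)⁻¹ x := by
    refine withDensity_congr_ae ?_
    have h0 : ∀ᵐ x : ℝ, x ≠ 0 := by
      simp [ae_iff]
    filter_upwards [h0] with x hx
    rcases lt_or_gt_of_ne hx with h | h
    · rw [show F.pdf x = 0 by cases F <;> simp [pdf, h.le]]
      simp [gammaPDF_of_neg h]
    · have hs := hF.hasSum_pdf h
      simp only [gammaPDF, ← ENNReal.ofReal_mul (hF.coeff_nonneg _)]
      rw [← ENNReal.ofReal_tsum_of_nonneg (fun n => mul_nonneg (hF.coeff_nonneg n)
        (gammaPDFReal_nonneg (hF.order_pos n) (inv_pos.2 hF.scale_pos) x)) hs.summable, hs.tsum_eq]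
  have hg : ∀ n, Measurable (gammaPDF (F.order n) (F.scale)⁻¹) := fun n =>
    (measurable_gammaPDFReal _ _).ennreal_ofReal
  rw [hlaw, lintegral_withDensity_eq_lintegral_mul _
    (Measurable.tsum fun n => (hg n).const_mul _) hf]
  simp only [Pi.mul_apply, ← ENNReal.tsum_mul_right]
  rw [lintegral_tsum fun n => (((hg n).const_mul _).fun_mul hf).aemeasurable]
  refine tsum_congr fun n => ?_
  rw [gammaMeasure, lintegral_withDensity_eq_lintegral_mul _ (hg n) hf,
    ← lintegral_const_mul _ ((hg n).mul hf)]
  simp only [Pi.mul_apply, mul_assoc]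

end Fading

end

/-! ### Moments and Laplace transforms of gamma and fading laws -/

section

theorem lintegral_gammaMeasure {i r : ℝ} (hi : 0 < i) (hr : 0 < r) {f : ℝ → ℝ} (hf : Measurable f) :
    ∫⁻ x, ENNReal.ofReal (f x) ∂(gammaMeasure i r)
      = ∫⁻ x in Set.Ioi 0, ENNReal.ofReal
        (r ^ i / Real.Gamma i * x ^ (i - 1) * Real.exp (-(r * x)) * f x) := by
  have hg : Measurable (gammaPDF i r) := (measurable_gammaPDFReal i r).ennreal_ofReal
  rw [gammaMeasure, lintegral_withDensity_eq_lintegral_mul _ hg hf.ennreal_ofReal,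
    ← lintegral_indicator measurableSet_Ioi]
  have h0 : ∀ᵐ x : ℝ, x ≠ 0 := by simp [ae_iff]
  refine lintegral_congr_ae ?_
  filter_upwards [h0] with x hx
  rcases lt_or_gt_of_ne hx with h | h
  · rw [Set.indicator_of_notMem (by simpa using h.le), Pi.mul_apply, gammaPDF_of_neg h, zero_mul]
  · rw [Set.indicator_of_mem (by simpa using h), Pi.mul_apply, gammaPDF_of_nonneg h.le,
      ← ENNReal.ofReal_mul]
    have := Real.Gamma_pos_of_pos hi
    positivity

theorem lintegral_gammaMeasure_rpow_mul_exp {i r δ t : ℝ} (hi : 0 < i) (hr : 0 < r) (hδ : 0 ≤ δ)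
    (ht : 0 ≤ t) :
    ∫⁻ x, ENNReal.ofReal (x ^ δ * Real.exp (-(t * x))) ∂(gammaMeasure i r)
      = ENNReal.ofReal (r ^ i / Real.Gamma i * (Real.Gamma (i + δ) * (1 / (r + t)) ^ (i + δ))) := by
  have hG := Real.Gamma_pos_of_pos hi
  rw [lintegral_gammaMeasure hi hr (by fun_prop)]
  have h1 := Real.integral_rpow_mul_exp_neg_mul_Ioi (by positivity : 0 < i + δ) (by positivity : 0 < r + t)
  -- The integral of a function that is not integrable is 0 by convention, so a positive value
  -- proves integrability.
  have hint : IntegrableOn (fun x : ℝ => x ^ (i + δ - 1) * Real.exp (-((r + t) * x))) (Set.Ioi 0) := by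
    by_contra hn
    rw [integral_undef hn] at h1
    have := Real.Gamma_pos_of_pos (by positivity : 0 < i + δ)
    have h2 : 0 < (1 / (r + t)) ^ (i + δ) * Real.Gamma (i + δ) := by positivity
    linarith
  have h2 : ∀ x ∈ Set.Ioi (0 : ℝ), r ^ i / Real.Gamma i * x ^ (i - 1) * Real.exp (-(r * x))
      * (x ^ δ * Real.exp (-(t * x)))
      = r ^ i / Real.Gamma i * (x ^ (i + δ - 1) * Real.exp (-((r + t) * x))) := by
    intro x hx
    rw [show i + δ - 1 = (i - 1) + δ by ring, Real.rpow_add hx,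
      show -((r + t) * x) = -(r * x) + -(t * x) by ring, Real.exp_add]
    ring
  rw [setLIntegral_congr_fun measurableSet_Ioi fun x hx => by rw [h2 x hx],
    ← ofReal_integral_eq_lintegral_ofReal (hint.const_mul _), integral_const_mul, h1, mul_comm
    (Real.Gamma _)]
  filter_upwards [ae_restrict_mem measurableSet_Ioi] with x hx
  have : (0 : ℝ) < x := hx
  positivity

theorem lintegral_gammaMeasure_rpow {i σ δ : ℝ} (hi : 0 < i) (hσ : 0 < σ) (hδ : 0 ≤ δ) :
    ∫⁻ x, ENNReal.ofReal (x ^ δ) ∂(gammaMeasure i σ⁻¹)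
      = ENNReal.ofReal (σ ^ δ * (Real.Gamma (i + δ) / Real.Gamma i)) := by
  have := lintegral_gammaMeasure_rpow_mul_exp hi (inv_pos.2 hσ) hδ le_rfl
  simp only [zero_mul, neg_zero, Real.exp_zero, mul_one, add_zero, one_div, inv_inv] at this
  rw [this, Real.rpow_add hσ, Real.inv_rpow hσ.le]
  congr 1
  field_simp

theorem lintegral_gammaMeasure_exp {i σ t : ℝ} (hi : 0 < i) (hσ : 0 < σ) (ht : 0 ≤ t) :
    ∫⁻ x, ENNReal.ofReal (Real.exp (-(t * x))) ∂(gammaMeasure i σ⁻¹)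
      = ENNReal.ofReal ((1 + σ * t) ^ (-i)) := by
  have := lintegral_gammaMeasure_rpow_mul_exp hi (inv_pos.2 hσ) le_rfl ht
  simp only [Real.rpow_zero, one_mul, add_zero] at this
  rw [this]
  have hG := Real.Gamma_pos_of_pos hi
  congr 1
  rw [show 1 + σ * t = σ * (σ⁻¹ + t) by field_simp, Real.rpow_neg (by positivity),
    Real.mul_rpow hσ.le (by positivity), one_div, Real.inv_rpow (by positivity),
    Real.inv_rpow (by positivity)]
  field_simp

namespace Fading

variable {F : Fading}

theorem Valid.ae_pos (hF : F.Valid) : ∀ᵐ x ∂F.law, 0 < x := by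
  have h := hF.lintegral_law (f := (Set.Iic (0 : ℝ)).indicator 1)
    (measurable_one.indicator measurableSet_Iic)
  rw [lintegral_indicator_one measurableSet_Iic] at h
  rw [ae_iff]
  have h2 : {x : ℝ | ¬0 < x} = Set.Iic 0 := by ext; simp
  rw [h2, h, ENNReal.tsum_eq_zero]
  intro n
  have h3 : ∫⁻ x, (Set.Iic (0 : ℝ)).indicator (1 : ℝ → ℝ≥0∞) x
      ∂(gammaMeasure (F.order n) F.scale⁻¹) = 0 := by
    rw [lintegral_indicator_one measurableSet_Iic, gammaMeasure, withDensity_apply _ measurableSet_Iic,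
      setLIntegral_congr Iio_ae_eq_Iic.symm]
    exact lintegral_gammaPDF_of_nonpos le_rfl
  rw [h3, mul_zero]

theorem Valid.summable_coeff (hF : F.Valid) : Summable F.coeff := by
  simpa using hF.summable_coeff_mul_pow 0

/-- The mixture formula for the constant 1 equates the sum of the weights with the mass of the law.
That this mass is one will follow from the existence of a random variable with this law, so the
weights need not be summed. -/
theorem Valid.tsum_coeff (hF : F.Valid) [IsProbabilityMeasure F.law] : ∑' n, F.coeff n = 1 := by
  have h := hF.lintegral_law (f := fun _ => 1) measurable_const
  have : ∀ n, IsProbabilityMeasure (gammaMeasure (F.order n) F.scale⁻¹) := fun n =>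
    isProbabilityMeasure_gammaMeasure (hF.order_pos n) (inv_pos.2 hF.scale_pos)
  simp only [lintegral_const, measure_univ, mul_one] at h
  rw [← ENNReal.ofReal_tsum_of_nonneg hF.coeff_nonneg hF.summable_coeff] at h
  have h0 : 0 ≤ ∑' n, F.coeff n := tsum_nonneg hF.coeff_nonneg
  rw [← ENNReal.toReal_ofReal h0, ← h, ENNReal.toReal_one]

theorem Valid.exists_order_le (hF : F.Valid) :
    ∃ C : ℝ, 1 ≤ C ∧ ∀ n, F.order n ≤ C * (1 + (n : ℝ)) := by
  cases F with
  | kappaMu κ μ w =>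
    obtain ⟨h1, h2, h3⟩ := hF
    refine ⟨μ + 1, by linarith, fun n => ?_⟩
    have : (0 : ℝ) ≤ n := n.cast_nonneg
    simp only [order]
    nlinarith
  | etaMu η μ w =>
    obtain ⟨h1, h2, h3⟩ := hF
    refine ⟨2 * μ + 2, by linarith, fun n => ?_⟩
    have : (0 : ℝ) ≤ n := n.cast_nonneg
    simp only [order]
    nlinarith

/-- The coefficients decay fast against powers of the orders. -/
theorem Valid.summable_coeff_mul_Gamma (hF : F.Valid) {b : ℝ} (hb : 0 ≤ b) :
    Summable fun n => F.coeff n * (Real.Gamma (F.order n + b) / Real.Gamma (F.order n)) := by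
  obtain ⟨K, hK⟩ := exists_nat_ge b
  obtain ⟨C, hC1, hC⟩ := hF.exists_order_le
  have hG := fun n => Real.Gamma_pos_of_pos (hF.order_pos n)
  have hGb := fun n => Real.Gamma_pos_of_pos (by linarith [hF.order_pos n] : 0 < F.order n + b)
  refine Summable.of_nonneg_of_le (fun n => mul_nonneg (hF.coeff_nonneg n)
    (div_pos (hGb n) (hG n)).le) (fun n => ?_)
    ((hF.summable_coeff_mul_pow K).mul_left (1 + (C + K) ^ K))
  have hn : (0 : ℝ) ≤ n := n.cast_nonneg
  have h1 : Real.Gamma (F.order n + b) / Real.Gamma (F.order n)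
      ≤ (1 + (C + K) ^ K) * (1 + (n : ℝ)) ^ K := by
    rw [div_le_iff₀ (hG n), mul_comm]
    refine (Gamma_add_le (hF.order_pos n) hb hK).trans (mul_le_mul_of_nonneg_left ?_ (hG n).le)
    have e1 : (F.order n + K) ^ K ≤ (C + K) ^ K * (1 + (n : ℝ)) ^ K := by
      rw [← mul_pow]
      refine pow_le_pow_left₀ (by have := hF.order_pos n; positivity) ?_ _
      have : (0 : ℝ) ≤ K * n := by positivity
      nlinarith [hC n]
    have e2 : 1 ≤ (1 + (n : ℝ)) ^ K := one_le_pow₀ (by linarith)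
    nlinarith
  calc _ ≤ F.coeff n * ((1 + (C + K) ^ K) * (1 + (n : ℝ)) ^ K) :=
        mul_le_mul_of_nonneg_left h1 (hF.coeff_nonneg n)
    _ = _ := by ring

theorem Valid.lintegral_rpow (hF : F.Valid) {δ : ℝ} (hδ : 0 ≤ δ) :
    ∫⁻ x, ENNReal.ofReal (x ^ δ) ∂F.law = ENNReal.ofReal (F.scale ^ δ * ∑' n, F.coeff n *
      (Real.Gamma (F.order n + δ) / Real.Gamma (F.order n))) := by
  have hs := hF.scale_pos
  rw [hF.lintegral_law (by fun_prop), ← tsum_mul_left, ENNReal.ofReal_tsum_of_nonneg]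
  · refine tsum_congr fun n => ?_
    rw [lintegral_gammaMeasure_rpow (hF.order_pos n) hs hδ, ← ENNReal.ofReal_mul (hF.coeff_nonneg n)]
    congr 1; ring
  · intro n
    have := Real.Gamma_pos_of_pos (hF.order_pos n)
    have := Real.Gamma_pos_of_pos (by linarith [hF.order_pos n] : 0 < F.order n + δ)
    have := hF.coeff_nonneg n
    positivity
  · exact (hF.summable_coeff_mul_Gamma hδ).mul_left _

theorem Valid.lintegral_exp (hF : F.Valid) {t : ℝ} (ht : 0 ≤ t) :
    ∫⁻ x, ENNReal.ofReal (Real.exp (-(t * x))) ∂F.law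
      = ∑' n, ENNReal.ofReal (F.coeff n * (1 + F.scale * t) ^ (-F.order n)) := by
  rw [hF.lintegral_law (by fun_prop)]
  refine tsum_congr fun n => ?_
  rw [lintegral_gammaMeasure_exp (hF.order_pos n) hF.scale_pos ht,
    ← ENNReal.ofReal_mul (hF.coeff_nonneg n)]

theorem Valid.integrable_id (hF : F.Valid) : Integrable (fun x => x) F.law := by
  refine ⟨measurable_id.aestronglyMeasurable, ?_⟩
  have h := hF.lintegral_rpow zero_le_one
  simp only [Real.rpow_one] at h
  rw [hasFiniteIntegral_iff_norm, lintegral_congr_ae (g := fun x => ENNReal.ofReal x), h]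
  · exact ENNReal.ofReal_lt_top
  · filter_upwards [hF.ae_pos] with x hx
    rw [Real.norm_of_nonneg hx.le]

/-- Integrals of bounded functions against the law of a power gain. -/
theorem Valid.integral_law (hF : F.Valid) {f : ℝ → ℝ} (hf : Measurable f) (hf0 : ∀ x, 0 ≤ f x)
    {B : ℝ} (hB : ∀ x, f x ≤ B) :
    ∫ x, f x ∂F.law = ∑' n, F.coeff n * ∫ x, f x ∂(gammaMeasure (F.order n) (F.scale)⁻¹) := by
  have hp : ∀ n, IsProbabilityMeasure (gammaMeasure (F.order n) F.scale⁻¹) := fun n =>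
    isProbabilityMeasure_gammaMeasure (hF.order_pos n) (inv_pos.2 hF.scale_pos)
  rw [integral_eq_lintegral_of_nonneg_ae (ae_of_all _ hf0) hf.aestronglyMeasurable,
    hF.lintegral_law hf.ennreal_ofReal, ENNReal.tsum_toReal_eq]
  · refine tsum_congr fun n => ?_
    rw [ENNReal.toReal_mul, ENNReal.toReal_ofReal (hF.coeff_nonneg n),
      integral_eq_lintegral_of_nonneg_ae (ae_of_all _ hf0) hf.aestronglyMeasurable]
  · intro n
    refine ENNReal.mul_ne_top ENNReal.ofReal_ne_top ?_
    refine ne_top_of_le_ne_top (b := ENNReal.ofReal B) ENNReal.ofReal_ne_top ?_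
    calc _ ≤ ∫⁻ _, ENNReal.ofReal B ∂(gammaMeasure (F.order n) F.scale⁻¹) :=
          lintegral_mono fun x => ENNReal.ofReal_le_ofReal (hB x)
      _ = _ := by simp

end Fading

end

section

/-! ### Integration and differentiation of series -/

theorem hasSum_setIntegral {s : Set ℝ} (hs : MeasurableSet s) {f : ℕ → ℝ → ℝ} {g : ℝ → ℝ}
    (hf : ∀ k, IntegrableOn (f k) s) (hsum : Summable fun k => ∫ x in s, |f k x|)
    (hg : ∀ x ∈ s, HasSum (fun k => f k x) (g x)) :
    HasSum (fun k => ∫ x in s, f k x) (∫ x in s, g x) := by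
  have h := hasSum_integral_of_summable_integral_norm (μ := volume.restrict s) hf (by simpa using hsum)
  rwa [setIntegral_congr_fun (g := g) hs fun x hx => (hg x hx).tsum_eq] at h

theorem continuous_tsum_mul_pow {c : ℕ → ℝ} (hc : ∀ r : ℝ, Summable fun k => |c k| * |r| ^ k) :
    Continuous fun x : ℝ => ∑' k, c k * x ^ k := by
  refine continuous_iff_continuousAt.2 fun x => ?_
  have h : ContinuousOn (fun x : ℝ => ∑' k, c k * x ^ k) (Metric.ball 0 (|x| + 1)) := by
    refine continuousOn_tsum (fun k => by fun_prop) (hc (|x| + 1)) fun k y hy => ?_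
    rw [mem_ball_zero_iff] at hy
    rw [norm_mul, norm_pow, abs_of_pos (by positivity : 0 < |x| + 1)]
    exact mul_le_mul_of_nonneg_left (pow_le_pow_left₀ (norm_nonneg _) hy.le k) (abs_nonneg _)
  exact h.continuousAt (Metric.isOpen_ball.mem_nhds (by simp))

theorem integral_beta {p q x : ℝ} (hp : 0 < p) (hq : 0 < q) (hx : 0 < x) :
    ∫ t in (0 : ℝ)..x, t ^ (p - 1) * (x - t) ^ (q - 1)
      = x ^ (p + q - 1) * (Real.Gamma p * Real.Gamma q / Real.Gamma (p + q)) := by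
  have h := Complex.betaIntegral_scaled p q hx
  rw [Complex.betaIntegral_eq_Gamma_mul_div _ _ (by simpa using hp) (by simpa using hq)] at h
  have h2 : ∫ t in (0 : ℝ)..x, (t : ℂ) ^ ((p : ℂ) - 1) * ((x : ℂ) - t) ^ ((q : ℂ) - 1)
      = ((∫ t in (0 : ℝ)..x, t ^ (p - 1) * (x - t) ^ (q - 1) : ℝ) : ℂ) := by
    rw [← intervalIntegral.integral_ofReal]
    refine intervalIntegral.integral_congr fun t ht => ?_
    rw [Set.uIcc_of_le hx.le] at ht
    push_cast
    rw [Complex.ofReal_cpow ht.1, ← Complex.ofReal_sub x t, Complex.ofReal_cpow (sub_nonneg.2 ht.2)]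
    push_cast
    rfl
  rw [h2] at h
  apply Complex.ofReal_injective
  rw [h]
  push_cast
  rw [Complex.ofReal_cpow hx.le, ← Complex.Gamma_ofReal, ← Complex.Gamma_ofReal,
    ← Complex.Gamma_ofReal]
  push_cast
  rfl

theorem integrableOn_beta {p q x : ℝ} (hp : 0 < p) (hq : 0 < q) (hx : 0 < x) :
    IntegrableOn (fun t => t ^ (p - 1) * (x - t) ^ (q - 1)) (Set.Ioc 0 x) := by
  have h := integral_beta hp hq hx
  rw [intervalIntegral.integral_of_le hx.le] at h
  refine Integrable.of_integral_ne_zero ?_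
  rw [h]
  have := Real.Gamma_pos_of_pos hp
  have := Real.Gamma_pos_of_pos hq
  have := Real.Gamma_pos_of_pos (add_pos hp hq)
  positivity

theorem integral_Ioc_beta {p q x : ℝ} (hp : 0 < p) (hq : 0 < q) (hx : 0 < x) :
    ∫ t in Set.Ioc 0 x, t ^ (p - 1) * (x - t) ^ (q - 1)
      = x ^ (p + q - 1) * (Real.Gamma p * Real.Gamma q / Real.Gamma (p + q)) := by
  rw [← intervalIntegral.integral_of_le hx.le, integral_beta hp hq hx]

theorem hasSum_exp_neg (t : ℝ) :
    HasSum (fun k : ℕ => (-t) ^ k / (k.factorial : ℝ)) (Real.exp (-t)) := by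
  rw [Real.exp_eq_exp_ℝ]
  exact NormedSpace.expSeries_div_hasSum_exp (-t)

/-! ### The incomplete gamma function -/

theorem integrableOn_gamma {b : ℝ} (hb : 0 < b) :
    IntegrableOn (fun t : ℝ => t ^ (b - 1) * Real.exp (-t)) (Set.Ioi 0) := by
  refine (Real.GammaIntegral_convergent hb).congr_fun (fun t _ => ?_) measurableSet_Ioi
  ring

theorem Gamma_sub_upperGamma {b y : ℝ} (hb : 0 < b) (hy : 0 ≤ y) :
    Real.Gamma b - upperGamma b y = ∫ t in Set.Ioc 0 y, t ^ (b - 1) * Real.exp (-t) := by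
  have h : Real.Gamma b = ∫ t in Set.Ioi 0, t ^ (b - 1) * Real.exp (-t) := by
    rw [Real.Gamma_eq_integral hb]; exact setIntegral_congr_fun measurableSet_Ioi fun t _ => by ring
  rw [upperGamma, h, ← Set.Ioc_union_Ioi_eq_Ioi hy, setIntegral_union
    (Set.Ioc_disjoint_Ioi le_rfl) measurableSet_Ioi
    ((integrableOn_gamma hb).mono_set Set.Ioc_subset_Ioi_self)
    ((integrableOn_gamma hb).mono_set (Set.Ioi_subset_Ioi hy))]
  ring

theorem integrableOn_rpow_Ioc {p y : ℝ} (hp : 0 < p) (hy : 0 < y) :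
    IntegrableOn (fun t : ℝ => t ^ (p - 1)) (Set.Ioc 0 y) := by
  simpa using integrableOn_beta hp one_pos hy

theorem integral_rpow_Ioc {p y : ℝ} (hp : 0 < p) (hy : 0 < y) :
    ∫ t in Set.Ioc 0 y, t ^ (p - 1) = y ^ p / p := by
  have := integral_Ioc_beta hp one_pos hy
  simp only [sub_self, Real.rpow_zero, mul_one, Real.Gamma_one, add_sub_cancel_right] at this
  rw [this, Real.Gamma_add_one hp.ne']
  have := (Real.Gamma_pos_of_pos hp).ne'
  field_simp

theorem hasSum_lowerGamma {b y : ℝ} (hb : 0 < b) (hy : 0 < y) :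
    HasSum (fun k : ℕ => (-1) ^ k * y ^ (b + k) / (k.factorial * (b + k)))
      (Real.Gamma b - upperGamma b y) := by
  rw [Gamma_sub_upperGamma hb hy.le]
  have hpow : ∀ (k : ℕ), ∀ t ∈ Set.Ioc 0 y, t ^ (b - 1) * ((-t) ^ k / k.factorial)
      = (-1) ^ k / k.factorial * t ^ (b + k - 1) := fun k t ht => by
    rw [show b + k - 1 = (b - 1) + k by ring, Real.rpow_add ht.1, Real.rpow_natCast, neg_pow]
    ring
  have hint : ∀ k : ℕ, IntegrableOn (fun t : ℝ => (-1 : ℝ) ^ k / k.factorial * t ^ (b + k - 1))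
      (Set.Ioc 0 y) := fun k => (integrableOn_rpow_Ioc (by positivity) hy).const_mul _
  have h := hasSum_setIntegral (s := Set.Ioc 0 y) measurableSet_Ioc
    (f := fun k t => (-1 : ℝ) ^ k / k.factorial * t ^ (b + k - 1))
    (g := fun t => t ^ (b - 1) * Real.exp (-t)) hint ?_ ?_
  · refine h.congr_fun fun k => ?_
    rw [integral_const_mul, integral_rpow_Ioc (by positivity) hy]
    field_simp
  · have h2 : ∀ k : ℕ, ∫ t in Set.Ioc 0 y, |(-1 : ℝ) ^ k / k.factorial * t ^ (b + k - 1)|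
        = y ^ k / k.factorial * (y ^ b / (b + k)) := fun k => by
      rw [setIntegral_congr_fun (g := fun t => 1 / (k.factorial : ℝ) * t ^ (b + k - 1))
        measurableSet_Ioc, integral_const_mul, integral_rpow_Ioc (by positivity) hy,
        Real.rpow_add hy, Real.rpow_natCast]
      · field_simp
      · intro t ht
        simp only [abs_mul, abs_div, abs_pow, abs_neg, abs_one, one_pow, Nat.abs_cast]
        rw [abs_of_nonneg (Real.rpow_nonneg ht.1.le _)]
    simp_rw [h2]
    refine Summable.of_nonneg_of_le (fun k => by positivity) (fun k => ?_)
      ((Real.summable_pow_div_factorial y).mul_right (y ^ b / b))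
    gcongr
    linarith [k.cast_nonneg (α := ℝ)]
  · intro t ht
    refine ((hasSum_exp_neg t).mul_left (t ^ (b - 1))).congr_fun fun k => ?_
    exact (hpow k t ht).symm

theorem upperGamma_nonneg {b y : ℝ} (hy : 0 ≤ y) : 0 ≤ upperGamma b y :=
  setIntegral_nonneg measurableSet_Ioi fun t ht => by
    have : 0 < t := lt_of_le_of_lt hy ht
    positivity

theorem upperGamma_le_Gamma {b y : ℝ} (hb : 0 < b) (hy : 0 ≤ y) : upperGamma b y ≤ Real.Gamma b := by
  rw [← sub_nonneg, Gamma_sub_upperGamma hb hy]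
  exact setIntegral_nonneg measurableSet_Ioc fun t ht => by
    have : 0 < t := ht.1
    positivity

/-- The power series of `y^(-b) γ(b, y)`. -/
theorem upperGamma_eq_sub_tsum {b y : ℝ} (hb : 0 < b) (hy : 0 < y) :
    upperGamma b y = Real.Gamma b
      - y ^ b * ∑' k : ℕ, (-1) ^ k / ((k.factorial : ℝ) * (b + k)) * y ^ k := by
  rw [← tsum_mul_left, eq_sub_iff_add_eq, add_comm, ← eq_sub_iff_add_eq, ← (hasSum_lowerGamma hb hy).tsum_eq]
  refine tsum_congr fun k => ?_
  rw [Real.rpow_add hy, Real.rpow_natCast]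
  ring

theorem summable_lowerGamma_coeff {b : ℝ} (hb : 0 < b) (r : ℝ) :
    Summable fun k : ℕ => |(-1) ^ k / ((k.factorial : ℝ) * (b + k))| * |r| ^ k := by
  refine Summable.of_nonneg_of_le (fun k => by positivity) (fun k => ?_)
    ((Real.summable_pow_div_factorial |r|).mul_right (1 / b))
  rw [abs_div, abs_pow, abs_neg, abs_one, one_pow, abs_of_pos (by positivity)]
  calc _ ≤ 1 / (k.factorial * b) * |r| ^ k := by
        gcongr; linarith [k.cast_nonneg (α := ℝ)]
    _ = _ := by field_simp

theorem continuousOn_upperGamma {b : ℝ} (hb : 0 < b) : ContinuousOn (upperGamma b) (Set.Ioi 0) := by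
  refine ContinuousOn.congr ?_ fun y hy => upperGamma_eq_sub_tsum hb hy
  refine continuousOn_const.sub (ContinuousOn.mul ?_
    (continuous_tsum_mul_pow (summable_lowerGamma_coeff hb)).continuousOn)
  exact fun x hx => (Real.continuousAt_rpow_const _ _ (Or.inl (ne_of_gt hx))).continuousWithinAt

/-! ### The Riemann-Liouville derivative -/

/-- Coefficients of the power series of `x ↦ x^(i-1) γ(b, a x)`, up to gamma factors. -/
def rlCoeff (a b i : ℝ) (k : ℕ) : ℝ :=
  (-1) ^ k * a ^ (b + k) / (k.factorial * (b + k)) * Real.Gamma (b + i + k)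

/-- The functions `x ↦ x^(m-1) / Γ(m) - …` that arise from `x^(i-1) Γ(b, a x)` by fractional
integration; the derivative of the function with index `m + 1` is the function with index `m`. -/
def rlSeries (a b i m x : ℝ) : ℝ :=
  Real.Gamma b * Real.Gamma i * (x ^ (m - 1) / Real.Gamma m)
    - ∑' k : ℕ, rlCoeff a b i k * (x ^ (b + k + m - 1) / Real.Gamma (b + k + m))

section

variable {a b i : ℝ}

theorem abs_rlCoeff_le (ha : 0 < a) (hb : 0 < b) (hi : 0 < i) (k : ℕ) :
    |rlCoeff a b i k| ≤ a ^ b / b * (|a| ^ k / k.factorial * Real.Gamma (b + i + k)) := by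
  have hG := Real.Gamma_pos_of_pos (by positivity : 0 < b + i + k)
  unfold rlCoeff
  rw [abs_mul, abs_div, abs_mul, abs_pow, abs_neg, abs_one, one_pow, one_mul, abs_of_pos hG,
    abs_of_pos (by positivity : 0 < a ^ (b + (k : ℝ))), Real.rpow_add ha, Real.rpow_natCast,
    abs_of_pos ha, abs_of_pos (by positivity : 0 < (k.factorial : ℝ) * (b + k))]
  calc _ ≤ a ^ b * a ^ k / (k.factorial * b) * Real.Gamma (b + i + k) := by
        gcongr; linarith [k.cast_nonneg (α := ℝ)]
    _ = _ := by field_simp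

theorem summable_rlCoeff (ha : 0 < a) (hb : 0 < b) (hi : 0 < i) (m : ℕ) (r : ℝ) :
    Summable fun k : ℕ => |rlCoeff a b i k| * (|r| ^ k / Real.Gamma (b + k + m)) := by
  refine Summable.of_nonneg_of_le (fun k => ?_) (fun k => ?_)
    ((summable_pow_div_factorial_mul_Gamma (by positivity : 0 < b + i)
      (by positivity : 0 < b + (m : ℝ)) (a * r) 0).mul_left (a ^ b / b))
  · have hG := Real.Gamma_pos_of_pos (by positivity : 0 < b + (k : ℝ) + m)
    positivity
  · have hG := Real.Gamma_pos_of_pos (by positivity : 0 < b + (k : ℝ) + m)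
    calc _ ≤ a ^ b / b * (|a| ^ k / k.factorial * Real.Gamma (b + i + k))
          * (|r| ^ k / Real.Gamma (b + k + m)) := by
          gcongr; exact abs_rlCoeff_le ha hb hi k
      _ = _ := by
        rw [abs_mul, mul_pow, show b + (m : ℝ) + k = b + k + m by ring]; ring

theorem summable_rlSeries (ha : 0 < a) (hb : 0 < b) (hi : 0 < i) (m : ℕ) {x : ℝ} (hx : 0 < x) :
    Summable fun k : ℕ => rlCoeff a b i k * (x ^ (b + k + m - 1) / Real.Gamma (b + k + m)) := by
  refine Summable.of_norm (((summable_rlCoeff ha hb hi m x).mul_left (x ^ (b + m - 1))).congr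
    fun k => ?_)
  have hG := Real.Gamma_pos_of_pos (by positivity : 0 < b + (k : ℝ) + m)
  rw [Real.norm_eq_abs, abs_mul, abs_of_pos (by positivity : 0 < x ^ (b + k + m - 1) /
    Real.Gamma (b + k + m)), show b + (k : ℝ) + m - 1 = (b + m - 1) + k by ring, Real.rpow_add hx,
    Real.rpow_natCast, abs_of_pos hx]
  ring

/-- The conventions `Real.Gamma 0 = 0` and `x / 0 = 0` give the correct 1/Γ(0) = 0, so the case p =
0 needs no exception in the statement. -/
theorem hasDerivAt_rpow_div_Gamma {p x : ℝ} (hx : 0 < x) :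
    HasDerivAt (fun y : ℝ => y ^ p / Real.Gamma (p + 1)) (x ^ (p - 1) / Real.Gamma p) x := by
  have h := (Real.hasDerivAt_rpow_const (p := p) (Or.inl hx.ne')).div_const (Real.Gamma (p + 1))
  refine h.congr_deriv ?_
  rcases eq_or_ne p 0 with rfl | hp
  · simp
  · rw [Real.Gamma_add_one hp]
    field_simp

/-- The normalization by 1/Γ makes termwise differentiation a mere shift of the index; it is
justified on (x/2, 2x) by the power series at 2x. -/
theorem hasDerivAt_rlSeries (ha : 0 < a) (hb : 0 < b) (hi : 0 < i) (m : ℕ) {x : ℝ} (hx : 0 < x) :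
    HasDerivAt (rlSeries a b i (m + 1 : ℕ)) (rlSeries a b i m x) x := by
  unfold rlSeries
  refine HasDerivAt.sub ?_ ?_
  · have := (hasDerivAt_rpow_div_Gamma (p := m) hx).const_mul (Real.Gamma b * Real.Gamma i)
    push_cast
    simpa only [add_sub_cancel_right] using this
  -- A power is monotone on this interval, hence bounded by one of its end values and so by their
  -- sum.
  · let M : ℝ := (x / 2) ^ (b + m - 1) + (2 * x) ^ (b + m - 1)
    have hM : ∀ y ∈ Set.Ioo (x / 2) (2 * x), y ^ (b + m - 1) ≤ M := fun y hy => by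
      have hy0 : 0 < y := by linarith [hy.1]
      rcases le_total 0 (b + m - 1) with h | h
      · have := Real.rpow_le_rpow hy0.le hy.2.le h
        have h2 : 0 ≤ (x / 2) ^ (b + m - 1) := by positivity
        simp only [M]; linarith
      · have := Real.rpow_le_rpow_of_nonpos (by linarith) hy.1.le h
        have h2 : 0 ≤ (2 * x) ^ (b + m - 1) := by positivity
        simp only [M]; linarith
    have hM0 : 0 ≤ M := by positivity
    have hmem : x ∈ Set.Ioo (x / 2) (2 * x) := ⟨by linarith, by linarith⟩
    have hs := summable_rlSeries ha hb hi (m + 1) hx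
    refine hasDerivAt_tsum_of_isPreconnected
      (g := fun (k : ℕ) (y : ℝ) => rlCoeff a b i k * (y ^ (b + k + (m + 1 : ℕ) - 1)
        / Real.Gamma (b + k + (m + 1 : ℕ))))
      (g' := fun (k : ℕ) (y : ℝ) => rlCoeff a b i k * (y ^ (b + k + m - 1)
        / Real.Gamma (b + k + m))) (t := Set.Ioo (x / 2) (2 * x)) (y₀ := x)
      (u := fun k : ℕ => M * (|rlCoeff a b i k| * (|2 * x| ^ k / Real.Gamma (b + k + m))))
      ((summable_rlCoeff ha hb hi m (2 * x)).mul_left M) isOpen_Ioo isPreconnected_Ioo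
      (fun k y hy => ?_) (fun k y hy => ?_) hmem hs hmem
    · have hy0 : 0 < y := by linarith [hy.1]
      have := (hasDerivAt_rpow_div_Gamma (p := b + k + m) hy0).const_mul (rlCoeff a b i k)
      push_cast
      rw [show b + (k : ℝ) + (m + 1) = b + k + m + 1 by ring, add_sub_cancel_right]
      exact this
    · have hy0 : 0 < y := by linarith [hy.1]
      have hG := Real.Gamma_pos_of_pos (by positivity : 0 < b + (k : ℝ) + m)
      rw [Real.norm_eq_abs, abs_mul, abs_of_pos (by positivity : 0 < y ^ (b + k + m - 1) /
        Real.Gamma (b + k + m)), show b + (k : ℝ) + m - 1 = (b + m - 1) + k by ring,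
        Real.rpow_add hy0, Real.rpow_natCast, abs_of_pos (by linarith : 0 < 2 * x)]
      calc _ ≤ |rlCoeff a b i k| * (M * (2 * x) ^ k / Real.Gamma (b + k + m)) := by
            gcongr
            · exact hM y hy
            · exact hy.2.le
        _ = _ := by ring

/-- At index 0 the first term disappears because 1/Γ(0) = 0; what is left is x^(b-1) times an entire
function. -/
theorem continuousOn_rlSeries_zero (ha : 0 < a) (hb : 0 < b) (hi : 0 < i) :
    ContinuousOn (rlSeries a b i 0) (Set.Ioi 0) := by
  have h : ∀ x ∈ Set.Ioi (0 : ℝ), rlSeries a b i 0 x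
      = -(x ^ (b - 1) * ∑' k : ℕ, rlCoeff a b i k / Real.Gamma (b + k) * x ^ k) := fun x hx => by
    have hx0 : (0 : ℝ) < x := hx
    simp only [rlSeries, Real.Gamma_zero, div_zero, mul_zero, zero_sub, add_zero]
    rw [← tsum_mul_left]
    congr 1
    refine tsum_congr fun k => ?_
    rw [show b + (k : ℝ) - 1 = (b - 1) + k by ring, Real.rpow_add hx0, Real.rpow_natCast]
    ring
  refine ContinuousOn.congr ?_ h
  refine (ContinuousOn.mul ?_ (continuous_tsum_mul_pow fun r => ?_).continuousOn).neg
  · exact fun x hx => (Real.continuousAt_rpow_const _ _ (Or.inl (ne_of_gt hx))).continuousWithinAt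
  · refine (summable_rlCoeff ha hb hi 0 r).congr fun k => ?_
    have hG := Real.Gamma_pos_of_pos (by positivity : 0 < b + (k : ℝ))
    rw [abs_div, abs_of_pos hG, Nat.cast_zero, add_zero]
    ring

theorem iteratedDeriv_rlSeries (ha : 0 < a) (hb : 0 < b) (hi : 0 < i) (m : ℕ) {x : ℝ}
    (hx : 0 < x) : iteratedDeriv m (rlSeries a b i m) x = rlSeries a b i 0 x := by
  induction m with
  | zero => simp
  | succ m ih =>
    rw [iteratedDeriv_succ', ← ih]
    refine Filter.EventuallyEq.iteratedDeriv_eq m ?_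
    filter_upwards [isOpen_Ioi.mem_nhds hx] with y hy
    exact (hasDerivAt_rlSeries ha hb hi m hy).deriv

theorem contDiffOn_rlSeries (ha : 0 < a) (hb : 0 < b) (hi : 0 < i) (m : ℕ) :
    ContDiffOn ℝ m (rlSeries a b i m) (Set.Ioi 0) := by
  induction m with
  | zero => simpa using continuousOn_rlSeries_zero ha hb hi
  | succ m ih =>
    rw [Nat.cast_succ, contDiffOn_succ_iff_deriv_of_isOpen isOpen_Ioi]
    refine ⟨fun y hy => (hasDerivAt_rlSeries ha hb hi m hy).differentiableAt.differentiableWithinAt,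
      by simp, ih.congr fun y hy => (hasDerivAt_rlSeries ha hb hi m hy).deriv⟩

/-- A fractional integral of order n - i maps x^(p-1)/Γ(p) to x^(p+n-i-1)/Γ(p+n-i), by the beta
integral. This is applied to p = i and, inside the expansion of the lower incomplete gamma function,
to p = b + k + i. -/
theorem rlIntegral_eq_rlSeries (ha : 0 < a) (hb : 0 < b) (hi : 0 < i) {n : ℕ} (hn : i ≤ n)
    {x : ℝ} (hx : 0 < x) :
    rlIntegral (n - i) (fun t => t ^ (i - 1) * upperGamma b (a * t)) x = rlSeries a b i n x := by
  have hn0 : (0 : ℝ) < n := hi.trans_le hn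
  have hexp : ∀ t, 0 < t → HasSum (fun k : ℕ => (-1) ^ k * a ^ (b + k) / (k.factorial * (b + k))
      * t ^ (b + k + i - 1)) (t ^ (i - 1) * (Real.Gamma b - upperGamma b (a * t))) := fun t ht => by
    refine ((hasSum_lowerGamma hb (mul_pos ha ht)).mul_left (t ^ (i - 1))).congr_fun fun k => ?_
    rw [show b + (k : ℝ) + i - 1 = (b + k) + (i - 1) by ring, Real.rpow_add ht,
      Real.mul_rpow ha.le ht.le]
    ring
  -- If i = n, the integral has order 0 and is the identity by definition; the beta integral needs n
  -- - i > 0.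
  rcases eq_or_lt_of_le hn with h | h
  · have : (n : ℝ) - i = 0 := by linarith
    simp only [rlIntegral, if_pos this, rlSeries]
    rw [← h]
    have h1 := (hexp x hx).tsum_eq
    have hGi := (Real.Gamma_pos_of_pos hi).ne'
    have h2 : ∀ k : ℕ, rlCoeff a b i k * (x ^ (b + k + i - 1) / Real.Gamma (b + k + i))
        = (-1) ^ k * a ^ (b + k) / (k.factorial * (b + k)) * x ^ (b + k + i - 1) := fun k => by
      have hG := (Real.Gamma_pos_of_pos (by positivity : 0 < b + (k : ℝ) + i)).ne'
      rw [rlCoeff, show b + i + (k : ℝ) = b + k + i by ring]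
      field_simp
    simp_rw [h2]
    rw [h1]
    field_simp
    ring
  · have hα : 0 < (n : ℝ) - i := by linarith
    have hGα := Real.Gamma_pos_of_pos hα
    simp only [rlIntegral, if_neg hα.ne']
    rw [intervalIntegral.integral_of_le hx.le]
    set d : ℕ → ℝ := fun k => (-1) ^ k * a ^ (b + k) / (k.factorial * (b + k)) with hd
    have hbeta := fun k : ℕ => integral_Ioc_beta (by positivity : 0 < b + k + i) hα hx
    have hbetaI := fun k : ℕ => integrableOn_beta (by positivity : 0 < b + k + i) hα hx
    have hsum := hasSum_setIntegral (s := Set.Ioc 0 x) measurableSet_Ioc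
      (f := fun k t => d k * (t ^ (b + k + i - 1) * (x - t) ^ ((n : ℝ) - i - 1)))
      (g := fun t => (x - t) ^ ((n : ℝ) - i - 1)
        * (t ^ (i - 1) * (Real.Gamma b - upperGamma b (a * t))))
      (fun k => (hbetaI k).const_mul _) ?_ ?_
    · have hterm : ∀ k : ℕ, ∫ t in Set.Ioc 0 x, d k * (t ^ (b + k + i - 1) * (x - t) ^ ((n : ℝ) - i - 1))
          = Real.Gamma (n - i) * (rlCoeff a b i k * (x ^ (b + k + n - 1) / Real.Gamma (b + k + n))) :=
        fun k => by
        rw [integral_const_mul, hbeta k, show b + (k : ℝ) + i + (n - i) = b + k + n by ring,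
          rlCoeff, show b + i + (k : ℝ) = b + k + i by ring]
        ring
      simp_rw [hterm] at hsum
      have hI1 := (integrableOn_beta hi hα hx).const_mul (Real.Gamma b)
      have hg : IntegrableOn (fun t => (x - t) ^ ((n : ℝ) - i - 1)
        * (t ^ (i - 1) * (Real.Gamma b - upperGamma b (a * t)))) (Set.Ioc 0 x) := by
        refine Integrable.mono' hI1 ?_ ?_
        · refine (Measurable.aestronglyMeasurable (by fun_prop)).mul
            ((Measurable.aestronglyMeasurable (by fun_prop)).mul ?_)
          refine (continuousOn_const.sub ((continuousOn_upperGamma hb).comp (by fun_prop)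
            fun t ht => mul_pos ha ht.1)).aestronglyMeasurable measurableSet_Ioc
        · filter_upwards [ae_restrict_mem measurableSet_Ioc] with t ht
          have h1 := upperGamma_nonneg (b := b) (mul_pos ha ht.1).le
          have h2 := upperGamma_le_Gamma hb (mul_pos ha ht.1).le
          have h3 : 0 ≤ (x - t) ^ ((n : ℝ) - i - 1) := Real.rpow_nonneg (sub_nonneg.2 ht.2) _
          have h4 : 0 ≤ t ^ (i - 1) := Real.rpow_nonneg ht.1.le _
          rw [Real.norm_of_nonneg (by have := sub_nonneg.2 h2; positivity)]
          calc _ ≤ (x - t) ^ ((n : ℝ) - i - 1) * (t ^ (i - 1) * Real.Gamma b) := by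
                gcongr; linarith
            _ = _ := by ring
      have hsplit : ∫ t in Set.Ioc 0 x, (x - t) ^ ((n : ℝ) - i - 1)
            * (t ^ (i - 1) * upperGamma b (a * t))
          = (∫ t in Set.Ioc 0 x, Real.Gamma b * (t ^ (i - 1) * (x - t) ^ ((n : ℝ) - i - 1)))
            - ∫ t in Set.Ioc 0 x, (x - t) ^ ((n : ℝ) - i - 1)
            * (t ^ (i - 1) * (Real.Gamma b - upperGamma b (a * t))) := by
        rw [← integral_sub hI1 hg]
        refine setIntegral_congr_fun measurableSet_Ioc fun t _ => ?_
        ring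
      rw [hsplit, ← hsum.tsum_eq, integral_const_mul, integral_Ioc_beta hi hα hx, tsum_mul_left,
        rlSeries, show i + ((n : ℝ) - i) = n by ring]
      field_simp
    · refine ((summable_rlSeries ha hb hi n hx).abs.mul_left (Real.Gamma (n - i))).congr fun k => ?_
      have e : ∀ t ∈ Set.Ioc 0 x, |d k * (t ^ (b + k + i - 1) * (x - t) ^ ((n : ℝ) - i - 1))|
          = |d k| * (t ^ (b + k + i - 1) * (x - t) ^ ((n : ℝ) - i - 1)) := fun t ht => by
        have h3 : 0 ≤ (x - t) ^ ((n : ℝ) - i - 1) := Real.rpow_nonneg (sub_nonneg.2 ht.2) _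
        have h4 : 0 ≤ t ^ (b + k + i - 1) := Real.rpow_nonneg ht.1.le _
        rw [abs_mul, abs_of_nonneg (mul_nonneg h4 h3)]
      have hG1 := Real.Gamma_pos_of_pos (by positivity : 0 < b + k + n)
      have hG2 := Real.Gamma_pos_of_pos (by positivity : 0 < b + k + i)
      rw [setIntegral_congr_fun measurableSet_Ioc e, integral_const_mul, hbeta k,
        show b + (k : ℝ) + i + (n - i) = b + k + n by ring, abs_mul,
        abs_of_nonneg (by positivity : 0 ≤ x ^ (b + k + n - 1) / Real.Gamma (b + k + n)), rlCoeff,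
        show b + i + (k : ℝ) = b + k + i by ring, abs_mul, abs_of_pos hG2]
      ring
    · intro t ht
      refine ((hexp t ht.1).mul_left ((x - t) ^ ((n : ℝ) - i - 1))).congr_fun fun k => ?_
      ring

end

end

section

/-! ### A Bessel function and its Laplace transforms -/

/-- The entire function `x ↦ ∑ (-x)^k / (k! Γ(b + 1 + k))`, a Bessel function of `√x` up to a
power of `x`. -/
def besselEntire (b x : ℝ) : ℝ :=
  ∑' k : ℕ, (-1) ^ k / ((k.factorial : ℝ) * Real.Gamma (b + 1 + k)) * x ^ k

/-- The entire function `x ↦ ∑ Γ(b + i + k) (-x)^k / (k! Γ(b + 1 + k))`, a multiple of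
`₁F₁(b + i; b + 1; -x)`. -/
def kummerEntire (b i x : ℝ) : ℝ :=
  ∑' k : ℕ, (-1) ^ k * Real.Gamma (b + i + k) / ((k.factorial : ℝ) * Real.Gamma (b + 1 + k)) * x ^ k

section

variable {a b i : ℝ}

theorem summable_besselEntire (hb : 0 < b) (r : ℝ) :
    Summable fun k : ℕ => |(-1) ^ k / ((k.factorial : ℝ) * Real.Gamma (b + 1 + k))| * |r| ^ k := by
  refine (summable_pow_div_factorial_mul_inv_Gamma (by positivity : 0 < b + 1) r).congr fun k => ?_
  have hG := Real.Gamma_pos_of_pos (by positivity : 0 < b + 1 + k)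
  rw [abs_div, abs_pow, abs_neg, abs_one, one_pow,
    abs_of_pos (by positivity : 0 < (k.factorial : ℝ) * Real.Gamma (b + 1 + k))]
  ring

theorem summable_kummerEntire (hb : 0 < b) (hi : 0 < i) (r : ℝ) :
    Summable fun k : ℕ => |(-1) ^ k * Real.Gamma (b + i + k)
      / ((k.factorial : ℝ) * Real.Gamma (b + 1 + k))| * |r| ^ k := by
  refine (summable_pow_div_factorial_mul_Gamma (by positivity : 0 < b + i)
    (by positivity : 0 < b + 1) r 0).congr fun k => ?_
  have hG := Real.Gamma_pos_of_pos (by positivity : 0 < b + 1 + k)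
  have hG' := Real.Gamma_pos_of_pos (by positivity : 0 < b + i + k)
  rw [abs_div, abs_mul, abs_pow, abs_neg, abs_one, one_pow,
    abs_of_pos (by positivity : 0 < (k.factorial : ℝ) * Real.Gamma (b + 1 + k)), abs_of_pos hG']
  field_simp

theorem hasSum_of_summable_abs {c : ℕ → ℝ} (hc : ∀ r : ℝ, Summable fun k => |c k| * |r| ^ k)
    (x : ℝ) : HasSum (fun k => c k * x ^ k) (∑' k, c k * x ^ k) :=
  (Summable.of_norm ((hc x).congr fun k => by
    rw [Real.norm_eq_abs, abs_mul, abs_pow])).hasSum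

theorem continuous_besselEntire (hb : 0 < b) : Continuous (besselEntire b) :=
  continuous_tsum_mul_pow (summable_besselEntire hb)

theorem continuous_kummerEntire (hb : 0 < b) (hi : 0 < i) : Continuous (kummerEntire b i) :=
  continuous_tsum_mul_pow (summable_kummerEntire hb hi)

theorem Gamma_nat_add_half (k : ℕ) :
    Real.Gamma (1 / 2 + k) = (2 * k).factorial * √Real.pi / (4 ^ k * k.factorial) := by
  have h := Real.Gamma_mul_Gamma_add_half (1 / 2 + k)
  rw [show (1 / 2 : ℝ) + k + 1 / 2 = k + 1 by ring, Real.Gamma_nat_eq_factorial,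
    show 2 * ((1 : ℝ) / 2 + k) = (2 * k : ℕ) + 1 by push_cast; ring, Real.Gamma_nat_eq_factorial,
    show (1 : ℝ) - ((2 * k : ℕ) + 1) = -((2 * k : ℕ) : ℝ) by ring, Real.rpow_neg two_pos.le,
    Real.rpow_natCast, pow_mul] at h
  norm_num at h
  have : (k.factorial : ℝ) ≠ 0 := by positivity
  rw [eq_div_iff (by positivity), ← mul_assoc, mul_comm _ ((4 : ℝ) ^ k), mul_assoc, h]
  field_simp

theorem hasSum_cos_sqrt {w : ℝ} (hw : 0 ≤ w) :
    HasSum (fun k : ℕ => (-1) ^ k * (4 ^ k / (2 * k).factorial) * w ^ k) (Real.cos (2 * √w)) := by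
  refine (Real.hasSum_cos (2 * √w)).congr_fun fun k => ?_
  rw [mul_pow, pow_mul, pow_mul, Real.sq_sqrt hw]
  ring

/-- Poisson's integral. -/
theorem besselEntire_eq_integral (hb : 0 < b) {x : ℝ} (hx : 0 ≤ x) :
    √Real.pi * Real.Gamma (b + 1 / 2) * besselEntire b x
      = ∫ u in Set.Ioc (0 : ℝ) 1, u ^ ((1 / 2 : ℝ) - 1) * (1 - u) ^ (b + 1 / 2 - 1)
        * Real.cos (2 * √(x * u)) := by
  have hGb := Real.Gamma_pos_of_pos (by positivity : 0 < b + 1 / 2)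
  set d : ℕ → ℝ := fun k => (-1) ^ k * (4 ^ k / (2 * k).factorial) * x ^ k with hd
  have hI := fun k : ℕ => integral_Ioc_beta (by positivity : 0 < (1 / 2 : ℝ) + k)
    (by positivity : 0 < b + 1 / 2) one_pos
  have hII := fun k : ℕ => integrableOn_beta (by positivity : 0 < (1 / 2 : ℝ) + k)
    (by positivity : 0 < b + 1 / 2) one_pos
  have hval : ∀ k : ℕ, d k * (1 ^ (1 / 2 + (k : ℝ) + (b + 1 / 2) - 1) * (Real.Gamma (1 / 2 + k)
      * Real.Gamma (b + 1 / 2) / Real.Gamma (1 / 2 + k + (b + 1 / 2))))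
      = √Real.pi * Real.Gamma (b + 1 / 2)
        * ((-1) ^ k / ((k.factorial : ℝ) * Real.Gamma (b + 1 + k)) * x ^ k) := fun k => by
    have hG := Real.Gamma_pos_of_pos (by positivity : 0 < b + 1 + k)
    rw [Real.one_rpow, one_mul, Gamma_nat_add_half, show (1 : ℝ) / 2 + k + (b + 1 / 2) = b + 1 + k by ring]
    simp only [hd]
    field_simp
  -- The cosine is expanded in powers of u, and the resulting beta integrals supply the factors
  -- 1/Γ(b+1+k).
  have h := hasSum_setIntegral (s := Set.Ioc (0 : ℝ) 1) measurableSet_Ioc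
    (f := fun k u => d k * (u ^ ((1 / 2 : ℝ) + k - 1) * (1 - u) ^ (b + 1 / 2 - 1)))
    (g := fun u => u ^ ((1 / 2 : ℝ) - 1) * (1 - u) ^ (b + 1 / 2 - 1) * Real.cos (2 * √(x * u)))
    (fun k => (hII k).const_mul _) ?_ ?_
  · rw [← h.tsum_eq]
    simp_rw [integral_const_mul, hI, hval]
    rw [tsum_mul_left, besselEntire]
  · refine ((summable_besselEntire hb x).mul_left (√Real.pi * Real.Gamma (b + 1 / 2))).congr
      fun k => ?_
    have e : ∀ u ∈ Set.Ioc (0 : ℝ) 1, |d k * (u ^ ((1 / 2 : ℝ) + k - 1) * (1 - u) ^ (b + 1 / 2 - 1))|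
        = |d k| * (u ^ ((1 / 2 : ℝ) + k - 1) * (1 - u) ^ (b + 1 / 2 - 1)) := fun u hu => by
      have h3 : 0 ≤ (1 - u) ^ (b + 1 / 2 - 1) := Real.rpow_nonneg (sub_nonneg.2 hu.2) _
      have h4 : 0 ≤ u ^ ((1 / 2 : ℝ) + k - 1) := Real.rpow_nonneg hu.1.le _
      rw [abs_mul, abs_of_nonneg (mul_nonneg h4 h3)]
    have hpos : 0 ≤ (1 : ℝ) ^ (1 / 2 + (k : ℝ) + (b + 1 / 2) - 1) * (Real.Gamma (1 / 2 + k)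
      * Real.Gamma (b + 1 / 2) / Real.Gamma (1 / 2 + k + (b + 1 / 2))) := by
      have := Real.Gamma_pos_of_pos (by positivity : 0 < (1 / 2 : ℝ) + k)
      have := Real.Gamma_pos_of_pos (by positivity : 0 < (1 / 2 : ℝ) + k + (b + 1 / 2))
      positivity
    rw [setIntegral_congr_fun measurableSet_Ioc e, integral_const_mul, hI, ← abs_of_nonneg hpos,
      ← abs_mul, hval, abs_mul, abs_mul _ (x ^ k), abs_pow x,
      abs_of_pos (by positivity : 0 < √Real.pi * Real.Gamma (b + 1 / 2))]
  · intro u hu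
    refine ((hasSum_cos_sqrt (mul_nonneg hx hu.1.le)).mul_left
      (u ^ ((1 / 2 : ℝ) - 1) * (1 - u) ^ (b + 1 / 2 - 1))).congr_fun fun k => ?_
    rw [show (1 / 2 : ℝ) + k - 1 = (1 / 2 - 1) + k by ring, Real.rpow_add hu.1, Real.rpow_natCast,
      mul_pow]
    simp only [hd]
    ring

/-- In Poisson's integral the cosine is at most 1 in absolute value. Absolute values taken in the
alternating series would give no bound uniform in x. -/
theorem abs_besselEntire_le (hb : 0 < b) {x : ℝ} (hx : 0 ≤ x) :
    |besselEntire b x| ≤ 1 / Real.Gamma (b + 1) := by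
  have hGb := Real.Gamma_pos_of_pos (by positivity : 0 < b + 1 / 2)
  have hGb1 := Real.Gamma_pos_of_pos (by positivity : 0 < b + 1)
  have h := besselEntire_eq_integral hb hx
  have hI := integral_Ioc_beta (by positivity : 0 < (1 / 2 : ℝ)) (by positivity : 0 < b + 1 / 2) one_pos
  have hII := integrableOn_beta (by positivity : 0 < (1 / 2 : ℝ)) (by positivity : 0 < b + 1 / 2) one_pos
  have h2 : |√Real.pi * Real.Gamma (b + 1 / 2) * besselEntire b x|
      ≤ √Real.pi * Real.Gamma (b + 1 / 2) * (1 / Real.Gamma (b + 1)) := by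
    rw [h]
    calc _ ≤ ∫ u in Set.Ioc (0 : ℝ) 1, u ^ ((1 / 2 : ℝ) - 1) * (1 - u) ^ (b + 1 / 2 - 1) := by
          rw [← Real.norm_eq_abs]
          refine norm_integral_le_of_norm_le hII ?_
          filter_upwards [ae_restrict_mem measurableSet_Ioc] with u hu
          have h3 : 0 ≤ (1 - u) ^ (b + 1 / 2 - 1) := Real.rpow_nonneg (sub_nonneg.2 hu.2) _
          have h4 : 0 ≤ u ^ ((1 / 2 : ℝ) - 1) := Real.rpow_nonneg hu.1.le _
          rw [norm_mul, Real.norm_of_nonneg (mul_nonneg h4 h3)]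
          exact mul_le_of_le_one_right (mul_nonneg h4 h3) (Real.abs_cos_le_one _)
      _ = _ := by
          rw [hI, Real.one_rpow, Real.Gamma_one_half_eq, show (1 : ℝ) / 2 + (b + 1 / 2) = b + 1 by ring]
          ring
  rw [abs_mul, abs_of_pos (by positivity)] at h2
  exact le_of_mul_le_mul_left h2 (by positivity)

theorem integrableOn_rpow_mul_exp {p z : ℝ} (hp : 0 < p) (hz : 0 < z) :
    IntegrableOn (fun t : ℝ => t ^ (p - 1) * Real.exp (-(z * t))) (Set.Ioi 0) := by
  refine Integrable.of_integral_ne_zero ?_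
  rw [Real.integral_rpow_mul_exp_neg_mul_Ioi hp hz]
  have := Real.Gamma_pos_of_pos hp
  positivity

/-- Integration of an entire function of exponential type against a gamma density. -/
theorem hasSum_integral_rpow_mul_exp {p z : ℝ} (hp : 0 < p) (hz : 0 < z) {c : ℕ → ℝ}
    (hc : Summable fun k : ℕ => |c k| * (Real.Gamma (p + k) / z ^ k))
    {g : ℝ → ℝ} (hg : ∀ t, 0 < t → HasSum (fun k => c k * t ^ k) (g t)) :
    HasSum (fun k : ℕ => c k * (Real.Gamma (p + k) / z ^ k) / z ^ p)
      (∫ t in Set.Ioi (0 : ℝ), t ^ (p - 1) * Real.exp (-(z * t)) * g t) := by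
  have hI : ∀ k : ℕ, ∫ t in Set.Ioi (0 : ℝ), t ^ (p + k - 1) * Real.exp (-(z * t))
      = Real.Gamma (p + k) / z ^ k / z ^ p := fun k => by
    rw [Real.integral_rpow_mul_exp_neg_mul_Ioi (by positivity) hz, one_div, Real.inv_rpow hz.le,
      Real.rpow_add hz, Real.rpow_natCast]
    field_simp
  have h := hasSum_setIntegral (s := Set.Ioi (0 : ℝ)) measurableSet_Ioi
    (f := fun k t => c k * (t ^ (p + k - 1) * Real.exp (-(z * t))))
    (g := fun t => t ^ (p - 1) * Real.exp (-(z * t)) * g t)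
    (fun k => (integrableOn_rpow_mul_exp (by positivity) hz).const_mul _) ?_ ?_
  · refine h.congr_fun fun k => ?_
    rw [integral_const_mul, hI]
    ring
  · refine (hc.div_const (z ^ p)).congr fun k => ?_
    have e : ∀ t ∈ Set.Ioi (0 : ℝ), |c k * (t ^ (p + k - 1) * Real.exp (-(z * t)))|
        = |c k| * (t ^ (p + k - 1) * Real.exp (-(z * t))) := fun t ht => by
      have : (0 : ℝ) < t := ht
      rw [abs_mul, abs_of_pos (by positivity : 0 < t ^ (p + k - 1) * Real.exp (-(z * t)))]
    rw [setIntegral_congr_fun measurableSet_Ioi e, integral_const_mul, hI]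
    ring
  · intro t ht
    refine ((hg t ht).mul_left (t ^ (p - 1) * Real.exp (-(z * t)))).congr_fun fun k => ?_
    rw [show p + k - 1 = (p - 1) + k by ring, Real.rpow_add ht, Real.rpow_natCast]
    ring

/-- Each u^k integrates to Γ(b+i+k), the factor by which the two series differ. This carries the
uniform bound over from the Bessel function. -/
theorem kummerEntire_eq_integral (hb : 0 < b) (hi : 0 < i) (y : ℝ) :
    kummerEntire b i y
      = ∫ u in Set.Ioi (0 : ℝ), u ^ (b + i - 1) * Real.exp (-u) * besselEntire b (y * u) := by
  have h := hasSum_integral_rpow_mul_exp (p := b + i) (z := 1) (by positivity) one_pos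
    (c := fun k : ℕ => (-1) ^ k / ((k.factorial : ℝ) * Real.Gamma (b + 1 + k)) * y ^ k)
    (g := fun u => besselEntire b (y * u)) ?_ ?_
  · simp only [one_mul, one_pow, Real.one_rpow, div_one] at h
    rw [← h.tsum_eq, kummerEntire]
    exact tsum_congr fun k => by ring
  · refine (summable_kummerEntire hb hi y).congr fun k => ?_
    have hG := Real.Gamma_pos_of_pos (by positivity : 0 < b + i + k)
    rw [one_pow, div_one, mul_div_right_comm, abs_mul, abs_of_pos hG, abs_mul, abs_pow]
    ring
  · intro t _
    refine (hasSum_of_summable_abs (summable_besselEntire hb) (y * t)).congr_fun fun k => ?_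
    rw [mul_pow]
    ring

theorem abs_kummerEntire_le (hb : 0 < b) (hi : 0 < i) {y : ℝ} (hy : 0 ≤ y) :
    |kummerEntire b i y| ≤ Real.Gamma (b + i) / Real.Gamma (b + 1) := by
  rw [kummerEntire_eq_integral hb hi]
  have hint := (integrableOn_gamma (by positivity : 0 < b + i)).mul_const (1 / Real.Gamma (b + 1))
  calc _ ≤ ∫ u in Set.Ioi (0 : ℝ), u ^ (b + i - 1) * Real.exp (-u) * (1 / Real.Gamma (b + 1)) := by
        rw [← Real.norm_eq_abs]
        refine norm_integral_le_of_norm_le hint ?_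
        filter_upwards [ae_restrict_mem measurableSet_Ioi] with u hu
        have hu0 : (0 : ℝ) < u := hu
        rw [norm_mul, Real.norm_of_nonneg (by positivity)]
        exact mul_le_mul_of_nonneg_left (abs_besselEntire_le hb (by positivity)) (by positivity)
    _ = _ := by
        rw [integral_mul_const, Real.Gamma_eq_integral (by positivity : 0 < b + i), mul_one_div]
        congr 1
        exact setIntegral_congr_fun measurableSet_Ioi fun t _ => by ring

/-- Laplace transform of `t^(b-1)` times the Bessel function. -/
theorem integral_besselEntire (hb : 0 < b) {v z : ℝ} (hv : 0 < v) (hz : 0 < z) :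
    ∫ t in Set.Ioi (0 : ℝ), t ^ (b - 1) * Real.exp (-(z * t)) * besselEntire b (v * t)
      = v⁻¹ ^ b * (Real.Gamma b - upperGamma b (v / z)) := by
  have h := hasSum_integral_rpow_mul_exp (p := b) (z := z) hb hz
    (c := fun k : ℕ => (-1) ^ k / ((k.factorial : ℝ) * Real.Gamma (b + 1 + k)) * v ^ k)
    (g := fun u => besselEntire b (v * u)) ?_ ?_
  · rw [← h.tsum_eq, ← (hasSum_lowerGamma hb (div_pos hv hz)).tsum_eq, ← tsum_mul_left]
    refine tsum_congr fun k => ?_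
    have hG := Real.Gamma_pos_of_pos (by positivity : 0 < b + k)
    rw [show b + 1 + (k : ℝ) = (b + k) + 1 by ring, Real.Gamma_add_one (by positivity),
      Real.rpow_add (by positivity), Real.rpow_natCast, Real.div_rpow hv.le hz.le,
      Real.inv_rpow hv.le, div_pow]
    field_simp
  · refine ((summable_lowerGamma_coeff hb (v / z))).congr fun k => ?_
    have hG := Real.Gamma_pos_of_pos (by positivity : 0 < b + k)
    rw [show b + 1 + (k : ℝ) = (b + k) + 1 by ring, Real.Gamma_add_one (by positivity),
      abs_of_pos (by positivity : 0 < v / z), abs_mul, abs_pow v, abs_of_pos hv, abs_div, abs_div,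
      abs_of_pos (by positivity : 0 < (k.factorial : ℝ) * (b + k)),
      abs_of_pos (by positivity : 0 < (k.factorial : ℝ) * ((b + k) * Real.Gamma (b + k))), div_pow]
    field_simp
  · intro t _
    refine (hasSum_of_summable_abs (summable_besselEntire hb) (v * t)).congr_fun fun k => ?_
    rw [mul_pow]
    ring

/-- Termwise integration would fail for z < a. Writing the Kummer function as an average of the
bounded Bessel function and exchanging the two integrals works for every z > 0. -/
theorem integral_kummerEntire (ha : 0 < a) (hb : 0 < b) (hi : 0 < i) {z : ℝ} (hz : 0 < z) :
    ∫ t in Set.Ioi (0 : ℝ), t ^ (b - 1) * Real.exp (-(z * t)) * kummerEntire b i (a * t)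
      = a⁻¹ ^ b * ∫ u in Set.Ioi (0 : ℝ), u ^ (i - 1) * Real.exp (-u)
        * (Real.Gamma b - upperGamma b (a * u / z)) := by
  have hswap := integral_integral_swap (μ := volume.restrict (Set.Ioi (0 : ℝ)))
    (ν := volume.restrict (Set.Ioi (0 : ℝ)))
    (f := fun t u => t ^ (b - 1) * Real.exp (-(z * t)) * (u ^ (b + i - 1) * Real.exp (-u))
      * besselEntire b (a * t * u)) ?_
  · calc _ = ∫ t in Set.Ioi (0 : ℝ), ∫ u in Set.Ioi (0 : ℝ), t ^ (b - 1) * Real.exp (-(z * t))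
          * (u ^ (b + i - 1) * Real.exp (-u)) * besselEntire b (a * t * u) := by
          refine setIntegral_congr_fun measurableSet_Ioi fun t _ => ?_
          rw [kummerEntire_eq_integral hb hi, ← integral_const_mul]
          simp only [mul_assoc]
      _ = _ := by
          rw [hswap, ← integral_const_mul]
          refine setIntegral_congr_fun measurableSet_Ioi fun u hu => ?_
          have hu0 : (0 : ℝ) < u := hu
          have h := integral_besselEntire hb (mul_pos ha hu0) hz
          calc _ = ∫ t in Set.Ioi (0 : ℝ), u ^ (b + i - 1) * Real.exp (-u) * (t ^ (b - 1)
                * Real.exp (-(z * t)) * besselEntire b (a * u * t)) := by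
                refine setIntegral_congr_fun measurableSet_Ioi fun t _ => ?_
                rw [show a * t * u = a * u * t by ring]
                ring
            _ = _ := by
                rw [integral_const_mul, h, mul_inv, Real.mul_rpow (by positivity) (by positivity),
                  show b + i - 1 = b + (i - 1) by ring, Real.rpow_add hu0, Real.inv_rpow hu0.le]
                field_simp
  · have hprod := ((integrableOn_rpow_mul_exp hb hz).mul_prod
      (integrableOn_gamma (by positivity : 0 < b + i))).mul_const (1 / Real.Gamma (b + 1))
    refine Integrable.mono' hprod ?_ ?_
    · refine Measurable.aestronglyMeasurable ?_
      have := (continuous_besselEntire hb).measurable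
      simp only [Function.uncurry_def]
      fun_prop
    · rw [Measure.prod_restrict]
      filter_upwards [ae_restrict_mem (measurableSet_Ioi.prod measurableSet_Ioi)] with p hp
      have h1 : (0 : ℝ) < p.1 := hp.1
      have h2 : (0 : ℝ) < p.2 := hp.2
      simp only [Function.uncurry_def]
      rw [norm_mul, Real.norm_of_nonneg (by positivity)]
      exact mul_le_mul_of_nonneg_left (abs_besselEntire_le hb (by positivity)) (by positivity)

/-! ### The derivative terms -/

theorem rlSeries_zero (ha : 0 < a) (hb : 0 < b) (hi : 0 < i) {x : ℝ} (hx : 0 < x) :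
    rlSeries a b i 0 x = -(a ^ b * x ^ (b - 1) * kummerEntire b i (a * x)) := by
  simp only [rlSeries, Real.Gamma_zero, div_zero, mul_zero, zero_sub, add_zero]
  rw [kummerEntire, ← tsum_mul_left]
  congr 1
  refine tsum_congr fun k => ?_
  have hG := Real.Gamma_pos_of_pos (by positivity : 0 < b + k)
  rw [rlCoeff, show b + (k : ℝ) - 1 = (b - 1) + k by ring, Real.rpow_add hx, Real.rpow_natCast,
    Real.rpow_add ha, Real.rpow_natCast, show b + 1 + (k : ℝ) = (b + k) + 1 by ring,
    Real.Gamma_add_one (by positivity), mul_pow]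
  field_simp

theorem rlIntegral_eventuallyEq (ha : 0 < a) (hb : 0 < b) (hi : 0 < i) {x : ℝ} (hx : 0 < x) :
    (rlIntegral ((⌈i⌉₊ : ℝ) - i) fun t => t ^ (i - 1) * upperGamma b (a * t))
      =ᶠ[𝓝 x] rlSeries a b i ⌈i⌉₊ := by
  filter_upwards [isOpen_Ioi.mem_nhds hx] with y hy
  exact rlIntegral_eq_rlSeries ha hb hi (Nat.le_ceil i) hy

theorem contDiffAt_rlIntegral (ha : 0 < a) (hb : 0 < b) (hi : 0 < i) {x : ℝ} (hx : 0 < x) :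
    ContDiffAt ℝ (⌈i⌉₊ : ℕ)
      (rlIntegral ((⌈i⌉₊ : ℝ) - i) fun t => t ^ (i - 1) * upperGamma b (a * t)) x :=
  ((contDiffOn_rlSeries ha hb hi ⌈i⌉₊).contDiffAt (isOpen_Ioi.mem_nhds hx)).congr_of_eventuallyEq
    (rlIntegral_eventuallyEq ha hb hi hx)

/-- ⌈i⌉ derivatives lower the index of `rlSeries` from ⌈i⌉ to 0. The later analysis of g_i starts
from this form. -/
theorem gTerm_eq (ha : 0 < a) (hb : 0 < b) (hi : 0 < i) {x : ℝ} (hx : 0 < x) :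
    gTerm a b i x = -(a ^ b * x ^ (b - 1) / (2 * Real.Gamma b * Real.Gamma i)
      * kummerEntire b i (a * x)) := by
  rw [gTerm, rlDeriv, (rlIntegral_eventuallyEq ha hb hi hx).iteratedDeriv_eq,
    iteratedDeriv_rlSeries ha hb hi _ hx, rlSeries_zero ha hb hi hx]
  ring

/-- The two features needed later: a power of x that is integrable at 0, and a dependence on i that
the mixture weights can absorb. -/
theorem abs_gTerm_le (ha : 0 < a) (hb : 0 < b) (hi : 0 < i) {x : ℝ} (hx : 0 < x) :
    |gTerm a b i x| ≤ a ^ b / (2 * Real.Gamma b * Real.Gamma (b + 1))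
      * (Real.Gamma (i + b) / Real.Gamma i) * x ^ (b - 1) := by
  have h1 := Real.Gamma_pos_of_pos hb
  have h2 := Real.Gamma_pos_of_pos hi
  have h3 := Real.Gamma_pos_of_pos (by positivity : 0 < b + 1)
  rw [gTerm_eq ha hb hi hx, abs_neg, abs_mul, abs_of_pos (by positivity)]
  refine (mul_le_mul_of_nonneg_left (abs_kummerEntire_le hb hi (by positivity))
    (by positivity)).trans_eq ?_
  rw [add_comm i b]
  field_simp

theorem continuousOn_gTerm (ha : 0 < a) (hb : 0 < b) (hi : 0 < i) :
    ContinuousOn (gTerm a b i) (Set.Ioi 0) := by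
  refine ContinuousOn.congr ?_ fun x hx => gTerm_eq ha hb hi hx
  refine (ContinuousOn.mul (ContinuousOn.div_const (continuousOn_const.mul ?_) _)
    ((continuous_kummerEntire hb hi).comp (by fun_prop)).continuousOn).neg
  exact fun x hx => (Real.continuousAt_rpow_const _ _ (Or.inl (ne_of_gt hx))).continuousWithinAt

end

end

section

/-! ### The bit error probability in gamma fading -/

theorem integral_gammaMeasure {i r : ℝ} (hi : 0 < i) (hr : 0 < r) (f : ℝ → ℝ) :
    ∫ x, f x ∂(gammaMeasure i r)
      = ∫ x in Set.Ioi 0, r ^ i / Real.Gamma i * x ^ (i - 1) * Real.exp (-(r * x)) * f x := by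
  have hg : Measurable (gammaPDF i r) := (measurable_gammaPDFReal i r).ennreal_ofReal
  rw [gammaMeasure, integral_withDensity_eq_integral_toReal_smul hg
    (ae_of_all _ fun x => ENNReal.ofReal_lt_top), ← integral_indicator measurableSet_Ioi]
  have h0 : ∀ᵐ x : ℝ, x ≠ 0 := by simp [ae_iff]
  refine integral_congr_ae ?_
  filter_upwards [h0] with x hx
  rcases lt_or_gt_of_ne hx with h | h
  · rw [Set.indicator_of_notMem (by simpa using h.le), gammaPDF_of_neg h]
    simp
  · have := Real.Gamma_pos_of_pos hi
    rw [Set.indicator_of_mem (by simpa using h), gammaPDF_of_nonneg h.le,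
      ENNReal.toReal_ofReal (by positivity), smul_eq_mul]

section

variable {a b i : ℝ}

theorem integrableOn_gTerm_mul_exp (ha : 0 < a) (hb : 0 < b) (hi : 0 < i) {z : ℝ} (hz : 0 < z) :
    IntegrableOn (fun t => gTerm a b i t * Real.exp (-(z * t))) (Set.Ioi 0) := by
  refine Integrable.mono' ((integrableOn_rpow_mul_exp hb hz).const_mul (a ^ b / (2 * Real.Gamma b
    * Real.Gamma (b + 1)) * (Real.Gamma (i + b) / Real.Gamma i))) ?_ ?_
  · exact ((continuousOn_gTerm ha hb hi).mul (by fun_prop)).aestronglyMeasurable measurableSet_Ioi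
  · filter_upwards [ae_restrict_mem measurableSet_Ioi] with t ht
    rw [norm_mul, Real.norm_of_nonneg (Real.exp_pos _).le, ← mul_assoc]
    exact mul_le_mul_of_nonneg_right (abs_gTerm_le ha hb hi ht) (Real.exp_pos _).le

theorem condBEP_eq (hb : 0 < b) (γ : ℝ) :
    condBEP a b γ = 1 / 2 - (Real.Gamma b - upperGamma b (a * γ)) / (2 * Real.Gamma b) := by
  have := (Real.Gamma_pos_of_pos hb).ne'
  rw [condBEP]; field_simp; ring

/-- The constant 1/2 is the BEP at SINR 0. The rest is the mean of -γ(b, ·)/(2Γ(b)) under the gamma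
law, which `integral_kummerEntire` identifies as a Laplace transform of g_i at y/σ. -/
theorem integral_condBEP_gammaMeasure (ha : 0 < a) (hb : 0 < b) (hi : 0 < i) {σ y : ℝ} (hσ : 0 < σ)
    (hy : 0 < y) :
    ∫ w, condBEP a b (w / y) ∂(gammaMeasure i σ⁻¹)
      = 1 / 2 + ∫ t in Set.Ioi 0, gTerm a b i t * Real.exp (-(y / σ * t)) := by
  have hGb := Real.Gamma_pos_of_pos hb
  have hGi := Real.Gamma_pos_of_pos hi
  have hz : 0 < y / σ := by positivity
  have hg : ∫ t in Set.Ioi 0, gTerm a b i t * Real.exp (-(y / σ * t))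
      = -(1 / (2 * Real.Gamma b * Real.Gamma i)) * ∫ u in Set.Ioi (0 : ℝ), u ^ (i - 1)
        * Real.exp (-u) * (Real.Gamma b - upperGamma b (a * u / (y / σ))) := by
    have h := integral_kummerEntire ha hb hi hz
    calc _ = ∫ t in Set.Ioi (0 : ℝ), -(a ^ b / (2 * Real.Gamma b * Real.Gamma i))
          * (t ^ (b - 1) * Real.exp (-(y / σ * t)) * kummerEntire b i (a * t)) := by
          refine setIntegral_congr_fun measurableSet_Ioi fun t ht => ?_
          rw [gTerm_eq ha hb hi ht]
          ring
      _ = _ := by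
          rw [integral_const_mul, h, Real.inv_rpow ha.le]
          rw [← mul_assoc]
          congr 1
          field_simp
  -- The substitution w = σu normalizes the gamma law to scale 1.
  have hsub := integral_comp_mul_left_Ioi (fun x => σ⁻¹ ^ i / Real.Gamma i * x ^ (i - 1)
    * Real.exp (-(σ⁻¹ * x)) * condBEP a b (x / y)) 0 hσ
  rw [mul_zero, smul_eq_mul, eq_inv_mul_iff_mul_eq₀ hσ.ne'] at hsub
  rw [integral_gammaMeasure hi (inv_pos.2 hσ), ← hsub, hg, ← integral_const_mul, ← integral_const_mul]
  have h1 : 1 / 2 = ∫ u in Set.Ioi (0 : ℝ), 1 / (2 * Real.Gamma i) * (u ^ (i - 1) * Real.exp (-u)) := by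
    rw [integral_const_mul, setIntegral_congr_fun (g := fun u => Real.exp (-u) * u ^ (i - 1))
      measurableSet_Ioi fun u _ => mul_comm _ _, ← Real.Gamma_eq_integral hi]
    field_simp
  rw [h1, ← integral_add]
  · refine setIntegral_congr_fun measurableSet_Ioi fun u hu => ?_
    have hu0 : (0 : ℝ) < u := hu
    rw [condBEP_eq hb, Real.mul_rpow hσ.le hu0.le, Real.inv_rpow hσ.le, Real.rpow_sub_one hσ.ne',
      show σ⁻¹ * (σ * u) = u by field_simp, show a * (σ * u / y) = a * u / (y / σ) by field_simp]
    field_simp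
    ring
  · exact (integrableOn_gamma hi).const_mul _
  · refine Integrable.const_mul (Integrable.mono' ((integrableOn_gamma hi).mul_const (Real.Gamma b))
      ?_ ?_) _
    · refine ContinuousOn.aestronglyMeasurable (ContinuousOn.mul (ContinuousOn.mul ?_ (by fun_prop))
        (continuousOn_const.sub ((continuousOn_upperGamma hb).comp (by fun_prop) fun t ht => ?_)))
        measurableSet_Ioi
      · exact fun x hx => (Real.continuousAt_rpow_const _ _ (Or.inl (ne_of_gt hx))).continuousWithinAt
      · have : (0 : ℝ) < t := ht
        exact div_pos (mul_pos ha this) hz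
    · filter_upwards [ae_restrict_mem measurableSet_Ioi] with u hu
      have hu0 : (0 : ℝ) < u := hu
      have h3 : 0 ≤ a * u / (y / σ) := by positivity
      have h4 := upperGamma_nonneg (b := b) h3
      have h5 := upperGamma_le_Gamma hb h3
      rw [norm_mul, Real.norm_of_nonneg (by positivity), Real.norm_of_nonneg (by linarith)]
      gcongr
      linarith

end

end

section

open Complex (VerticalIntegrable)

/-! ### Mellin-Barnes integrals -/

theorem norm_Gamma_le {w : ℂ} (hw : 0 < w.re) : ‖Complex.Gamma w‖ ≤ Real.Gamma w.re := by
  rw [Complex.Gamma_eq_integral hw, Complex.GammaIntegral, Real.Gamma_eq_integral hw]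
  refine norm_integral_le_of_norm_le (Real.GammaIntegral_convergent hw) ?_
  filter_upwards [ae_restrict_mem measurableSet_Ioi] with x hx
  rw [norm_mul, Complex.norm_cpow_eq_rpow_re_of_pos hx, Complex.norm_real,
    Real.norm_of_nonneg (Real.exp_pos _).le]
  simp

/-- From Γ(w+2) = w(w+1)Γ(w) with |w|, |w+1| ≥ |t|. Quadratic decay is enough for absolute
convergence; Stirling's formula is not needed. -/
theorem norm_Gamma_line_le {c : ℝ} (hc : 0 < c) (t : ℝ) :
    ‖Complex.Gamma (c + t * Complex.I)‖ ≤ (Real.Gamma c + Real.Gamma (c + 2)) * (1 + t ^ 2)⁻¹ := by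
  set w : ℂ := c + t * Complex.I with hw
  have hre : w.re = c := by simp [hw]
  have him : w.im = t := by simp [hw]
  have hw0 : w ≠ 0 := fun h => by rw [h] at hre; simp at hre; linarith
  have hw1 : w + 1 ≠ 0 := fun h => by
    have := congrArg Complex.re h
    simp [hre] at this; linarith
  have h1 : ‖Complex.Gamma w‖ ≤ Real.Gamma c := by
    have := norm_Gamma_le (w := w) (by rw [hre]; exact hc)
    rwa [hre] at this
  have h2 : ‖Complex.Gamma (w + 1 + 1)‖ ≤ Real.Gamma (c + 2) := by
    have := norm_Gamma_le (w := w + 1 + 1) (by simp [hre]; linarith)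
    simp only [Complex.add_re, hre, Complex.one_re] at this
    rwa [show c + 1 + 1 = c + 2 by ring] at this
  rw [Complex.Gamma_add_one _ hw1, Complex.Gamma_add_one _ hw0, norm_mul, norm_mul] at h2
  have h3 : |t| ≤ ‖w‖ := him ▸ Complex.abs_im_le_norm w
  have h4 : |t| ≤ ‖w + 1‖ := by
    have := Complex.abs_im_le_norm (w + 1)
    simpa [him] using this
  rw [← div_eq_mul_inv, le_div_iff₀ (by positivity)]
  have h5 : t ^ 2 ≤ ‖w + 1‖ * ‖w‖ := by
    rw [← sq_abs, sq]
    gcongr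
  have h6 := norm_nonneg (Complex.Gamma w)
  nlinarith

theorem continuous_Gamma_comp {f : ℝ → ℂ} (hf : Continuous f) (h : ∀ t, 0 < (f t).re) :
    Continuous fun t => Complex.Gamma (f t) :=
  continuous_iff_continuousAt.2 fun t => by
    refine ContinuousAt.comp (g := Complex.Gamma)
      (Complex.differentiableAt_Gamma _ fun m hm => ?_).continuousAt hf.continuousAt
    have := h t
    rw [hm] at this
    simp at this
    have h2 : (0 : ℝ) ≤ m := m.cast_nonneg
    linarith

theorem verticalIntegrable_Gamma {B c : ℝ} (hc : 0 < B + c) :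
    VerticalIntegrable (fun s => Complex.Gamma (B + s)) c := by
  refine Integrable.mono' (integrable_inv_one_add_sq.const_mul
    (Real.Gamma (B + c) + Real.Gamma (B + c + 2))) ?_ (ae_of_all _ fun t => ?_)
  · refine (continuous_Gamma_comp (by fun_prop) fun t => ?_).aestronglyMeasurable
    simpa using hc
  · have := norm_Gamma_line_le hc t
    push_cast at this
    rwa [add_assoc] at this

/-- Mellin inversion of e^(-x) on the line Re s = B + c; the shift of s by B produces the factor
y^B. -/
theorem mellinInv_Gamma {B c : ℝ} (hc : 0 < B + c) {y : ℝ} (hy : 0 < y) :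
    mellinInv c (fun s => Complex.Gamma (B + s)) y = ((y ^ B * Real.exp (-y) : ℝ) : ℂ) := by
  have h := mellinInv_mellin_eq (B + c) (fun x : ℝ => ((Real.exp (-x) : ℝ) : ℂ)) hy ?_ ?_ (by fun_prop)
  · have hcongr : ∀ t : ℝ, mellin (fun x : ℝ => ((Real.exp (-x) : ℝ) : ℂ)) ((B + c : ℝ) + t * Complex.I)
        = Complex.Gamma ((B + c : ℝ) + t * Complex.I) := fun t => by
      rw [Complex.Gamma_eq_integral (by simpa using hc), Complex.GammaIntegral_eq_mellin]
    rw [mellinInv] at h ⊢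
    simp only [hcongr] at h
    rw [Complex.ofReal_mul, ← h, mul_smul_comm, ← integral_const_mul, Complex.ofReal_cpow hy.le]
    congr 1
    refine integral_congr_ae (ae_of_all _ fun t => ?_)
    have hy0 : (y : ℂ) ≠ 0 := by exact_mod_cast hy.ne'
    simp only [smul_eq_mul]
    rw [← mul_assoc, ← Complex.cpow_add _ _ hy0]
    push_cast
    congr 2 <;> ring
  · have := Complex.GammaIntegral_convergent (s := (B + c : ℝ)) (by simpa using hc)
    refine this.congr_fun (fun x _ => ?_) measurableSet_Ioi
    simp only [smul_eq_mul]; ring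
  · refine (verticalIntegrable_Gamma (B := 0) (c := B + c) (by simpa using hc)).congr
      (ae_of_all _ fun t => ?_)
    simp only
    rw [Complex.Gamma_eq_integral (by simpa using hc), Complex.GammaIntegral_eq_mellin]
    simp

section

variable {c : ℝ} {Φ : ℂ → ℂ} {k : ℝ → ℝ} {K : ℂ → ℂ}

theorem norm_cpow_neg_line {u : ℝ} (hu : 0 < u) (c t : ℝ) :
    ‖(u : ℂ) ^ (-((c : ℂ) + t * Complex.I))‖ = u ^ (-c) := by
  rw [Complex.norm_cpow_eq_rpow_re_of_pos hu]; simp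

/-- Multiplication by the Mellin transform of a kernel. -/
theorem verticalIntegrable_mul (hk : IntegrableOn (fun u => k u * u ^ (-c)) (Set.Ioi 0))
    (hΦ : VerticalIntegrable Φ c) (hKc : Continuous fun t : ℝ => K (c + t * Complex.I))
    (hK : ∀ t : ℝ, K (c + t * Complex.I)
      = ∫ u in Set.Ioi (0 : ℝ), (k u : ℂ) * (u : ℂ) ^ (-((c : ℂ) + t * Complex.I))) :
    VerticalIntegrable (fun s => K s * Φ s) c := by
  refine Integrable.mono' (hΦ.norm.const_mul (∫ u in Set.Ioi (0 : ℝ), ‖k u * u ^ (-c)‖))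
    (hKc.aestronglyMeasurable.mul hΦ.aestronglyMeasurable) (ae_of_all _ fun t => ?_)
  rw [norm_mul]
  refine mul_le_mul_of_nonneg_right ?_ (norm_nonneg _)
  rw [hK]
  refine norm_integral_le_of_norm_le (μ := volume.restrict (Set.Ioi 0)) hk.norm ?_
  filter_upwards [ae_restrict_mem measurableSet_Ioi] with u hu
  rw [norm_mul, norm_cpow_neg_line hu, norm_mul, Complex.norm_real,
    Real.norm_of_nonneg (Real.rpow_nonneg (le_of_lt hu) _)]

/-- Because y^(-s) u^(-s) = (yu)^(-s), exchanging the integrals turns the factor K into an average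
over dilations. This takes the place of contour shifts and residues. -/
theorem mellinInv_mul (hk : IntegrableOn (fun u => k u * u ^ (-c)) (Set.Ioi 0))
    (hΦ : VerticalIntegrable Φ c)
    (hK : ∀ t : ℝ, K (c + t * Complex.I)
      = ∫ u in Set.Ioi (0 : ℝ), (k u : ℂ) * (u : ℂ) ^ (-((c : ℂ) + t * Complex.I)))
    {y : ℝ} (hy : 0 < y) :
    mellinInv c (fun s => K s * Φ s) y = ∫ u in Set.Ioi (0 : ℝ), (k u : ℂ) * mellinInv c Φ (y * u) := by
  simp only [mellinInv, smul_eq_mul, Complex.real_smul, hK]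
  have hswap := integral_integral_swap (μ := volume) (ν := volume.restrict (Set.Ioi (0 : ℝ)))
    (f := fun (t : ℝ) (u : ℝ) => (k u : ℂ) * (((y * u : ℝ) : ℂ) ^ (-((c : ℂ) + t * Complex.I))
      * Φ (c + t * Complex.I))) ?_
  · calc _ = 1 / (2 * (Real.pi : ℂ)) * ∫ t : ℝ, ∫ u in Set.Ioi (0 : ℝ), (k u : ℂ)
          * (((y * u : ℝ) : ℂ) ^ (-((c : ℂ) + t * Complex.I)) * Φ (c + t * Complex.I)) := by
          push_cast
          congr 1
          refine integral_congr_ae (ae_of_all _ fun t => ?_)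
          simp only
          rw [← mul_assoc, ← integral_const_mul, ← integral_mul_const]
          refine setIntegral_congr_fun measurableSet_Ioi fun u hu => ?_
          rw [← Complex.ofReal_mul, Complex.ofReal_mul, Complex.mul_cpow_ofReal_nonneg hy.le (le_of_lt hu)]
          ring
      _ = _ := by
          rw [hswap, ← integral_const_mul]
          refine setIntegral_congr_fun measurableSet_Ioi fun u hu => ?_
          rw [integral_const_mul]
          push_cast
          ring
  · have hprod := (hΦ.norm.mul_prod hk.norm).const_mul (y ^ (-c))
    -- The hypotheses give measurability of `k` only together with the weight u^(-c), which is
    -- divided out again below.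
    have hint : AEStronglyMeasurable (fun z : ℝ × ℝ => Φ (c + z.1 * Complex.I)
        * ((k z.2 * z.2 ^ (-c) : ℝ) : ℂ)) (volume.prod (volume.restrict (Set.Ioi 0))) :=
      (Integrable.mul_prod hΦ (hk.ofReal (𝕜 := ℂ))).aestronglyMeasurable
    refine Integrable.mono' hprod ?_ ?_
    · have hm : Measurable fun p : ℝ × ℝ => (((y * p.2 : ℝ) : ℂ) ^ (-((c : ℂ) + p.1 * Complex.I)))
          / ((p.2 ^ (-c) : ℝ) : ℂ) := by fun_prop
      refine (hint.mul hm.aestronglyMeasurable).congr ?_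
      rw [← Measure.restrict_univ (μ := (volume : Measure ℝ)), Measure.prod_restrict]
      filter_upwards [ae_restrict_mem (MeasurableSet.univ.prod measurableSet_Ioi)] with p hp
      have h2 : (0 : ℝ) < p.2 := hp.2
      have h3 : ((p.2 ^ (-c) : ℝ) : ℂ) ≠ 0 := by
        exact_mod_cast (Real.rpow_pos_of_pos h2 _).ne'
      simp only [Pi.mul_apply, Function.uncurry_def]
      push_cast
      field_simp
    · rw [← Measure.restrict_univ (μ := (volume : Measure ℝ)), Measure.prod_restrict]
      filter_upwards [ae_restrict_mem (MeasurableSet.univ.prod measurableSet_Ioi)] with p hp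
      have h2 : (0 : ℝ) < p.2 := hp.2
      simp only [Function.uncurry_def]
      rw [norm_mul, norm_mul, norm_cpow_neg_line (mul_pos hy h2), norm_mul, Complex.norm_real,
        Real.norm_of_nonneg (Real.rpow_nonneg h2.le _), Real.mul_rpow hy.le h2.le]
      apply le_of_eq
      ring

end

end

section

open Complex (VerticalIntegrable)

/-! ### Kernels of products of gamma functions -/

/-- The density whose Mellin transform at `-s` is `Γ(p - s) / Γ(p + α - s)`. -/
def betaKernel (p α : ℝ) : ℝ → ℝ :=
  (Set.Ioc 0 1).indicator fun u => u ^ (p - 1) * (1 - u) ^ (α - 1) / Real.Gamma α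

theorem setIntegral_betaKernel_mul (p α : ℝ) (f : ℝ → ℂ) :
    ∫ u in Set.Ioi (0 : ℝ), (betaKernel p α u : ℂ) * f u
      = ∫ u in Set.Ioc (0 : ℝ) 1,
        ((u ^ (p - 1) * (1 - u) ^ (α - 1) / Real.Gamma α : ℝ) : ℂ) * f u := by
  rw [← Set.inter_eq_self_of_subset_right (Set.Ioc_subset_Ioi_self : Set.Ioc (0 : ℝ) 1 ⊆ Set.Ioi 0),
    ← setIntegral_indicator measurableSet_Ioc]
  congr 1
  funext u
  by_cases hu : u ∈ Set.Ioc (0 : ℝ) 1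
  · simp only [betaKernel, Set.indicator_of_mem hu]
  · simp only [betaKernel, Set.indicator_of_notMem hu, Complex.ofReal_zero, zero_mul]

section

variable {p α c : ℝ}

theorem integrableOn_betaKernel (hp : 0 < p - c) (hα : 0 < α) :
    IntegrableOn (fun u => betaKernel p α u * u ^ (-c)) (Set.Ioi 0) := by
  have h : IntegrableOn (fun u => u ^ (p - 1) * (1 - u) ^ (α - 1) / Real.Gamma α * u ^ (-c))
      (Set.Ioc 0 1) := by
    refine IntegrableOn.congr_fun ((integrableOn_beta hp hα one_pos).div_const (Real.Gamma α))
      (fun u hu => ?_) measurableSet_Ioc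
    rw [show p - c - 1 = p - 1 + -c by ring, Real.rpow_add hu.1]
    ring
  refine ((integrable_indicator_iff measurableSet_Ioc).2 h).integrableOn.congr_fun
    (fun u _ => ?_) measurableSet_Ioi
  by_cases hu : u ∈ Set.Ioc (0 : ℝ) 1
  · simp only [betaKernel, Set.indicator_of_mem hu]
  · simp only [betaKernel, Set.indicator_of_notMem hu, zero_mul]

theorem integral_betaKernel (hp : 0 < p - c) (hα : 0 < α) (t : ℝ) :
    Complex.Gamma (p - (c + t * Complex.I)) / Complex.Gamma (p + α - (c + t * Complex.I))
      = ∫ u in Set.Ioi (0 : ℝ), (betaKernel p α u : ℂ) * (u : ℂ) ^ (-((c : ℂ) + t * Complex.I)) := by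
  have h := Complex.betaIntegral_eq_Gamma_mul_div (p - (c + t * Complex.I)) α
    (by simpa using hp) (by simpa using hα)
  have hΓ : (Real.Gamma α : ℂ) ≠ 0 := by exact_mod_cast (Real.Gamma_pos_of_pos hα).ne'
  rw [Complex.Gamma_ofReal] at h
  rw [setIntegral_betaKernel_mul, show (p : ℂ) + α - (c + t * Complex.I)
    = p - (c + t * Complex.I) + α by ring]
  calc _ = Complex.betaIntegral (p - (c + t * Complex.I)) α / Real.Gamma α := by
        rw [h]; field_simp
    _ = _ := by
        rw [Complex.betaIntegral, intervalIntegral.integral_of_le zero_le_one, ← integral_div]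
        refine setIntegral_congr_fun measurableSet_Ioc fun u hu => ?_
        have hu0 : (u : ℂ) ≠ 0 := by exact_mod_cast hu.1.ne'
        rw [show (p : ℂ) - (c + t * Complex.I) - 1 = ((p - 1 : ℝ) : ℂ) + -(c + t * Complex.I) by
          push_cast; ring, Complex.cpow_add _ _ hu0, ← Complex.ofReal_cpow hu.1.le]
        have h1 : (1 - (u : ℂ)) ^ ((α : ℂ) - 1) = (((1 - u) ^ (α - 1) : ℝ) : ℂ) := by
          rw [Complex.ofReal_cpow (by linarith [hu.2])]
          push_cast; rfl
        rw [h1]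
        push_cast
        ring

theorem continuous_betaKernel_mellin (hp : 0 < p - c) (hα : 0 < α) :
    Continuous fun t : ℝ => Complex.Gamma (p - (c + t * Complex.I))
      / Complex.Gamma (p + α - (c + t * Complex.I)) := by
  have h2 : ∀ t : ℝ, 0 < ((p : ℂ) + α - (c + t * Complex.I)).re := fun t => by
    simp; linarith
  refine (continuous_Gamma_comp (by fun_prop) fun t => by simpa using hp).div
    (continuous_Gamma_comp (by fun_prop) h2) fun t => Complex.Gamma_ne_zero_of_re_pos (h2 t)

theorem integrableOn_gammaKernel {A : ℝ} (hA : 0 < A - c) :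
    IntegrableOn (fun u : ℝ => u ^ (A - 1) * Real.exp (-u) * u ^ (-c)) (Set.Ioi 0) := by
  refine (integrableOn_gamma hA).congr_fun (fun u hu => ?_) measurableSet_Ioi
  simp only
  rw [show A - c - 1 = A - 1 + -c by ring, Real.rpow_add hu]
  ring

theorem integral_gammaKernel {A : ℝ} (hA : 0 < A - c) (t : ℝ) :
    Complex.Gamma (A - (c + t * Complex.I))
      = ∫ u in Set.Ioi (0 : ℝ), ((u ^ (A - 1) * Real.exp (-u) : ℝ) : ℂ)
        * (u : ℂ) ^ (-((c : ℂ) + t * Complex.I)) := by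
  rw [Complex.Gamma_eq_integral (by simpa using hA), Complex.GammaIntegral]
  refine setIntegral_congr_fun measurableSet_Ioi fun u hu => ?_
  have hu0 : (u : ℂ) ≠ 0 := by exact_mod_cast (ne_of_gt hu)
  rw [show (A : ℂ) - (c + t * Complex.I) - 1 = ((A - 1 : ℝ) : ℂ) + -(c + t * Complex.I) by
    push_cast; ring, Complex.cpow_add _ _ hu0, ← Complex.ofReal_cpow (le_of_lt hu)]
  push_cast
  ring

theorem verticalIntegrable_Gamma_mul_Gamma {A B : ℝ} (hA : 0 < A - c) (hB : 0 < B + c) :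
    VerticalIntegrable (fun s => Complex.Gamma (A - s) * Complex.Gamma (B + s)) c :=
  verticalIntegrable_mul (K := fun s => Complex.Gamma (A - s)) (integrableOn_gammaKernel hA)
    (verticalIntegrable_Gamma hB)
    (continuous_Gamma_comp (by fun_prop) fun t => by simpa using hA) (integral_gammaKernel hA)

/-- Averaging (yu)^B e^(-yu) against u^(A-1) e^(-u) is again a gamma integral, now with rate 1 + y.
-/
theorem mellinInv_Gamma_mul_Gamma {A B : ℝ} (hA : 0 < A - c) (hB : 0 < B + c) {y : ℝ}
    (hy : 0 < y) :
    mellinInv c (fun s => Complex.Gamma (A - s) * Complex.Gamma (B + s)) y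
      = ((y ^ B * Real.Gamma (A + B) * (1 + y) ^ (-(A + B)) : ℝ) : ℂ) := by
  rw [mellinInv_mul (K := fun s => Complex.Gamma (A - s)) (integrableOn_gammaKernel hA)
    (verticalIntegrable_Gamma hB) (integral_gammaKernel hA) hy]
  have hAB : 0 < A + B := by linarith
  have h := Real.integral_rpow_mul_exp_neg_mul_Ioi hAB (by linarith : 0 < 1 + y)
  rw [one_div, Real.inv_rpow (by linarith), ← Real.rpow_neg (by linarith)] at h
  rw [mul_assoc, mul_comm (Real.Gamma _), ← h, ← integral_const_mul, ← integral_complex_ofReal]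
  refine setIntegral_congr_fun measurableSet_Ioi fun u hu => ?_
  have hu0 : (0 : ℝ) < u := hu
  rw [mellinInv_Gamma hB (mul_pos hy hu0), Real.mul_rpow hy.le hu0.le,
    show A + B - 1 = A - 1 + B by ring, Real.rpow_add hu0,
    show -((1 + y) * u) = -u + -(y * u) by ring, Real.exp_add, ← Complex.ofReal_mul]
  congr 1
  ring

end

/-! ### The Meijer functions -/

/-- `meijerG` is computed on an unspecified separating line, so the value is established on all of
them. The point t = 0 is excluded because the value 0 of `Complex.Gamma` at its poles can violate
the functional equation there. -/
theorem meijerG_eq {m n : ℕ} {as bs : List ℝ} {z : ℝ} {F : ℂ → ℂ} {V : ℂ} (hz : 0 < z)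
    (hex : ∃ c, MeijerSeparates m n as bs c)
    (hF : ∀ c, MeijerSeparates m n as bs c → ∀ t : ℝ, t ≠ 0 →
      meijerIntegrand m n as bs z (c + t * Complex.I)
        = F (c + t * Complex.I) * (z : ℂ) ^ ((c : ℂ) + t * Complex.I))
    (hint : ∀ c, MeijerSeparates m n as bs c → VerticalIntegrable F c)
    (hV : ∀ c, MeijerSeparates m n as bs c → mellinInv c F z⁻¹ = V) :
    MeijerConverges m n as bs z ∧ meijerG m n as bs z = V := by
  have hae : ∀ᵐ t : ℝ, t ≠ 0 := by simp [ae_iff, measure_singleton]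
  have hz0 : (z : ℂ) ≠ 0 := by exact_mod_cast hz.ne'
  have harg : (z : ℂ).arg ≠ Real.pi := by
    rw [Complex.arg_ofReal_of_nonneg hz.le]; exact Real.pi_pos.ne
  refine ⟨⟨hex, fun c hc => ?_⟩, ?_⟩
  · have h : Integrable fun t : ℝ => F (c + t * Complex.I) * (z : ℂ) ^ ((c : ℂ) + t * Complex.I) := by
      refine Integrable.mono' ((hint c hc).norm.mul_const (z ^ c))
        ((hint c hc).aestronglyMeasurable.mul ?_) (ae_of_all _ fun t => ?_)
      · exact (Continuous.const_cpow (by fun_prop) (Or.inl hz0)).aestronglyMeasurable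
      · rw [norm_mul, Complex.norm_cpow_eq_rpow_re_of_pos hz]
        simp
    refine h.congr ?_
    filter_upwards [hae] with t ht
    rw [hF c hc t ht]
  · rw [meijerG, dif_pos hex, ← hV _ hex.choose_spec, mellinInv, Complex.real_smul]
    push_cast
    congr 1
    refine integral_congr_ae ?_
    filter_upwards [hae] with t ht
    rw [hF _ hex.choose_spec t ht, smul_eq_mul, Complex.inv_cpow _ _ harg, Complex.cpow_neg, inv_inv,
      mul_comm]

section

variable {δ ν z : ℝ}

/-- Here Γ(-s)/Γ(1-s) is the transform of the kernel u^(-1) on (0, 1], integrable against u^(-c)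
since c < 0, and Γ(ν-δ-s)Γ(δ+s) belongs to Γ(ν) y^δ (1+y)^(-ν). -/
theorem meijerG_two_one (hδ : 0 < δ) (hν : 0 < ν) (hz : 0 < z) :
    MeijerConverges 2 1 [1 - δ, 1] [0, ν - δ] z ∧
      meijerG 2 1 [1 - δ, 1] [0, ν - δ] z
        = ((Real.Gamma ν * z ^ (-δ)
          * ∫ u in Set.Ioc (0 : ℝ) 1, u ^ (δ - 1) * (1 + u / z) ^ (-ν) : ℝ) : ℂ) := by
  have hsep : ∀ c, MeijerSeparates 2 1 [1 - δ, 1] [0, ν - δ] c ↔ -δ < c ∧ c < 0 ∧ c < ν - δ :=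
    fun c => by
      simp [MeijerSeparates]
  refine meijerG_eq (F := fun s => Complex.Gamma ((0 : ℝ) - s) / Complex.Gamma ((0 : ℝ) + (1 : ℝ) - s)
    * (Complex.Gamma ((ν - δ : ℝ) - s) * Complex.Gamma (δ + s))) hz ?_ ?_ ?_ ?_
  · obtain ⟨c, h1, h2⟩ := exists_between (a₁ := -δ) (a₂ := min 0 (ν - δ))
      (lt_min (by linarith) (by linarith))
    exact ⟨c, (hsep c).2 ⟨h1, (lt_min_iff.1 h2).1, (lt_min_iff.1 h2).2⟩⟩
  · intro c hc t _
    simp [meijerIntegrand]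
    left; ring
  · intro c hc
    obtain ⟨h1, h2, h3⟩ := (hsep c).1 hc
    exact verticalIntegrable_mul (K := fun s => Complex.Gamma ((0 : ℝ) - s)
        / Complex.Gamma ((0 : ℝ) + (1 : ℝ) - s))
      (integrableOn_betaKernel (by linarith) one_pos)
      (verticalIntegrable_Gamma_mul_Gamma (by linarith) (by linarith))
      (continuous_betaKernel_mellin (by linarith) one_pos)
      (integral_betaKernel (by linarith) one_pos)
  · intro c hc
    obtain ⟨h1, h2, h3⟩ := (hsep c).1 hc
    rw [mellinInv_mul (K := fun s => Complex.Gamma ((0 : ℝ) - s)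
        / Complex.Gamma ((0 : ℝ) + (1 : ℝ) - s))
      (integrableOn_betaKernel (by linarith) one_pos)
      (verticalIntegrable_Gamma_mul_Gamma (by linarith) (by linarith))
      (integral_betaKernel (by linarith) one_pos) (inv_pos.2 hz), setIntegral_betaKernel_mul,
      ← integral_const_mul, ← integral_complex_ofReal]
    refine setIntegral_congr_fun measurableSet_Ioc fun u hu => ?_
    have hu0 : 0 < u := hu.1
    rw [mellinInv_Gamma_mul_Gamma (by linarith) (by linarith) (by positivity), ← Complex.ofReal_mul,
      Real.mul_rpow (by positivity) hu0.le, Real.inv_rpow hz.le, ← Real.rpow_neg hz.le,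
      sub_self, Real.rpow_zero, Real.Gamma_one, sub_add_cancel, Real.rpow_sub hu0 0, Real.rpow_zero,
      Real.rpow_one, Real.rpow_sub hu0, Real.rpow_one, inv_mul_eq_div]
    congr 1
    field_simp

end

/-! ### Recurrence and Euler integral of the Kummer function, and the Meijer form of g_i -/

section

theorem kummerEntire_one {b : ℝ} (hb : 0 < b) (y : ℝ) : kummerEntire b 1 y = Real.exp (-y) := by
  rw [← (hasSum_exp_neg y).tsum_eq, kummerEntire]
  refine tsum_congr fun k => ?_
  have := Real.Gamma_pos_of_pos (by positivity : 0 < b + 1 + k)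
  rw [neg_pow y]
  field_simp

/-- In Γ(b+i+1+k) = (b+i+k) Γ(b+i+k), the summand b + i gives the first term; the summand k cancels
against k! and shifts the series to the parameter b + 1. -/
theorem kummerEntire_add_one {b i : ℝ} (hb : 0 < b) (hi : 0 < i) (y : ℝ) :
    kummerEntire b (i + 1) y = (i + b) * kummerEntire b i y - y * kummerEntire (b + 1) i y := by
  have h1 := hasSum_of_summable_abs (summable_kummerEntire hb (by positivity : 0 < i + 1)) y
  have h2 := hasSum_of_summable_abs (summable_kummerEntire hb hi) y
  have h3 := hasSum_of_summable_abs (summable_kummerEntire (by positivity : 0 < b + 1) hi) y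
  have h4 := (hasSum_nat_add_iff' 1).2 (h1.sub (h2.mul_left (i + b)))
  have h5 : HasSum (fun k : ℕ => (-1) ^ (k + 1) * Real.Gamma (b + (i + 1) + (k + 1 : ℕ))
      / (((k + 1).factorial : ℝ) * Real.Gamma (b + 1 + (k + 1 : ℕ))) * y ^ (k + 1)
      - (i + b) * ((-1) ^ (k + 1) * Real.Gamma (b + i + (k + 1 : ℕ))
      / (((k + 1).factorial : ℝ) * Real.Gamma (b + 1 + (k + 1 : ℕ))) * y ^ (k + 1)))
      (-y * kummerEntire (b + 1) i y) := by
    refine (h3.mul_left (-y)).congr_fun fun k => ?_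
    have hΓ := Real.Gamma_pos_of_pos (by positivity : 0 < b + 1 + (k + 1 : ℕ))
    have hne : b + i + (k + 1 : ℕ) ≠ 0 := by positivity
    rw [show b + (i + 1) + (k + 1 : ℕ) = b + i + (k + 1 : ℕ) + 1 by ring, Real.Gamma_add_one hne,
      show b + 1 + i + (k : ℝ) = b + i + (k + 1 : ℕ) by push_cast; ring,
      show b + 1 + 1 + (k : ℝ) = b + 1 + (k + 1 : ℕ) by push_cast; ring, Nat.factorial_succ]
    push_cast
    field_simp
    ring
  have h6 := h4.unique h5
  have hb1 : b ≠ 0 := hb.ne'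
  simp only [Finset.range_one, Finset.sum_singleton, pow_zero, Nat.factorial_zero, Nat.cast_zero,
    add_zero, Nat.cast_one, one_mul, mul_one] at h6
  rw [show b + (i + 1) = b + i + 1 by ring, Real.Gamma_add_one (by positivity)] at h6
  rw [kummerEntire, kummerEntire]
  simp only [← add_assoc] at h6 ⊢
  linear_combination h6

end

section

variable {b c : ℝ}

/-- `∏_{j < m} (2 + j - s) Γ(b - 1 + s)`, the Mellin transform of `y^(b-1) kummerEntire b (m+1) y`. -/
def gammaPoly (m : ℕ) (b : ℝ) (s : ℂ) : ℂ :=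
  (∏ j ∈ Finset.range m, (2 + j - s)) * Complex.Gamma ((b - 1 : ℝ) + s)

/-- The new factor is 2 + m - s = (m+1+b) - (b-1+s), and b-1+s raises the argument of Γ by one.
Under Mellin inversion this matches `kummerEntire_add_one` at i = m + 1. -/
theorem gammaPoly_succ (m : ℕ) (b : ℝ) {s : ℂ} (hs : ((b - 1 : ℝ) : ℂ) + s ≠ 0) :
    gammaPoly (m + 1) b s = ((m + 1 + b : ℝ) : ℂ) * gammaPoly m b s - gammaPoly m (b + 1) s := by
  rw [gammaPoly, gammaPoly, gammaPoly, Finset.prod_range_succ,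
    show ((b + 1 - 1 : ℝ) : ℂ) + s = ((b - 1 : ℝ) : ℂ) + s + 1 by push_cast; ring,
    Complex.Gamma_add_one _ hs]
  push_cast
  ring

theorem line_ne_zero (hb : 0 < b) (hc : 1 < c) (t : ℝ) :
    ((b - 1 : ℝ) : ℂ) + (c + t * Complex.I) ≠ 0 := fun h => by
  have := congrArg Complex.re h
  simp at this
  linarith

theorem verticalIntegrable_gammaPoly (hb : 0 < b) (hc : 1 < c) (m : ℕ) :
    VerticalIntegrable (gammaPoly m b) c := by
  induction m generalizing b with
  | zero =>
    refine (verticalIntegrable_Gamma (B := b - 1) (by linarith : 0 < b - 1 + c)).congr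
      (ae_of_all _ fun t => ?_)
    simp [gammaPoly]
  | succ m ih =>
    have h : Integrable fun t : ℝ => ((m + 1 + b : ℝ) : ℂ) * gammaPoly m b (c + t * Complex.I)
        - gammaPoly m (b + 1) (c + t * Complex.I) :=
      ((ih hb).const_mul _).sub (ih (by positivity : 0 < b + 1))
    exact h.congr (ae_of_all _ fun t => (gammaPoly_succ m b (line_ne_zero hb hc t)).symm)

theorem mellinInv_gammaPoly (hb : 0 < b) (hc : 1 < c) (m : ℕ) {y : ℝ} (hy : 0 < y) :
    mellinInv c (gammaPoly m b) y = ((y ^ (b - 1) * kummerEntire b (m + 1) y : ℝ) : ℂ) := by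
  induction m generalizing b with
  | zero =>
    have h := mellinInv_Gamma (B := b - 1) (by linarith : 0 < b - 1 + c) hy
    rw [Nat.cast_zero, zero_add, kummerEntire_one hb, ← h]
    simp only [mellinInv, gammaPoly, Finset.range_zero, Finset.prod_empty, one_mul]
  | succ m ih =>
    have hint : ∀ β : ℝ, 0 < β → Integrable fun t : ℝ => (y : ℂ) ^ (-((c : ℂ) + t * Complex.I))
        * gammaPoly m β (c + t * Complex.I) := fun β hβ => by
      refine Integrable.mono' ((verticalIntegrable_gammaPoly hβ hc m).norm.const_mul (y ^ (-c)))
        (AEStronglyMeasurable.mul ?_ (verticalIntegrable_gammaPoly hβ hc m).aestronglyMeasurable)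
        (ae_of_all _ fun t => ?_)
      · exact (Continuous.const_cpow (by fun_prop)
          (Or.inl (by exact_mod_cast hy.ne'))).aestronglyMeasurable
      · rw [norm_mul, norm_cpow_neg_line hy]
    have h : mellinInv c (gammaPoly (m + 1) b) y = ((m + 1 + b : ℝ) : ℂ) * mellinInv c (gammaPoly m b) y
        - mellinInv c (gammaPoly m (b + 1)) y := by
      simp only [mellinInv, smul_eq_mul, Complex.real_smul]
      rw [mul_left_comm, ← mul_sub]
      congr 1
      rw [← integral_const_mul, ← integral_sub
        ((hint b hb).const_mul _) (hint (b + 1) (by positivity))]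
      refine integral_congr_ae (ae_of_all _ fun t => ?_)
      simp only
      rw [gammaPoly_succ m b (line_ne_zero hb hc t)]
      ring
    rw [h, ih hb, ih (by positivity : 0 < b + 1), Nat.cast_succ,
      kummerEntire_add_one hb (by positivity : (0 : ℝ) < m + 1), ← Complex.ofReal_mul,
      ← Complex.ofReal_sub, show b + 1 - 1 = b - 1 + 1 by ring, Real.rpow_add_one hy.ne']
    congr 1
    ring

/-- Euler's integral: the beta average multiplies the k-th coefficient by Γ(b+i+k)/Γ(b+i+α+k), and
so lowers the index from i + α to i. -/
theorem integral_beta_kummerEntire {i α y : ℝ} (hb : 0 < b) (hi : 0 < i) (hα : 0 < α) :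
    ∫ u in Set.Ioc (0 : ℝ) 1, u ^ (b + i - 1) * (1 - u) ^ (α - 1) / Real.Gamma α
      * kummerEntire b (i + α) (y * u) = kummerEntire b i y := by
  have hΓα := Real.Gamma_pos_of_pos hα
  have hbeta : ∀ k : ℕ, ∫ u in Set.Ioc (0 : ℝ) 1, u ^ (b + i + k - 1) * (1 - u) ^ (α - 1)
      = Real.Gamma (b + i + k) * Real.Gamma α / Real.Gamma (b + i + k + α) := fun k => by
    rw [integral_Ioc_beta (by positivity) hα one_pos, Real.one_rpow, one_mul]
  have hbint : ∀ k : ℕ, IntegrableOn (fun u : ℝ => u ^ (b + i + k - 1) * (1 - u) ^ (α - 1))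
      (Set.Ioc (0 : ℝ) 1) := fun k => integrableOn_beta (by positivity) hα one_pos
  set e : ℕ → ℝ := fun k => (-1) ^ k * Real.Gamma (b + (i + α) + k)
    / ((k.factorial : ℝ) * Real.Gamma (b + 1 + k)) * y ^ k / Real.Gamma α with he
  have hval : ∀ k : ℕ, e k * (Real.Gamma (b + i + k) * Real.Gamma α / Real.Gamma (b + i + k + α))
      = (-1) ^ k * Real.Gamma (b + i + k)
        / ((k.factorial : ℝ) * Real.Gamma (b + 1 + k)) * y ^ k := fun k => by
    have := Real.Gamma_pos_of_pos (by positivity : 0 < b + i + k + α)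
    simp only [he]
    rw [show b + (i + α) + k = b + i + k + α by ring]
    field_simp
  have h := hasSum_setIntegral (s := Set.Ioc (0 : ℝ) 1) measurableSet_Ioc
    (f := fun k u => e k * (u ^ (b + i + k - 1) * (1 - u) ^ (α - 1)))
    (g := fun u => u ^ (b + i - 1) * (1 - u) ^ (α - 1) / Real.Gamma α
      * kummerEntire b (i + α) (y * u)) (fun k => (hbint k).const_mul _) ?_ ?_
  · rw [← h.tsum_eq, kummerEntire]
    refine tsum_congr fun k => ?_
    rw [integral_const_mul, hbeta, hval]
  · refine (summable_kummerEntire hb hi y).congr fun k => ?_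
    have hcongr : ∫ u in Set.Ioc (0 : ℝ) 1, |e k * (u ^ (b + i + k - 1) * (1 - u) ^ (α - 1))|
        = |e k| * (Real.Gamma (b + i + k) * Real.Gamma α / Real.Gamma (b + i + k + α)) := by
      rw [← hbeta, ← integral_const_mul]
      refine setIntegral_congr_fun measurableSet_Ioc fun u hu => ?_
      have h1 : 0 ≤ 1 - u := by linarith [hu.2]
      have h2 : 0 < u := hu.1
      rw [abs_mul, abs_of_nonneg (by positivity : 0 ≤ u ^ (b + i + k - 1) * (1 - u) ^ (α - 1))]
    have h1 := Real.Gamma_pos_of_pos (by positivity : 0 < b + i + k + α)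
    have h2 := Real.Gamma_pos_of_pos (by positivity : 0 < b + i + k)
    rw [hcongr, ← abs_of_pos (by positivity :
      0 < Real.Gamma (b + i + k) * Real.Gamma α / Real.Gamma (b + i + k + α)), ← abs_mul, hval,
      abs_mul, abs_pow]
  · intro u hu
    have h1 := hasSum_of_summable_abs (summable_kummerEntire hb (by positivity : 0 < i + α)) (y * u)
    refine (h1.mul_left (u ^ (b + i - 1) * (1 - u) ^ (α - 1) / Real.Gamma α)).congr_fun fun k => ?_
    simp only [he]
    rw [show b + i + k - 1 = b + i - 1 + k by ring, Real.rpow_add hu.1, Real.rpow_natCast,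
      mul_pow]
    ring

/-- By Γ(s) = (s-1)Γ(s-1) and Γ(2-s) = (1-s)Γ(1-s), the integrand is -Γ(1+i-s)Γ(b-1+s)/Γ(2-s) z^s.
With m = ⌊i⌋ the quotient Γ(1+i-s)/Γ(2-s) splits into the beta factor Γ(1+i-s)/Γ(2+m-s) and a
polynomial of degree m. The polynomial part yields the Kummer function of index m + 1, and the beta
average lowers the index to i. -/
theorem meijerG_one_two {i z : ℝ} (hb : 0 < b) (hi : 0 < i) (hz : 0 < z) :
    MeijerConverges 1 2 [2, 2 - b, 1] [1 + i, 1] z ∧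
      meijerG 1 2 [2, 2 - b, 1] [1 + i, 1] z
        = ((-(z⁻¹ ^ (b - 1) * kummerEntire b i z⁻¹) : ℝ) : ℂ) := by
  have hsep : ∀ c, MeijerSeparates 1 2 [2, 2 - b, 1] [1 + i, 1] c
      ↔ (1 < c ∧ 1 - b < c) ∧ c < 1 + i := fun c => by
    simp [MeijerSeparates]
    norm_num
    intro _ _
    constructor <;> intro h <;> linarith
  set m : ℕ := ⌊i⌋₊ with hm
  -- Rounding up to ⌊i⌋ + 1 keeps α positive for integer i too, so that the beta kernel is defined
  -- in all cases.
  set α : ℝ := m + 1 - i with hα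
  have hα0 : 0 < α := by
    have := Nat.lt_floor_add_one i
    rw [hα]; linarith
  set K : ℂ → ℂ := fun s => Complex.Gamma ((1 + i : ℝ) - s)
    / Complex.Gamma ((1 + i : ℝ) + (α : ℝ) - s) with hK
  refine meijerG_eq (F := fun s => -1 * (K s * gammaPoly m b s)) hz ?_ ?_ ?_ ?_
  · refine ⟨1 + i / 2, (hsep _).2 ⟨⟨?_, ?_⟩, ?_⟩⟩ <;> linarith
  · intro c hc t ht
    obtain ⟨⟨h1, h2⟩, h3⟩ := (hsep c).1 hc
    set s : ℂ := c + t * Complex.I with hs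
    have hre : s.re = c := by simp [hs]
    have him : s.im = t := by simp [hs]
    -- As t ≠ 0, s is not real, and the functional equations below meet no exceptional point.
    have hne : ∀ r : ℝ, (r : ℂ) - s ≠ 0 := fun r h => by
      have := congrArg Complex.im h
      simp [him] at this
      exact ht this
    have hprod : ∀ n : ℕ, Complex.Gamma (2 + n - s)
        = (∏ j ∈ Finset.range n, (2 + j - s)) * Complex.Gamma (2 - s) := fun n => by
      induction n with
      | zero => simp
      | succ n ih =>
        rw [Finset.prod_range_succ, show (2 : ℂ) + (n + 1 : ℕ) - s = 2 + n - s + 1 by push_cast; ring,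
          Complex.Gamma_add_one _ (by exact_mod_cast hne (2 + n)), ih]
        ring
    have hprod0 : ∏ j ∈ Finset.range m, (2 + (j : ℂ) - s) ≠ 0 :=
      Finset.prod_ne_zero_iff.2 fun j _ => by exact_mod_cast hne (2 + j)
    have e1 : Complex.Gamma ((1 + i : ℝ) + (α : ℝ) - s)
        = (∏ j ∈ Finset.range m, (2 + j - s)) * Complex.Gamma (2 - s) := by
      rw [← hprod, hα]; congr 1; push_cast; ring
    have e2 : Complex.Gamma (2 - s) = (1 - s) * Complex.Gamma (1 - s) := by
      rw [← Complex.Gamma_add_one _ (by exact_mod_cast hne 1)]; congr 1; ring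
    have hs1 : s - 1 ≠ 0 := fun h => hne 1 (by rw [Complex.ofReal_one, ← neg_sub, h, neg_zero])
    have e3 : Complex.Gamma s = (s - 1) * Complex.Gamma (s - 1) := by
      rw [← Complex.Gamma_add_one _ hs1]; congr 1; ring
    have hΓ : Complex.Gamma (s - 1) ≠ 0 :=
      Complex.Gamma_ne_zero_of_re_pos (by simp [hre]; linarith)
    have hM : meijerIntegrand 1 2 [2, 2 - b, 1] [1 + i, 1] z s
        = Complex.Gamma (1 + i - s) * (Complex.Gamma (s - 1) * Complex.Gamma (b - 1 + s))
          / (Complex.Gamma s * Complex.Gamma (1 - s)) * (z : ℂ) ^ s := by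
      rw [show s - 1 = 1 - 2 + s by ring, show (b : ℂ) - 1 + s = 1 - (2 - b) + s by ring]
      simp [meijerIntegrand]
    rw [hM, e3]
    simp only [hK, gammaPoly, e1, e2]
    congr 1
    push_cast
    have h1s : 1 - s ≠ 0 := by exact_mod_cast hne 1
    by_cases hG : Complex.Gamma (1 - s) = 0
    · simp [hG]
    · field_simp
      ring
  · intro c hc
    obtain ⟨⟨h1, h2⟩, h3⟩ := (hsep c).1 hc
    exact Integrable.const_mul (verticalIntegrable_mul (K := K)
      (integrableOn_betaKernel (by linarith) hα0) (verticalIntegrable_gammaPoly hb h1 m)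
      (continuous_betaKernel_mellin (by linarith) hα0) (integral_betaKernel (by linarith) hα0)) _
  · intro c hc
    obtain ⟨⟨h1, h2⟩, h3⟩ := (hsep c).1 hc
    have hneg : mellinInv c (fun s => -1 * (K s * gammaPoly m b s)) z⁻¹
        = -mellinInv c (fun s => K s * gammaPoly m b s) z⁻¹ := by
      simp only [mellinInv, smul_eq_mul, Complex.real_smul, neg_mul, one_mul, mul_neg,
        integral_neg]
    rw [hneg, mellinInv_mul (K := K) (integrableOn_betaKernel (by linarith) hα0)
      (verticalIntegrable_gammaPoly hb h1 m) (integral_betaKernel (by linarith) hα0)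
      (inv_pos.2 hz), setIntegral_betaKernel_mul, Complex.ofReal_neg,
      ← integral_beta_kummerEntire hb hi hα0, ← integral_const_mul, ← integral_complex_ofReal]
    congr 1
    refine setIntegral_congr_fun measurableSet_Ioc fun u hu => ?_
    have hu0 : 0 < u := hu.1
    have hzi : 0 < z⁻¹ := inv_pos.2 hz
    rw [mellinInv_gammaPoly hb h1 m (by positivity), ← Complex.ofReal_mul,
      Real.mul_rpow hzi.le hu0.le, show (1 : ℝ) + i - 1 = i by ring,
      show b + i - 1 = i + (b - 1) by ring, Real.rpow_add hu0, show i + α = m + 1 by rw [hα]; ring]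
    congr 1
    ring

theorem gTerm_eq_meijerG {a i x : ℝ} (ha : 0 < a) (hb : 0 < b) (hi : 0 < i) (hx : 0 < x) :
    (gTerm a b i x : ℂ) = ((a / (2 * Real.Gamma b * Real.Gamma i) : ℝ) : ℂ)
      * meijerG 1 2 [2, 2 - b, 1] [1 + i, 1] (1 / (a * x)) := by
  rw [(meijerG_one_two hb hi (by positivity)).2, gTerm_eq ha hb hi hx, ← Complex.ofReal_mul,
    one_div, inv_inv, Real.mul_rpow ha.le hx.le, Real.rpow_sub_one ha.ne']
  congr 1
  field_simp

end

end

section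

open Polynomial (C X)

/-! ### Laguerre polynomials -/

theorem integrableOn_pow_mul_exp (n : ℕ) :
    IntegrableOn (fun t : ℝ => t ^ n * Real.exp (-t)) (Set.Ioi 0) := by
  refine (integrableOn_gamma (by positivity : (0 : ℝ) < n + 1)).congr_fun (fun t _ => ?_)
    measurableSet_Ioi
  simp only
  rw [add_sub_cancel_right, Real.rpow_natCast]

theorem integral_pow_mul_exp (n : ℕ) :
    ∫ t in Set.Ioi (0 : ℝ), t ^ n * Real.exp (-t) = n.factorial := by
  rw [← Real.Gamma_nat_eq_factorial, Real.Gamma_eq_integral (by positivity)]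
  refine setIntegral_congr_fun measurableSet_Ioi fun t _ => ?_
  rw [add_sub_cancel_right, Real.rpow_natCast, mul_comm]

theorem integrableOn_eval_mul_exp (p : Polynomial ℝ) :
    IntegrableOn (fun t : ℝ => p.eval t * Real.exp (-t)) (Set.Ioi 0) := by
  induction p using Polynomial.induction_on' with
  | add p q hp hq =>
    simp only [Polynomial.eval_add, add_mul]
    exact Integrable.add hp hq
  | monomial n a =>
    simp only [Polynomial.eval_monomial, mul_assoc]
    exact Integrable.const_mul (integrableOn_pow_mul_exp n) a

/-- The integral of a polynomial against `e^(-t)` on `(0, ∞)`. -/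
def expMean : Polynomial ℝ →ₗ[ℝ] ℝ where
  toFun p := ∫ t in Set.Ioi (0 : ℝ), p.eval t * Real.exp (-t)
  map_add' p q := by
    simp only [Polynomial.eval_add, add_mul]
    exact integral_add (integrableOn_eval_mul_exp p) (integrableOn_eval_mul_exp q)
  map_smul' a p := by
    simp only [Polynomial.eval_smul, smul_eq_mul, mul_assoc, RingHom.id_apply]
    exact integral_const_mul _ _

theorem expMean_apply (p : Polynomial ℝ) :
    expMean p = ∫ t in Set.Ioi (0 : ℝ), p.eval t * Real.exp (-t) := rfl

theorem expMean_X_pow (n : ℕ) : expMean (X ^ n) = n.factorial := by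
  rw [expMean_apply, ← integral_pow_mul_exp]
  simp

theorem expMean_C_mul (a : ℝ) (p : Polynomial ℝ) : expMean (C a * p) = a * expMean p := by
  rw [← Polynomial.smul_eq_C_mul, map_smul, smul_eq_mul]

theorem expMean_nonneg {p : Polynomial ℝ} (hp : ∀ t, 0 < t → 0 ≤ p.eval t) : 0 ≤ expMean p :=
  setIntegral_nonneg measurableSet_Ioi fun t ht => mul_nonneg (hp t ht) (Real.exp_pos _).le

theorem expMean_pos {p : Polynomial ℝ} (hp : ∀ t, 0 < t → 0 ≤ p.eval t) (h0 : p ≠ 0) :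
    0 < expMean p := by
  refine (expMean_nonneg hp).lt_of_ne' fun h => ?_
  rw [expMean_apply, setIntegral_eq_zero_iff_of_nonneg_ae ?_ (integrableOn_eval_mul_exp p)] at h
  · have h2 : volume (Set.Ioi (0 : ℝ) \ p.rootSet ℝ) = 0 := by
      rw [Filter.EventuallyEq, ae_restrict_iff' measurableSet_Ioi] at h
      refine measure_mono_null (fun t ht => ?_) h
      simp only [Set.mem_compl_iff, Set.mem_ofPred_eq, Pi.zero_apply, mul_eq_zero, (Real.exp_pos _).ne',
        or_false]
      intro h3
      refine ht.2 ((Polynomial.mem_rootSet_of_ne h0).2 ?_)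
      simpa using h3 ht.1
    rw [measure_sdiff_null (Set.Finite.measure_zero (Polynomial.rootSet_finite p ℝ) _)] at h2
    simp at h2
  · filter_upwards [ae_restrict_mem measurableSet_Ioi] with t ht
    exact mul_nonneg (hp t ht) (Real.exp_pos _).le

/-- `(x + 1) (x + 2) ⋯ (x + n)`. -/
def risingPoly (n : ℕ) : Polynomial ℝ := ∏ j ∈ Finset.range n, (X + C ((j : ℝ) + 1))

theorem factorial_mul_eval_risingPoly (n k : ℕ) :
    (k.factorial : ℝ) * (risingPoly n).eval (k : ℝ) = (k + n).factorial := by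
  induction n with
  | zero => simp [risingPoly]
  | succ n ih =>
    rw [risingPoly, Finset.prod_range_succ, ← risingPoly, Polynomial.eval_mul, ← mul_assoc, ih,
      ← add_assoc, Nat.factorial_succ]
    simp
    ring

theorem monic_risingPoly (n : ℕ) : (risingPoly n).Monic :=
  Polynomial.monic_prod_of_monic _ _ fun _ _ => Polynomial.monic_X_add_C _

theorem natDegree_risingPoly (n : ℕ) : (risingPoly n).natDegree = n := by
  rw [risingPoly, Polynomial.natDegree_prod_of_monic _ _ fun _ _ => Polynomial.monic_X_add_C _]
  simp only [Polynomial.natDegree_X_add_C, Finset.sum_const, Finset.card_range, smul_eq_mul, mul_one]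

/-- The moments are factorials, and (k+n)!/k! is the value at k of a polynomial of degree n. With
the signed binomial coefficients of L_M the sum becomes an M-th finite difference. -/
theorem expMean_X_pow_mul_laguerrePoly (n M : ℕ) :
    expMean (X ^ n * laguerrePoly M)
      = (-1) ^ M * (fwdDiff (1 : ℝ))^[M] (fun x => (risingPoly n).eval x) 0 := by
  rw [fwdDiff_iter_eq_sum_shift, Finset.mul_sum, laguerrePoly, Finset.mul_sum, map_sum]
  refine Finset.sum_congr rfl fun k hk => ?_
  have hk : k ≤ M := Nat.lt_succ_iff.1 (Finset.mem_range.1 hk)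
  rw [mul_left_comm, ← pow_add, expMean_C_mul, expMean_X_pow, add_comm n,
    ← factorial_mul_eval_risingPoly, zero_add, nsmul_eq_mul, mul_one, zsmul_eq_mul]
  push_cast
  have h1 : (-1 : ℝ) ^ M * (-1) ^ (M - k) = (-1) ^ k := by
    rw [← pow_add, show M + (M - k) = k + 2 * (M - k) by omega, pow_add, pow_mul]
    simp
  have h2 : (k.factorial : ℝ) ≠ 0 := by positivity
  rw [← mul_assoc ((-1 : ℝ) ^ M), ← mul_assoc ((-1 : ℝ) ^ M), h1]
  field_simp

/-- An M-th difference annihilates degrees below M and equals M! on monic polynomials of degree M.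
This contains the orthogonality of the Laguerre polynomials. -/
theorem expMean_mul_laguerrePoly {p : Polynomial ℝ} {M : ℕ} (hp : p.natDegree ≤ M) :
    expMean (p * laguerrePoly M) = p.coeff M * ((-1) ^ M * M.factorial) := by
  conv_lhs => rw [p.as_sum_range_C_mul_X_pow' (Nat.lt_succ_of_le hp)]
  rw [Finset.sum_mul, map_sum, Finset.sum_eq_single M]
  · rw [mul_assoc, expMean_C_mul, expMean_X_pow_mul_laguerrePoly]
    have h := (risingPoly M).fwdDiff_iter_degree_eq_factorial
    rw [natDegree_risingPoly, (monic_risingPoly M).leadingCoeff] at h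
    rw [h]
    simp
  · intro n hn hnM
    have hn : n < M := lt_of_le_of_ne (Nat.lt_succ_iff.1 (Finset.mem_range.1 hn)) hnM
    have h := Polynomial.fwdDiff_iter_eq_zero_of_degree_lt (P := risingPoly n) (n := M)
      (by rwa [natDegree_risingPoly])
    rw [mul_assoc, expMean_C_mul, expMean_X_pow_mul_laguerrePoly, h]
    simp
  · intro h
    simp at h

theorem coeff_laguerrePoly (M k : ℕ) :
    (laguerrePoly M).coeff k = if k ≤ M then (M.choose k : ℝ) * (-1) ^ k / k.factorial else 0 := by
  rw [laguerrePoly, Polynomial.finsetSum_coeff]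
  simp only [Polynomial.coeff_C_mul, Polynomial.coeff_X_pow, mul_ite, mul_one, mul_zero,
    Finset.sum_ite_eq, Finset.mem_range, Nat.lt_succ_iff]

theorem coeff_laguerrePoly_self (M : ℕ) :
    (laguerrePoly M).coeff M = (-1) ^ M / M.factorial := by
  simp [coeff_laguerrePoly]

theorem natDegree_laguerrePoly (M : ℕ) : (laguerrePoly M).natDegree = M := by
  refine Polynomial.natDegree_eq_of_le_of_coeff_ne_zero ?_ ?_
  · refine Polynomial.natDegree_le_iff_coeff_eq_zero.2 fun k hk => ?_
    rw [coeff_laguerrePoly, if_neg (by omega)]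
  · rw [coeff_laguerrePoly_self]
    positivity

theorem laguerrePoly_ne_zero (M : ℕ) : laguerrePoly M ≠ 0 := fun h => by
  have := coeff_laguerrePoly_self M
  rw [h, Polynomial.coeff_zero] at this
  have h2 : (-1 : ℝ) ^ M / M.factorial ≠ 0 := by positivity
  exact h2 this.symm

theorem expMean_laguerrePoly_sq (M : ℕ) : expMean (laguerrePoly M * laguerrePoly M) = 1 := by
  rw [expMean_mul_laguerrePoly (natDegree_laguerrePoly M).le, coeff_laguerrePoly_self]
  have : (M.factorial : ℝ) ≠ 0 := by positivity
  field_simp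
  rw [← pow_mul, mul_comm, pow_mul]
  simp

theorem one_add_le_eval_laguerrePoly {M : ℕ} (hM : 1 ≤ M) {t : ℝ} (ht : 0 ≤ t) :
    1 + M * t ≤ (laguerrePoly M).eval (-t) := by
  have h : (laguerrePoly M).eval (-t)
      = ∑ k ∈ Finset.range (M + 1), (M.choose k : ℝ) / k.factorial * t ^ k := by
    rw [laguerrePoly, Polynomial.eval_finsetSum]
    refine Finset.sum_congr rfl fun k _ => ?_
    simp only [Polynomial.eval_mul, Polynomial.eval_C, Polynomial.eval_pow, Polynomial.eval_X]
    rw [neg_pow t, show ((M.choose k : ℝ) * (-1) ^ k / k.factorial) * ((-1) ^ k * t ^ k)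
      = (M.choose k : ℝ) / k.factorial * t ^ k * ((-1) ^ k * (-1) ^ k) by ring, ← pow_add,
      ← two_mul, pow_mul]
    simp
  rw [h]
  calc 1 + M * t = ∑ k ∈ Finset.range 2, (M.choose k : ℝ) / k.factorial * t ^ k := by
        simp [Finset.sum_range_succ]
    _ ≤ _ := Finset.sum_le_sum_of_subset_of_nonneg (Finset.range_mono (by omega))
        fun k _ _ => by positivity

/-- A polynomial without real roots does not change its sign. -/
theorem eval_mul_eval_pos {q : Polynomial ℝ} (hq : q ≠ 0) (h : q.roots = 0) (x y : ℝ) :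
    0 < q.eval x * q.eval y := by
  have hne : ∀ z, q.eval z ≠ 0 := fun z hz => by
    have : z ∈ q.roots := (Polynomial.mem_roots hq).2 hz
    rw [h] at this
    simp at this
  by_contra! hle
  obtain ⟨z, hz⟩ := mem_range_of_exists_le_of_exists_ge
    (f := fun z => q.eval z * q.eval y) (c := 0) (by fun_prop) ⟨x, hle⟩ ⟨y, mul_self_nonneg _⟩
  exact (mul_ne_zero (hne z) (hne y)) hz

/-- Let T be the product of X - r over the positive roots r of L_M of odd multiplicity. Then T L_M
has constant sign on (0, ∞), so its mean is not 0; by orthogonality T cannot have degree less than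
M. Hence L_M has M distinct positive roots and no others. -/
theorem laguerreNodes_pos_and_card (M : ℕ) :
    (∀ x ∈ laguerreNodes M, 0 < x) ∧ (laguerreNodes M).card = M := by
  classical
  set L := laguerrePoly M with hL
  -- q is the cofactor of L without real roots; it has constant sign.
  obtain ⟨q, hq, -, hqr⟩ := L.exists_prod_multiset_X_sub_C_mul
  have hL0 : L ≠ 0 := laguerrePoly_ne_zero M
  have hq0 : q ≠ 0 := fun h => hL0 (by rw [← hq, h, mul_zero])
  set S := (laguerreNodes M).filter fun r => 0 < r ∧ Odd (L.roots.count r) with hS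
  set T : Polynomial ℝ := ∏ r ∈ S, (X - C r) with hT
  have hSsub : S ⊆ laguerreNodes M := Finset.filter_subset _ _
  have hTdeg : T.natDegree = S.card := by
    rw [hT, Polynomial.natDegree_prod_of_monic _ _ fun _ _ => Polynomial.monic_X_sub_C _]
    simp only [Polynomial.natDegree_X_sub_C, Finset.sum_const, smul_eq_mul, mul_one]
  have hT0 : T ≠ 0 := (Polynomial.monic_prod_of_monic _ _ fun _ _ => Polynomial.monic_X_sub_C _).ne_zero
  have hcard : (laguerreNodes M).card ≤ M :=
    (Multiset.toFinset_card_le _).trans ((L.card_roots').trans (natDegree_laguerrePoly M).le)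
  have hSM : M ≤ S.card := by
    by_contra! hlt
    have hq00 : q.eval 0 ≠ 0 := fun h => by
      have := eval_mul_eval_pos hq0 hqr 0 0
      rw [h] at this
      simp at this
    -- The factor q(0) compensates the sign of q, so the polynomial is nonnegative on (0, ∞).
    have hpos : 0 < expMean (C (q.eval 0) * (T * L)) := by
      refine expMean_pos (fun t ht => ?_) (mul_ne_zero (by simpa using hq00) (mul_ne_zero hT0 hL0))
      have hTe : T.eval t = ∏ r ∈ laguerreNodes M,
          (t - r) ^ (if 0 < r ∧ Odd (L.roots.count r) then 1 else 0) := by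
        rw [hT, hS, Finset.prod_filter, Polynomial.eval_prod]
        refine Finset.prod_congr rfl fun r _ => ?_
        split_ifs <;> simp
      have hLe : L.eval t = (∏ r ∈ laguerreNodes M, (t - r) ^ L.roots.count r) * q.eval t := by
        conv_lhs => rw [← hq, Finset.prod_multiset_map_count]
        rw [Polynomial.eval_mul, Polynomial.eval_prod]
        simp [laguerreNodes, hL]
      rw [Polynomial.eval_mul, Polynomial.eval_C, Polynomial.eval_mul, hTe, hLe, ← mul_assoc,
        ← mul_assoc, mul_assoc (q.eval 0), ← Finset.prod_mul_distrib, mul_comm (q.eval 0), mul_assoc]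
      refine mul_nonneg (Finset.prod_nonneg fun r _ => ?_) (eval_mul_eval_pos hq0 hqr 0 t).le
      rw [← pow_add]
      by_cases hr : 0 < r
      · refine Even.pow_nonneg ?_ _
        by_cases ho : Odd (L.roots.count r)
        · rw [if_pos ⟨hr, ho⟩, add_comm]
          exact ho.add_one
        · rw [if_neg (by tauto), zero_add]
          exact Nat.not_odd_iff_even.1 ho
      · exact pow_nonneg (by linarith) _
    rw [expMean_C_mul, hL, expMean_mul_laguerrePoly (by omega),
      Polynomial.coeff_eq_zero_of_natDegree_lt (by omega)] at hpos
    simp at hpos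
  have hSeq : S = laguerreNodes M := Finset.eq_of_subset_of_card_le hSsub (hcard.trans hSM)
  refine ⟨fun x hx => ?_, le_antisymm hcard (hSM.trans (Finset.card_le_card hSsub))⟩
  rw [← hSeq] at hx
  exact (Finset.mem_filter.1 hx).2.1

theorem laguerreNodes_pos {M : ℕ} {x : ℝ} (hx : x ∈ laguerreNodes M) : 0 < x :=
  (laguerreNodes_pos_and_card M).1 x hx

theorem card_laguerreNodes (M : ℕ) : (laguerreNodes M).card = M :=
  (laguerreNodes_pos_and_card M).2

theorem eval_laguerrePoly {M : ℕ} {x : ℝ} (hx : x ∈ laguerreNodes M) :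
    (laguerrePoly M).eval x = 0 :=
  (Polynomial.mem_roots (laguerrePoly_ne_zero M)).1 (Multiset.mem_toFinset.1 hx)

/-! ### The Gauss-Laguerre rule -/

/-- The Gauss-Laguerre rule of order `M`. -/
def laguerreRule (M : ℕ) (f : ℝ → ℝ) : ℝ := ∑ x ∈ laguerreNodes M, laguerreWeight M x * f x

theorem laguerreRule_eq_expMean_of_degree_lt {M : ℕ} {p : Polynomial ℝ} (hp : p.degree < M) :
    laguerreRule M (fun x => p.eval x) = expMean p := by
  have h := Lagrange.eq_interpolate (s := laguerreNodes M) (v := id) (Set.injOn_id _)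
    (by rwa [card_laguerreNodes] : p.degree < (laguerreNodes M).card)
  conv_rhs => rw [h, Lagrange.interpolate_apply, map_sum]
  refine Finset.sum_congr rfl fun x _ => ?_
  rw [expMean_C_mul, mul_comm]
  rfl

/-- Divide by L_M: the quotient has degree less than M and is orthogonal to L_M, which also vanishes
at the nodes; the remainder is integrated exactly by interpolation. -/
theorem laguerreRule_eq_expMean {M : ℕ} {p : Polynomial ℝ} (hp : p.natDegree < 2 * M) :
    laguerreRule M (fun x => p.eval x) = expMean p := by
  set L := laguerrePoly M with hL
  have hL0 : L ≠ 0 := laguerrePoly_ne_zero M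
  have hdiv := EuclideanDomain.div_add_mod p L
  have hmod : (p % L).degree < M := by
    have := Polynomial.degree_mod_lt p hL0
    rwa [Polynomial.degree_eq_natDegree hL0, natDegree_laguerrePoly] at this
  have hdeg : (p / L).natDegree < M := by
    by_cases h0 : p / L = 0
    · rw [h0, Polynomial.natDegree_zero]; omega
    · have h1 : (L * (p / L)).natDegree < 2 * M := by
        rw [eq_sub_of_add_eq hdiv]
        refine (Polynomial.natDegree_sub_le _ _).trans_lt (max_lt hp ?_)
        by_cases h2 : p % L = 0
        · rw [h2, Polynomial.natDegree_zero]; omega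
        · have := (Polynomial.natDegree_lt_iff_degree_lt h2).2 hmod
          omega
      rw [Polynomial.natDegree_mul hL0 h0, natDegree_laguerrePoly] at h1
      omega
  have h1 : laguerreRule M (fun x => p.eval x) = laguerreRule M (fun x => (p % L).eval x) := by
    refine Finset.sum_congr rfl fun x hx => ?_
    conv_lhs => rw [← hdiv]
    simp only
    rw [Polynomial.eval_add, Polynomial.eval_mul, eval_laguerrePoly hx, zero_mul, zero_add]
  rw [h1, laguerreRule_eq_expMean_of_degree_lt hmod]
  conv_rhs => rw [← hdiv]
  rw [map_add, mul_comm, expMean_mul_laguerrePoly hdeg.le,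
    Polynomial.coeff_eq_zero_of_natDegree_lt hdeg, zero_mul, zero_add]

/-- The rule is exact on the square of the Lagrange basis polynomial, of degree 2M - 2, and this
gives the weight as the integral of a square. -/
theorem laguerreWeight_nonneg {M : ℕ} {x : ℝ} (hx : x ∈ laguerreNodes M) :
    0 ≤ laguerreWeight M x := by
  set B := Lagrange.basis (laguerreNodes M) id x with hB
  have hinj : Set.InjOn id (laguerreNodes M : Set ℝ) := Set.injOn_id _
  have hM : 0 < M := by
    rw [← card_laguerreNodes M]
    exact Finset.card_pos.2 ⟨x, hx⟩
  have hdeg : (B * B).natDegree < 2 * M := by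
    refine Polynomial.natDegree_mul_le.trans_lt ?_
    rw [hB, Lagrange.natDegree_basis hinj hx, card_laguerreNodes]
    omega
  have h := laguerreRule_eq_expMean hdeg
  rw [laguerreRule, Finset.sum_eq_single x] at h
  · have h1 : B.eval x = 1 := Lagrange.eval_basis_self hinj hx
    rw [Polynomial.eval_mul, h1, mul_one, mul_one] at h
    rw [h]
    exact expMean_nonneg fun t _ => by rw [Polynomial.eval_mul]; exact mul_self_nonneg _
  · intro y hy hyx
    have h1 : B.eval y = 0 := Lagrange.eval_basis_of_ne (v := id) hyx.symm hy
    rw [Polynomial.eval_mul, h1, mul_zero, mul_zero]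
  · exact fun h => (h hx).elim

end

/-! ### Convergence of the Gauss-Laguerre rules for continuous functions of 1/(x+1) -/

section

open Polynomial (C X)

theorem laguerreRule_congr {M : ℕ} {f g : ℝ → ℝ} (h : ∀ x, 0 < x → f x = g x) :
    laguerreRule M f = laguerreRule M g :=
  Finset.sum_congr rfl fun x hx => by rw [h x (laguerreNodes_pos hx)]

theorem laguerreRule_add (M : ℕ) (f g : ℝ → ℝ) :
    laguerreRule M (fun x => f x + g x) = laguerreRule M f + laguerreRule M g := by
  simp only [laguerreRule, mul_add, Finset.sum_add_distrib]

theorem laguerreRule_const_mul (M : ℕ) (c : ℝ) (f : ℝ → ℝ) :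
    laguerreRule M (fun x => c * f x) = c * laguerreRule M f := by
  simp only [laguerreRule, Finset.mul_sum, mul_left_comm]

theorem abs_laguerreRule_le {M : ℕ} {f g : ℝ → ℝ} (h : ∀ x, 0 < x → |f x| ≤ g x) :
    |laguerreRule M f| ≤ laguerreRule M g := by
  refine (Finset.abs_sum_le_sum_abs _ _).trans (Finset.sum_le_sum fun x hx => ?_)
  rw [abs_mul, abs_of_nonneg (laguerreWeight_nonneg hx)]
  exact mul_le_mul_of_nonneg_left (h x (laguerreNodes_pos hx)) (laguerreWeight_nonneg hx)

/-- The Gauss-Laguerre rules converge on `f`. -/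
structure LaguerreConverges (f : ℝ → ℝ) : Prop where
  integrableOn : IntegrableOn (fun x => f x * Real.exp (-x)) (Set.Ioi 0)
  tendsto : Tendsto (fun M => laguerreRule M f) atTop
    (𝓝 (∫ x in Set.Ioi (0 : ℝ), f x * Real.exp (-x)))

namespace LaguerreConverges

variable {f g : ℝ → ℝ}

theorem congr (hf : LaguerreConverges f) (h : ∀ x, 0 < x → f x = g x) : LaguerreConverges g where
  integrableOn := hf.1.congr_fun (fun x hx => by simp only [h x hx]) measurableSet_Ioi
  tendsto := by
    have heq : ∫ x in Set.Ioi (0 : ℝ), f x * Real.exp (-x) = ∫ x in Set.Ioi (0 : ℝ), g x * Real.exp (-x) :=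
      setIntegral_congr_fun measurableSet_Ioi fun x hx => by simp only [h x hx]
    rw [← heq]
    exact hf.2.congr fun M => laguerreRule_congr h

theorem add (hf : LaguerreConverges f) (hg : LaguerreConverges g) :
    LaguerreConverges fun x => f x + g x where
  integrableOn := by simp only [add_mul]; exact Integrable.add hf.1 hg.1
  tendsto := by
    simp only [add_mul]
    rw [integral_add hf.1 hg.1]
    exact (hf.2.add hg.2).congr fun M => (laguerreRule_add M f g).symm

theorem const_mul (hf : LaguerreConverges f) (c : ℝ) : LaguerreConverges fun x => c * f x where
  integrableOn := by simp only [mul_assoc]; exact Integrable.const_mul hf.1 c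
  tendsto := by
    simp only [mul_assoc]
    rw [integral_const_mul]
    exact (hf.2.const_mul c).congr fun M => (laguerreRule_const_mul M c f).symm

theorem sub (hf : LaguerreConverges f) (hg : LaguerreConverges g) :
    LaguerreConverges fun x => f x - g x :=
  (hf.add (hg.const_mul (-1))).congr fun x _ => by ring

theorem of_polynomial (p : Polynomial ℝ) : LaguerreConverges fun x => p.eval x where
  integrableOn := integrableOn_eval_mul_exp p
  tendsto := by
    refine tendsto_const_nhds.congr' ?_
    filter_upwards [eventually_gt_atTop p.natDegree] with M hM
    rw [laguerreRule_eq_expMean (by omega), expMean_apply]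

theorem const (c : ℝ) : LaguerreConverges fun _ => c :=
  (of_polynomial (C c)).congr fun x _ => by simp

/-- The weights are nonnegative, so the rule on f - g is bounded by the rule on `d`, which tends to
a small integral. The bound `d` need not be uniform in x; this allows singular functions. -/
theorem of_approx (hf : IntegrableOn (fun x => f x * Real.exp (-x)) (Set.Ioi 0))
    (h : ∀ ε : ℝ, 0 < ε → ∃ g d : ℝ → ℝ, LaguerreConverges g ∧ LaguerreConverges d ∧
      (∀ x, 0 < x → |f x - g x| ≤ d x) ∧ ∫ x in Set.Ioi (0 : ℝ), d x * Real.exp (-x) ≤ ε) :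
    LaguerreConverges f where
  integrableOn := hf
  tendsto := by
    rw [Metric.tendsto_atTop]
    intro ε hε
    obtain ⟨g, d, hg, hd, hfg, hdε⟩ := h (ε / 4) (by positivity)
    obtain ⟨M₁, h₁⟩ := Metric.tendsto_atTop.1 hg.2 (ε / 4) (by positivity)
    obtain ⟨M₂, h₂⟩ := Metric.tendsto_atTop.1 hd.2 (ε / 4) (by positivity)
    refine ⟨max M₁ M₂, fun M hM => ?_⟩
    have e1 := h₁ M (le_of_max_le_left hM)
    have e2 := h₂ M (le_of_max_le_right hM)
    rw [Real.dist_eq] at e1 e2 ⊢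
    have e3 : |laguerreRule M f - laguerreRule M g| ≤ laguerreRule M d := by
      have := abs_laguerreRule_le (M := M) hfg
      rwa [show laguerreRule M (fun x => f x - g x) = laguerreRule M f - laguerreRule M g by
        simp only [laguerreRule, mul_sub, Finset.sum_sub_distrib]] at this
    have e4 : |(∫ x in Set.Ioi (0 : ℝ), f x * Real.exp (-x))
        - ∫ x in Set.Ioi (0 : ℝ), g x * Real.exp (-x)|
        ≤ ∫ x in Set.Ioi (0 : ℝ), d x * Real.exp (-x) := by
      rw [← integral_sub hf hg.1, ← Real.norm_eq_abs]
      refine norm_integral_le_of_norm_le hd.1 ?_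
      filter_upwards [ae_restrict_mem measurableSet_Ioi] with x hx
      rw [← sub_mul, norm_mul, Real.norm_eq_abs, Real.norm_of_nonneg (Real.exp_pos _).le]
      exact mul_le_mul_of_nonneg_right (hfg x hx) (Real.exp_pos _).le
    rw [abs_lt] at e1 e2 ⊢
    rw [abs_le] at e3 e4
    constructor <;> linarith [e1.1, e1.2, e2.1, e2.2, e3.1, e3.2, e4.1, e4.2]

end LaguerreConverges

theorem integrableOn_mul_exp_of_bounded {f : ℝ → ℝ} (hf : ContinuousOn f (Set.Ioi 0)) {K : ℝ}
    (hK : ∀ x, 0 < x → |f x| ≤ K) :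
    IntegrableOn (fun x => f x * Real.exp (-x)) (Set.Ioi 0) := by
  have h := (LaguerreConverges.const K).1
  refine Integrable.mono' h ?_ ?_
  · exact (hf.mul (by fun_prop)).aestronglyMeasurable measurableSet_Ioi
  · filter_upwards [ae_restrict_mem measurableSet_Ioi] with x hx
    rw [norm_mul, Real.norm_eq_abs, Real.norm_of_nonneg (Real.exp_pos _).le]
    exact mul_le_mul_of_nonneg_right (hK x hx) (Real.exp_pos _).le

theorem integral_const_mul_exp (c : ℝ) : ∫ x in Set.Ioi (0 : ℝ), c * Real.exp (-x) = c := by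
  rw [integral_const_mul, integral_exp_neg_Ioi_zero, mul_one]

theorem continuousOn_resolvent {t : ℝ} (ht : 0 < t) :
    ContinuousOn (fun x : ℝ => 1 / (x + t)) (Set.Ioi 0) :=
  continuousOn_const.div (by fun_prop) fun x hx => by
    have hx0 : (0 : ℝ) < x := hx
    positivity

theorem integrableOn_resolvent {t : ℝ} (ht : 0 < t) :
    IntegrableOn (fun x => 1 / (x + t) * Real.exp (-x)) (Set.Ioi 0) := by
  refine integrableOn_mul_exp_of_bounded (continuousOn_resolvent ht) (K := 1 / t) fun x hx => ?_
  rw [abs_of_pos (by positivity : 0 < 1 / (x + t))]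
  exact one_div_le_one_div_of_le ht (by linarith)

/-- Let l = L_M(-t)². The polynomial (L_M(x)² - l)/(x+t) has degree less than 2M, and at the nodes
it equals -l/(x+t). Exactness gives l (E - Q) = ∫ L_M(x)² e^(-x)/(x+t) dx, which lies in [0, 1/t]
because L_M has norm 1. -/
theorem laguerreRule_resolvent {M : ℕ} (hM : 1 ≤ M) {t : ℝ} (ht : 0 < t) :
    laguerreRule M (fun x => 1 / (x + t)) ≤ ∫ x in Set.Ioi (0 : ℝ), 1 / (x + t) * Real.exp (-x) ∧
    (∫ x in Set.Ioi (0 : ℝ), 1 / (x + t) * Real.exp (-x))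
      - laguerreRule M (fun x => 1 / (x + t)) ≤ 1 / (t * (1 + M * t)) := by
  set L := laguerrePoly M with hL
  set l : ℝ := (L * L).eval (-t) with hl
  have hLt := one_add_le_eval_laguerrePoly hM ht.le
  have hl1 : 1 + M * t ≤ l := by
    rw [hl, Polynomial.eval_mul]
    have : (1 : ℝ) ≤ 1 + M * t := by have : (0 : ℝ) ≤ M * t := by positivity
                                     linarith
    nlinarith
  have hl0 : 0 < l := lt_of_lt_of_le (by positivity) hl1
  have hdvd : X - C (-t) ∣ L * L - C l := by
    rw [Polynomial.dvd_iff_isRoot, Polynomial.IsRoot.def, Polynomial.eval_sub, Polynomial.eval_C,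
      ← hl, sub_self]
  obtain ⟨p, hp⟩ := hdvd
  have hdeg : p.natDegree < 2 * M := by
    by_cases hp0 : p = 0
    · rw [hp0, Polynomial.natDegree_zero]; omega
    · have h1 := congrArg Polynomial.natDegree hp
      rw [Polynomial.natDegree_mul (Polynomial.X_sub_C_ne_zero _) hp0, Polynomial.natDegree_X_sub_C]
        at h1
      have h2 : (L * L - C l).natDegree ≤ 2 * M := by
        refine (Polynomial.natDegree_sub_le _ _).trans (max_le ?_ (by simp))
        refine Polynomial.natDegree_mul_le.trans ?_
        rw [hL, natDegree_laguerrePoly]; omega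
      omega
  have hpe : ∀ x : ℝ, 0 < x → p.eval x = (L * L).eval x * (1 / (x + t)) - l * (1 / (x + t)) :=
    fun x hx => by
      have h1 := congrArg (Polynomial.eval x) hp
      simp only [Polynomial.eval_sub, Polynomial.eval_C, Polynomial.eval_mul, Polynomial.eval_X] at h1
      have : x + t ≠ 0 := by positivity
      rw [Polynomial.eval_mul]
      field_simp
      linarith
  have hQ : laguerreRule M (fun x => p.eval x) = -(l * laguerreRule M fun x => 1 / (x + t)) := by
    rw [← laguerreRule_const_mul, laguerreRule, laguerreRule, ← Finset.sum_neg_distrib]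
    refine Finset.sum_congr rfl fun x hx => ?_
    rw [hpe x (laguerreNodes_pos hx), Polynomial.eval_mul, eval_laguerrePoly hx]
    ring
  have hLint : IntegrableOn (fun x => (L * L).eval x * Real.exp (-x) * (1 / (x + t))) (Set.Ioi 0) := by
    refine Integrable.mono' ((integrableOn_eval_mul_exp (L * L)).mul_const (1 / t)) ?_ ?_
    · exact ((by fun_prop : ContinuousOn (fun x => (L * L).eval x * Real.exp (-x)) (Set.Ioi 0)).mul
        (continuousOn_resolvent ht)).aestronglyMeasurable measurableSet_Ioi
    · filter_upwards [ae_restrict_mem measurableSet_Ioi] with x hx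
      have hx0 : (0 : ℝ) < x := hx
      rw [Polynomial.eval_mul, Real.norm_of_nonneg (by positivity [mul_self_nonneg (L.eval x)])]
      exact mul_le_mul_of_nonneg_left (one_div_le_one_div_of_le ht (by linarith))
        (mul_nonneg (mul_self_nonneg _) (Real.exp_pos _).le)
  have hE : expMean p = (∫ x in Set.Ioi (0 : ℝ), (L * L).eval x * Real.exp (-x) * (1 / (x + t)))
      - l * ∫ x in Set.Ioi (0 : ℝ), 1 / (x + t) * Real.exp (-x) := by
    rw [← integral_const_mul, ← integral_sub hLint ((integrableOn_resolvent ht).const_mul l),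
      expMean_apply]
    refine setIntegral_congr_fun measurableSet_Ioi fun x hx => ?_
    simp only [hpe x hx]
    ring
  have h0 : 0 ≤ ∫ x in Set.Ioi (0 : ℝ), (L * L).eval x * Real.exp (-x) * (1 / (x + t)) := by
    refine setIntegral_nonneg measurableSet_Ioi fun x hx => ?_
    have hx0 : (0 : ℝ) < x := hx
    rw [Polynomial.eval_mul]
    exact mul_nonneg (mul_nonneg (mul_self_nonneg _) (Real.exp_pos _).le) (by positivity)
  have h1 : ∫ x in Set.Ioi (0 : ℝ), (L * L).eval x * Real.exp (-x) * (1 / (x + t)) ≤ 1 / t := by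
    have h2 : ∫ x in Set.Ioi (0 : ℝ), (L * L).eval x * Real.exp (-x) * (1 / t) = 1 / t := by
      rw [integral_mul_const, ← expMean_apply, expMean_laguerrePoly_sq, one_mul]
    rw [← h2]
    refine setIntegral_mono_on hLint ((integrableOn_eval_mul_exp (L * L)).mul_const (1 / t))
      measurableSet_Ioi fun x hx => ?_
    have hx0 : (0 : ℝ) < x := hx
    rw [Polynomial.eval_mul]
    exact mul_le_mul_of_nonneg_left (one_div_le_one_div_of_le ht (by linarith))
        (mul_nonneg (mul_self_nonneg _) (Real.exp_pos _).le)
  have h3 := laguerreRule_eq_expMean hdeg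
  rw [hQ, hE] at h3
  set E := ∫ x in Set.Ioi (0 : ℝ), 1 / (x + t) * Real.exp (-x)
  set Q := laguerreRule M fun x => 1 / (x + t)
  have h4 : 0 ≤ l * (E - Q) := by linarith
  have h5 : l * (E - Q) ≤ 1 / t := by linarith
  have h6 : 0 ≤ E - Q := nonneg_of_mul_nonneg_right h4 hl0
  refine ⟨by linarith, ?_⟩
  rw [le_div_iff₀ (by positivity)] at h5 ⊢
  calc (E - Q) * (t * (1 + M * t)) ≤ (E - Q) * (t * l) := by gcongr
    _ ≤ 1 := by linarith

theorem LaguerreConverges.resolvent {t : ℝ} (ht : 0 < t) :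
    LaguerreConverges fun x => 1 / (x + t) where
  integrableOn := integrableOn_resolvent ht
  tendsto := by
    have h0 : Tendsto (fun M : ℕ => 1 / (t * (1 + M * t))) atTop (𝓝 0) := by
      refine Tendsto.div_atTop tendsto_const_nhds (Tendsto.const_mul_atTop ht ?_)
      exact tendsto_atTop_add_const_left _ _
        (tendsto_natCast_atTop_atTop.atTop_mul_const ht)
    set E := ∫ x in Set.Ioi (0 : ℝ), 1 / (x + t) * Real.exp (-x)
    refine tendsto_of_tendsto_of_tendsto_of_le_of_le' (g := fun M : ℕ => E - 1 / (t * (1 + M * t)))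
      (h := fun _ => E) (by simpa using tendsto_const_nhds.sub h0) tendsto_const_nhds ?_ ?_
    · filter_upwards [eventually_ge_atTop 1] with M hM
      linarith [(laguerreRule_resolvent hM ht).2]
    · filter_upwards [eventually_ge_atTop 1] with M hM
      exact (laguerreRule_resolvent hM ht).1

/-- For t < 1 the identity 1/((x+1)(x+t)) = (1/(x+t) - 1/(x+1))/(1-t) trades a factor for a
difference; t = 1 is a uniform limit. -/
theorem LaguerreConverges.pow_resolvent (k : ℕ) {t : ℝ} (ht : 0 < t) (ht1 : t ≤ 1) :
    LaguerreConverges fun x => (1 / (x + 1)) ^ k * (1 / (x + t)) := by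
  induction k generalizing t with
  | zero => exact (LaguerreConverges.resolvent ht).congr fun x _ => by simp
  | succ k ih =>
    have hlt : ∀ t : ℝ, 0 < t → t < 1 →
        LaguerreConverges fun x => (1 / (x + 1)) ^ (k + 1) * (1 / (x + t)) := fun t ht ht1 => by
      refine (((ih ht ht1.le).sub (ih one_pos le_rfl)).const_mul (1 / (1 - t))).congr fun x hx => ?_
      have h1 : 1 - t ≠ 0 := by linarith
      have h2 : x + 1 ≠ 0 := by positivity
      have h3 : x + t ≠ 0 := by positivity
      rw [pow_succ]
      field_simp
      ring
    rcases ht1.lt_or_eq with h | rfl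
    · exact hlt t ht h
    · refine LaguerreConverges.of_approx ?_ fun ε hε => ?_
      · refine integrableOn_mul_exp_of_bounded
          (((continuousOn_resolvent one_pos).pow _).mul (continuousOn_resolvent one_pos)) (K := 1)
          fun x hx => ?_
        rw [abs_of_pos (by positivity), ← pow_succ]
        exact pow_le_one₀ (by positivity) (by rw [div_le_one (by positivity)]; linarith)
      -- The witness t = 1/(1+ε) satisfies (1-t)/t = ε, a uniform bound for the difference of the
      -- two resolvents.
      · have ht0 : 0 < 1 / (1 + ε) := by positivity
        refine ⟨_, fun _ => ε, hlt (1 / (1 + ε)) ht0 ?_, LaguerreConverges.const ε, fun x hx => ?_,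
          (integral_const_mul_exp ε).le⟩
        · rw [div_lt_one (by positivity)]; linarith
        · set t := 1 / (1 + ε) with htdef
          have he : (1 - t) / t = ε := by rw [htdef]; field_simp; ring
          have ht1 : t ≤ 1 := by
            rw [htdef, div_le_one (by positivity)]; linarith
          rw [← mul_sub, abs_mul, abs_of_pos (by positivity : 0 < (1 / (x + 1)) ^ (k + 1))]
          have h1 : (1 / (x + 1)) ^ (k + 1) ≤ 1 :=
            pow_le_one₀ (by positivity) (by rw [div_le_one (by positivity)]; linarith)
          have h2 : |1 / (x + 1) - 1 / (x + t)| ≤ ε := by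
            rw [div_sub_div _ _ (by positivity) (by positivity), abs_div,
              show 1 * (x + t) - (x + 1) * 1 = -(1 - t) by ring, abs_neg,
              abs_of_nonneg (by linarith : 0 ≤ 1 - t),
              abs_of_pos (by positivity : 0 < (x + 1) * (x + t)), ← he]
            refine div_le_div_of_nonneg_left (by linarith) ht0 ?_
            nlinarith
          calc _ ≤ 1 * ε := by gcongr
            _ = ε := one_mul ε

theorem LaguerreConverges.polynomial_resolvent (p : Polynomial ℝ) :
    LaguerreConverges fun x => p.eval (1 / (x + 1)) := by
  induction p using Polynomial.induction_on' with
  | add p q hp hq => exact (hp.add hq).congr fun x _ => by rw [Polynomial.eval_add]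
  | monomial n a =>
    rcases n with _ | n
    · exact (LaguerreConverges.const a).congr fun x _ => by simp
    · exact ((LaguerreConverges.pow_resolvent n one_pos le_rfl).const_mul a).congr fun x _ => by
        rw [Polynomial.eval_monomial, pow_succ]

/-- Weierstrass approximation in the variable y = 1/(x+1), which compactifies the half-line. -/
theorem LaguerreConverges.comp_resolvent {φ : ℝ → ℝ} (hφ : ContinuousOn φ (Set.Icc 0 1)) :
    LaguerreConverges fun x => φ (1 / (x + 1)) := by
  have hmem : ∀ x : ℝ, 0 < x → 1 / (x + 1) ∈ Set.Icc (0 : ℝ) 1 := fun x hx =>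
    ⟨by positivity, by rw [div_le_one (by positivity)]; linarith⟩
  obtain ⟨K, hK⟩ := isCompact_Icc.exists_bound_of_continuousOn hφ
  refine LaguerreConverges.of_approx ?_ fun ε hε => ?_
  · exact integrableOn_mul_exp_of_bounded
      (hφ.comp (continuousOn_resolvent one_pos) fun x hx => hmem x hx)
      fun x hx => hK _ (hmem x hx)
  · obtain ⟨p, hp⟩ := exists_polynomial_near_of_continuousOn 0 1 φ hφ ε hε
    refine ⟨_, fun _ => ε, LaguerreConverges.polynomial_resolvent p, LaguerreConverges.const ε,
      fun x hx => ?_, (integral_const_mul_exp ε).le⟩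
    rw [abs_sub_comm]
    exact (hp _ (hmem x hx)).le

end

/-! ### Power singularities and convergence by domination -/

section

theorem integrableOn_rpow_div {p x : ℝ} (hp0 : 0 < p) (hp1 : p < 1) (hx : 0 < x) :
    IntegrableOn (fun t : ℝ => t ^ (p - 1) * (1 / (x + t))) (Set.Ioi 0) := by
  have hmeas : ∀ s ⊆ Set.Ioi (0 : ℝ), MeasurableSet s →
      AEStronglyMeasurable (fun t : ℝ => t ^ (p - 1) * (1 / (x + t))) (volume.restrict s) :=
    fun s hs hsm => by
      refine ContinuousOn.aestronglyMeasurable (fun t ht => ?_) hsm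
      have ht0 : 0 < t := hs ht
      have hxt : x + t ≠ 0 := by positivity
      exact ((Real.continuousAt_rpow_const _ _ (Or.inl ht0.ne')).mul
        (continuousAt_const.div (by fun_prop) hxt)).continuousWithinAt
  rw [← Set.Ioc_union_Ioi_eq_Ioi zero_le_one]
  refine IntegrableOn.union ?_ ?_
  · have h := (intervalIntegral.intervalIntegrable_rpow' (a := 0) (b := 1) (by linarith : -1 < p - 1)).1
    refine Integrable.mono' (h.mul_const (1 / x)) (hmeas _ Set.Ioc_subset_Ioi_self measurableSet_Ioc) ?_
    filter_upwards [ae_restrict_mem measurableSet_Ioc] with t ht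
    have ht0 : 0 < t := ht.1
    rw [Real.norm_of_nonneg (by positivity)]
    gcongr
    linarith
  · have h := integrableOn_Ioi_rpow_of_lt (by linarith : p - 2 < -1) one_pos
    refine Integrable.mono' h (hmeas _ (Set.Ioi_subset_Ioi zero_le_one) measurableSet_Ioi) ?_
    filter_upwards [ae_restrict_mem measurableSet_Ioi] with t ht
    have ht0 : (0 : ℝ) < t := one_pos.trans ht
    rw [Real.norm_of_nonneg (by positivity)]
    calc t ^ (p - 1) * (1 / (x + t)) ≤ t ^ (p - 1) * (1 / t) := by gcongr; linarith
      _ = t ^ (p - 2) := by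
        rw [show p - 2 = p - 1 - 1 by ring, Real.rpow_sub_one ht0.ne' (p - 1), mul_one_div]

theorem integral_rpow_div {p x : ℝ} (hx : 0 < x) :
    ∫ t in Set.Ioi (0 : ℝ), t ^ (p - 1) * (1 / (x + t))
      = x ^ (p - 1) * ∫ t in Set.Ioi (0 : ℝ), t ^ (p - 1) * (1 / (1 + t)) := by
  have h := integral_comp_mul_left_Ioi (fun t : ℝ => t ^ (p - 1) * (1 / (x + t))) 0 hx
  rw [mul_zero, smul_eq_mul, eq_inv_mul_iff_mul_eq₀ hx.ne', ← integral_const_mul] at h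
  rw [← h, ← integral_const_mul]
  refine setIntegral_congr_fun measurableSet_Ioi fun t ht => ?_
  have ht0 : (0 : ℝ) < t := ht
  rw [Real.mul_rpow hx.le ht0.le]
  field_simp

theorem integral_rpow_div_pos {p : ℝ} (hp0 : 0 < p) (hp1 : p < 1) :
    0 < ∫ t in Set.Ioi (0 : ℝ), t ^ (p - 1) * (1 / (1 + t)) := by
  rw [setIntegral_pos_iff_support_of_nonneg_ae ?_ (integrableOn_rpow_div hp0 hp1 one_pos)]
  · have : Set.Ioi (0 : ℝ) ⊆ (Function.support fun t : ℝ => t ^ (p - 1) * (1 / (1 + t))) ∩ Set.Ioi 0 :=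
      fun t ht => by
        have ht0 : (0 : ℝ) < t := ht
        exact ⟨by rw [Function.mem_support]; positivity, ht⟩
    refine lt_of_lt_of_le ?_ (measure_mono this)
    simp
  · filter_upwards [ae_restrict_mem measurableSet_Ioi] with t ht
    have ht0 : (0 : ℝ) < t := ht
    simp only [Pi.zero_apply]
    positivity

/-- By scaling, κ x^(p-1) = ∫ t^(p-1)/(x+t) dt is a positive mixture of resolvents. On each
resolvent the rule never exceeds the integral, and this dominates the passage to the limit under the
integral over t. -/
theorem LaguerreConverges.rpow {p : ℝ} (hp0 : 0 < p) (hp1 : p < 1) :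
    LaguerreConverges fun x => x ^ (p - 1) := by
  set κ := ∫ t in Set.Ioi (0 : ℝ), t ^ (p - 1) * (1 / (1 + t)) with hκ
  have hκ0 : 0 < κ := integral_rpow_div_pos hp0 hp1
  have hint := integrableOn_gamma hp0
  have hprod : Integrable (Function.uncurry fun x t : ℝ => t ^ (p - 1) * (1 / (x + t) * Real.exp (-x)))
      ((volume.restrict (Set.Ioi 0)).prod (volume.restrict (Set.Ioi 0))) := by
    have hm : AEStronglyMeasurable
        (Function.uncurry fun x t : ℝ => t ^ (p - 1) * (1 / (x + t) * Real.exp (-x)))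
        ((volume.restrict (Set.Ioi 0)).prod (volume.restrict (Set.Ioi 0))) := by
      refine Measurable.aestronglyMeasurable ?_
      simp only [Function.uncurry_def]
      fun_prop
    rw [integrable_prod_iff hm]
    refine ⟨?_, ?_⟩
    · filter_upwards [ae_restrict_mem measurableSet_Ioi] with x hx
      refine ((integrableOn_rpow_div hp0 hp1 hx).mul_const (Real.exp (-x))).congr
        (ae_of_all _ fun t => ?_)
      simp only [Function.uncurry_apply_pair]
      ring
    · refine (hint.const_mul κ).congr ?_
      filter_upwards [ae_restrict_mem measurableSet_Ioi] with x hx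
      rw [← mul_assoc, mul_comm κ, hκ, ← integral_rpow_div hx, ← integral_mul_const]
      refine setIntegral_congr_fun measurableSet_Ioi fun t ht => ?_
      have ht0 : (0 : ℝ) < t := ht
      have hx0 : (0 : ℝ) < x := hx
      simp only [Function.uncurry_apply_pair]
      rw [Real.norm_of_nonneg (by positivity)]
      ring
  refine ⟨hint, ?_⟩
  have hE : ∫ t in Set.Ioi (0 : ℝ), t ^ (p - 1) * (∫ x in Set.Ioi (0 : ℝ), 1 / (x + t) * Real.exp (-x))
      = κ * ∫ x in Set.Ioi (0 : ℝ), x ^ (p - 1) * Real.exp (-x) := by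
    have h := integral_integral_swap hprod
    simp only [integral_const_mul] at h
    rw [← h, ← integral_const_mul]
    refine setIntegral_congr_fun measurableSet_Ioi fun x hx => ?_
    rw [← mul_assoc, mul_comm κ, hκ, ← integral_rpow_div hx, ← integral_mul_const]
    refine setIntegral_congr_fun measurableSet_Ioi fun t _ => ?_
    ring
  have hQ : ∀ M, laguerreRule M (fun x => x ^ (p - 1))
      = κ⁻¹ * ∫ t in Set.Ioi (0 : ℝ), t ^ (p - 1) * laguerreRule M fun x => 1 / (x + t) := fun M => by
    rw [eq_inv_mul_iff_mul_eq₀ hκ0.ne', ← laguerreRule_const_mul]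
    have h1 : ∀ t : ℝ, t ^ (p - 1) * laguerreRule M (fun x => 1 / (x + t))
        = ∑ x ∈ laguerreNodes M, laguerreWeight M x * (t ^ (p - 1) * (1 / (x + t))) := fun t => by
      rw [laguerreRule, Finset.mul_sum]
      exact Finset.sum_congr rfl fun x _ => by ring
    simp only [h1]
    rw [integral_finsetSum _ fun x hx =>
      (integrableOn_rpow_div hp0 hp1 (laguerreNodes_pos hx)).const_mul _]
    refine Finset.sum_congr rfl fun x hx => ?_
    simp only
    rw [integral_const_mul, integral_rpow_div (laguerreNodes_pos hx), mul_comm κ]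
  have hlim : Tendsto (fun M => ∫ t in Set.Ioi (0 : ℝ), t ^ (p - 1) * laguerreRule M fun x => 1 / (x + t))
      atTop (𝓝 (κ * ∫ x in Set.Ioi (0 : ℝ), x ^ (p - 1) * Real.exp (-x))) := by
    rw [← hE]
    refine tendsto_integral_filter_of_dominated_convergence
      (fun t => t ^ (p - 1) * ∫ x in Set.Ioi (0 : ℝ), 1 / (x + t) * Real.exp (-x)) ?_ ?_ ?_ ?_
    · refine Eventually.of_forall fun M => Measurable.aestronglyMeasurable ?_
      simp only [laguerreRule]
      fun_prop
    · filter_upwards [eventually_ge_atTop 1] with M hM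
      filter_upwards [ae_restrict_mem measurableSet_Ioi] with t ht
      have ht0 : (0 : ℝ) < t := ht
      have h0 : 0 ≤ laguerreRule M fun x => 1 / (x + t) :=
        Finset.sum_nonneg fun x hx => mul_nonneg (laguerreWeight_nonneg hx) (by
          have := laguerreNodes_pos hx
          positivity)
      rw [Real.norm_of_nonneg (by positivity)]
      exact mul_le_mul_of_nonneg_left (laguerreRule_resolvent hM ht).1 (by positivity)
    · have h := hprod.integral_prod_right
      refine h.congr (ae_of_all _ fun t => ?_)
      simp only [Function.uncurry_apply_pair, integral_const_mul]
    · filter_upwards [ae_restrict_mem measurableSet_Ioi] with t ht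
      exact (LaguerreConverges.resolvent ht).2.const_mul _
  have h := hlim.const_mul κ⁻¹
  rw [inv_mul_cancel_left₀ hκ0.ne'] at h
  exact h.congr fun M => (hQ M).symm

/-- A cutoff of `(0, 1)`: it vanishes outside `(1/k, 1 - 1/k)`. -/
def cutoff (k : ℕ) (y : ℝ) : ℝ := min 1 (max 0 (min (k * y - 1) (k * (1 - y) - 1)))

theorem continuous_cutoff (k : ℕ) : Continuous (cutoff k) := by unfold cutoff; fun_prop

theorem cutoff_nonneg (k : ℕ) (y : ℝ) : 0 ≤ cutoff k y := le_min zero_le_one (le_max_left _ _)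

theorem cutoff_le_one (k : ℕ) (y : ℝ) : cutoff k y ≤ 1 := min_le_left _ _

theorem tendsto_cutoff {y : ℝ} (h0 : 0 < y) (h1 : y < 1) :
    Tendsto (fun k => cutoff k y) atTop (𝓝 1) := by
  refine tendsto_const_nhds.congr' ?_
  have e1 := (tendsto_natCast_atTop_atTop (R := ℝ)).atTop_mul_const h0
  have e2 := (tendsto_natCast_atTop_atTop (R := ℝ)).atTop_mul_const (sub_pos.2 h1)
  filter_upwards [e1.eventually_ge_atTop 2, e2.eventually_ge_atTop 2] with k hk1 hk2
  rw [cutoff, min_eq_left]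
  exact le_max_of_le_right (le_min (by linarith) (by linarith))

/-- Where the cutoff is nonzero, 1/(x+1) lies in [1/k, 1 - 1/k]. Clamping y to this interval makes
the product a continuous function of y on [0, 1]; the interval is nonempty for k ≥ 3. -/
theorem LaguerreConverges.mul_cutoff {F : ℝ → ℝ} (hF : ContinuousOn F (Set.Ioi 0)) {k : ℕ}
    (hk : 3 ≤ k) : LaguerreConverges fun x => F x * cutoff k (1 / (x + 1)) := by
  have hk0 : (3 : ℝ) ≤ k := by exact_mod_cast hk
  set cl : ℝ → ℝ := fun y => max (1 / k) (min y (1 - 1 / k)) with hcl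
  have hinv : (1 : ℝ) / k ≤ 1 / 3 := one_div_le_one_div_of_le (by norm_num) hk0
  have hinv0 : (0 : ℝ) < 1 / k := by positivity
  have hcl0 : ∀ y, 0 < cl y := fun y => lt_of_lt_of_le hinv0 (le_max_left _ _)
  have hcl1 : ∀ y, cl y < 1 := fun y =>
    max_lt (by linarith) ((min_le_right _ _).trans_lt (by linarith))
  have hcont : Continuous cl := by rw [hcl]; fun_prop
  have hφ : Continuous fun y => F (1 / cl y - 1) * cutoff k y := by
    refine (hF.comp_continuous ((continuous_const.div hcont fun y => (hcl0 y).ne').sub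
      continuous_const) fun y => ?_).mul (continuous_cutoff k)
    have := (one_lt_one_div (hcl0 y) (hcl1 y))
    simpa using this
  refine (LaguerreConverges.comp_resolvent hφ.continuousOn).congr fun x hx => ?_
  by_cases h : cutoff k (1 / (x + 1)) = 0
  · simp only [h, mul_zero]
  · have hpos : 0 < min (k * (1 / (x + 1)) - 1) (k * (1 - 1 / (x + 1)) - 1) := by
      by_contra! hle
      exact h (by rw [cutoff, max_eq_left hle]; exact min_eq_right zero_le_one)
    obtain ⟨h1, h2⟩ := lt_min_iff.1 hpos
    have hkpos : (0 : ℝ) < k := by linarith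
    have h3 : 1 / (k : ℝ) ≤ 1 / (x + 1) := by
      rw [div_le_iff₀ hkpos]; linarith
    have h4 : 1 / (k : ℝ) ≤ 1 - 1 / (x + 1) := by
      rw [div_le_iff₀ hkpos]; linarith
    have h5 : cl (1 / (x + 1)) = 1 / (x + 1) := by
      rw [hcl]
      simp only
      rw [min_eq_left (by linarith), max_eq_right h3]
    have h6 : 1 / (1 / (x + 1)) - 1 = x := by rw [one_div_one_div]; ring
    simp only [h5, h6]

/-- F is approximated by its product with the cutoff. The error is at most D times (1 - cutoff); the
rules converge on this bound as well, and its integral tends to 0 by dominated convergence. -/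
theorem LaguerreConverges.of_le {F D : ℝ → ℝ} (hF : ContinuousOn F (Set.Ioi 0))
    (hD : ContinuousOn D (Set.Ioi 0)) (hDc : LaguerreConverges D) (hFD : ∀ x, 0 < x → |F x| ≤ D x) :
    LaguerreConverges F := by
  refine LaguerreConverges.of_approx ?_ fun ε hε => ?_
  · refine Integrable.mono' hDc.1 ((hF.mul (by fun_prop)).aestronglyMeasurable measurableSet_Ioi) ?_
    filter_upwards [ae_restrict_mem measurableSet_Ioi] with x hx
    rw [norm_mul, Real.norm_eq_abs, Real.norm_of_nonneg (Real.exp_pos _).le]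
    exact mul_le_mul_of_nonneg_right (hFD x hx) (Real.exp_pos _).le
  · have hlim : Tendsto (fun k : ℕ => ∫ x in Set.Ioi (0 : ℝ),
        D x * (1 - cutoff k (1 / (x + 1))) * Real.exp (-x)) atTop (𝓝 0) := by
      suffices h : Tendsto (fun k : ℕ => ∫ x in Set.Ioi (0 : ℝ),
          D x * (1 - cutoff k (1 / (x + 1))) * Real.exp (-x)) atTop
          (𝓝 (∫ x in Set.Ioi (0 : ℝ), (0 : ℝ))) by simpa using h
      refine tendsto_integral_filter_of_dominated_convergence
        (fun x => D x * Real.exp (-x)) ?_ ?_ hDc.1 ?_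
      · refine Eventually.of_forall fun k => ContinuousOn.aestronglyMeasurable ?_ measurableSet_Ioi
        exact (hD.mul (continuousOn_const.sub ((continuous_cutoff k).comp_continuousOn
          (continuousOn_resolvent one_pos)))).mul (by fun_prop)
      · refine Eventually.of_forall fun k => ?_
        filter_upwards [ae_restrict_mem measurableSet_Ioi] with x hx
        have h1 := (abs_nonneg _).trans (hFD x hx)
        have h2 := cutoff_nonneg k (1 / (x + 1))
        have h3 := cutoff_le_one k (1 / (x + 1))
        rw [Real.norm_of_nonneg (mul_nonneg (mul_nonneg h1 (by linarith)) (Real.exp_pos _).le)]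
        refine mul_le_mul_of_nonneg_right ?_ (Real.exp_pos _).le
        nlinarith
      · filter_upwards [ae_restrict_mem measurableSet_Ioi] with x hx
        have hx0 : (0 : ℝ) < x := hx
        have h := tendsto_cutoff (y := 1 / (x + 1)) (by positivity)
          (by rw [div_lt_one (by positivity)]; linarith)
        simpa using ((h.const_sub 1).const_mul (D x)).mul_const (Real.exp (-x))
    obtain ⟨k, hk, hk3⟩ := ((hlim.eventually_le_const hε).and (eventually_ge_atTop 3)).exists
    refine ⟨_, fun x => D x * (1 - cutoff k (1 / (x + 1))), LaguerreConverges.mul_cutoff hF hk3,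
      (hDc.sub (LaguerreConverges.mul_cutoff hD hk3)).congr fun x _ => by ring, fun x hx => ?_, hk⟩
    have h3 := cutoff_le_one k (1 / (x + 1))
    rw [← mul_one_sub, abs_mul, abs_of_nonneg (by linarith : 0 ≤ 1 - cutoff k (1 / (x + 1)))]
    exact mul_le_mul_of_nonneg_right (hFD x hx) (by linarith)

/-- Convergence of the Gauss-Laguerre rules on continuous functions with a power bound. -/
theorem LaguerreConverges.of_abs_le_rpow {F : ℝ → ℝ} {K b : ℝ} (hb : 0 < b)
    (hF : ContinuousOn F (Set.Ioi 0)) (hK : ∀ x, 0 < x → |F x| ≤ K * x ^ (b - 1)) :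
    LaguerreConverges F := by
  -- For x ≤ 1 the bound is at most x^(p-1) with 0 < p < 1; for x ≥ 1 it is at most the polynomial
  -- x^⌈b⌉.
  set p := min b (1 / 2) with hp
  have hp0 : 0 < p := lt_min hb (by norm_num)
  have hp1 : p < 1 := (min_le_right _ _).trans_lt (by norm_num)
  have hK0 : 0 ≤ K := by
    have := (abs_nonneg _).trans (hK 1 one_pos)
    simpa using this
  have hD := ((LaguerreConverges.rpow hp0 hp1).add
    ((LaguerreConverges.of_polynomial (Polynomial.X ^ ⌈b⌉₊)))).const_mul K
  refine LaguerreConverges.of_le hF ?_ hD fun x hx => (hK x hx).trans ?_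
  · refine continuousOn_const.mul (ContinuousOn.add (fun x hx => ?_) (by fun_prop))
    exact (Real.continuousAt_rpow_const _ _ (Or.inl (ne_of_gt hx))).continuousWithinAt
  · refine mul_le_mul_of_nonneg_left ?_ hK0
    rw [Polynomial.eval_pow, Polynomial.eval_X, ← Real.rpow_natCast]
    rcases le_total x 1 with h1 | h1
    · have : x ^ (b - 1) ≤ x ^ (p - 1) :=
        Real.rpow_le_rpow_of_exponent_ge hx h1 (by linarith [min_le_left b (1 / 2)])
      linarith [Real.rpow_nonneg hx.le (⌈b⌉₊ : ℝ)]
    · have : x ^ (b - 1) ≤ x ^ (⌈b⌉₊ : ℝ) :=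
        Real.rpow_le_rpow_of_exponent_le h1 (by linarith [Nat.le_ceil b])
      linarith [Real.rpow_nonneg hx.le (p - 1)]

end

section

/-! ### Laws of the marks -/

theorem isProbabilityMeasure_coin {q : ℝ} (hq : q ∈ Set.Icc (0 : ℝ) 1) :
    IsProbabilityMeasure (coin q) := ⟨by
  rw [coin, Measure.add_apply, Measure.smul_apply, Measure.smul_apply, measure_univ, measure_univ,
    smul_eq_mul, smul_eq_mul, mul_one, mul_one, ← ENNReal.ofReal_add hq.1 (by linarith [hq.2])]
  simp⟩

theorem lintegral_coin (q : ℝ) (f : Bool → ℝ≥0∞) :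
    ∫⁻ x, f x ∂(coin q) = ENNReal.ofReal q * f true + ENNReal.ofReal (1 - q) * f false := by
  rw [coin, lintegral_add_measure, lintegral_smul_measure, lintegral_smul_measure, lintegral_dirac,
    lintegral_dirac, smul_eq_mul, smul_eq_mul]

namespace Params

variable (p : Params)

theorem hasDerivAt_exp_sq (x : ℝ) :
    HasDerivAt (fun x => -Real.exp (-(p.xi * Real.pi * x ^ 2)))
      (2 * Real.pi * p.xi * x * Real.exp (-(p.xi * Real.pi * x ^ 2))) x := by
  have h := ((((hasDerivAt_pow 2 x).const_mul (p.xi * Real.pi)).neg).exp).neg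
  refine h.congr_deriv ?_
  simp
  ring

theorem tendsto_exp_sq :
    Tendsto (fun x => -Real.exp (-(p.xi * Real.pi * x ^ 2))) atTop (𝓝 0) := by
  have h : Tendsto (fun x : ℝ => p.xi * Real.pi * x ^ 2) atTop atTop :=
    Tendsto.const_mul_atTop (mul_pos p.xi_pos Real.pi_pos) (tendsto_pow_atTop two_ne_zero)
  simpa using (Real.tendsto_exp_neg_atTop_nhds_zero.comp h).neg

theorem d2dLengthLaw_Ioi {θ : ℝ} (hθ : 0 ≤ θ) :
    p.d2dLengthLaw (Set.Ioi θ) = ENNReal.ofReal (Real.exp (-(p.xi * Real.pi * θ ^ 2))) := by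
  have hnn : ∀ x ∈ Set.Ioi θ, 0 ≤ 2 * Real.pi * p.xi * x * Real.exp (-(p.xi * Real.pi * x ^ 2)) :=
    fun x hx => by
      have hx0 : 0 < x := lt_of_le_of_lt hθ hx
      have := p.xi_pos
      positivity
  have hint := integrableOn_Ioi_deriv_of_nonneg (a := θ)
    (p.hasDerivAt_exp_sq θ).continuousAt.continuousWithinAt (fun x _ => p.hasDerivAt_exp_sq x)
    hnn p.tendsto_exp_sq
  have hval := integral_Ioi_of_hasDerivAt_of_nonneg (a := θ)
    (p.hasDerivAt_exp_sq θ).continuousAt.continuousWithinAt (fun x _ => p.hasDerivAt_exp_sq x)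
    hnn p.tendsto_exp_sq
  rw [zero_sub, neg_neg] at hval
  rw [← hval, ofReal_integral_eq_lintegral_ofReal hint
    ((ae_restrict_iff' measurableSet_Ioi).2 (ae_of_all _ hnn)), d2dLengthLaw,
    withDensity_apply _ measurableSet_Ioi]
  refine setLIntegral_congr_fun measurableSet_Ioi fun x hx => ?_
  rw [if_pos (le_of_lt (lt_of_le_of_lt hθ hx))]

theorem d2dLengthLaw_neg : p.d2dLengthLaw (Set.Iic 0) = 0 := by
  rw [d2dLengthLaw, withDensity_apply _ measurableSet_Iic, lintegral_eq_zero_iff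
      (Measurable.ite measurableSet_Ici (by fun_prop) measurable_const).ennreal_ofReal,
    Filter.EventuallyEq, ae_restrict_iff' measurableSet_Iic]
  refine ae_of_all _ fun x hx => ?_
  rcases (Set.mem_Iic.1 hx).lt_or_eq with h | h
  · simp [not_le.2 h]
  · simp [h]

theorem isProbabilityMeasure_d2dLengthLaw : IsProbabilityMeasure p.d2dLengthLaw := ⟨by
  rw [← Set.Iic_union_Ioi (a := (0 : ℝ)), measure_union (Set.Iic_disjoint_Ioi le_rfl)
    measurableSet_Ioi, p.d2dLengthLaw_neg, p.d2dLengthLaw_Ioi le_rfl]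
  simp⟩

theorem ae_d2dLengthLaw_pos : ∀ᵐ x ∂p.d2dLengthLaw, 0 < x := by
  rw [ae_iff]
  convert p.d2dLengthLaw_neg using 2
  ext; simp

theorem probCell_eq : p.probCell = Real.exp (-(p.xi * Real.pi * p.theta ^ 2)) := by
  rw [probCell, measureReal_def, p.d2dLengthLaw_Ioi p.theta_pos.le,
    ENNReal.toReal_ofReal (Real.exp_pos _).le]

theorem probD2D_eq : p.probD2D = 1 - Real.exp (-(p.xi * Real.pi * p.theta ^ 2)) := by
  have := p.isProbabilityMeasure_d2dLengthLaw
  have h := probReal_add_probReal_compl (μ := p.d2dLengthLaw) (s := Set.Iic p.theta) measurableSet_Iic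
  rw [Set.compl_Iic] at h
  have h2 := p.probCell_eq
  rw [probCell] at h2
  rw [probD2D]
  linarith

/-- Substitution v = ξπx². The second moment occurs because the transmit power L^τ_d enters the
exponent with the power 2/τ_d; its value is 1/(π ξ̂). -/
theorem lintegral_d2dLengthLaw_sq :
    ∫⁻ x, (Set.Iic p.theta).indicator (fun x => ENNReal.ofReal (x ^ 2)) x ∂p.d2dLengthLaw
      = ENNReal.ofReal (lowerGamma 2 (p.xi * Real.pi * p.theta ^ 2) / (p.xi * Real.pi)) := by
  have hk : 0 < p.xi * Real.pi := mul_pos p.xi_pos Real.pi_pos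
  have hsub : ∫ x in (0 : ℝ)..p.theta, x ^ 2 * (2 * Real.pi * p.xi * x
      * Real.exp (-(p.xi * Real.pi * x ^ 2)))
      = lowerGamma 2 (p.xi * Real.pi * p.theta ^ 2) / (p.xi * Real.pi) := by
    have h := intervalIntegral.integral_comp_mul_deriv (a := 0) (b := p.theta)
      (f := fun x => p.xi * Real.pi * x ^ 2) (f' := fun x => p.xi * Real.pi * (2 * x))
      (g := fun v => v * Real.exp (-v)) (fun x _ => by
        simpa using (hasDerivAt_pow 2 x).const_mul (p.xi * Real.pi)) (by fun_prop) (by fun_prop)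
    rw [eq_div_iff hk.ne', ← intervalIntegral.integral_mul_const, lowerGamma]
    have e : ∀ t : ℝ, t ^ ((2 : ℝ) - 1) * Real.exp (-t) = t * Real.exp (-t) := fun t => by
      rw [show (2 : ℝ) - 1 = 1 by norm_num, Real.rpow_one]
    simp only [e]
    rw [show (0 : ℝ) = p.xi * Real.pi * 0 ^ 2 by ring] at h ⊢
    simp only [ne_eq, OfNat.ofNat_ne_zero, not_false_eq_true, zero_pow, mul_zero] at h ⊢
    rw [← h]
    refine intervalIntegral.integral_congr fun x _ => ?_
    simp only [Function.comp_apply]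
    ring
  have hdm : Measurable fun x : ℝ => ENNReal.ofReal (if 0 ≤ x then
      2 * Real.pi * p.xi * x * Real.exp (-(p.xi * Real.pi * x ^ 2)) else 0) :=
    (Measurable.ite measurableSet_Ici (by fun_prop) measurable_const).ennreal_ofReal
  have hm : Measurable fun x : ℝ => (Set.Iic p.theta).indicator (fun x => ENNReal.ofReal (x ^ 2)) x :=
    Measurable.indicator (by fun_prop) measurableSet_Iic
  rw [d2dLengthLaw, lintegral_withDensity_eq_lintegral_mul _ hdm hm, ← hsub,
    intervalIntegral.integral_of_le p.theta_pos.le, ofReal_integral_eq_lintegral_ofReal,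
    ← lintegral_indicator measurableSet_Ioc]
  · refine lintegral_congr fun x => ?_
    rw [Pi.mul_apply]
    by_cases h1 : 0 < x
    · by_cases h2 : x ≤ p.theta
      · rw [if_pos h1.le, Set.indicator_of_mem (Set.mem_Iic.2 h2), Set.indicator_of_mem (Set.mem_Ioc.2 ⟨h1, h2⟩),
          ← ENNReal.ofReal_mul' (by positivity), mul_comm]
      · rw [Set.indicator_of_notMem (by simpa using h2), Set.indicator_of_notMem fun h => h2 h.2,
          mul_zero]
    · rw [Set.indicator_of_notMem fun h : x ∈ Set.Ioc 0 p.theta => h1 h.1]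
      rcases (not_lt.1 h1).lt_or_eq with h3 | h3
      · simp [not_le.2 h3]
      · simp [h3]
  · exact (Continuous.integrableOn_Icc (by fun_prop)).mono_set Set.Ioc_subset_Icc_self
  · filter_upwards [ae_restrict_mem measurableSet_Ioc] with x hx
    have := hx.1
    have := p.xi_pos
    simp only [Pi.zero_apply]
    positivity

theorem R_pos : 0 < p.R := Real.sqrt_pos.2 (by have := p.lamB_pos; positivity)

theorem pi_mul_lamB_mul_R_sq : Real.pi * p.lamB * p.R ^ 2 = 1 := by
  have := p.lamB_pos
  rw [R, Real.sq_sqrt (by positivity)]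
  field_simp

theorem deltaC_pos : 0 < p.deltaC := div_pos two_pos (two_pos.trans p.tauC_gt)

theorem deltaD_pos : 0 < p.deltaD := div_pos two_pos (two_pos.trans p.tauD_gt)

theorem deltaD_lt_one : p.deltaD < 1 := by
  rw [deltaD, div_lt_one (two_pos.trans p.tauD_gt)]; exact p.tauD_gt

/-- The substitution `u = (l / R)^τ_c` in the law of the cellular link length. -/
theorem lintegral_cellLengthLaw {f : ℝ → ℝ} (hf : Measurable f) (hf0 : ∀ u, 0 ≤ f u)
    {B : ℝ} (hB : ∀ u, f u ≤ B) :
    ∫⁻ l, ENNReal.ofReal (f ((l / p.R) ^ p.tauC)) ∂p.cellLengthLaw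
      = ENNReal.ofReal (p.deltaC * ∫ u in Set.Ioc (0 : ℝ) 1, u ^ (p.deltaC - 1) * f u) := by
  have hR := p.R_pos
  have hτ : 0 < p.tauC := two_pos.trans p.tauC_gt
  have hδ := p.deltaC_pos
  set g : ℝ → ℝ := (Set.Ioc (0 : ℝ) 1).indicator fun u => u ^ (p.deltaC - 1) * f u with hg
  have hsub : ∫ l in Set.Ioc (0 : ℝ) p.R, 2 * l / p.R ^ 2 * f ((l / p.R) ^ p.tauC)
      = p.deltaC * ∫ u in Set.Ioc (0 : ℝ) 1, u ^ (p.deltaC - 1) * f u := by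
    have h1 : ∫ u in Set.Ioc (0 : ℝ) 1, u ^ (p.deltaC - 1) * f u = ∫ u in Set.Ioi 0, g u := by
      rw [hg, setIntegral_indicator measurableSet_Ioc,
        Set.inter_eq_self_of_subset_right Set.Ioc_subset_Ioi_self]
    have h2 := integral_comp_mul_left_Ioi (fun x => (p.tauC * x ^ (p.tauC - 1)) • g (x ^ p.tauC))
      0 (inv_pos.2 hR)
    rw [mul_zero, integral_comp_rpow_Ioi_of_pos hτ, inv_inv, ← h1, smul_eq_mul] at h2
    rw [← mul_right_inj' hR.ne', mul_left_comm, ← h2, ← integral_const_mul, ← integral_const_mul,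
      ← Set.inter_eq_self_of_subset_right (Set.Ioc_subset_Ioi_self : Set.Ioc (0 : ℝ) p.R ⊆ Set.Ioi 0),
      ← setIntegral_indicator measurableSet_Ioc]
    refine setIntegral_congr_fun measurableSet_Ioi fun l hl => ?_
    have hl0 : (0 : ℝ) < l := hl
    have hmem : (p.R⁻¹ * l) ^ p.tauC ∈ Set.Ioc (0 : ℝ) 1 ↔ l ∈ Set.Ioc 0 p.R := by
      have h3 : 0 < p.R⁻¹ * l := by positivity
      simp only [Set.mem_Ioc, Real.rpow_pos_of_pos h3, hl0, true_and]
      rw [Real.rpow_le_one_iff_of_pos h3]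
      constructor
      · rintro (⟨h4, h5⟩ | ⟨h4, h5⟩)
        · linarith
        · rwa [inv_mul_le_iff₀ hR, mul_one] at h4
      · intro h4
        right
        exact ⟨by rwa [inv_mul_le_iff₀ hR, mul_one], hτ.le⟩
    by_cases h : l ∈ Set.Ioc 0 p.R
    · rw [Set.indicator_of_mem h, hg, Set.indicator_of_mem (hmem.2 h), smul_eq_mul,
        ← Real.rpow_mul (by positivity), div_eq_inv_mul l]
      have h3 : 0 < p.R⁻¹ * l := by positivity
      have h4 : (p.R⁻¹ * l) ^ (p.tauC - 1) * (p.R⁻¹ * l) ^ (p.tauC * (p.deltaC - 1)) = p.R⁻¹ * l := by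
        rw [← Real.rpow_add h3, show p.tauC - 1 + p.tauC * (p.deltaC - 1) = 1 by
          rw [deltaC]; field_simp; ring, Real.rpow_one]
      calc _ = p.R * (2 * (p.R⁻¹ * (p.R⁻¹ * l)) * f ((p.R⁻¹ * l) ^ p.tauC)) := by
            field_simp
        _ = p.R * (2 * (p.R⁻¹ * ((p.R⁻¹ * l) ^ (p.tauC - 1)
            * (p.R⁻¹ * l) ^ (p.tauC * (p.deltaC - 1)))) * f ((p.R⁻¹ * l) ^ p.tauC)) := by rw [h4]
        _ = _ := by
            rw [deltaC]; field_simp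
    · rw [Set.indicator_of_notMem h, hg, Set.indicator_of_notMem (mt hmem.1 h)]
      simp
  have hdm : Measurable fun x : ℝ => ENNReal.ofReal (if 0 ≤ x ∧ x ≤ p.R then 2 * x / p.R ^ 2 else 0) :=
    (Measurable.ite measurableSet_Icc (by fun_prop) measurable_const).ennreal_ofReal
  rw [cellLengthLaw, lintegral_withDensity_eq_lintegral_mul _ hdm (by fun_prop), ← hsub,
    ofReal_integral_eq_lintegral_ofReal, ← lintegral_indicator measurableSet_Ioc]
  · refine lintegral_congr_ae ?_
    have h0 : ∀ᵐ x : ℝ, x ≠ 0 := by simp [ae_iff]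
    filter_upwards [h0] with l hl
    rw [Pi.mul_apply]
    by_cases h : l ∈ Set.Ioc 0 p.R
    · rw [Set.indicator_of_mem h, if_pos ⟨h.1.le, h.2⟩, ENNReal.ofReal_mul' (hf0 _)]
    · rw [Set.indicator_of_notMem h, if_neg fun h' => h ⟨lt_of_le_of_ne h'.1 hl.symm, h'.2⟩,
        ENNReal.ofReal_zero, zero_mul]
  · refine Integrable.mono' ((by fun_prop : Continuous fun l : ℝ => 2 * l / p.R ^ 2 * B).integrableOn_Icc.mono_set
      Set.Ioc_subset_Icc_self) (by fun_prop) ?_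
    filter_upwards [ae_restrict_mem measurableSet_Ioc] with l hl
    have h1 := hl.1
    have h2 := hf0 ((l / p.R) ^ p.tauC)
    rw [Real.norm_of_nonneg (by positivity)]
    exact mul_le_mul_of_nonneg_left (hB _) (by positivity)
  · filter_upwards [ae_restrict_mem measurableSet_Ioc] with l hl
    have h1 := hl.1
    have h2 := hf0 ((l / p.R) ^ p.tauC)
    simp only [Pi.zero_apply]
    positivity

theorem isProbabilityMeasure_cellLengthLaw : IsProbabilityMeasure p.cellLengthLaw := ⟨by
  have h := p.lintegral_cellLengthLaw (f := fun _ => 1) measurable_const (fun _ => zero_le_one)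
    (B := 1) fun _ => le_rfl
  have hδ := p.deltaC_pos
  have h2 : ∫ u in Set.Ioc (0 : ℝ) 1, u ^ (p.deltaC - 1) * 1 = 1 / p.deltaC := by
    rw [← intervalIntegral.integral_of_le zero_le_one]
    simp only [mul_one]
    rw [integral_rpow (Or.inl (by linarith))]
    simp [hδ.ne']
  rw [h2, mul_one_div_cancel hδ.ne'] at h
  simpa using h⟩

theorem ae_cellLengthLaw : ∀ᵐ x ∂p.cellLengthLaw, x ∈ Set.Icc 0 p.R := by
  rw [cellLengthLaw, ae_withDensity_iff (Measurable.ennreal_ofReal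
    (Measurable.ite measurableSet_Icc (by fun_prop) measurable_const))]
  refine ae_of_all _ fun x hx => ?_
  by_contra h
  exact hx (by rw [if_neg fun h' => h (Set.mem_Icc.2 h'), ENNReal.ofReal_zero])

end Params

/-- The joint law of the marks is the law of a random variable, hence of mass one; this passes the
property on to the fading factor. -/
theorem isProbabilityMeasure_of_prod {α β : Type*} [MeasurableSpace α] [MeasurableSpace β]
    {μ : Measure α} {ν : Measure β} [IsProbabilityMeasure μ] [SFinite ν]
    (h : IsProbabilityMeasure (μ.prod ν)) : IsProbabilityMeasure ν := ⟨by
  have := h.measure_univ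
  rwa [← Set.univ_prod_univ, Measure.prod_prod, measure_univ, one_mul] at this⟩

end

section

/-! ### Interference at the D2D receiver -/

/-- Tonelli, after writing 1 - E as E(1 - ·). With the marks fixed, the integral over the plane can
be computed first. -/
theorem shotExponent_eq {E M : Type*} [MeasurableSpace E] [MeasurableSpace M] {Λ : Measure E}
    [SFinite Λ] {ν : Measure M} [IsProbabilityMeasure ν] {u : E × M → ℝ} (hu : Measurable u) (s : ℝ) :
    shotExponent Λ ν u s
      = ∫⁻ y, ∫⁻ x, 1 - expNeg (ENNReal.ofReal (s * u (x, y))) ∂Λ ∂ν := by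
  have hm : Measurable fun z : E × M => expNeg (ENNReal.ofReal (s * u z)) :=
    measurable_expNeg.comp (hu.const_mul s).ennreal_ofReal
  rw [shotExponent, lintegral_lintegral_swap (measurable_const.sub (hm.comp measurable_swap)).aemeasurable]
  refine lintegral_congr fun x => ?_
  rw [lintegral_sub (f := fun _ => 1) (g := fun y => expNeg (ENNReal.ofReal (s * u (x, y))))
    (hm.comp measurable_prodMk_left), lintegral_one, measure_univ]
  · refine ((lintegral_mono fun y => expNeg_le_one _).trans_lt ?_).ne
    simp
  · exact ae_of_all _ fun y => expNeg_le_one _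

theorem one_sub_exp_neg_eq_lintegral {c : ℝ} (hc : 0 ≤ c) :
    1 - ENNReal.ofReal (Real.exp (-c))
      = ∫⁻ v in Set.Ioi (0 : ℝ), (Set.Iio c).indicator (fun v => ENNReal.ofReal (Real.exp (-v))) v := by
  rw [setLIntegral_indicator measurableSet_Iio, Set.Iio_inter_Ioi, ← ENNReal.ofReal_one,
    ← ENNReal.ofReal_sub _ (Real.exp_pos _).le, setLIntegral_congr Ioo_ae_eq_Ioc,
    ← ofReal_integral_eq_lintegral_ofReal
      ((by fun_prop : Continuous fun v : ℝ => Real.exp (-v)).integrableOn_Icc.mono_set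
        Set.Ioc_subset_Icc_self) (ae_of_all _ fun v => (Real.exp_pos _).le),
    ← intervalIntegral.integral_of_le hc]
  congr 1
  rw [intervalIntegral.integral_comp_neg (fun x => Real.exp x), integral_exp]
  simp

/-- Layer-cake formula: 1 - e^(-c) is the integral of e^(-v) over 0 < v < c. For fixed v the
condition on x describes a disc of area π (A/v)^(2/τ), and the integral over v is Γ(1 - 2/τ), finite
as τ > 2. -/
theorem lintegral_plane_one_sub_exp {A τ : ℝ} (hA : 0 ≤ A) (hτ : 2 < τ) :
    ∫⁻ x : Plane, 1 - ENNReal.ofReal (Real.exp (-(A * ‖x‖ ^ (-τ))))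
      = ENNReal.ofReal (Real.pi * Real.Gamma (1 - 2 / τ) * A ^ (2 / τ)) := by
  have hτ0 : 0 < τ := two_pos.trans hτ
  have hδ1 : 0 < 1 - 2 / τ := by rw [sub_pos, div_lt_one hτ0]; exact hτ
  have hmeas : Measurable fun z : Plane × ℝ =>
      (Set.Iio (A * ‖z.1‖ ^ (-τ))).indicator (fun v => ENNReal.ofReal (Real.exp (-v))) z.2 := by
    have : (fun z : Plane × ℝ => (Set.Iio (A * ‖z.1‖ ^ (-τ))).indicator
        (fun v => ENNReal.ofReal (Real.exp (-v))) z.2)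
        = Set.indicator {z : Plane × ℝ | z.2 < A * ‖z.1‖ ^ (-τ)}
          (fun z => ENNReal.ofReal (Real.exp (-z.2))) := by
      funext z
      simp only [Set.indicator_apply, Set.mem_Iio, Set.mem_ofPred_eq]
    rw [this]
    exact Measurable.indicator (by fun_prop) (measurableSet_lt (by fun_prop) (by fun_prop))
  have h1 : ∀ x : Plane, 1 - ENNReal.ofReal (Real.exp (-(A * ‖x‖ ^ (-τ))))
      = ∫⁻ v in Set.Ioi (0 : ℝ),
        (Set.Iio (A * ‖x‖ ^ (-τ))).indicator (fun v => ENNReal.ofReal (Real.exp (-v))) v :=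
    fun x => one_sub_exp_neg_eq_lintegral (by positivity)
  simp only [h1]
  rw [lintegral_lintegral_swap hmeas.aemeasurable]
  have h2 : ∀ v ∈ Set.Ioi (0 : ℝ), ∫⁻ x : Plane,
      (Set.Iio (A * ‖x‖ ^ (-τ))).indicator (fun v => ENNReal.ofReal (Real.exp (-v))) v
      = ENNReal.ofReal (Real.pi * A ^ (2 / τ) * (v ^ (1 - 2 / τ - 1) * Real.exp (-v))) := fun v hv => by
    have hv0 : (0 : ℝ) < v := hv
    -- By convention `0 ^ (-τ) = 0`, so the origin, a null set, may be wrongly missing from the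
    -- disc.
    have hae : ∀ᵐ x : Plane, x ≠ 0 := by simp [ae_iff]
    have h3 : ∀ᵐ x : Plane,
        (Set.Iio (A * ‖x‖ ^ (-τ))).indicator (fun v => ENNReal.ofReal (Real.exp (-v))) v
        = (Metric.ball (0 : Plane) ((A / v) ^ (1 / τ))).indicator
          (fun _ => ENNReal.ofReal (Real.exp (-v))) x := by
      filter_upwards [hae] with x hx
      have hx0 : 0 < ‖x‖ := norm_pos_iff.2 hx
      have hiff : v < A * ‖x‖ ^ (-τ) ↔ x ∈ Metric.ball (0 : Plane) ((A / v) ^ (1 / τ)) := by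
        rw [mem_ball_zero_iff, Real.rpow_neg hx0.le, ← div_eq_mul_inv,
          lt_div_iff₀ (Real.rpow_pos_of_pos hx0 _), ← lt_div_iff₀' hv0,
          ← Real.rpow_lt_rpow_iff (x := ‖x‖) hx0.le (by positivity) hτ0,
          ← Real.rpow_mul (by positivity), one_div_mul_cancel hτ0.ne', Real.rpow_one]
      by_cases h : v < A * ‖x‖ ^ (-τ)
      · rw [Set.indicator_of_mem (Set.mem_Iio.2 h), Set.indicator_of_mem (hiff.1 h)]
      · rw [Set.indicator_of_notMem (mt Set.mem_Iio.1 h), Set.indicator_of_notMem (mt hiff.2 h)]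
    rw [lintegral_congr_ae h3, lintegral_indicator_const Metric.isOpen_ball.measurableSet,
      EuclideanSpace.volume_ball_fin_two, ← ENNReal.ofReal_pow (by positivity)]
    have h4 : ((A / v) ^ (1 / τ)) ^ 2 = A ^ (2 / τ) * v ^ (-(2 / τ)) := by
      rw [← Real.rpow_natCast, ← Real.rpow_mul (by positivity), Real.div_rpow hA hv0.le,
        Real.rpow_neg hv0.le, div_eq_mul_inv]
      congr 2
      · push_cast; ring
      · push_cast; ring_nf
    rw [h4, ← ENNReal.ofReal_mul (by positivity),
      ← ENNReal.ofReal_mul (by positivity)]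
    congr 1
    rw [show (1 : ℝ) - 2 / τ - 1 = -(2 / τ) by ring]
    ring
  rw [setLIntegral_congr_fun measurableSet_Ioi h2, ← ofReal_integral_eq_lintegral_ofReal
    ((integrableOn_gamma hδ1).const_mul _), integral_const_mul]
  · rw [Real.Gamma_eq_integral hδ1]
    congr 1
    simp only [mul_comm (Real.exp _)]
    ring
  · filter_upwards [ae_restrict_mem measurableSet_Ioi] with v hv
    have hv0 : (0 : ℝ) < v := hv
    simp only [Pi.zero_apply]
    positivity

/-! ### The constant of the D2D mode -/

theorem eval_ascPochhammer {a : ℝ} (ha : 0 < a) (n : ℕ) :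
    (ascPochhammer ℝ n).eval a = Real.Gamma (a + n) / Real.Gamma a := by
  have hΓ := (Real.Gamma_pos_of_pos ha).ne'
  induction n with
  | zero => simp [hΓ]
  | succ n ih =>
    rw [ascPochhammer_succ_eval, ih, Nat.cast_succ, ← add_assoc,
      Real.Gamma_add_one (by positivity : a + n ≠ 0)]
    ring

theorem one_div_nsinc {δ : ℝ} (h0 : 0 < δ) (h1 : δ < 1) :
    1 / nsinc δ = Real.Gamma (1 - δ) * Real.Gamma (δ + 1) := by
  have h := Real.Gamma_mul_Gamma_one_sub δ
  have hsin : 0 < Real.sin (Real.pi * δ) :=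
    Real.sin_pos_of_pos_of_lt_pi (by positivity) (by nlinarith [Real.pi_pos])
  rw [nsinc, Real.sinc_of_ne_zero (by positivity), Real.Gamma_add_one h0.ne',
    show Real.Gamma (1 - δ) * (δ * Real.Gamma δ) = δ * (Real.Gamma δ * Real.Gamma (1 - δ)) by ring,
    h, one_div_div]
  ring

/-- The closed form is unfolded into the factors the computation yields. The reflection formula
turns 1/sinc into Γ(1-δ)Γ(1+δ), and the hypergeometric series are the series for E[G^δ] over the
gamma mixture. -/
theorem d2dConst_eq (p : Params) {F : Fading} (hF : F.Valid) :
    d2dConst p F = p.lam * (Real.pi * Real.Gamma (1 - p.deltaD)) * p.q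
      * (lowerGamma 2 (p.xi * Real.pi * p.theta ^ 2) / (p.xi * Real.pi)) * p.eps
      * (F.scale ^ p.deltaD * ∑' n, F.coeff n *
        (Real.Gamma (F.order n + p.deltaD) / Real.Gamma (F.order n))) := by
  set δ := p.deltaD with hδ
  have hδ0 : 0 < δ := p.deltaD_pos
  have hsinc := one_div_nsinc hδ0 p.deltaD_lt_one
  have hG1 := Real.Gamma_pos_of_pos (by positivity : 0 < δ + 1)
  have hxi := p.xi_pos
  cases F with
  | kappaMu κ μ w =>
    obtain ⟨hκ, hμ, hw⟩ := hF
    have hGμ := Real.Gamma_pos_of_pos hμ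
    have hGμδ := Real.Gamma_pos_of_pos (by positivity : 0 < μ + δ)
    have hsum : hyp1F1 (μ + δ) μ (μ * κ) = Real.exp (μ * κ) * (Real.Gamma μ / Real.Gamma (μ + δ))
        * ∑' n, Fading.coeff (.kappaMu κ μ w) n * (Real.Gamma (Fading.order (.kappaMu κ μ w) n + δ)
          / Real.Gamma (Fading.order (.kappaMu κ μ w) n)) := by
      rw [hyp1F1, ← tsum_mul_left]
      refine tsum_congr fun n => ?_
      have := Real.Gamma_pos_of_pos (by positivity : 0 < μ + n)
      rw [eval_ascPochhammer (by positivity), eval_ascPochhammer hμ, Fading.coeff, Fading.order,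
        show μ + δ + n = μ + n + δ by ring]
      have := Real.exp_pos (μ * κ)
      field_simp
    rw [d2dConst, hsum, div_eq_mul_one_div _ (nsinc _), hsinc, gbinom, xiHat, Fading.scale,
      show μ + p.deltaD - 1 + 1 = μ + δ by rw [hδ]; ring,
      show μ + p.deltaD - 1 - p.deltaD + 1 = μ by ring, mul_comm (1 + κ) μ]
    simp only [← hδ]
    have := Real.exp_pos (μ * κ)
    field_simp
  | etaMu η μ w =>
    obtain ⟨hη, hμ, hw⟩ := hF
    have hGμ := Real.Gamma_pos_of_pos (by positivity : 0 < 2 * μ)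
    have hGμδ := Real.Gamma_pos_of_pos (by positivity : 0 < 2 * μ + δ)
    have hh := Fading.hPar_pos hη
    -- Duplication for rising factorials: those of y and y + 1/2 of order n combine to 4^(-n) times
    -- that of 2y of order 2n. It is used at y = μ + δ/2 and at y = μ.
    have hdup : ∀ y : ℝ, 0 < y → ∀ n : ℕ, Real.Gamma (y + n) / Real.Gamma y
        * (Real.Gamma (y + 1 / 2 + n) / Real.Gamma (y + 1 / 2))
        = Real.Gamma (2 * y + 2 * n) / Real.Gamma (2 * y) * 2 ^ (-(2 * (n : ℝ))) := fun y hy n => by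
      have h1 := Real.Gamma_mul_Gamma_add_half (y + n)
      have h2 := Real.Gamma_mul_Gamma_add_half y
      have e1 := Real.Gamma_pos_of_pos hy
      have e2 := Real.Gamma_pos_of_pos (by positivity : 0 < y + 1 / 2)
      have e3 := Real.Gamma_pos_of_pos (by positivity : 0 < 2 * y)
      rw [show y + 1 / 2 + n = y + n + 1 / 2 by ring, div_mul_div_comm, h1, h2,
        show 2 * (y + n) = 2 * y + 2 * n by ring,
        show 1 - (2 * y + 2 * n) = 1 - 2 * y + -(2 * (n : ℝ)) by ring, Real.rpow_add two_pos]
      have e4 : (0 : ℝ) < 2 ^ (1 - 2 * y) := by positivity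
      have e5 : 0 < √Real.pi := by positivity
      field_simp
    have hsum : ₂F₁ (μ + δ / 2 + 1 / 2) (μ + δ / 2) (μ + 1 / 2)
          ((Fading.HPar η / Fading.hPar η) ^ 2)
        = Fading.hPar η ^ μ * (Real.Gamma (2 * μ) / Real.Gamma (2 * μ + δ))
        * ∑' n, Fading.coeff (.etaMu η μ w) n * (Real.Gamma (Fading.order (.etaMu η μ w) n + δ)
          / Real.Gamma (Fading.order (.etaMu η μ w) n)) := by
      rw [ordinaryHypergeometric_eq_tsum, ← tsum_mul_left]
      refine tsum_congr fun n => ?_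
      have h1 := hdup (μ + δ / 2) (by positivity) n
      have h2 := hdup μ hμ n
      have e1 := Real.Gamma_pos_of_pos (by positivity : 0 < 2 * μ + 2 * (n : ℝ))
      have e2 := Real.Gamma_pos_of_pos (by positivity : 0 < μ + (n : ℝ))
      have e3 := Real.Gamma_pos_of_pos hμ
      have e4 := Real.Gamma_pos_of_pos (by positivity : 0 < μ + 1 / 2 + (n : ℝ))
      have e5 := Real.Gamma_pos_of_pos (by positivity : 0 < μ + 1 / 2)
      have e6 : (0 : ℝ) < 2 ^ (-(2 * (n : ℝ))) := by positivity
      have e7 : 0 < Fading.hPar η ^ μ := Real.rpow_pos_of_pos hh _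
      rw [smul_eq_mul, eval_ascPochhammer (by positivity), eval_ascPochhammer (by positivity),
        eval_ascPochhammer (by positivity), Fading.coeff_etaMu hη, Fading.order, add_comm (n : ℝ) μ,
        mul_assoc ((n.factorial : ℝ)⁻¹), mul_comm (Real.Gamma (μ + δ / 2 + 1 / 2 + n) / _), h1]
      rw [← eq_div_iff (by positivity)] at h2
      rw [div_eq_iff (by positivity)] at h2
      rw [show (Real.Gamma (μ + 1 / 2 + n) / Real.Gamma (μ + 1 / 2))⁻¹
        = Real.Gamma (μ + n) / Real.Gamma μ * (Real.Gamma (2 * μ) / Real.Gamma (2 * μ + 2 * n))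
          / 2 ^ (-(2 * (n : ℝ))) by
        rw [h2]; field_simp]
      rw [show 2 * (μ + δ / 2) + 2 * (n : ℝ) = 2 * μ + 2 * n + δ by ring,
        show 2 * (μ + δ / 2) = 2 * μ + δ by ring]
      field_simp
    rw [d2dConst, hsum, div_eq_mul_one_div _ (nsinc _), hsinc, gbinom, xiHat, Fading.scale,
      show 2 * μ + p.deltaD - 1 + 1 = 2 * μ + δ by rw [hδ]; ring,
      show 2 * μ + p.deltaD - 1 - p.deltaD + 1 = 2 * μ by ring]
    simp only [← hδ]
    have e7 : 0 < Fading.hPar η ^ μ := Real.rpow_pos_of_pos hh _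
    field_simp

end

/-! ### The Laplace transform of the D2D interference -/

section

/-- The contribution to the D2D interference of a UE at `z.1` with marks `z.2`. -/
def d2dPower (p : Params) (z : Plane × Bool × ℝ × Bool × ℝ) : ℝ :=
  if z.2.1 = true ∧ z.2.2.1 ≤ p.theta ∧ z.2.2.2.1 = true then
    z.2.2.1 ^ p.tauD * z.2.2.2.2 * ‖z.1‖ ^ (-p.tauD)
  else 0

/-- The law of the marks of a UE in the D2D model. -/
def d2dMarkLaw (p : Params) (F : Fading) : Measure (Bool × ℝ × Bool × ℝ) :=
  (coin p.q).prod (p.d2dLengthLaw.prod ((coin p.eps).prod F.law))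

theorem measurable_d2dPower (p : Params) : Measurable (d2dPower p) := by
  refine Measurable.ite ?_ (by fun_prop) measurable_const
  refine MeasurableSet.inter ?_ (MeasurableSet.inter ?_ ?_)
  · exact (measurable_fst.comp measurable_snd) (measurableSet_singleton true)
  · exact measurableSet_le (measurable_fst.comp (measurable_snd.comp measurable_snd)) measurable_const
  · exact (measurable_fst.comp (measurable_snd.comp (measurable_snd.comp measurable_snd)))
      (measurableSet_singleton true)

instance sfinite_law (F : Fading) : SFinite F.law := by
  unfold Fading.law; infer_instance

theorem ae_d2dMarkLaw (p : Params) {F : Fading} (hF : F.Valid) :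
    ∀ᵐ y ∂d2dMarkLaw p F, 0 < y.2.1 ∧ 0 < y.2.2.2 := by
  have := isProbabilityMeasure_coin p.q_mem
  have := isProbabilityMeasure_coin p.eps_mem
  have := p.isProbabilityMeasure_d2dLengthLaw
  have h2 : ∀ᵐ y ∂((coin p.eps).prod F.law), 0 < y.2 :=
    Measure.quasiMeasurePreserving_snd.ae hF.ae_pos
  have h1 : ∀ᵐ y ∂(p.d2dLengthLaw.prod ((coin p.eps).prod F.law)), 0 < y.1 ∧ 0 < y.2.2 := by
    filter_upwards [Measure.quasiMeasurePreserving_fst.ae p.ae_d2dLengthLaw_pos,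
      Measure.quasiMeasurePreserving_snd.ae h2] with y h h' using ⟨h, h'⟩
  exact Measure.quasiMeasurePreserving_snd.ae h1

/-- With A = s L^τ_d G one has A^δ_d = s^δ_d L² G^δ_d: one factor for each mark, so the mean over
the independent marks will be a product. -/
theorem lintegral_plane_d2dPower (p : Params) {s : ℝ} (hs : 0 ≤ s) {y : Bool × ℝ × Bool × ℝ}
    (hL : 0 < y.2.1) (hG : 0 < y.2.2.2) :
    ∫⁻ x, 1 - expNeg (ENNReal.ofReal (s * d2dPower p (x, y)))
        ∂(ENNReal.ofReal p.lam • (volume : Measure Plane))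
      = ENNReal.ofReal (p.lam * (Real.pi * Real.Gamma (1 - p.deltaD)) * s ^ p.deltaD)
        * ((if y.1 then 1 else 0) * ((Set.Iic p.theta).indicator (fun x => ENNReal.ofReal (x ^ 2)) y.2.1
          * ((if y.2.2.1 then 1 else 0) * ENNReal.ofReal (y.2.2.2 ^ p.deltaD)))) := by
  obtain ⟨ty, L, act, G⟩ := y
  simp only at hL hG
  have hτ0 : 0 < p.tauD := two_pos.trans p.tauD_gt
  have hδ0 := p.deltaD_pos
  have hlam := p.lam_pos
  have hΓ := Real.Gamma_pos_of_pos (sub_pos.2 p.deltaD_lt_one)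
  rw [lintegral_smul_measure, smul_eq_mul]
  by_cases h : ty = true ∧ L ≤ p.theta ∧ act = true
  · obtain ⟨rfl, h2, rfl⟩ := h
    have h3 : ∀ x : Plane, 1 - expNeg (ENNReal.ofReal (s * d2dPower p (x, true, L, true, G)))
        = 1 - ENNReal.ofReal (Real.exp (-((s * (L ^ p.tauD * G)) * ‖x‖ ^ (-p.tauD)))) := fun x => by
      rw [d2dPower, if_pos ⟨rfl, h2, rfl⟩, expNeg_ofReal (by positivity), ← mul_assoc]
    simp only [h3]
    rw [lintegral_plane_one_sub_exp (by positivity) p.tauD_gt, ← Params.deltaD,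
      Set.indicator_of_mem (Set.mem_Iic.2 h2)]
    simp only [if_true, one_mul]
    rw [← ENNReal.ofReal_mul (by positivity), ← ENNReal.ofReal_mul (by positivity),
      ← ENNReal.ofReal_mul (by positivity), Real.mul_rpow hs (by positivity),
      Real.mul_rpow (by positivity) hG.le, ← Real.rpow_mul hL.le,
      show p.tauD * p.deltaD = (2 : ℕ) by rw [Params.deltaD]; push_cast; field_simp,
      Real.rpow_natCast]
    congr 1
    ring
  · have h3 : ∀ x : Plane, 1 - expNeg (ENNReal.ofReal (s * d2dPower p (x, ty, L, act, G))) = 0 :=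
      fun x => by
        rw [d2dPower, if_neg h, mul_zero, ENNReal.ofReal_zero, expNeg_zero, tsub_self]
    simp only [h3, lintegral_zero, mul_zero]
    rw [eq_comm, mul_eq_zero]
    right
    by_cases h1 : ty = true
    · by_cases h2 : L ≤ p.theta
      · by_cases h4 : act = true
        · exact (h ⟨h1, h2, h4⟩).elim
        · simp [h4]
      · rw [Set.indicator_of_notMem (mt Set.mem_Iic.1 h2)]
        simp
    · simp [h1]

theorem d2dConst_nonneg (p : Params) {F : Fading} (hF : F.Valid) : 0 ≤ d2dConst p F := by
  rw [d2dConst_eq p hF]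
  have h1 := Real.Gamma_pos_of_pos (sub_pos.2 p.deltaD_lt_one)
  have h2 := p.lam_pos
  have h3 := p.q_mem.1
  have h4 := p.eps_mem.1
  have h5 := p.xi_pos
  have h6 := hF.scale_pos
  have h7 : 0 ≤ ∑' n, F.coeff n * (Real.Gamma (F.order n + p.deltaD) / Real.Gamma (F.order n)) :=
    tsum_nonneg fun n => mul_nonneg (hF.coeff_nonneg n)
      (div_nonneg (Real.Gamma_pos_of_pos (add_pos (hF.order_pos n) p.deltaD_pos)).le
        (Real.Gamma_pos_of_pos (hF.order_pos n)).le)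
  have h8 : 0 ≤ lowerGamma 2 (p.xi * Real.pi * p.theta ^ 2) :=
    intervalIntegral.integral_nonneg (by positivity) fun t ht =>
      mul_nonneg (Real.rpow_nonneg ht.1 _) (Real.exp_pos _).le
  positivity

theorem shotExponent_d2dPower (p : Params) {F : Fading} (hF : F.Valid) [IsProbabilityMeasure F.law]
    {s : ℝ} (hs : 0 ≤ s) :
    shotExponent (ENNReal.ofReal p.lam • (volume : Measure Plane)) (d2dMarkLaw p F) (d2dPower p) s
      = ENNReal.ofReal (d2dConst p F * s ^ p.deltaD) := by
  have := isProbabilityMeasure_coin p.q_mem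
  have := isProbabilityMeasure_coin p.eps_mem
  have := p.isProbabilityMeasure_d2dLengthLaw
  have : IsProbabilityMeasure (d2dMarkLaw p F) := by unfold d2dMarkLaw; infer_instance
  have : SFinite (ENNReal.ofReal p.lam • (volume : Measure Plane)) := by infer_instance
  have hlam := p.lam_pos
  have hΓ := Real.Gamma_pos_of_pos (sub_pos.2 p.deltaD_lt_one)
  rw [shotExponent_eq (measurable_d2dPower p)]
  have hae : ∀ᵐ y ∂d2dMarkLaw p F, ∫⁻ x, 1 - expNeg (ENNReal.ofReal (s * d2dPower p (x, y)))
        ∂(ENNReal.ofReal p.lam • (volume : Measure Plane))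
      = ENNReal.ofReal (p.lam * (Real.pi * Real.Gamma (1 - p.deltaD)) * s ^ p.deltaD)
        * ((if y.1 then 1 else 0) * ((Set.Iic p.theta).indicator (fun x => ENNReal.ofReal (x ^ 2)) y.2.1
          * ((if y.2.2.1 then 1 else 0) * ENNReal.ofReal (y.2.2.2 ^ p.deltaD)))) := by
    filter_upwards [ae_d2dMarkLaw p hF] with y hy
    exact lintegral_plane_d2dPower p hs hy.1 hy.2
  have hm1 : Measurable fun b : Bool => (if b then 1 else 0 : ℝ≥0∞) := measurable_of_finite _
  have hm2 : Measurable ((Set.Iic p.theta).indicator fun x => ENNReal.ofReal (x ^ 2)) :=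
    Measurable.indicator (by fun_prop) measurableSet_Iic
  have hm3 : Measurable fun z : Bool × ℝ => (if z.1 then 1 else 0 : ℝ≥0∞)
      * ENNReal.ofReal (z.2 ^ p.deltaD) := (hm1.comp measurable_fst).mul (by fun_prop)
  have hm4 : Measurable fun z : ℝ × Bool × ℝ =>
      (Set.Iic p.theta).indicator (fun x => ENNReal.ofReal (x ^ 2)) z.1
        * ((if z.2.1 then 1 else 0 : ℝ≥0∞) * ENNReal.ofReal (z.2.2 ^ p.deltaD)) :=
    (hm2.comp measurable_fst).mul (hm3.comp measurable_snd)
  have hm5 : Measurable fun y : Bool × ℝ × Bool × ℝ => (if y.1 then 1 else 0 : ℝ≥0∞)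
      * ((Set.Iic p.theta).indicator (fun x => ENNReal.ofReal (x ^ 2)) y.2.1
        * ((if y.2.2.1 then 1 else 0) * ENNReal.ofReal (y.2.2.2 ^ p.deltaD))) :=
    (hm1.comp measurable_fst).mul (hm4.comp measurable_snd)
  rw [lintegral_congr_ae hae, lintegral_const_mul _ hm5, d2dMarkLaw,
    lintegral_prod_mul (f := fun b : Bool => (if b then 1 else 0 : ℝ≥0∞))
      hm1.aemeasurable hm4.aemeasurable,
    lintegral_prod_mul (g := fun z : Bool × ℝ => (if z.1 then 1 else 0 : ℝ≥0∞)
      * ENNReal.ofReal (z.2 ^ p.deltaD)) hm2.aemeasurable hm3.aemeasurable,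
    lintegral_prod_mul (f := fun b : Bool => (if b then 1 else 0 : ℝ≥0∞))
      (g := fun x : ℝ => ENNReal.ofReal (x ^ p.deltaD)) hm1.aemeasurable (by fun_prop),
    lintegral_coin, lintegral_coin, p.lintegral_d2dLengthLaw_sq, hF.lintegral_rpow p.deltaD_pos.le]
  simp only [if_true, mul_one, Bool.false_eq_true, if_false, mul_zero, add_zero]
  have h8 : 0 ≤ lowerGamma 2 (p.xi * Real.pi * p.theta ^ 2) :=
    intervalIntegral.integral_nonneg (by have := p.xi_pos; positivity) fun t ht =>
      mul_nonneg (Real.rpow_nonneg ht.1 _) (Real.exp_pos _).le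
  have hxi := p.xi_pos
  have hq := p.q_mem.1
  rw [← ENNReal.ofReal_mul p.eps_mem.1, ← ENNReal.ofReal_mul (by positivity),
    ← ENNReal.ofReal_mul hq, ← ENNReal.ofReal_mul (by positivity), d2dConst_eq p hF]
  congr 1
  ring

section

variable {Ω : Type*} [MeasurableSpace Ω] {P : Measure Ω} [IsProbabilityMeasure P] {p : Params}
  {FW FI : Fading} {X : ℕ → Ω → Plane} {ty : ℕ → Ω → Bool} {L : ℕ → Ω → ℝ} {act : ℕ → Ω → Bool}
  {G : ℕ → Ω → ℝ} {W : Ω → ℝ}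

theorem tendsto_ofReal_mul_rpow (c : ℝ) {δ : ℝ} (hδ : 0 < δ) :
    Tendsto (fun s : ℝ => ENNReal.ofReal (c * s ^ δ)) (𝓝[>] 0) (𝓝 0) := by
  have h : Tendsto (fun s : ℝ => c * s ^ δ) (𝓝[>] 0) (𝓝 (c * 0 ^ δ)) :=
    ((Real.continuousAt_rpow_const _ _ (Or.inr hδ.le)).tendsto.mono_left nhdsWithin_le_nhds).const_mul c
  rw [Real.zero_rpow hδ.ne', mul_zero] at h
  simpa using ENNReal.tendsto_ofReal h

theorem sigmaFinite_ofReal_smul {E : Type*} [MeasurableSpace E] (c : ℝ) (Λ : Measure E)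
    [SigmaFinite Λ] : SigmaFinite (ENNReal.ofReal c • Λ) :=
  inferInstanceAs (SigmaFinite (Real.toNNReal c • Λ))

theorem IsD2DLink.isProbabilityMeasure_law (h : IsD2DLink P p FW FI X ty L act G W) :
    IsProbabilityMeasure FI.law := by
  have := isProbabilityMeasure_coin p.q_mem
  have := isProbabilityMeasure_coin p.eps_mem
  have := p.isProbabilityMeasure_d2dLengthLaw
  have h1 := (h.marks_law 0).isProbabilityMeasure_iff.1 inferInstance
  exact isProbabilityMeasure_of_prod (isProbabilityMeasure_of_prod (isProbabilityMeasure_of_prod h1))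

theorem IsD2DLink.interference (h : IsD2DLink P p FW FI X ty L act G W) (hF : FI.Valid) :
    (∀ᵐ ω ∂P, Summable (d2dInterferenceTerm p X ty L act G ω)) ∧
      AEMeasurable (d2dInterference p X ty L act G) P ∧
      (∀ᵐ ω ∂P, 0 ≤ d2dInterference p X ty L act G ω) ∧
      ∀ s, 0 ≤ s → laplace P (d2dInterference p X ty L act G) s
        = Real.exp (-(d2dConst p FI * s ^ p.deltaD)) := by
  have := isProbabilityMeasure_coin p.q_mem
  have := isProbabilityMeasure_coin p.eps_mem
  have := p.isProbabilityMeasure_d2dLengthLaw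
  have := h.isProbabilityMeasure_law
  have : IsProbabilityMeasure (d2dMarkLaw p FI) := by unfold d2dMarkLaw; infer_instance
  have := sigmaFinite_ofReal_smul p.lam (volume : Measure Plane)
  have hu0 : ∀ᵐ y ∂d2dMarkLaw p FI, ∀ x, 0 ≤ d2dPower p (x, y) := by
    filter_upwards [ae_d2dMarkLaw p hF] with y hy x
    have h1 := hy.1
    have h2 := hy.2
    rw [d2dPower]
    split_ifs
    · positivity
    · exact le_rfl
  have hJ : Tendsto (shotExponent (ENNReal.ofReal p.lam • (volume : Measure Plane)) (d2dMarkLaw p FI)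
      (d2dPower p)) (𝓝[>] 0) (𝓝 0) := by
    refine (tendsto_ofReal_mul_rpow (d2dConst p FI) p.deltaD_pos).congr' ?_
    filter_upwards [self_mem_nhdsWithin] with s hs
    exact (shotExponent_d2dPower p hF (le_of_lt hs)).symm
  obtain ⟨h1, h2, h3, h4⟩ := h.points.shotNoise (ν := d2dMarkLaw p FI) h.marks_law h.marks_indep
    h.points_marks (measurable_d2dPower p) hu0 hJ
  refine ⟨h1, h2, h3, fun s hs => ?_⟩
  rcases hs.eq_or_lt with rfl | hs0
  · simp [laplace, Real.zero_rpow p.deltaD_pos.ne']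
  · refine (h4 s hs0).trans ?_
    rw [shotExponent_d2dPower p hF hs, expNeg_ofReal (mul_nonneg (d2dConst_nonneg p hF)
      (Real.rpow_nonneg hs _)), ENNReal.toReal_ofReal (Real.exp_pos _).le]

end

end

section

/-! ### Interference at the base station -/

/-- The contribution to the cellular interference of a transmitter at `z.1` with marks `z.2`. -/
def cellPower (p : Params) (z : Plane × ℝ × ℝ) : ℝ :=
  if p.R ≤ ‖z.1‖ then z.2.1 ^ p.tauC * z.2.2 * ‖z.1‖ ^ (-p.tauC) else 0

/-- The law of the marks of a transmitter in the cellular model. -/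
def cellMarkLaw (p : Params) (F : Fading) : Measure (ℝ × ℝ) := p.cellLengthLaw.prod F.law

/-- The Laplace transform of the power received from a transmitter at distance `r`. -/
def cellLap (p : Params) (F : Fading) (s r : ℝ) : ℝ :=
  (∫⁻ y, expNeg (ENNReal.ofReal (s * (y.1 ^ p.tauC * y.2 * r ^ (-p.tauC)))) ∂cellMarkLaw p F).toReal

theorem measurable_cellPower (p : Params) : Measurable (cellPower p) :=
  Measurable.ite (measurableSet_le measurable_const (by fun_prop)) (by fun_prop) measurable_const

section

variable (p : Params) {F : Fading}

theorem isProbabilityMeasure_cellMarkLaw [IsProbabilityMeasure F.law] :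
    IsProbabilityMeasure (cellMarkLaw p F) := by
  have := p.isProbabilityMeasure_cellLengthLaw
  unfold cellMarkLaw
  infer_instance

theorem ae_cellMarkLaw (hF : F.Valid) :
    ∀ᵐ y ∂cellMarkLaw p F, (0 ≤ y.1 ∧ y.1 ≤ p.R) ∧ 0 < y.2 := by
  have := p.isProbabilityMeasure_cellLengthLaw
  filter_upwards [Measure.quasiMeasurePreserving_fst.ae p.ae_cellLengthLaw,
    Measure.quasiMeasurePreserving_snd.ae hF.ae_pos] with y h h' using ⟨h, h'⟩

theorem ofReal_cellLap [IsProbabilityMeasure F.law] (s r : ℝ) :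
    ENNReal.ofReal (cellLap p F s r)
      = ∫⁻ y, expNeg (ENNReal.ofReal (s * (y.1 ^ p.tauC * y.2 * r ^ (-p.tauC)))) ∂cellMarkLaw p F := by
  have := isProbabilityMeasure_cellMarkLaw p (F := F)
  refine ENNReal.ofReal_toReal ((lintegral_mono fun y => expNeg_le_one _).trans_lt ?_).ne
  simp

theorem cellLap_nonneg (s r : ℝ) : 0 ≤ cellLap p F s r := ENNReal.toReal_nonneg

theorem cellLap_le_one [IsProbabilityMeasure F.law] (s r : ℝ) : cellLap p F s r ≤ 1 := by
  have := isProbabilityMeasure_cellMarkLaw p (F := F)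
  rw [← ENNReal.ofReal_le_one, ofReal_cellLap]
  exact (lintegral_mono fun y => expNeg_le_one _).trans (by simp)

theorem measurable_cellLap (s : ℝ) : Measurable (cellLap p F s) := by
  have : SFinite (cellMarkLaw p F) := by
    have := p.isProbabilityMeasure_cellLengthLaw
    unfold cellMarkLaw
    infer_instance
  refine (Measurable.lintegral_prod_right' (f := fun z : ℝ × ℝ × ℝ =>
    expNeg (ENNReal.ofReal (s * (z.2.1 ^ p.tauC * z.2.2 * z.1 ^ (-p.tauC))))) ?_).ennreal_toReal
  exact measurable_expNeg.comp (by fun_prop)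

/-- From 1 - e^(-x) ≤ x, L ≤ R and E G < ∞. The decay in r makes the exponent finite outside the
cell because τ_c > 2, and the factor s makes it vanish as s tends to 0. -/
theorem exists_one_sub_cellLap_le (hF : F.Valid) [IsProbabilityMeasure F.law] :
    ∃ K : ℝ, 0 ≤ K ∧ ∀ s r : ℝ, 0 < s → 0 < r → 1 - cellLap p F s r ≤ K * s * r ^ (-p.tauC) := by
  have := isProbabilityMeasure_cellMarkLaw p (F := F)
  have := p.isProbabilityMeasure_cellLengthLaw
  have hR := p.R_pos
  have hτ : 0 < p.tauC := two_pos.trans p.tauC_gt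
  have hm := hF.lintegral_rpow zero_le_one
  simp only [Real.rpow_one] at hm
  set m : ℝ := F.scale * ∑' n, F.coeff n * (Real.Gamma (F.order n + 1) / Real.Gamma (F.order n))
  have hB : ∫⁻ y, ENNReal.ofReal y.2 ∂cellMarkLaw p F = ENNReal.ofReal (max m 0) := by
    have h := lintegral_prod_mul (μ := p.cellLengthLaw) (ν := F.law) (f := fun _ => 1)
      (g := fun x => ENNReal.ofReal x) (by fun_prop) (by fun_prop)
    simp only [one_mul, lintegral_one, measure_univ] at h
    rw [cellMarkLaw, h, hm]
    rcases le_total m 0 with h0 | h0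
    · rw [max_eq_right h0, ENNReal.ofReal_of_nonpos h0, ENNReal.ofReal_zero]
    · rw [max_eq_left h0]
  refine ⟨p.R ^ p.tauC * max m 0, by positivity, fun s r hs hr => ?_⟩
  have hmeas : Measurable fun y : ℝ × ℝ =>
      expNeg (ENNReal.ofReal (s * (y.1 ^ p.tauC * y.2 * r ^ (-p.tauC)))) :=
    measurable_expNeg.comp (by fun_prop)
  have h1 : ENNReal.ofReal (1 - cellLap p F s r)
      ≤ ENNReal.ofReal (p.R ^ p.tauC * s * r ^ (-p.tauC)) * ENNReal.ofReal (max m 0) := by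
    rw [ENNReal.ofReal_sub _ (cellLap_nonneg p s r), ofReal_cellLap, ENNReal.ofReal_one, ← hB,
      ← lintegral_const_mul _ (by fun_prop), ← measure_univ (μ := cellMarkLaw p F), ← lintegral_one,
      tsub_le_iff_right, ← lintegral_add_right _ hmeas]
    refine lintegral_mono_ae ?_
    filter_upwards [ae_cellMarkLaw p hF] with y hy
    obtain ⟨⟨h0, h2⟩, h3⟩ := hy
    rw [expNeg_ofReal (by positivity), ← ENNReal.ofReal_mul (by positivity),
      ← ENNReal.ofReal_add (by positivity) (Real.exp_pos _).le, ← ENNReal.ofReal_one]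
    refine ENNReal.ofReal_le_ofReal ?_
    have h4 := Real.add_one_le_exp (-(s * (y.1 ^ p.tauC * y.2 * r ^ (-p.tauC))))
    have h5 : y.1 ^ p.tauC ≤ p.R ^ p.tauC := Real.rpow_le_rpow h0 h2 hτ.le
    have h6 : s * (y.1 ^ p.tauC * y.2 * r ^ (-p.tauC)) ≤ p.R ^ p.tauC * s * r ^ (-p.tauC) * y.2 := by
      calc _ = y.1 ^ p.tauC * (s * r ^ (-p.tauC) * y.2) := by ring
        _ ≤ p.R ^ p.tauC * (s * r ^ (-p.tauC) * y.2) := by gcongr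
        _ = _ := by ring
    linarith
  rw [← ENNReal.ofReal_mul (by positivity)] at h1
  have h2 := (ENNReal.ofReal_le_ofReal_iff (by positivity)).1 h1
  calc _ ≤ _ := h2
    _ = _ := by ring

theorem integrableOn_one_sub_cellLap (hF : F.Valid) [IsProbabilityMeasure F.law] {s : ℝ}
    (hs : 0 < s) : IntegrableOn (fun r => (1 - cellLap p F s r) * r) (Set.Ioi p.R) := by
  obtain ⟨K, hK0, hK⟩ := exists_one_sub_cellLap_le p hF
  have hR := p.R_pos
  have h := integrableOn_Ioi_rpow_of_lt (by linarith [p.tauC_gt] : 1 - p.tauC < -1) hR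
  refine Integrable.mono' (h.const_mul (K * s))
    ((measurable_const.sub (measurable_cellLap p s)).mul measurable_id).aestronglyMeasurable ?_
  filter_upwards [ae_restrict_mem measurableSet_Ioi] with r hr
  have hr0 : 0 < r := hR.trans hr
  have h1 := cellLap_le_one p (F := F) s r
  rw [Real.norm_of_nonneg (mul_nonneg (by linarith) hr0.le),
    show 1 - p.tauC = -p.tauC + 1 by ring, Real.rpow_add_one hr0.ne', ← mul_assoc]
  exact mul_le_mul_of_nonneg_right (hK s r hs hr0) hr0.le

theorem integral_plane_norm (f : ℝ → ℝ) (hf : IntegrableOn (fun r => f r * r) (Set.Ioi 0)) :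
    Integrable (fun x : Plane => f ‖x‖) ∧
      ∫ x : Plane, f ‖x‖ = 2 * Real.pi * ∫ r in Set.Ioi (0 : ℝ), f r * r := by
  have hdim : Module.finrank ℝ Plane = 2 := by simp
  have hball : (volume : Measure Plane).real (Metric.ball 0 1) = Real.pi := by
    rw [measureReal_def, EuclideanSpace.volume_ball_fin_two]
    simp [Real.pi_pos.le]
  constructor
  · rw [integrable_fun_norm_addHaar, hdim]
    refine hf.congr_fun (fun r _ => ?_) measurableSet_Ioi
    simp [mul_comm]
  · rw [integral_fun_norm_addHaar, hdim, hball]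
    simp [mul_comm, mul_assoc, mul_left_comm]

theorem shotExponent_cellPower (hF : F.Valid) [IsProbabilityMeasure F.law] {s : ℝ} (hs : 0 < s) :
    shotExponent (ENNReal.ofReal p.lamB • (volume : Measure Plane)) (cellMarkLaw p F) (cellPower p) s
      = ENNReal.ofReal (2 * Real.pi * p.lamB
        * ∫ r in Set.Ioi p.R, (1 - cellLap p F s r) * r) := by
  have := isProbabilityMeasure_cellMarkLaw p (F := F)
  have hR := p.R_pos
  set g : ℝ → ℝ := (Set.Ioi p.R).indicator fun r => 1 - cellLap p F s r with hg
  have hgr : (fun r => g r * r) = (Set.Ioi p.R).indicator fun r => (1 - cellLap p F s r) * r := by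
    funext r
    by_cases h : r ∈ Set.Ioi p.R
    · simp only [hg, Set.indicator_of_mem h]
    · simp only [hg, Set.indicator_of_notMem h, zero_mul]
  have hint : IntegrableOn (fun r => g r * r) (Set.Ioi 0) := by
    rw [hgr]
    exact ((integrable_indicator_iff measurableSet_Ioi).2
      (integrableOn_one_sub_cellLap p hF hs)).integrableOn
  obtain ⟨h1, h2⟩ := integral_plane_norm g hint
  have hg0 : ∀ r, 0 ≤ g r := Set.indicator_nonneg fun r _ => by
    linarith [cellLap_le_one p (F := F) s r]
  -- The circle of radius R is a null set, so the closed condition on ‖x‖ may be exchanged for the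
  -- open one.
  have hae : ∀ᵐ x : Plane, ‖x‖ ≠ p.R := by
    have : (volume : Measure Plane) (Metric.sphere 0 p.R) = 0 := Measure.addHaar_sphere _ _ _
    rw [ae_iff]
    convert this using 2
    ext x; simp
  have hin : ∀ᵐ x : Plane, 1 - ∫⁻ y, expNeg (ENNReal.ofReal (s * cellPower p (x, y))) ∂cellMarkLaw p F
      = ENNReal.ofReal (g ‖x‖) := by
    filter_upwards [hae] with x hx
    by_cases h : p.R ≤ ‖x‖
    · have h' : ‖x‖ ∈ Set.Ioi p.R := lt_of_le_of_ne h hx.symm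
      simp only [cellPower, if_pos h, hg, Set.indicator_of_mem h']
      rw [← ofReal_cellLap, ENNReal.ofReal_sub _ (cellLap_nonneg p s _), ENNReal.ofReal_one]
    · have h' : ‖x‖ ∉ Set.Ioi p.R := fun h' => h (le_of_lt h')
      simp only [cellPower, if_neg h, hg, Set.indicator_of_notMem h', mul_zero, ENNReal.ofReal_zero,
        expNeg_zero, lintegral_one, measure_univ, tsub_self]
  rw [shotExponent, lintegral_smul_measure, smul_eq_mul, lintegral_congr_ae hin,
    ← ofReal_integral_eq_lintegral_ofReal h1 (ae_of_all _ fun x => hg0 _), h2, hgr,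
    setIntegral_indicator measurableSet_Ioi,
    Set.inter_eq_self_of_subset_right (Set.Ioi_subset_Ioi hR.le), ← ENNReal.ofReal_mul p.lamB_pos.le]
  congr 1
  ring

theorem tendsto_shotExponent_cellPower (hF : F.Valid) [IsProbabilityMeasure F.law] :
    Tendsto (shotExponent (ENNReal.ofReal p.lamB • (volume : Measure Plane)) (cellMarkLaw p F)
      (cellPower p)) (𝓝[>] 0) (𝓝 0) := by
  obtain ⟨K, hK0, hK⟩ := exists_one_sub_cellLap_le p hF
  have hR := p.R_pos
  have hlam := p.lamB_pos
  have h := integrableOn_Ioi_rpow_of_lt (by linarith [p.tauC_gt] : 1 - p.tauC < -1) hR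
  set D : ℝ := ∫ r in Set.Ioi p.R, r ^ (1 - p.tauC)
  refine tendsto_of_tendsto_of_tendsto_of_le_of_le' tendsto_const_nhds
    (tendsto_ofReal_mul_rpow (2 * Real.pi * p.lamB * (K * D)) one_pos)
    (Eventually.of_forall fun s => bot_le) ?_
  filter_upwards [self_mem_nhdsWithin] with s hs
  rw [shotExponent_cellPower p hF hs, Real.rpow_one]
  refine ENNReal.ofReal_le_ofReal ?_
  rw [mul_assoc (2 * Real.pi * p.lamB)]
  refine mul_le_mul_of_nonneg_left ?_ (by positivity)
  rw [show K * D * s = K * s * D by ring, ← integral_const_mul]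
  refine setIntegral_mono_on (integrableOn_one_sub_cellLap p hF hs) (h.const_mul _)
    measurableSet_Ioi fun r hr => ?_
  have hr0 : 0 < r := hR.trans hr
  rw [show 1 - p.tauC = -p.tauC + 1 by ring, Real.rpow_add_one hr0.ne', ← mul_assoc]
  exact mul_le_mul_of_nonneg_right (hK s r hs hr0) hr0.le

/-! ### The function `φ` -/

/-- For a fixed length the gamma mixture gives ∑ α_n (1 + σt)^(-i_n); the length is then averaged
through u = (l/R)^τ_c. All terms are nonnegative, so summation and integration commute in [0, ∞],
and finiteness follows from the left side. -/
theorem hasSum_cellLap (hF : F.Valid) [IsProbabilityMeasure F.law] {s r : ℝ} (hs : 0 < s)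
    (hr : 0 < r) :
    HasSum (fun n => F.coeff n * (p.deltaC * ∫ u in Set.Ioc (0 : ℝ) 1, u ^ (p.deltaC - 1)
      * (1 + u * (F.scale * s * p.R ^ p.tauC * r ^ (-p.tauC))) ^ (-F.order n))) (cellLap p F s r) := by
  have := p.isProbabilityMeasure_cellLengthLaw
  have hR := p.R_pos
  have hδ := p.deltaC_pos
  have hσ := hF.scale_pos
  set y : ℝ := F.scale * s * p.R ^ p.tauC * r ^ (-p.tauC) with hy
  have hy0 : 0 < y := by positivity
  -- With |u| the function is bounded by 1 on all of ℝ, as the substitution lemma requires; on (0,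
  -- 1] nothing changes.
  have hm : ∀ i : ℝ, Measurable fun u : ℝ => (1 + |u| * y) ^ (-i) := fun i => by fun_prop
  have hpos : ∀ n, 0 ≤ F.coeff n * (p.deltaC * ∫ u in Set.Ioc (0 : ℝ) 1, u ^ (p.deltaC - 1)
      * (1 + u * y) ^ (-F.order n)) := fun n => by
    have h1 : 0 ≤ ∫ u in Set.Ioc (0 : ℝ) 1, u ^ (p.deltaC - 1) * (1 + u * y) ^ (-F.order n) :=
      setIntegral_nonneg measurableSet_Ioc fun u hu => by
        have := hu.1
        positivity
    have := hF.coeff_nonneg n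
    positivity
  have hterm : ∀ n, ∫⁻ l, ENNReal.ofReal (F.coeff n
        * (1 + F.scale * (s * l ^ p.tauC * r ^ (-p.tauC))) ^ (-F.order n)) ∂p.cellLengthLaw
      = ENNReal.ofReal (F.coeff n * (p.deltaC * ∫ u in Set.Ioc (0 : ℝ) 1, u ^ (p.deltaC - 1)
      * (1 + u * y) ^ (-F.order n))) := fun n => by
    have hc := hF.coeff_nonneg n
    have h1 := p.lintegral_cellLengthLaw (hm (F.order n)) (fun u => by positivity) (B := 1)
      (fun u => Real.rpow_le_one_of_one_le_of_nonpos
        (by have : 0 ≤ |u| * y := by positivity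
            linarith) (by linarith [hF.order_pos n]))
    have h2 : ∫ u in Set.Ioc (0 : ℝ) 1, u ^ (p.deltaC - 1) * (1 + |u| * y) ^ (-F.order n)
        = ∫ u in Set.Ioc (0 : ℝ) 1, u ^ (p.deltaC - 1) * (1 + u * y) ^ (-F.order n) :=
      setIntegral_congr_fun measurableSet_Ioc fun u hu => by
        simp only [abs_of_pos hu.1]
    rw [ENNReal.ofReal_mul hc, ← h2, ← h1, ← lintegral_const_mul _ (by fun_prop)]
    refine lintegral_congr_ae ?_
    filter_upwards [p.ae_cellLengthLaw] with l hl
    have hl0 : 0 ≤ l := hl.1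
    rw [ENNReal.ofReal_mul hc, abs_of_nonneg (by positivity), Real.div_rpow hl0 hR.le]
    congr 4
    rw [hy]
    have := Real.rpow_pos_of_pos hR p.tauC
    field_simp
  have hsum : ENNReal.ofReal (cellLap p F s r) = ∑' n, ENNReal.ofReal (F.coeff n * (p.deltaC
      * ∫ u in Set.Ioc (0 : ℝ) 1, u ^ (p.deltaC - 1) * (1 + u * y) ^ (-F.order n))) := by
    have hmeas : Measurable fun y : ℝ × ℝ =>
        expNeg (ENNReal.ofReal (s * (y.1 ^ p.tauC * y.2 * r ^ (-p.tauC)))) :=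
      measurable_expNeg.comp (by fun_prop)
    rw [ofReal_cellLap, cellMarkLaw, lintegral_prod _ hmeas.aemeasurable]
    calc _ = ∫⁻ l, ∑' n, ENNReal.ofReal (F.coeff n
          * (1 + F.scale * (s * l ^ p.tauC * r ^ (-p.tauC))) ^ (-F.order n)) ∂p.cellLengthLaw := by
          refine lintegral_congr_ae ?_
          filter_upwards [p.ae_cellLengthLaw] with l hl
          have hl0 : 0 ≤ l := hl.1
          rw [← hF.lintegral_exp (by positivity)]
          refine lintegral_congr_ae ?_
          filter_upwards [hF.ae_pos] with x hx
          rw [expNeg_ofReal (by positivity)]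
          congr 3
          ring
      _ = _ := by
          rw [lintegral_tsum fun n => by fun_prop]
          exact tsum_congr hterm
  have hne : ∑' n, ENNReal.ofReal (F.coeff n * (p.deltaC * ∫ u in Set.Ioc (0 : ℝ) 1,
      u ^ (p.deltaC - 1) * (1 + u * y) ^ (-F.order n))) ≠ ⊤ := hsum ▸ ENNReal.ofReal_ne_top
  have hsm : Summable fun n => F.coeff n * (p.deltaC * ∫ u in Set.Ioc (0 : ℝ) 1,
      u ^ (p.deltaC - 1) * (1 + u * y) ^ (-F.order n)) :=
    (ENNReal.summable_toReal hne).congr fun n => ENNReal.toReal_ofReal (hpos n)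
  rw [← ENNReal.ofReal_tsum_of_nonneg hpos hsm,
    ENNReal.ofReal_eq_ofReal_iff (cellLap_nonneg p s r) (tsum_nonneg hpos)] at hsum
  rw [hsum]
  exact hsm.hasSum

/-- Since πλ_b = R^(-2), the argument of the Meijer functions is z = r^τ_c/(σ s R^τ_c). The factor
z^(-δ_c) from `meijerG_two_one` cancels the factor πλ_b r² (σs)^(-δ_c) in front of the series for φ.
-/
theorem meijer_arg {σ s r : ℝ} (hσ : 0 < σ) (hs : 0 < s) (hr : 0 < r) :
    ((σ * s)⁻¹ * (Real.pi * p.lamB) ^ (1 / p.deltaC) * r ^ p.tauC)⁻¹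
        = σ * s * p.R ^ p.tauC * r ^ (-p.tauC) ∧
      ((σ * s)⁻¹ * (Real.pi * p.lamB) ^ (1 / p.deltaC) * r ^ p.tauC) ^ (-p.deltaC)
        = (σ * s) ^ p.deltaC / (Real.pi * p.lamB * r ^ 2) := by
  have hR := p.R_pos
  have hlam := p.lamB_pos
  have hδ := p.deltaC_pos
  have hτ : 0 < p.tauC := two_pos.trans p.tauC_gt
  have hpl : 0 < Real.pi * p.lamB := by positivity
  have h1 : Real.pi * p.lamB = (p.R ^ 2)⁻¹ := by
    have := p.pi_mul_lamB_mul_R_sq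
    field_simp
    linarith
  have h2 : (Real.pi * p.lamB) ^ (1 / p.deltaC) = (p.R ^ p.tauC)⁻¹ := by
    rw [h1, Real.inv_rpow (by positivity), ← Real.rpow_natCast, ← Real.rpow_mul hR.le]
    congr 2
    rw [Params.deltaC]
    push_cast
    field_simp
  constructor
  · rw [h2, Real.rpow_neg hr.le]
    have := Real.rpow_pos_of_pos hR p.tauC
    have := Real.rpow_pos_of_pos hr p.tauC
    field_simp
  · rw [Real.mul_rpow (by positivity) (by positivity), Real.mul_rpow (by positivity) (by positivity),
      ← Real.rpow_mul hpl.le, ← Real.rpow_mul hr.le, Real.inv_rpow (by positivity),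
      Real.rpow_neg (by positivity), inv_inv, show 1 / p.deltaC * -p.deltaC = -1 by field_simp,
      show p.tauC * -p.deltaC = -(2 : ℕ) by rw [Params.deltaC]; push_cast; field_simp,
      Real.rpow_neg_one, Real.rpow_neg hr.le, Real.rpow_natCast]
    field_simp

theorem cellPhi_eq (hF : F.Valid) [IsProbabilityMeasure F.law] {s r : ℝ} (hs : 0 < s)
    (hr : 0 < r) :
    Summable (cellPhiTerm p s r F) ∧ cellPhi p F s r = (cellLap p F s r : ℂ) := by
  have hlap := hasSum_cellLap p hF hs hr
  have hδ := p.deltaC_pos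
  have hlam := p.lamB_pos
  -- The prefactor is nonzero, so a termwise identity transfers both the summability and the sum.
  suffices h : ∃ c : ℝ, c ≠ 0 ∧ cellPhi p F s r = (c : ℂ) * ∑' n, cellPhiTerm p s r F n ∧
      ∀ n, (c : ℂ) * cellPhiTerm p s r F n = ((F.coeff n * (p.deltaC * ∫ u in Set.Ioc (0 : ℝ) 1,
        u ^ (p.deltaC - 1) * (1 + u * (F.scale * s * p.R ^ p.tauC * r ^ (-p.tauC)))
          ^ (-F.order n)) : ℝ) : ℂ) by
    obtain ⟨c, hc, h1, h2⟩ := h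
    have hc' : (c : ℂ) ≠ 0 := by exact_mod_cast hc
    have h3 := Complex.hasSum_ofReal.2 hlap
    simp only [← h2] at h3
    refine ⟨(summable_mul_left_iff hc').1 h3.summable, ?_⟩
    rw [h1, ← tsum_mul_left, h3.tsum_eq]
  cases F with
  | kappaMu κ μ w =>
    obtain ⟨hκ, hμ, hw⟩ := id hF
    obtain ⟨hz1, hz2⟩ := meijer_arg p hF.scale_pos hs hr
    refine ⟨Real.pi * p.lamB * r ^ 2 * p.deltaC / Real.exp (μ * κ)
      * (μ * (1 + κ) / (s * w)) ^ p.deltaC, ?_, rfl, fun n => ?_⟩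
    · have : 0 < 1 + κ := by positivity
      positivity
    · have hz : μ * (1 + κ) * (Real.pi * p.lamB) ^ (1 / p.deltaC) * r ^ p.tauC / (s * w)
          = (Fading.scale (.kappaMu κ μ w) * s)⁻¹ * (Real.pi * p.lamB) ^ (1 / p.deltaC)
            * r ^ p.tauC := by
        rw [Fading.scale]; field_simp
      have hz0 : 0 < (Fading.scale (.kappaMu κ μ w) * s)⁻¹ * (Real.pi * p.lamB) ^ (1 / p.deltaC)
            * r ^ p.tauC := by
        have := hF.scale_pos
        positivity
      have hc : μ * (1 + κ) / (s * w) = (Fading.scale (.kappaMu κ μ w) * s)⁻¹ := by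
        rw [Fading.scale]; field_simp
      rw [cellPhiTerm, hz, (meijerG_two_one hδ (by positivity : 0 < (n : ℝ) + μ) hz0).2,
        ← Complex.ofReal_mul, ← Complex.ofReal_mul, hz2, hc]
      simp only [div_eq_mul_inv _ ((Fading.scale (.kappaMu κ μ w) * s)⁻¹ * (Real.pi * p.lamB) ^ (1 / p.deltaC)
            * r ^ p.tauC), hz1]
      rw [Fading.order, Fading.coeff, add_comm (n : ℝ) μ,
        Real.inv_rpow (mul_pos hF.scale_pos hs).le]
      have e1 := Real.rpow_pos_of_pos (mul_pos hF.scale_pos hs) p.deltaC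
      have e2 := Real.Gamma_pos_of_pos (by positivity : 0 < μ + (n : ℝ))
      have e3 := Real.exp_pos (μ * κ)
      generalize Fading.scale (.kappaMu κ μ w) * s * p.R ^ p.tauC * r ^ (-p.tauC) = y
      congr 1
      field_simp
      simp only [mul_comm y]
  | etaMu η μ w =>
    obtain ⟨hη, hμ, hw⟩ := id hF
    have hh := Fading.hPar_pos hη
    obtain ⟨hz1, hz2⟩ := meijer_arg p hF.scale_pos hs hr
    have e0 := Real.Gamma_pos_of_pos hμ
    refine ⟨2 * Real.pi ^ (3 / 2 : ℝ) * p.lamB * r ^ 2 * p.deltaC / (Real.Gamma μ * Fading.hPar η ^ μ)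
      * (2 * μ * Fading.hPar η / (s * w)) ^ p.deltaC, ?_, rfl, fun n => ?_⟩
    · positivity
    · have hz : 2 * μ * Fading.hPar η * (Real.pi * p.lamB) ^ (1 / p.deltaC) * r ^ p.tauC / (s * w)
          = (Fading.scale (.etaMu η μ w) * s)⁻¹ * (Real.pi * p.lamB) ^ (1 / p.deltaC)
            * r ^ p.tauC := by
        rw [Fading.scale]; field_simp
      have hz0 : 0 < (Fading.scale (.etaMu η μ w) * s)⁻¹ * (Real.pi * p.lamB) ^ (1 / p.deltaC)
            * r ^ p.tauC := by
        have := hF.scale_pos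
        positivity
      have hc : 2 * μ * Fading.hPar η / (s * w) = (Fading.scale (.etaMu η μ w) * s)⁻¹ := by
        rw [Fading.scale]; field_simp
      rw [cellPhiTerm, hz, (meijerG_two_one hδ (by positivity : 0 < 2 * (n : ℝ) + 2 * μ) hz0).2,
        ← Complex.ofReal_mul, ← Complex.ofReal_mul, hz2, hc]
      simp only [div_eq_mul_inv _ ((Fading.scale (.etaMu η μ w) * s)⁻¹ * (Real.pi * p.lamB) ^ (1 / p.deltaC)
            * r ^ p.tauC), hz1]
      have hdup := Real.Gamma_mul_Gamma_add_half (μ + n)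
      rw [Fading.order, Fading.coeff_etaMu hη, add_comm (2 * (n : ℝ)) (2 * μ), add_comm (n : ℝ) μ,
        Real.inv_rpow (mul_pos hF.scale_pos hs).le]
      have e1 := Real.rpow_pos_of_pos (mul_pos hF.scale_pos hs) p.deltaC
      have e2 := Real.Gamma_pos_of_pos (by positivity : 0 < μ + (n : ℝ))
      have e3 := Real.Gamma_pos_of_pos (by positivity : 0 < μ + (n : ℝ) + 1 / 2)
      have e4 := Real.rpow_pos_of_pos hh μ
      have e5 : (0 : ℝ) < 2 ^ (-2 * (n : ℝ) - 2 * μ) := by positivity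
      have e6 : 0 < √Real.pi := by positivity
      have hpi : Real.pi ^ (3 / 2 : ℝ) = Real.pi * √Real.pi := by
        rw [Real.sqrt_eq_rpow, show (3 / 2 : ℝ) = 1 + 1 / 2 by norm_num,
          Real.rpow_add Real.pi_pos, Real.rpow_one]
      have hG : Real.Gamma (2 * μ + 2 * n) = Real.Gamma (μ + n) * Real.Gamma (μ + n + 1 / 2)
          / (2 * 2 ^ (-2 * (n : ℝ) - 2 * μ) * √Real.pi) := by
        rw [hdup, show 1 - 2 * (μ + (n : ℝ)) = (-2 * (n : ℝ) - 2 * μ) + 1 by ring,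
          Real.rpow_add_one two_ne_zero, show 2 * (μ + (n : ℝ)) = 2 * μ + 2 * n by ring]
        field_simp
      rw [hG, hpi, ← pow_mul]
      generalize Fading.scale (.etaMu η μ w) * s * p.R ^ p.tauC * r ^ (-p.tauC) = y
      congr 1
      field_simp
      simp only [mul_comm y]

end

section

variable {Ω : Type*} [MeasurableSpace Ω] {P : Measure Ω} [IsProbabilityMeasure P] {p : Params}
  {FW FI : Fading} {Y : ℕ → Ω → Plane} {L : ℕ → Ω → ℝ} {G : ℕ → Ω → ℝ} {W : Ω → ℝ}

theorem IsCellLink.isProbabilityMeasure_law (h : IsCellLink P p FW FI Y L G W) :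
    IsProbabilityMeasure FI.law := by
  have := p.isProbabilityMeasure_cellLengthLaw
  have h1 := (h.marks_law 0).isProbabilityMeasure_iff.1 inferInstance
  exact isProbabilityMeasure_of_prod h1

theorem IsCellLink.interference (h : IsCellLink P p FW FI Y L G W) (hF : FI.Valid) :
    (∀ᵐ ω ∂P, Summable (cellInterferenceTerm p Y L G ω)) ∧
      AEMeasurable (cellInterference p Y L G) P ∧
      (∀ᵐ ω ∂P, 0 ≤ cellInterference p Y L G ω) ∧
      ∀ s, 0 < s → laplace P (cellInterference p Y L G) s
        = Real.exp (-(2 * Real.pi * p.lamB * ∫ r in Set.Ioi p.R, (1 - cellLap p FI s r) * r)) := by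
  have := h.isProbabilityMeasure_law
  have := isProbabilityMeasure_cellMarkLaw p (F := FI)
  have := sigmaFinite_ofReal_smul p.lamB (volume : Measure Plane)
  have hu0 : ∀ᵐ y ∂cellMarkLaw p FI, ∀ x, 0 ≤ cellPower p (x, y) := by
    filter_upwards [ae_cellMarkLaw p hF] with y hy x
    have h1 := hy.1.1
    have h2 := hy.2
    rw [cellPower]
    split_ifs
    · positivity
    · exact le_rfl
  obtain ⟨h1, h2, h3, h4⟩ := h.points.shotNoise (ν := cellMarkLaw p FI) h.marks_law h.marks_indep
    h.points_marks (measurable_cellPower p) hu0 (tendsto_shotExponent_cellPower p hF)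
  refine ⟨h1, h2, h3, fun s hs => ?_⟩
  have hlam := p.lamB_pos
  have h0 : 0 ≤ ∫ r in Set.Ioi p.R, (1 - cellLap p FI s r) * r :=
    setIntegral_nonneg measurableSet_Ioi fun r hr =>
      mul_nonneg (by linarith [cellLap_le_one p (F := FI) s r]) (p.R_pos.trans hr).le
  refine (h4 s hs).trans ?_
  rw [shotExponent_cellPower p hF hs, expNeg_ofReal (by positivity),
    ENNReal.toReal_ofReal (Real.exp_pos _).le]

end

end

section

/-! ### A link with independent signal and interference -/

/-- A link whose gain `W` follows the fading model `F` and is independent of the interference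
`I`. -/
structure IsFadedLink {Ω : Type*} [MeasurableSpace Ω] (P : Measure Ω) (F : Fading)
    (W I : Ω → ℝ) : Prop where
  valid : F.Valid
  signal_law : HasLaw W F.law P
  aemeasurable : AEMeasurable I P
  nonneg : ∀ᵐ ω ∂P, 0 ≤ I ω
  indep : IndepFun W I P

theorem condBEP_nonneg {a b γ : ℝ} (ha : 0 < a) (hb : 0 < b) (hγ : 0 ≤ γ) : 0 ≤ condBEP a b γ :=
  div_nonneg (upperGamma_nonneg (by positivity))
    (mul_pos two_pos (Real.Gamma_pos_of_pos hb)).le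

theorem condBEP_le_half {a b γ : ℝ} (ha : 0 < a) (hb : 0 < b) (hγ : 0 ≤ γ) :
    condBEP a b γ ≤ 1 / 2 := by
  have h := upperGamma_le_Gamma hb (by positivity : 0 ≤ a * γ)
  have hG := Real.Gamma_pos_of_pos hb
  rw [condBEP, div_le_div_iff₀ (by positivity) two_pos]
  linarith

theorem measurable_indicator_condBEP {a b : ℝ} (ha : 0 < a) (hb : 0 < b) :
    Measurable ((Set.Ioi 0).indicator (condBEP a b)) := by
  classical
  have h : ContinuousOn (condBEP a b) (Set.Ioi 0) :=
    ((continuousOn_upperGamma hb).comp (by fun_prop) fun x hx => mul_pos ha hx).div_const _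
  exact h.measurable_piecewise continuousOn_const measurableSet_Ioi

theorem laplace_nonneg {Ω : Type*} [MeasurableSpace Ω] (P : Measure Ω) (I : Ω → ℝ) (s : ℝ) :
    0 ≤ laplace P I s :=
  integral_nonneg fun _ => (Real.exp_pos _).le

theorem ae_gammaMeasure_pos (i r : ℝ) : ∀ᵐ x ∂gammaMeasure i r, 0 < x := by
  have h : {x : ℝ | ¬0 < x} = Set.Iic 0 := by ext; simp
  rw [ae_iff, h, gammaMeasure, withDensity_apply _ measurableSet_Iic,
    setLIntegral_congr Iio_ae_eq_Iic.symm]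
  exact lintegral_gammaPDF_of_nonpos le_rfl

namespace IsFadedLink

variable {Ω : Type*} [MeasurableSpace Ω] {P : Measure Ω} {F : Fading}
  {W I : Ω → ℝ}

theorem ae_map_nonneg (h : IsFadedLink P F W I) : ∀ᵐ y ∂(P.map I), 0 ≤ y :=
  (ae_map_iff h.aemeasurable measurableSet_Ici).2 h.nonneg

theorem ae_signal_pos (h : IsFadedLink P F W I) : ∀ᵐ ω ∂P, 0 < W ω := by
  have h1 := h.valid.ae_pos
  rw [← h.signal_law.map_eq] at h1
  exact ae_of_ae_map h.signal_law.aemeasurable h1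

theorem aemeasurable_sinr (h : IsFadedLink P F W I) (p : Params) : AEMeasurable (sinr p W I) P :=
  h.signal_law.aemeasurable.div (h.aemeasurable.add_const _)

theorem ae_sinr (h : IsFadedLink P F W I) (p : Params) : ∀ᵐ ω ∂P, 0 < sinr p W I ω ∧ sinr p W I ω ≤ W ω / p.N0 := by
  filter_upwards [h.ae_signal_pos, h.nonneg] with ω h1 h2
  have hN := p.N0_pos
  refine ⟨div_pos h1 (by linarith), div_le_div_of_nonneg_left h1.le hN (by linarith)⟩

theorem laplace_eq_map (h : IsFadedLink P F W I) (s : ℝ) :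
    laplace P I s = ∫ y, Real.exp (-(s * y)) ∂(P.map I) := by
  rw [laplace, integral_map h.aemeasurable (by fun_prop)]

/-- Since log(1+x) ≤ x, the integrand is dominated by W/N₀, and the gain has a finite mean. -/
theorem integrable_log (h : IsFadedLink P F W I) (p : Params) : Integrable (fun ω => Real.log (1 + sinr p W I ω)) P := by
  have hW : Integrable W P := by
    have h1 := h.valid.integrable_id
    rw [← h.signal_law.map_eq] at h1
    exact h1.comp_aemeasurable h.signal_law.aemeasurable
  refine Integrable.mono' (hW.div_const p.N0)
    ((h.aemeasurable_sinr p).const_add 1).log.aestronglyMeasurable ?_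
  filter_upwards [h.ae_sinr p] with ω hω
  rw [Real.norm_of_nonneg (Real.log_nonneg (by linarith))]
  have := Real.log_le_sub_one_of_pos (by linarith [hω.1] : 0 < 1 + sinr p W I ω)
  linarith

variable [IsProbabilityMeasure P]

theorem isProbabilityMeasure_law (h : IsFadedLink P F W I) : IsProbabilityMeasure F.law :=
  h.signal_law.isProbabilityMeasure_iff.1 inferInstance

theorem integrable_condBEP (h : IsFadedLink P F W I) (p : Params) {a b : ℝ} (ha : 0 < a) (hb : 0 < b) :
    Integrable (fun ω => condBEP a b (sinr p W I ω)) P := by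
  refine Integrable.of_bound (C := 1 / 2) ?_ ?_
  · refine ((measurable_indicator_condBEP ha hb).comp_aemeasurable
      (h.aemeasurable_sinr p)).aestronglyMeasurable.congr ?_
    filter_upwards [h.ae_sinr p] with ω hω
    exact Set.indicator_of_mem (s := Set.Ioi (0 : ℝ)) hω.1 _
  · filter_upwards [h.ae_sinr p] with ω hω
    rw [Real.norm_of_nonneg (condBEP_nonneg ha hb hω.1.le)]
    exact condBEP_le_half ha hb hω.1.le

theorem integrable_exp (h : IsFadedLink P F W I) {s : ℝ} (hs : 0 ≤ s) : Integrable (fun ω => Real.exp (-(s * I ω))) P := by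
  refine Integrable.of_bound (C := 1) (h.aemeasurable.const_mul s).neg.exp.aestronglyMeasurable ?_
  filter_upwards [h.nonneg] with ω hω
  rw [Real.norm_of_nonneg (Real.exp_pos _).le, Real.exp_le_one_iff]
  have := mul_nonneg hs hω
  linarith

theorem laplace_le_one (h : IsFadedLink P F W I) {s : ℝ} (hs : 0 ≤ s) : laplace P I s ≤ 1 := by
  have h1 : laplace P I s ≤ ∫ _, (1 : ℝ) ∂P := by
    refine integral_mono_ae (h.integrable_exp hs) (integrable_const _) ?_
    filter_upwards [h.nonneg] with ω hω
    rw [Real.exp_le_one_iff]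
    have := mul_nonneg hs hω
    linarith
  simpa using h1

theorem continuousOn_laplace (h : IsFadedLink P F W I) : ContinuousOn (laplace P I) (Set.Ici 0) := by
  refine continuousOn_of_dominated (bound := fun _ => 1)
    (fun s _ => (h.aemeasurable.const_mul s).neg.exp.aestronglyMeasurable) (fun s hs => ?_)
    (integrable_const _) (ae_of_all _ fun ω => by fun_prop)
  filter_upwards [h.nonneg] with ω hω
  rw [Real.norm_of_nonneg (Real.exp_pos _).le, Real.exp_le_one_iff]
  have := mul_nonneg hs hω
  linarith

/-- Averaging over the interference turns the exponential kernel into its Laplace transform. -/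
theorem integral_gTerm_mul_exp (h : IsFadedLink P F W I) (p : Params) {a b i σ : ℝ} (ha : 0 < a) (hb : 0 < b) (hi : 0 < i)
    (hσ : 0 < σ) :
    ∫ y, (∫ t in Set.Ioi 0, gTerm a b i t * Real.exp (-((y + p.N0) / σ * t))) ∂(P.map I)
      = σ / p.N0 * ∫ x in Set.Ioi (0 : ℝ),
          gTerm a b i (σ * x / p.N0) * laplace P I (x / p.N0) * Real.exp (-x) := by
  have hN := p.N0_pos
  have := Measure.isProbabilityMeasure_map h.aemeasurable
  have hy := h.ae_map_nonneg
  have hg : AEStronglyMeasurable (gTerm a b i) (volume.restrict (Set.Ioi 0)) :=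
    (continuousOn_gTerm ha hb hi).aestronglyMeasurable measurableSet_Ioi
  -- As y ≥ 0, the kernel is at most e^(-N₀ t/σ): the noise alone makes the double integral
  -- absolutely convergent.
  have hint : Integrable (Function.uncurry fun y t => gTerm a b i t *
      Real.exp (-((y + p.N0) / σ * t))) ((P.map I).prod (volume.restrict (Set.Ioi 0))) := by
    have h1 := (integrableOn_gTerm_mul_exp ha hb hi (z := p.N0 / σ) (by positivity)).norm
    have h2 := (integrable_const (1 : ℝ) (μ := P.map I)).mul_prod h1
    refine h2.mono' ?_ ?_
    · exact hg.comp_snd.mul (by fun_prop)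
    · have e1 : ∀ᵐ z ∂(P.map I).prod (volume.restrict (Set.Ioi (0 : ℝ))), 0 ≤ z.1 :=
        Measure.quasiMeasurePreserving_fst.ae hy
      have e2 : ∀ᵐ z ∂(P.map I).prod (volume.restrict (Set.Ioi (0 : ℝ))), z.2 ∈ Set.Ioi (0 : ℝ) :=
        Measure.quasiMeasurePreserving_snd.ae (ae_restrict_mem measurableSet_Ioi)
      filter_upwards [e1, e2] with z hz1 hz2
      have hz2' : 0 < z.2 := hz2
      simp only [Function.uncurry, one_mul, norm_mul, Real.norm_eq_abs, Real.abs_exp]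
      gcongr
      linarith
  rw [integral_integral_swap hint]
  have hsub := integral_comp_mul_left_Ioi
    (fun t => gTerm a b i t * (Real.exp (-(p.N0 / σ * t)) * laplace P I (t / σ))) 0
    (div_pos hσ hN)
  rw [mul_zero, smul_eq_mul, eq_inv_mul_iff_mul_eq₀ (by positivity)] at hsub
  calc _ = ∫ t in Set.Ioi 0, gTerm a b i t * (Real.exp (-(p.N0 / σ * t)) * laplace P I (t / σ)) := by
        refine setIntegral_congr_fun measurableSet_Ioi fun t ht => ?_
        rw [h.laplace_eq_map, ← integral_const_mul, ← integral_const_mul]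
        refine integral_congr_ae (ae_of_all _ fun y => ?_)
        simp only [← Real.exp_add]
        congr 2
        field_simp
        ring
    _ = _ := by
        rw [← hsub]
        congr 1
        refine setIntegral_congr_fun measurableSet_Ioi fun x hx => ?_
        have e1 : σ / p.N0 * x = σ * x / p.N0 := by ring
        have e2 : p.N0 / σ * (σ / p.N0 * x) = x := by field_simp
        have e3 : σ / p.N0 * x / σ = x / p.N0 := by field_simp
        simp only [e2, e3]
        rw [e1]
        ring

/-- By independence (W, I) has a product law. The law of W is split into gamma laws, and in each of
them the integrals are exchanged so that the formula for fixed interference applies inside. -/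
theorem avgBEP_eq_tsum (h : IsFadedLink P F W I) (p : Params) {a b : ℝ} (ha : 0 < a) (hb : 0 < b) :
    avgBEP P p a b W I = ∑' n, F.coeff n * (1 / 2 + F.scale / p.N0 * ∫ x in Set.Ioi (0 : ℝ),
      gTerm a b (F.order n) (F.scale * x / p.N0) * laplace P I (x / p.N0) * Real.exp (-x)) := by
  have hN := p.N0_pos
  have hσ := h.valid.scale_pos
  have := h.isProbabilityMeasure_law
  have := Measure.isProbabilityMeasure_map h.aemeasurable
  have hy := h.ae_map_nonneg
  -- Cut off to the positive axis, the BEP is measurable and bounded on all of ℝ; the SINR is almost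
  -- surely positive, so no average changes.
  set k : ℝ → ℝ := (Set.Ioi 0).indicator (condBEP a b) with hk
  have hkm : Measurable k := measurable_indicator_condBEP ha hb
  have hk0 : ∀ x, 0 ≤ k x := Set.indicator_nonneg fun x hx => condBEP_nonneg ha hb (le_of_lt hx)
  have hk1 : ∀ x, k x ≤ 1 / 2 := fun x =>
    Set.indicator_apply_le' (fun hx => condBEP_le_half ha hb (le_of_lt hx)) fun _ => by norm_num
  have hkz : Measurable fun z : ℝ × ℝ => k (z.1 / (z.2 + p.N0)) := hkm.comp (by fun_prop)
  have hint : ∀ ν : Measure ℝ, IsProbabilityMeasure ν →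
      Integrable (fun z : ℝ × ℝ => k (z.1 / (z.2 + p.N0))) (ν.prod (P.map I)) := fun ν hν =>
    Integrable.of_bound hkz.aestronglyMeasurable (1 / 2) (ae_of_all _ fun z => by
      rw [Real.norm_of_nonneg (hk0 _)]; exact hk1 _)
  have hprod : P.map (fun ω => (W ω, I ω)) = F.law.prod (P.map I) := by
    rw [(indepFun_iff_map_prod_eq_prod_map_map h.signal_law.aemeasurable h.aemeasurable).1 h.indep,
      h.signal_law.map_eq]
  have h1 : avgBEP P p a b W I = ∫ w, (∫ y, k (w / (y + p.N0)) ∂(P.map I)) ∂F.law := by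
    rw [← integral_prod _ (hint F.law inferInstance), ← hprod,
      integral_map (h.signal_law.aemeasurable.prodMk h.aemeasurable) hkz.aestronglyMeasurable]
    refine integral_congr_ae ?_
    filter_upwards [h.ae_sinr p] with ω hω
    exact (Set.indicator_of_mem (s := Set.Ioi (0 : ℝ)) hω.1 _).symm
  have hm : Measurable fun w => ∫ y, k (w / (y + p.N0)) ∂(P.map I) :=
    hkz.stronglyMeasurable.integral_prod_right.measurable
  have hm1 : ∀ w, ∫ y, k (w / (y + p.N0)) ∂(P.map I) ≤ 1 / 2 := fun w => by
    have : ∫ y, k (w / (y + p.N0)) ∂(P.map I) ≤ ∫ _, (1 / 2 : ℝ) ∂(P.map I) :=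
      integral_mono_of_nonneg (ae_of_all _ fun y => hk0 _) (integrable_const _)
        (ae_of_all _ fun y => hk1 _)
    simpa using this
  rw [h1, h.valid.integral_law hm (fun w => integral_nonneg fun y => hk0 _) hm1]
  refine tsum_congr fun n => ?_
  have hi := h.valid.order_pos n
  have hγ := isProbabilityMeasure_gammaMeasure hi (inv_pos.2 hσ)
  have hin : ∀ y, 0 ≤ y → ∫ w, k (w / (y + p.N0)) ∂gammaMeasure (F.order n) F.scale⁻¹
      = 1 / 2 + ∫ t in Set.Ioi 0,
          gTerm a b (F.order n) t * Real.exp (-((y + p.N0) / F.scale * t)) := fun y hy => by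
    rw [← integral_condBEP_gammaMeasure ha hb hi hσ (by positivity)]
    refine integral_congr_ae ?_
    filter_upwards [ae_gammaMeasure_pos (F.order n) F.scale⁻¹] with w hw
    exact Set.indicator_of_mem (s := Set.Ioi (0 : ℝ)) (div_pos hw (by positivity)) _
  rw [integral_integral_swap (hint _ hγ),
    integral_congr_ae (g := fun y => 1 / 2 + ∫ t in Set.Ioi 0,
      gTerm a b (F.order n) t * Real.exp (-((y + p.N0) / F.scale * t)))
      (hy.mono fun y hy => hin y hy), integral_add (integrable_const _) ?_,
    h.integral_gTerm_mul_exp p ha hb hi hσ]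
  · simp
  · have h2 : Integrable (fun y => ∫ w, k (w / (y + p.N0)) ∂gammaMeasure (F.order n) F.scale⁻¹)
        (P.map I) := (hint _ hγ).integral_prod_right
    refine (h2.sub (integrable_const (1 / 2))).congr ?_
    filter_upwards [hy] with y hy
    simp only [Pi.sub_apply, hin y hy]
    ring

end IsFadedLink

end

section

/-! ### The series for the average bit error probability -/

/-- The constant in the bound on `seriesTerm`. -/
def seriesBound (p : Params) (F : Fading) (a b : ℝ) (n : ℕ) : ℝ :=
  a ^ b / (2 * Real.Gamma b * Real.Gamma (b + 1)) * (F.scale / p.N0) ^ (b - 1)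
    * (F.coeff n * (Real.Gamma (F.order n + b) / Real.Gamma (F.order n)))

theorem summable_seriesBound (p : Params) {F : Fading} (hF : F.Valid) (a : ℝ) {b : ℝ}
    (hb : 0 < b) : Summable (seriesBound p F a b) :=
  (hF.summable_coeff_mul_Gamma hb.le).mul_left _

namespace IsFadedLink

variable {Ω : Type*} [MeasurableSpace Ω] {P : Measure Ω} [IsProbabilityMeasure P] {F : Fading}
  {W I : Ω → ℝ}

theorem abs_seriesTerm_le (h : IsFadedLink P F W I) (p : Params) {a b : ℝ} (ha : 0 < a)
    (hb : 0 < b) (n : ℕ) {x : ℝ} (hx : 0 < x) :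
    |seriesTerm p F a b (laplace P I) n x| ≤ seriesBound p F a b n * x ^ (b - 1) := by
  have hN := p.N0_pos
  have hσ := h.valid.scale_pos
  have hc := h.valid.coeff_nonneg n
  have hg := abs_gTerm_le ha hb (h.valid.order_pos n) (by positivity : 0 < F.scale * x / p.N0)
  have hL := h.laplace_le_one (by positivity : 0 ≤ x / p.N0)
  rw [seriesTerm, abs_mul, abs_mul, abs_of_nonneg hc, abs_of_nonneg (laplace_nonneg P I _)]
  have hpow : (F.scale * x / p.N0) ^ (b - 1) = (F.scale / p.N0) ^ (b - 1) * x ^ (b - 1) := by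
    rw [← Real.mul_rpow (by positivity) hx.le]
    congr 1
    ring
  rw [hpow] at hg
  calc _ ≤ F.coeff n * |gTerm a b (F.order n) (F.scale * x / p.N0)| :=
        mul_le_of_le_one_right (by positivity) hL
    _ ≤ _ := mul_le_mul_of_nonneg_left hg hc
    _ = _ := by rw [seriesBound]; ring

theorem continuousOn_seriesTerm (h : IsFadedLink P F W I) (p : Params) {a b : ℝ} (ha : 0 < a)
    (hb : 0 < b) (n : ℕ) :
    ContinuousOn (seriesTerm p F a b (laplace P I) n) (Set.Ioi 0) := by
  have hN := p.N0_pos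
  have hσ := h.valid.scale_pos
  refine (continuousOn_const.mul ((continuousOn_gTerm ha hb (h.valid.order_pos n)).comp
    (by fun_prop) fun x hx => ?_)).mul (h.continuousOn_laplace.comp (by fun_prop) fun x hx => ?_)
  · exact div_pos (mul_pos hσ hx) hN
  · exact div_nonneg (le_of_lt hx) hN.le

theorem summable_seriesTerm (h : IsFadedLink P F W I) (p : Params) {a b : ℝ} (ha : 0 < a)
    (hb : 0 < b) {x : ℝ} (hx : 0 < x) :
    Summable fun n => seriesTerm p F a b (laplace P I) n x :=
  Summable.of_norm_bounded ((summable_seriesBound p h.valid a hb).mul_right _)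
    fun n => h.abs_seriesTerm_le p ha hb n hx

theorem integrableOn_seriesTerm (h : IsFadedLink P F W I) (p : Params) {a b : ℝ} (ha : 0 < a)
    (hb : 0 < b) (n : ℕ) :
    IntegrableOn (fun x => seriesTerm p F a b (laplace P I) n x * Real.exp (-x)) (Set.Ioi 0) :=
  (LaguerreConverges.of_abs_le_rpow hb (h.continuousOn_seriesTerm p ha hb n)
    fun _ hx => h.abs_seriesTerm_le p ha hb n hx).integrableOn

theorem summable_integral_norm_seriesTerm (h : IsFadedLink P F W I) (p : Params) {a b : ℝ}
    (ha : 0 < a) (hb : 0 < b) : Summable fun n => ∫ x in Set.Ioi (0 : ℝ),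
      ‖seriesTerm p F a b (laplace P I) n x * Real.exp (-x)‖ := by
  refine Summable.of_nonneg_of_le (fun n => integral_nonneg fun x => norm_nonneg _) (fun n => ?_)
    ((summable_seriesBound p h.valid a hb).mul_right (Real.Gamma b))
  rw [Real.Gamma_eq_integral hb, ← integral_const_mul]
  refine setIntegral_mono_on (h.integrableOn_seriesTerm p ha hb n).norm
    ((Real.GammaIntegral_convergent hb).const_mul _) measurableSet_Ioi fun x hx => ?_
  have h1 := h.abs_seriesTerm_le p ha hb n hx
  rw [norm_mul, Real.norm_eq_abs, Real.norm_eq_abs, Real.abs_exp]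
  calc _ ≤ seriesBound p F a b n * x ^ (b - 1) * Real.exp (-x) := by gcongr
    _ = _ := by ring

theorem laguerreConverges_tsum_seriesTerm (h : IsFadedLink P F W I) (p : Params) {a b : ℝ}
    (ha : 0 < a) (hb : 0 < b) :
    LaguerreConverges fun x => ∑' n, seriesTerm p F a b (laplace P I) n x := by
  have hD := summable_seriesBound p h.valid a hb
  refine LaguerreConverges.of_abs_le_rpow (K := ∑' n, seriesBound p F a b n) hb ?_ fun x hx => ?_
  -- Division by x^(b-1) makes the bounds on the terms independent of x, so the quotient series
  -- converges uniformly and its sum is continuous.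
  · have h1 : ContinuousOn (fun x => x ^ (b - 1)
        * ∑' n, (x ^ (b - 1))⁻¹ * seriesTerm p F a b (laplace P I) n x) (Set.Ioi 0) := by
      have hc : ContinuousOn (fun x : ℝ => x ^ (b - 1)) (Set.Ioi 0) := fun x hx =>
        (Real.continuousAt_rpow_const x _ (Or.inl (ne_of_gt hx))).continuousWithinAt
      refine hc.mul (continuousOn_tsum (fun n => ?_) hD fun n x hx => ?_)
      · exact (hc.inv₀ fun x hx => (Real.rpow_pos_of_pos hx _).ne').mul
          (h.continuousOn_seriesTerm p ha hb n)
      · have hx' := Real.rpow_pos_of_pos hx (b - 1)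
        rw [norm_mul, norm_inv, Real.norm_of_nonneg hx'.le, inv_mul_le_iff₀ hx', mul_comm]
        exact h.abs_seriesTerm_le p ha hb n hx
    refine h1.congr fun x hx => ?_
    have hx' := Real.rpow_pos_of_pos hx (b - 1)
    simp only [tsum_mul_left]
    field_simp
  · rw [← tsum_mul_right]
    exact tsum_of_norm_bounded (f := fun n => seriesTerm p F a b (laplace P I) n x)
      (hD.mul_right (x ^ (b - 1))).hasSum fun n => h.abs_seriesTerm_le p ha hb n hx

/-- The weights sum to one, which collects the constants 1/2; the remaining series converges by the
bound on its terms. -/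
theorem avgBEP_eq (h : IsFadedLink P F W I) (p : Params) {a b : ℝ} (ha : 0 < a) (hb : 0 < b) :
    avgBEP P p a b W I = 1 / 2 + F.scale / p.N0 * ∑' n, ∫ x in Set.Ioi (0 : ℝ),
      seriesTerm p F a b (laplace P I) n x * Real.exp (-x) := by
  have := h.isProbabilityMeasure_law
  have hs : Summable fun n => ∫ x in Set.Ioi (0 : ℝ),
      seriesTerm p F a b (laplace P I) n x * Real.exp (-x) :=
    (h.summable_integral_norm_seriesTerm p ha hb).of_norm_bounded
      fun n => norm_integral_le_integral_norm _
  rw [h.avgBEP_eq_tsum p ha hb]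
  have h1 : ∀ n, F.coeff n * (1 / 2 + F.scale / p.N0 * ∫ x in Set.Ioi (0 : ℝ),
        gTerm a b (F.order n) (F.scale * x / p.N0) * laplace P I (x / p.N0) * Real.exp (-x))
      = F.coeff n * (1 / 2) + F.scale / p.N0 * ∫ x in Set.Ioi (0 : ℝ),
        seriesTerm p F a b (laplace P I) n x * Real.exp (-x) := fun n => by
    have h2 : ∫ x in Set.Ioi (0 : ℝ), seriesTerm p F a b (laplace P I) n x * Real.exp (-x)
        = F.coeff n * ∫ x in Set.Ioi (0 : ℝ), gTerm a b (F.order n) (F.scale * x / p.N0)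
          * laplace P I (x / p.N0) * Real.exp (-x) := by
      rw [← integral_const_mul]
      refine integral_congr_ae (ae_of_all _ fun x => ?_)
      simp only [seriesTerm]
      ring
    rw [h2]
    ring
  rw [tsum_congr h1, (h.valid.summable_coeff.mul_right _).tsum_add (hs.mul_left _), tsum_mul_right,
    tsum_mul_left, h.valid.tsum_coeff, one_mul]

/-- The average bit error probability of a link as a series of integrals, and as the limit of
Gauss-Laguerre sums. -/
theorem avgBEP_series (h : IsFadedLink P F W I) (p : Params) {a b : ℝ} (ha : 0 < a) (hb : 0 < b) :
    (∀ n, IntegrableOn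
        (fun x => seriesTerm p F a b (laplace P I) n x * Real.exp (-x)) (Set.Ioi 0)) ∧
      Summable (fun n => ∫ x in Set.Ioi (0 : ℝ),
        seriesTerm p F a b (laplace P I) n x * Real.exp (-x)) ∧
      avgBEP P p a b W I = 1 / 2 + F.scale / p.N0 * ∑' n, ∫ x in Set.Ioi (0 : ℝ),
        seriesTerm p F a b (laplace P I) n x * Real.exp (-x) ∧
      (∀ x, 0 < x → Summable fun n => seriesTerm p F a b (laplace P I) n x) ∧
      Tendsto (fun M : ℕ => 1 / 2 + F.scale / p.N0 * ∑ x ∈ laguerreNodes M,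
          ∑' n, laguerreWeight M x * seriesTerm p F a b (laplace P I) n x)
        atTop (𝓝 (avgBEP P p a b W I)) := by
  have hsum := hasSum_integral_of_summable_integral_norm
    (fun n => h.integrableOn_seriesTerm p ha hb n) (h.summable_integral_norm_seriesTerm p ha hb)
  refine ⟨h.integrableOn_seriesTerm p ha hb, hsum.summable, h.avgBEP_eq p ha hb,
    fun x hx => h.summable_seriesTerm p ha hb hx, ?_⟩
  rw [h.avgBEP_eq p ha hb, hsum.tsum_eq]
  simp only [tsum_mul_left, tsum_mul_right]
  exact ((h.laguerreConverges_tsum_seriesTerm p ha hb).tendsto.const_mul _).const_add _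

end IsFadedLink

end

section

/-! ### Links of the network -/

section

variable {Ω : Type*} [MeasurableSpace Ω] {P : Measure Ω} [IsProbabilityMeasure P] {p : Params}
  {FW FI : Fading}

theorem IsD2DLink.isFadedLink {X : ℕ → Ω → Plane} {ty : ℕ → Ω → Bool} {L : ℕ → Ω → ℝ}
    {act : ℕ → Ω → Bool} {G : ℕ → Ω → ℝ} {W : Ω → ℝ} (h : IsD2DLink P p FW FI X ty L act G W)
    (hW : FW.Valid) (hI : FI.Valid) :
    IsFadedLink P FW W (d2dInterference p X ty L act G) := by
  obtain ⟨-, h2, h3, -⟩ := h.interference hI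
  refine ⟨hW, h.signal_law, h2, h3, ?_⟩
  -- The interference is a measurable function of all points and marks jointly, so the independence
  -- of the signal passes to it.
  have hm : Measurable fun z : (ℕ → Plane) × (ℕ → Bool × ℝ × Bool × ℝ) =>
      ∑' j, d2dPower p (z.1 j, z.2 j) :=
    Measurable.tsum fun j => (measurable_d2dPower p).comp (by fun_prop)
  exact h.signal_indep.comp measurable_id hm

theorem IsCellLink.isFadedLink {Y : ℕ → Ω → Plane} {L : ℕ → Ω → ℝ} {G : ℕ → Ω → ℝ} {W : Ω → ℝ}
    (h : IsCellLink P p FW FI Y L G W) (hW : FW.Valid) (hI : FI.Valid) :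
    IsFadedLink P FW W (cellInterference p Y L G) := by
  obtain ⟨-, h2, h3, -⟩ := h.interference hI
  refine ⟨hW, h.signal_law, h2, h3, ?_⟩
  have hm : Measurable fun z : (ℕ → Plane) × (ℕ → ℝ × ℝ) => ∑' j, cellPower p (z.1 j, z.2 j) :=
    Measurable.tsum fun j => (measurable_cellPower p).comp (by fun_prop)
  exact h.signal_indep.comp measurable_id hm

theorem IsCellLink.laplace_eq_exp_cellPhi {Y : ℕ → Ω → Plane} {L : ℕ → Ω → ℝ} {G : ℕ → Ω → ℝ}
    {W : Ω → ℝ} (h : IsCellLink P p FW FI Y L G W) (hI : FI.Valid) {s : ℝ} (hs : 0 < s) :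
    (∀ r, p.R < r → Summable (cellPhiTerm p s r FI)) ∧
      IntegrableOn (fun r : ℝ => (1 - cellPhi p FI s r) * (r : ℂ)) (Set.Ioi p.R) ∧
      (laplace P (cellInterference p Y L G) s : ℂ)
        = Complex.exp (-(2 * (Real.pi : ℂ) * (p.lamB : ℂ)
          * ∫ r in Set.Ioi p.R, (1 - cellPhi p FI s r) * (r : ℂ))) := by
  have := h.isProbabilityMeasure_law
  have hR := p.R_pos
  have hphi : Set.EqOn (fun r : ℝ => (((1 - cellLap p FI s r) * r : ℝ) : ℂ))
      (fun r : ℝ => (1 - cellPhi p FI s r) * (r : ℂ)) (Set.Ioi p.R) := fun r hr => by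
    simp only [(cellPhi_eq p hI hs (hR.trans hr)).2]
    push_cast
    rfl
  refine ⟨fun r hr => (cellPhi_eq p hI hs (hR.trans hr)).1, ?_, ?_⟩
  · exact IntegrableOn.congr_fun (integrableOn_one_sub_cellLap p hI hs).ofReal hphi
      measurableSet_Ioi
  · rw [← setIntegral_congr_fun measurableSet_Ioi hphi, integral_complex_ofReal,
      (h.interference hI).2.2.2 s hs]
    push_cast
    rfl

end

namespace Params

variable (p : Params)

/-- Even for q = 1 the cellular mode has positive probability; this makes division by λ_c
legitimate. -/
theorem lamC_pos : 0 < p.lamC := by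
  obtain ⟨h0, h1⟩ := p.q_mem
  have hc : 0 < p.probCell := by rw [p.probCell_eq]; positivity
  refine mul_pos ?_ p.lam_pos
  rcases h0.eq_or_lt with h | h
  · rw [← h]; norm_num
  · have := mul_pos h hc
    linarith

/-- Since (k+1) k! = (k+1)!, the sum is 1/m times the Poisson series without its term at 0. -/
theorem integral_inv_succ_poissonMeasure {m : ℝ≥0} (hm : m ≠ 0) :
    ∫ k : ℕ, 1 / ((k : ℝ) + 1) ∂poissonMeasure m = (1 - Real.exp (-m)) / m := by
  have hm' : (m : ℝ) ≠ 0 := by exact_mod_cast hm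
  have h := ((hasSum_nat_add_iff' 1).2 (hasSum_one_poissonMeasure m)).div_const (m : ℝ)
  simp only [Finset.sum_range_one, pow_zero, Nat.factorial_zero, Nat.cast_one, mul_one, div_one]
    at h
  rw [integral_poissonMeasure, ← h.tsum_eq]
  refine tsum_congr fun k => ?_
  have hk : (k.factorial : ℝ) ≠ 0 := by positivity
  rw [Nat.factorial_succ, smul_eq_mul]
  push_cast
  field_simp
  exact (pow_succ' _ _).symm

theorem cellShare_eq : p.cellShare = p.lamB / p.lamC * (1 - Real.exp (-(p.lamC / p.lamB))) := by
  have hc := p.lamC_pos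
  have hb := p.lamB_pos
  have h1 : p.lamC * (Real.pi * p.R ^ 2) = p.lamC / p.lamB := by
    have := p.pi_mul_lamB_mul_R_sq
    rw [eq_div_iff hb.ne']
    linear_combination p.lamC * this
  have h2 : 0 < p.lamC / p.lamB := by positivity
  rw [cellShare, h1, integral_inv_succ_poissonMeasure (by simpa using h2),
    Real.coe_toNNReal _ h2.le]
  field_simp

theorem integral_ite_d2dLengthLaw (c d : ℝ) :
    ∫ l, (if l ≤ p.theta then c else d) ∂p.d2dLengthLaw = d * p.probCell + c * p.probD2D := by
  have := p.isProbabilityMeasure_d2dLengthLaw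
  have h : (fun l => if l ≤ p.theta then c else d) = (Set.Iic p.theta).piecewise
      (fun _ => c) (fun _ => d) := rfl
  rw [h, integral_piecewise measurableSet_Iic (integrable_const _).integrableOn
    (integrable_const _).integrableOn, setIntegral_const, setIntegral_const, Set.compl_Iic]
  simp only [smul_eq_mul, probCell, probD2D]
  ring

end Params

theorem mixedBEP_eq (p : Params) (rc ec rd ed : ℝ) :
    mixedBEP p rc ec rd ed
      = (rc * p.probCell * ec + rd * p.probD2D * ed) / (rc * p.probCell + rd * p.probD2D) := by
  rw [mixedBEP, p.integral_ite_d2dLengthLaw, p.integral_ite_d2dLengthLaw]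
  ring_nf

end

end Overlay

end

end

open Overlay in
theorem theorem4 {Ω : Type*} [MeasurableSpace Ω] (P : Measure Ω) [IsProbabilityMeasure P]
    (p : Params) (a b : ℝ) (ha : 0 < a) (hb : 0 < b)
    -- fading models of the intended (`W`) and interfering (`I`) links, in D2D and cellular mode
    (FWd FId FWc FIc : Fading)
    (hFWd : FWd.Valid) (hFId : FId.Valid) (hFWc : FWc.Valid) (hFIc : FIc.Valid)
    -- a typical D2D link
    (X : ℕ → Ω → Plane) (ty : ℕ → Ω → Bool) (Ld : ℕ → Ω → ℝ) (act : ℕ → Ω → Bool)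
    (Gd : ℕ → Ω → ℝ) (Wd : Ω → ℝ) (hd : IsD2DLink P p FWd FId X ty Ld act Gd Wd)
    -- a typical cellular link
    (Y : ℕ → Ω → Plane) (Lc : ℕ → Ω → ℝ) (Gc : ℕ → Ω → ℝ) (Wc : Ω → ℝ)
    (hc : IsCellLink P p FWc FIc Y Lc Gc Wc)
    -- the interference powers
    (Id Ic : Ω → ℝ) (hId : Id = d2dInterference p X ty Ld act Gd)
    (hIc : Ic = cellInterference p Y Lc Gc) :
    -- the interference is almost surely finite, and the averages exist
    ((∀ᵐ ω ∂P, Summable (d2dInterferenceTerm p X ty Ld act Gd ω)) ∧ AEMeasurable Id P ∧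
      Integrable (fun ω => condBEP a b (sinr p Wd Id ω)) P ∧
      Integrable (fun ω => Real.log (1 + sinr p Wd Id ω)) P) ∧
    ((∀ᵐ ω ∂P, Summable (cellInterferenceTerm p Y Lc Gc ω)) ∧ AEMeasurable Ic P ∧
      Integrable (fun ω => condBEP a b (sinr p Wc Ic ω)) P ∧
      Integrable (fun ω => Real.log (1 + sinr p Wc Ic ω)) P) ∧
    -- mode selection, rates, and the average BEP of a potential D2D UE
    (p.probD2D = 1 - Real.exp (-(p.xi * Real.pi * p.theta ^ 2)) ∧
      p.probCell = Real.exp (-(p.xi * Real.pi * p.theta ^ 2))) ∧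
    rateCell P p Wc Ic = (1 - p.beta) *
      (p.lamB / p.lamC * (1 - Real.exp (-(p.lamC / p.lamB)))) * avgLog P p Wc Ic ∧
    rateD2D P p Wd Id = p.beta * p.eps * avgLog P p Wd Id ∧
    mixedBEP p (rateCell P p Wc Ic) (avgBEP P p a b Wc Ic)
        (rateD2D P p Wd Id) (avgBEP P p a b Wd Id)
      = (rateCell P p Wc Ic * p.probCell * avgBEP P p a b Wc Ic
          + rateD2D P p Wd Id * p.probD2D * avgBEP P p a b Wd Id)
        / (rateCell P p Wc Ic * p.probCell + rateD2D P p Wd Id * p.probD2D) ∧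
    -- the average BEP in D2D mode
    ((∀ n, IntegrableOn
        (fun x => seriesTerm p FWd a b (laplace P Id) n x * Real.exp (-x)) (Set.Ioi 0)) ∧
      Summable (fun n => ∫ x in Set.Ioi (0 : ℝ),
        seriesTerm p FWd a b (laplace P Id) n x * Real.exp (-x)) ∧
      avgBEP P p a b Wd Id = 1 / 2 + FWd.scale / p.N0 * ∑' n, ∫ x in Set.Ioi (0 : ℝ),
        seriesTerm p FWd a b (laplace P Id) n x * Real.exp (-x) ∧
      (∀ x, 0 < x → Summable fun n => seriesTerm p FWd a b (laplace P Id) n x) ∧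
      Tendsto (fun M : ℕ => 1 / 2 + FWd.scale / p.N0 * ∑ x ∈ laguerreNodes M,
          ∑' n, laguerreWeight M x * seriesTerm p FWd a b (laplace P Id) n x)
        atTop (𝓝 (avgBEP P p a b Wd Id))) ∧
    -- the average BEP of a cellular UE
    ((∀ n, IntegrableOn
        (fun x => seriesTerm p FWc a b (laplace P Ic) n x * Real.exp (-x)) (Set.Ioi 0)) ∧
      Summable (fun n => ∫ x in Set.Ioi (0 : ℝ),
        seriesTerm p FWc a b (laplace P Ic) n x * Real.exp (-x)) ∧
      avgBEP P p a b Wc Ic = 1 / 2 + FWc.scale / p.N0 * ∑' n, ∫ x in Set.Ioi (0 : ℝ),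
        seriesTerm p FWc a b (laplace P Ic) n x * Real.exp (-x) ∧
      (∀ x, 0 < x → Summable fun n => seriesTerm p FWc a b (laplace P Ic) n x) ∧
      Tendsto (fun M : ℕ => 1 / 2 + FWc.scale / p.N0 * ∑ x ∈ laguerreNodes M,
          ∑' n, laguerreWeight M x * seriesTerm p FWc a b (laplace P Ic) n x)
        atTop (𝓝 (avgBEP P p a b Wc Ic))) ∧
    -- the Laplace transform of the interference at the D2D receiver
    (∀ s, 0 ≤ s → laplace P Id s = Real.exp (-(d2dConst p FId * s ^ p.deltaD))) ∧
    -- the Laplace transform of the interference at the base station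
    (∀ (n : ℕ) (z : ℝ), 0 < z →
      MeijerConverges 2 1 [1 - p.deltaC, 1] [0, FIc.order n - p.deltaC] z) ∧
    (∀ s, 0 < s →
      (∀ r, p.R < r → Summable (cellPhiTerm p s r FIc)) ∧
      IntegrableOn (fun r : ℝ => (1 - cellPhi p FIc s r) * (r : ℂ)) (Set.Ioi p.R) ∧
      (laplace P Ic s : ℂ) = Complex.exp (-(2 * (Real.pi : ℂ) * (p.lamB : ℂ)
        * ∫ r in Set.Ioi p.R, (1 - cellPhi p FIc s r) * (r : ℂ)))) ∧
    -- the derivative terms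
    (∀ i x, 0 < i → 0 < x →
      ContDiffAt ℝ (⌈i⌉₊ : ℕ)
        (rlIntegral ((⌈i⌉₊ : ℝ) - i) fun t => t ^ (i - 1) * upperGamma b (a * t)) x ∧
      MeijerConverges 1 2 [2, 2 - b, 1] [1 + i, 1] (1 / (a * x)) ∧
      (gTerm a b i x : ℂ) = ((a / (2 * Real.Gamma b * Real.Gamma i) : ℝ) : ℂ)
        * meijerG 1 2 [2, 2 - b, 1] [1 + i, 1] (1 / (a * x))) := by
  subst hId hIc
  have hld := hd.isFadedLink hFWd hFId
  have hlc := hc.isFadedLink hFWc hFIc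
  obtain ⟨hd1, hd2, -, hd4⟩ := hd.interference hFId
  obtain ⟨hc1, hc2, -, -⟩ := hc.interference hFIc
  refine ⟨⟨hd1, hd2, hld.integrable_condBEP p ha hb, hld.integrable_log p⟩,
    ⟨hc1, hc2, hlc.integrable_condBEP p ha hb, hlc.integrable_log p⟩,
    ⟨p.probD2D_eq, p.probCell_eq⟩, ?_, ?_, mixedBEP_eq p _ _ _ _, hld.avgBEP_series p ha hb,
    hlc.avgBEP_series p ha hb, hd4,
    fun n z hz => (meijerG_two_one p.deltaC_pos (hFIc.order_pos n) hz).1,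
    fun s hs => hc.laplace_eq_exp_cellPhi hFIc hs,
    fun i x hi hx => ⟨contDiffAt_rlIntegral ha hb hi hx,
      (meijerG_one_two hb hi (by positivity)).1, gTerm_eq_meijerG ha hb hi hx⟩⟩
  · rw [rateCell, p.cellShare_eq]
    ring
  · rw [rateD2D]
    ring
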